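/- **Setting.** Let $N\ge 1$, $q\in\mathbb C$, and let $L$ be the lattice with basis $A^i,B^i$ ($1\le i\le N$), $(A^i,B^j)=\delta_{ij}$, $(A^i,A^j)=(B^i,B^j)=0$. Let $V_L=\Lambda\otimes S\otimes\mathbb C[L]$, where $S$ is the polynomial algebra on $A^i_{-k-1},B^i_{-k-1}$ and $\Lambda$ the exterior algebra on $\Phi^i_{-k},\Psi^i_{-k-1}$ ($k\ge 0$), be the tensor product of the lattice vertex algebra of $L$ and the vertex algebra of $N$ pairs of free fermions $\Phi^i(z)=\sum_j\Phi^i_jz^{-j}$, $\Psi^i(z)=\sum_j\Psi^i_jz^{-j-1}$, with $[\Phi^i_m,\Psi^j_n]=\delta_{ij}\delta_{m+n,0}$. Explicitly, $$e^\alpha(z)(u\otimes e^\beta)=\varepsilon(\alpha,\beta)\,z^{(\alpha,\beta)}\exp\Big(-\sum_{n<0}\tfrac{\alpha_n}{n}z^{-n}\Big)\exp\Big(-\sum_{n>0}\tfrac{\alpha_n}{n}z^{-n}\Big)u\otimes e^{\alpha+\beta},$$ where $\varepsilon(\alpha,\beta)=(-1)^{\sum_i m_in'_i}$ for $\alpha=\sum_i(n_iA^i+m_iB^i)$,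 $\beta=\sum_i(n_i'A^i+m_i'B^i)$, and the fields of the other states are normally ordered products of divided derivatives of $A^i(z),B^i(z),\Phi^i(z),\Psi^i(z)$ and $e^\alpha(z)$. Put $\xi_i=A^i$ for $i\le N$ and $\xi_{N+1}=-A^1-\dots-A^N$. Every $\alpha$ in the span $L_A$ of the $A^i$ is uniquely $\sum_{i=1}^{N+1}c_i\xi_i$ with integers $c_i\ge 0$, at least one of them $0$; put $\mathrm{ht}(\alpha)=\sum_i c_i$, and extend $\mathrm{ht}$ to $L$ through the projection $L\to L_A$ along the $B^i$. The vertex algebra $V_{L,q}$ is the space $V_L$ with the $n$-th products $$(x\otimes e^\alpha)_{(n),q}(y\otimes e^\beta)=q^{\mathrm{ht}(\alpha)+\mathrm{ht}(\beta)-\mathrm{ht}(\alpha+\beta)}\,(x\otimes e^\alpha)_{(n)}(y\otimes e^\beta),\qquad n\in\mathbb Z$$ (with $q^0=1$, also for $q=0$). Consider on $V_{L,q}$ the odd operators $$D=\Big(\sum_{i=1}^N\Psi^i_{-1}\big(e^{A^i}-e^{-A^1-\dots-A^N}\big)\Big)_{(0),q},\qquad Q_0=\Big(\sum_{i=1}^N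 A^i_{-1}\Phi^i_0e^0\Big)_{(0),q}.$$ The fermionic charge is the number of factors $\Phi$ minus the number of factors $\Psi$; let $V^{\le n}\subset V_{L,q}$ be the span of the monomials of charge at most $n$. Then $Q_0$ raises the charge by $1$ and $D$ lowers it by $1$. For the filtration $V^{\le n}$ and the total differential $d=D+Q_0$, let $$Z_r^n=\{x\in V^{\le n}: dx\in V^{\le n+1-2r}\}+V^{\le n-1},\qquad B_r^n=\big(V^{\le n}\cap d(V^{\le n+2r-3})\big)+V^{\le n-1},\qquad E_r^n=Z_r^n/B_r^n ,$$ and let $d^{(r)}:E_r^n\to E_r^{n+1-2r}$ be induced by $d$. This is the spectral sequence of the fermionic-charge filtration, with $E_1=H_{Q_0}(V_{L,q})$ and $E_2=H_D(H_{Q_0}(V_{L,q}))$. **Theorem.** Let $N\ge 1$ and $q\in\mathbb C$. Then $D^2=Q_0^2=0$ and $DQ_0+Q_0D=0$, and the following hold. 1. The $(-1)$-st product of $V_{L,q}$ induces a multiplication on $H_{D+Q_0}(V_{L,q})$, and there is an isomorphism of algebras $$\mathbb C[T]/(T^{N+1}-q^{N+1})\;\cong\;H_{D+Q_0}(V_{L,q})$$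 that sends $1$ to the class of $e^0$ and $T$ to the class of $e^{-A^1-\dots-A^N}$. 2. The spectral sequence $\{E_r^n,d^{(r)}\}$ converges to $H_{D+Q_0}(V_{L,q})$: the filtration of $H_{D+Q_0}(V_{L,q})$ by the classes of cocycles in $V^{\le n}$ is exhaustive and separated, $\bigcap_rZ_r^n=(V^{\le n}\cap\operatorname{Ker}d)+V^{\le n-1}$ and $\bigcup_rB_r^n=(V^{\le n}\cap\operatorname{Im}d)+V^{\le n-1}$. It collapses at $E_2$: $d^{(r)}=0$ for all $r\ge 2$. 3. Every class in $H_D(H_{Q_0}(V_{L,q}))$ is represented by some $x$ with $Q_0x=Dx=0$, and there is a linear isomorphism $H_D(H_{Q_0}(V_{L,q}))\cong H_{D+Q_0}(V_{L,q})$ that sends the class of each such $x$ to the class of $x$. -/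

import Mathlib

open scoped TensorProduct Polynomial

noncomputable section

namespace ChiralPN

/-! ### Cohomology of a single (ungraded) differential -/

section Cohomology

variable {V : Type*} [AddCommGroup V] [Module ℂ V]

/-- The cohomology `Ker d / Im d` of an endomorphism `d` (meaningful when `d * d = 0`). -/
def Coh (d : Module.End ℂ V) : Type _ :=
  LinearMap.ker d ⧸ (LinearMap.range d).submoduleOf (LinearMap.ker d)

instance (d : Module.End ℂ V) : AddCommGroup (Coh d) :=
  inferInstanceAs (AddCommGroup (_ ⧸ (LinearMap.range d).submoduleOf (LinearMap.ker d)))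

instance (d : Module.End ℂ V) : Module ℂ (Coh d) :=
  inferInstanceAs (Module ℂ (_ ⧸ (LinearMap.range d).submoduleOf (LinearMap.ker d)))

/-- The class of a cocycle. -/
def Coh.mk (d : Module.End ℂ V) : LinearMap.ker d →ₗ[ℂ] Coh d :=
  ((LinearMap.range d).submoduleOf (LinearMap.ker d)).mkQ

/-- `x` is a cocycle and its cohomology class is `c`. -/
def Represents (d : Module.End ℂ V) (x : V) (c : Coh d) : Prop :=
  ∃ hx : x ∈ LinearMap.ker d, Coh.mk d ⟨x, hx⟩ = c

theorem mem_ker_of_anticomm {d e : Module.End ℂ V} (h : d * e + e * d = 0) {x : V}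
    (hx : x ∈ LinearMap.ker d) : e x ∈ LinearMap.ker d := by
  have h1 := LinearMap.congr_fun h x
  simp only [LinearMap.add_apply, Module.End.mul_apply, LinearMap.zero_apply,
    LinearMap.mem_ker.mp hx, map_zero, add_zero] at h1
  exact LinearMap.mem_ker.mpr h1

/-- An endomorphism `e` that anticommutes with `d` acts on the cohomology of `d`. -/
def Coh.induced (d e : Module.End ℂ V) (h : d * e + e * d = 0) : Module.End ℂ (Coh d) :=
  Submodule.mapQ _ _ (e.restrict fun _ hx => mem_ker_of_anticomm h hx) (by
    rintro ⟨x, hx⟩ hxr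
    obtain ⟨y, hy⟩ := hxr
    have hy' : d y = x := hy
    refine ⟨-(e y), ?_⟩
    have h1 := LinearMap.congr_fun h y
    simp only [LinearMap.add_apply, Module.End.mul_apply, LinearMap.zero_apply] at h1
    rw [hy'] at h1
    change d (-(e y)) = e x
    rw [map_neg]
    exact neg_eq_of_add_eq_zero_right h1)

end Cohomology

/-! ### The spectral sequence of a filtered space whose differential shifts the filtration

`F` is an increasing filtration with `d (F n) ⊆ F (n + 1)`, coming from a grading of which `d`
changes the parity. The differential on the `r`-th page lowers the filtration index by `2 r - 1`. -/

section SpectralSequence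

variable {V : Type*} [AddCommGroup V] [Module ℂ V]

/-- The preimage in `F n` of the `r`-cycles in `F n / F (n - 1)`. -/
def ssZ (d : Module.End ℂ V) (F : ℤ → Submodule ℂ V) (r : ℕ) (n : ℤ) : Submodule ℂ V :=
  (F n ⊓ (F (n + 1 - 2 * r)).comap d) ⊔ F (n - 1)

/-- The preimage in `F n` of the `r`-boundaries in `F n / F (n - 1)`. The component `E_r^n` of the
`r`-th page is `ssZ d F r n / ssB d F r n`. -/
def ssB (d : Module.End ℂ V) (F : ℤ → Submodule ℂ V) (r : ℕ) (n : ℤ) : Submodule ℂ V :=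
  (F n ⊓ (F (n + 2 * r - 3)).map d) ⊔ F (n - 1)

/-- The preimage in `F n` of the leading terms of cocycles. -/
def ssZinf (d : Module.End ℂ V) (F : ℤ → Submodule ℂ V) (n : ℤ) : Submodule ℂ V :=
  (F n ⊓ LinearMap.ker d) ⊔ F (n - 1)

/-- The preimage in `F n` of the leading terms of coboundaries. The quotient
`ssZinf d F n / ssBinf d F n` is the component `Gr_n` of the graded space associated with the
filtration on the cohomology of `d` by the classes of the cocycles in `F n`. -/
def ssBinf (d : Module.End ℂ V) (F : ℤ → Submodule ℂ V) (n : ℤ) : Submodule ℂ V :=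
  (F n ⊓ LinearMap.range d) ⊔ F (n - 1)

/-- The differential `d^{(r)} : E_r^n → E_r^{n + 1 - 2 r}`, which sends the class of an `x ∈ F n`
with `d x ∈ F (n + 1 - 2 r)` to the class of `d x`, is zero for every `n`. -/
def DifferentialVanishes (d : Module.End ℂ V) (F : ℤ → Submodule ℂ V) (r : ℕ) : Prop :=
  ∀ (n : ℤ) (x : V), x ∈ F n → d x ∈ F (n + 1 - 2 * r) → d x ∈ ssB d F r (n + 1 - 2 * r)

/-- Convergence to the cohomology of `d`: the filtration on cohomology is exhaustive and separated,
and the limit term of the spectral sequence is its associated graded space. -/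
structure Converges (d : Module.End ℂ V) (F : ℤ → Submodule ℂ V) : Prop where
  exhaustive : ∀ x ∈ LinearMap.ker d, ∃ n, x ∈ (F n ⊓ LinearMap.ker d) ⊔ LinearMap.range d
  separated : ∀ x ∈ LinearMap.ker d,
    (∀ n, x ∈ (F n ⊓ LinearMap.ker d) ⊔ LinearMap.range d) → x ∈ LinearMap.range d
  cycles : ∀ n, ⨅ r : ℕ, ssZ d F r n = ssZinf d F n
  boundaries : ∀ n, ⨆ r : ℕ, ssB d F r n = ssBinf d F n

end SpectralSequence

/-! ### Generalities on fields -/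

section Fields

variable {V W : Type*} [AddCommGroup V] [Module ℂ V] [AddCommGroup W] [Module ℂ W]

/-- The pointwise finite sum of a sequence of linear maps. -/
def locSum (f : ℕ → V →ₗ[ℂ] W) (hf : ∀ v, ∃ K, ∀ j ≥ K, f j v = 0) : V →ₗ[ℂ] W :=
  have hs : ∀ v, (Function.support fun j => f j v).Finite := fun v => by
    obtain ⟨K, hK⟩ := hf v
    refine (Set.finite_lt_nat K).subset fun j hj => ?_
    by_contra hlt
    exact hj (hK j (not_lt.mp hlt))
  { toFun := fun v => ∑ᶠ j, f j v
    map_add' := fun v w => by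
      simp only [map_add]
      exact finsum_add_distrib (hs v) (hs w)
    map_smul' := fun c v => by
      simp only [map_smul, RingHom.id_apply]
      exact (smul_finsum' c (hs v)).symm }

/-- The field `a(z) = ∑ a_(n) z^(-n-1)` with the given Fourier modes `a_(n)`. -/
def ofModes (a : ℤ → Module.End ℂ V) (ha : ∀ v, ∃ K : ℤ, ∀ n ≥ K, a n v = 0) :
    VertexOperator ℂ V :=
  VertexOperator.of_coeff (fun p => a (-p - 1)) fun v => by
    obtain ⟨K, hK⟩ := ha v
    refine ⟨-K, fun p hp => ?_⟩
    by_contra hlt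
    exact hp (hK (-p - 1) (by omega))

theorem ncoeff_ofModes (a : ℤ → Module.End ℂ V) (ha) (n : ℤ) :
    VertexOperator.ncoeff (ofModes a ha) n = a n := by
  rw [ofModes, VertexOperator.ncoeff_of_coeff]
  congr 1
  ring

theorem ncoeff_trunc (a : VertexOperator ℂ V) (v : V) :
    ∃ K : ℤ, ∀ n ≥ K, VertexOperator.ncoeff a n v = 0 := by
  refine ⟨-HahnSeries.order ((HahnModule.of ℂ).symm (a v)), fun n hn => ?_⟩
  exact VertexOperator.ncoeff_eq_zero_of_lt_order a n v (by omega)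

/-- The divided derivative `(1/k!) a(z)^{(k)}`. -/
def divDeriv (k : ℕ) (a : VertexOperator ℂ V) : VertexOperator ℂ V :=
  ofModes (fun m => Ring.choose ((k : ℤ) - m - 1) k • VertexOperator.ncoeff a (m - k)) fun v => by
    obtain ⟨K, hK⟩ := ncoeff_trunc a v
    exact ⟨K + k, fun n hn => by
      rw [LinearMap.smul_apply, hK _ (by omega), smul_zero]⟩

/-- The `j`-th summand of the `m`-th mode of the normally ordered product. -/
def normalTerm (τ : Module.End ℂ V) (a b : VertexOperator ℂ V) (m : ℤ) (j : ℕ) :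
    Module.End ℂ V :=
  VertexOperator.ncoeff a (-(j : ℤ) - 1) * VertexOperator.ncoeff b (m + j) +
    τ * VertexOperator.ncoeff b (m - 1 - j) * τ * VertexOperator.ncoeff a j

theorem normalTerm_trunc (τ : Module.End ℂ V) (a b : VertexOperator ℂ V) (m : ℤ) (v : V) :
    ∃ K : ℕ, ∀ j ≥ K, normalTerm τ a b m j v = 0 := by
  obtain ⟨K, hK⟩ := ncoeff_trunc a v
  obtain ⟨K', hK'⟩ := ncoeff_trunc b v
  refine ⟨(max K (K' - m)).toNat, fun j hj => ?_⟩
  simp only [normalTerm, LinearMap.add_apply, Module.End.mul_apply]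
  rw [hK j (by omega), hK' (m + j) (by omega)]
  simp

/-- The normally ordered product `:a(z) b(z): = a(z)₋ b(z) ± b(z) a(z)₊`, where `a(z)₊` collects the
modes `a_(j)` with `j ≥ 0`. Here `τ = 1` if `a` is even, and `τ` is the parity involution if `a` is
odd, so that `τ b_(n) τ = ± b_(n)` carries the sign rule. -/
def normalOrder (τ : Module.End ℂ V) (a b : VertexOperator ℂ V) : VertexOperator ℂ V :=
  ofModes (fun m => locSum (normalTerm τ a b m) (normalTerm_trunc τ a b m)) fun v => by
    obtain ⟨J, hJ⟩ := ncoeff_trunc a v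
    obtain ⟨K, hK⟩ := ncoeff_trunc b v
    choose L hL using fun j : ℕ => ncoeff_trunc b (τ (VertexOperator.ncoeff a j v))
    obtain ⟨M, hM⟩ : ∃ M : ℤ, ∀ j ∈ Finset.range J.toNat, L j + 1 + j ≤ M := by
      obtain ⟨M, hM⟩ := ((Finset.range J.toNat).image fun j : ℕ => L j + 1 + j).bddAbove
      exact ⟨M, fun j hj => hM (Finset.mem_coe.mpr (Finset.mem_image_of_mem _ hj))⟩
    refine ⟨max K M, fun n hn => ?_⟩
    refine (finsum_congr fun j => ?_).trans finsum_zero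
    simp only [normalTerm, LinearMap.add_apply, Module.End.mul_apply]
    rw [hK (n + j) (by omega), map_zero, zero_add]
    by_cases hj : j < J.toNat
    · rw [hL j (n - 1 - j) (by have := hM j (Finset.mem_range.mpr hj); omega), map_zero]
    · rw [hJ j (by omega)]
      simp

end Fields

/-! ### The space `V_L` -/

/-- Labels of the oscillators. For bosons, `(false, i, k)` stands for `A^i_{-k-1}` and `(true, i, k)`
for `B^i_{-k-1}`; for fermions, `(false, i, k)` stands for `Φ^i_{-k}` and `(true, i, k)` for
`Ψ^i_{-k-1}`. -/
abbrev Osc (N : ℕ) : Type := Bool ×ₗ (Fin N ×ₗ ℕ)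

/-- The label `(b, i, k)`. -/
def osc {N : ℕ} (b : Bool) (i : Fin N) (k : ℕ) : Osc N := toLex (b, toLex (i, k))

/-- The lattice `L`; `(n, m)` stands for `∑ n_i A^i + ∑ m_i B^i`. -/
abbrev Lat (N : ℕ) : Type := (Fin N → ℤ) × (Fin N → ℤ)

/-- The bilinear form of `L`: `(A^i, B^j) = δ_ij`, `(A^i, A^j) = (B^i, B^j) = 0`. -/
def pairing {N : ℕ} (α β : Lat N) : ℤ := ∑ i, (α.1 i * β.2 i + α.2 i * β.1 i)

/-- The bimultiplicative cocycle `ε` of the lattice vertex algebra, with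
`ε(α, β) ε(β, α) = (-1)^(α, β)`, and `ε(α, β) = 1` for `α ∈ L_A`. -/
def cocycle {N : ℕ} (α β : Lat N) : ℂ := (-1 : ℂ) ^ (∑ i, α.2 i * β.1 i)

/-- The fermionic factor `Λ`. -/
abbrev Ferm (N : ℕ) : Type := ExteriorAlgebra ℂ (Osc N →₀ ℂ)

/-- The bosonic factor `S`. -/
abbrev Bos (N : ℕ) : Type := MvPolynomial (Osc N) ℂ

/-- `Λ ⊗ S`. -/
def Fock (N : ℕ) : Type := Ferm N ⊗[ℂ] Bos N

instance (N : ℕ) : AddCommGroup (Fock N) := inferInstanceAs (AddCommGroup (Ferm N ⊗[ℂ] Bos N))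

instance (N : ℕ) : Module ℂ (Fock N) := inferInstanceAs (Module ℂ (Ferm N ⊗[ℂ] Bos N))

/-- The element `x ⊗ y` of `Λ ⊗ S`. -/
def pureFock {N : ℕ} (x : Ferm N) (y : Bos N) : Fock N := x ⊗ₜ[ℂ] y

/-- The operator `f ⊗ g` on `Λ ⊗ S`. -/
def mapFock {N : ℕ} (f : Module.End ℂ (Ferm N)) (g : Module.End ℂ (Bos N)) :
    Module.End ℂ (Fock N) := TensorProduct.map f g

theorem mapFock_pureFock {N : ℕ} (f : Module.End ℂ (Ferm N)) (g : Module.End ℂ (Bos N))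
    (x : Ferm N) (y : Bos N) : mapFock f g (pureFock x y) = pureFock (f x) (g y) :=
  TensorProduct.map_tmul f g x y

theorem pureFock_zero_left {N : ℕ} (y : Bos N) : pureFock (0 : Ferm N) y = 0 :=
  TensorProduct.zero_tmul _ y

theorem pureFock_zero_right {N : ℕ} (x : Ferm N) : pureFock x (0 : Bos N) = 0 :=
  TensorProduct.tmul_zero _ x

/-- `V_L = Λ ⊗ S ⊗ ℂ[L]`, written as the direct sum over `α ∈ L` of copies of `Λ ⊗ S`:
`Finsupp.single α u` stands for `u ⊗ e^α`. -/
abbrev VL (N : ℕ) : Type := Lat N →₀ Fock N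

/-- An operator on `Λ ⊗ S`, acting on `V_L` identically along `ℂ[L]`. -/
def onFock {N : ℕ} (f : Module.End ℂ (Fock N)) : Module.End ℂ (VL N) :=
  Finsupp.mapRange.linearMap f

theorem onFock_trunc {N : ℕ} (f : ℤ → Module.End ℂ (Fock N))
    (hf : ∀ u, ∃ K : ℤ, ∀ n ≥ K, f n u = 0) (v : VL N) :
    ∃ K : ℤ, ∀ n ≥ K, onFock (f n) v = 0 := by
  induction v using Finsupp.induction_linear with
  | zero => exact ⟨0, fun n _ => map_zero _⟩
  | add v w hv hw =>
    obtain ⟨K, hK⟩ := hv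
    obtain ⟨K', hK'⟩ := hw
    exact ⟨max K K', fun n hn => by
      rw [map_add, hK n (by omega), hK' n (by omega), add_zero]⟩
  | single α u =>
    obtain ⟨K, hK⟩ := hf u
    exact ⟨K, fun n hn => by simp [onFock, hK n hn]⟩

theorem fock_induction {N : ℕ} {p : Fock N → Prop} (h0 : p 0) (hp : ∀ x y, p (pureFock x y))
    (ha : ∀ u v, p u → p v → p (u + v)) (u : Fock N) : p u :=
  TensorProduct.induction_on (motive := p) u h0 hp ha

theorem fock_trunc {N : ℕ} (f : ℤ → Module.End ℂ (Fock N))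
    (hf : ∀ x y, ∃ K : ℤ, ∀ n ≥ K, f n (pureFock x y) = 0) (u : Fock N) :
    ∃ K : ℤ, ∀ n ≥ K, f n u = 0 := by
  induction u using fock_induction with
  | h0 => exact ⟨0, fun n _ => map_zero _⟩
  | hp x y => exact hf x y
  | ha v w hv hw =>
    obtain ⟨K, hK⟩ := hv
    obtain ⟨K', hK'⟩ := hw
    exact ⟨max K K', fun n hn => by
      rw [map_add, hK n (by omega), hK' n (by omega), add_zero]⟩

/-- The parity involution of `V_L`. -/
def parity (N : ℕ) : Module.End ℂ (VL N) :=
  onFock (mapFock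
    (CliffordAlgebra.involute (Q := (0 : QuadraticForm ℂ (Osc N →₀ ℂ)))).toLinearMap 1)

/-! ### The fermions -/

/-- The mode `x_(n)` of the fermion `x = Φ^i` (`b = false`) or `Ψ^i` (`b = true`) on `Λ`, in the
indexing `x(z) = ∑ x_(n) z^(-n-1)`; thus `Ψ^i_(n) = Ψ^i_n` and `Φ^i_(n) = Φ^i_{n+1}`. -/
def fermMode {N : ℕ} (b : Bool) (i : Fin N) : ℤ → Module.End ℂ (Ferm N)
  | Int.negSucc k => LinearMap.mulLeft ℂ (ExteriorAlgebra.ι ℂ (Finsupp.single (osc b i k) (1 : ℂ)))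
  | Int.ofNat k => CliffordAlgebra.contractLeft (Q := (0 : QuadraticForm ℂ (Osc N →₀ ℂ)))
      (Finsupp.lapply (osc (!b) i k))

theorem fermMode_trunc {N : ℕ} (b : Bool) (i : Fin N) (x : Ferm N) :
    ∃ K : ℤ, ∀ n ≥ K, fermMode b i n x = 0 := by
  suffices h : ∃ K : ℕ, ∀ k ≥ K, fermMode b i (Int.ofNat k) x = 0 by
    obtain ⟨K, hK⟩ := h
    refine ⟨K, fun n hn => ?_⟩
    obtain ⟨k, rfl⟩ := Int.eq_ofNat_of_zero_le (show 0 ≤ n by omega)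
    exact hK k (by omega)
  induction x using CliffordAlgebra.left_induction with
  | algebraMap r => exact ⟨0, fun k _ => CliffordAlgebra.contractLeft_algebraMap _ _ r⟩
  | add x y hx hy =>
    obtain ⟨K, hK⟩ := hx
    obtain ⟨K', hK'⟩ := hy
    exact ⟨max K K', fun n hn => by
      rw [map_add, hK n (by omega), hK' n (by omega), add_zero]⟩
  | ι_mul x m hx =>
    obtain ⟨K, hK⟩ := hx
    refine ⟨max K ((m.support.image fun o : Osc N => (ofLex (ofLex o).2).2).sup id + 1),
      fun k hk => ?_⟩
    have h0 : m (osc (!b) i k) = 0 := by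
      by_contra hne
      have h1 : k ∈ m.support.image fun o : Osc N => (ofLex (ofLex o).2).2 :=
        Finset.mem_image.mpr ⟨osc (!b) i k, Finsupp.mem_support_iff.mpr hne, rfl⟩
      have h2 : k ≤ _ := Finset.le_sup (f := id) h1
      omega
    have h3 := hK k (by omega)
    simp only [fermMode] at h3 ⊢
    rw [CliffordAlgebra.contractLeft_ι_mul, h3]
    simp [h0]

/-- The fields `Φ^i(z)` (`b = false`) and `Ψ^i(z)` (`b = true`). -/
def fermField {N : ℕ} (b : Bool) (i : Fin N) : VertexOperator ℂ (VL N) :=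
  ofModes (fun n => onFock (mapFock (fermMode b i n) 1)) <|
    onFock_trunc _ <| fock_trunc _ fun x y => by
      obtain ⟨K, hK⟩ := fermMode_trunc b i x
      exact ⟨K, fun n hn => by rw [mapFock_pureFock, hK n hn, pureFock_zero_left]⟩

/-! ### The bosons -/

/-- The mode `x_n`, `n ≠ 0`, of `x = A^i` (`b = false`) or `B^i` (`b = true`) on `S`. -/
def bosMode {N : ℕ} (b : Bool) (i : Fin N) : ℤ → Module.End ℂ (Bos N)
  | Int.negSucc k => LinearMap.mulLeft ℂ (MvPolynomial.X (osc b i k))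
  | Int.ofNat 0 => 0
  | Int.ofNat (k + 1) => ((k : ℂ) + 1) • (MvPolynomial.pderiv (osc (!b) i k)).toLinearMap

theorem bosMode_trunc {N : ℕ} (b : Bool) (i : Fin N) (p : Bos N) :
    ∃ K : ℤ, ∀ n ≥ K, bosMode b i n p = 0 := by
  refine ⟨((p.vars.image fun o : Osc N => (ofLex (ofLex o).2).2).sup id : ℕ) + 2,
    fun n hn => ?_⟩
  obtain ⟨k, rfl⟩ : ∃ k : ℕ, n = Int.ofNat (k + 1) := ⟨(n - 1).toNat, by simp; omega⟩
  have h0 : osc (!b) i k ∉ p.vars := fun hmem => by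
    have h1 : k ∈ p.vars.image fun o : Osc N => (ofLex (ofLex o).2).2 :=
      Finset.mem_image.mpr ⟨osc (!b) i k, hmem, rfl⟩
    have h2 : k ≤ _ := Finset.le_sup (f := id) h1
    simp only [Int.ofNat_eq_natCast, Nat.cast_add, Nat.cast_one] at hn
    omega
  simp [bosMode, MvPolynomial.pderiv_eq_zero_of_notMem_vars h0]

/-- The zero mode: `x_0 (u ⊗ e^β) = (x, β) u ⊗ e^β`. -/
def zeroMode {N : ℕ} (b : Bool) (i : Fin N) : Module.End ℂ (VL N) :=
  Finsupp.lsum ℂ fun β : Lat N =>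
    ((if b then β.1 i else β.2 i : ℤ) : ℂ) • Finsupp.lsingle (R := ℂ) (M := Fock N) β

/-- The fields `A^i(z)` (`b = false`) and `B^i(z)` (`b = true`). -/
def bosField {N : ℕ} (b : Bool) (i : Fin N) : VertexOperator ℂ (VL N) :=
  ofModes (fun n => onFock (mapFock 1 (bosMode b i n)) +
      if n = 0 then zeroMode b i else 0) fun v => by
    obtain ⟨K, hK⟩ := onFock_trunc (fun n => mapFock 1 (bosMode b i n))
      (fock_trunc _ fun x y => by
        obtain ⟨K, hK⟩ := bosMode_trunc b i y
        exact ⟨K, fun n hn => by rw [mapFock_pureFock, hK n hn, pureFock_zero_right]⟩) v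
    refine ⟨max K 1, fun n hn => ?_⟩
    rw [LinearMap.add_apply, hK n (by omega), if_neg (by omega)]
    simp

/-! ### The vertex operators `e^α(z)` -/

/-- The mode `α_n`, `n ≠ 0`, of `α ∈ L` on `S`. -/
def latMode {N : ℕ} (α : Lat N) (n : ℤ) : Module.End ℂ (Bos N) :=
  ∑ i, ((α.1 i : ℂ) • bosMode false i n + (α.2 i : ℂ) • bosMode true i n)

/-- The coefficient at `z^k` of `exp X(z)`, for a power series `X` without constant term. -/
def expCoeff {E : Type*} [Ring E] [Algebra ℂ E] (X : PowerSeries E) (k : ℕ) : E :=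
  ∑ n ∈ Finset.range (k + 1), ((n.factorial : ℂ)⁻¹) • PowerSeries.coeff k (X ^ n)

/-- `-∑_{n<0} (α_n / n) z^(-n)`, as a power series in `z`. -/
def creationSeries {N : ℕ} (α : Lat N) : PowerSeries (Module.End ℂ (Bos N)) :=
  PowerSeries.mk fun k => if k = 0 then 0 else ((k : ℂ)⁻¹) • latMode α (-(k : ℤ))

/-- `-∑_{n>0} (α_n / n) z^(-n)`, as a power series in `z^(-1)`. -/
def annihilationSeries {N : ℕ} (α : Lat N) : PowerSeries (Module.End ℂ (Bos N)) :=
  PowerSeries.mk fun k => if k = 0 then 0 else (-(k : ℂ)⁻¹) • latMode α k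

/-- The weight of an oscillator. -/
def oscWeight {N : ℕ} (o : Osc N) : ℕ := (ofLex (ofLex o).2).2 + 1

/-- The span of the monomials of weight less than `K`. -/
def lowWeight (N : ℕ) (K : ℕ) : Submodule ℂ (Bos N) :=
  Submodule.span ℂ {p | ∃ s : Osc N →₀ ℕ,
    (∑ o ∈ s.support, s o * oscWeight o < K) ∧ p = MvPolynomial.monomial s 1}

theorem lowWeight_mono {N : ℕ} {K K' : ℕ} (h : K ≤ K') : lowWeight N K ≤ lowWeight N K' :=
  Submodule.span_mono fun _ ⟨s, hs, hp⟩ => ⟨s, hs.trans_le h, hp⟩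

theorem lowWeight_zero (N : ℕ) : lowWeight N 0 = ⊥ := by
  rw [lowWeight, Submodule.span_eq_bot]
  rintro p ⟨s, hs, -⟩
  omega

theorem exists_lowWeight {N : ℕ} (p : Bos N) : ∃ K, p ∈ lowWeight N K := by
  induction p using MvPolynomial.induction_on' with
  | monomial s c =>
    refine ⟨(∑ o ∈ s.support, s o * oscWeight o) + 1, ?_⟩
    have : MvPolynomial.monomial s c = c • MvPolynomial.monomial s (1 : ℂ) := by
      rw [MvPolynomial.smul_monomial, smul_eq_mul, mul_one]
    rw [this]
    exact Submodule.smul_mem _ _ (Submodule.subset_span ⟨s, by omega, rfl⟩)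
  | add p p' hp hp' =>
    obtain ⟨K, hK⟩ := hp
    obtain ⟨K', hK'⟩ := hp'
    exact ⟨max K K', Submodule.add_mem _ (lowWeight_mono (le_max_left _ _) hK)
      (lowWeight_mono (le_max_right _ _) hK')⟩

theorem bosMode_lowWeight {N : ℕ} (b : Bool) (i : Fin N) (k K : ℕ) (p : Bos N)
    (hp : p ∈ lowWeight N K) : bosMode b i k p ∈ lowWeight N (K - k) := by
  cases k with
  | zero => exact Submodule.zero_mem _
  | succ k =>
    induction hp using Submodule.span_induction with
    | zero => rw [map_zero]; exact Submodule.zero_mem _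
    | add x y _ _ hx hy => rw [map_add]; exact Submodule.add_mem _ hx hy
    | smul c x _ hx => rw [map_smul]; exact Submodule.smul_mem _ _ hx
    | mem x hx =>
      obtain ⟨s, hs, rfl⟩ := hx
      change ((k : ℂ) + 1) • MvPolynomial.pderiv (osc (!b) i k) (MvPolynomial.monomial s (1 : ℂ)) ∈ _
      refine Submodule.smul_mem _ _ ?_
      rw [MvPolynomial.pderiv_monomial, one_mul]
      set o := osc (!b) i k with ho
      by_cases h0 : s o = 0
      · rw [h0]; simp
      have h1 : MvPolynomial.monomial (s - Finsupp.single o 1) ((s o : ℕ) : ℂ) =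
          ((s o : ℕ) : ℂ) • MvPolynomial.monomial (s - Finsupp.single o 1) (1 : ℂ) := by
        rw [MvPolynomial.smul_monomial, smul_eq_mul, mul_one]
      rw [h1]
      refine Submodule.smul_mem _ _ (Submodule.subset_span ⟨_, ?_, rfl⟩)
      have hw : ∀ t : Osc N →₀ ℕ, ∑ o ∈ t.support, t o * oscWeight o =
          Finsupp.linearCombination ℕ oscWeight t := fun t => by
        rw [Finsupp.linearCombination_apply, Finsupp.sum]; simp
      rw [hw] at hs ⊢
      have h2 : s = (s - Finsupp.single o 1) + Finsupp.single o 1 :=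
        (tsub_add_cancel_of_le (Finsupp.single_le_iff.mpr (Nat.one_le_iff_ne_zero.mpr h0))).symm
      have h3 : Finsupp.linearCombination ℕ oscWeight s =
          Finsupp.linearCombination ℕ oscWeight (s - Finsupp.single o 1) + (k + 1) := by
        conv_lhs => rw [h2]
        rw [map_add, Finsupp.linearCombination_single, one_smul]
        rfl
      omega

theorem annihilation_pow_lowWeight {N : ℕ} (α : Lat N) (n k K : ℕ) (p : Bos N)
    (hp : p ∈ lowWeight N K) :
    PowerSeries.coeff k (annihilationSeries α ^ n) p ∈ lowWeight N (K - k) := by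
  induction n generalizing k K p with
  | zero =>
    rw [pow_zero, PowerSeries.coeff_one]
    split_ifs with h
    · subst h; simpa using hp
    · exact Submodule.zero_mem _
  | succ n ih =>
    rw [pow_succ, PowerSeries.coeff_mul, LinearMap.sum_apply]
    refine Submodule.sum_mem _ fun ⟨i, j⟩ hij => ?_
    rw [Finset.HasAntidiagonal.mem_antidiagonal] at hij
    have hj : PowerSeries.coeff j (annihilationSeries α) p ∈ lowWeight N (K - j) := by
      rw [annihilationSeries, PowerSeries.coeff_mk]
      split_ifs with h
      · exact Submodule.zero_mem _
      · rw [LinearMap.smul_apply, latMode, LinearMap.sum_apply]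
        exact Submodule.smul_mem _ _ (Submodule.sum_mem _ fun l _ => Submodule.add_mem _
          (Submodule.smul_mem _ _ (bosMode_lowWeight _ _ _ _ _ hp))
          (Submodule.smul_mem _ _ (bosMode_lowWeight _ _ _ _ _ hp)))
    have := ih i (K - j) _ hj
    rwa [Nat.sub_sub, show j + i = k by simpa [add_comm] using hij] at this

theorem annihilation_trunc {N : ℕ} (α : Lat N) (p : Bos N) :
    ∃ K, ∀ j ≥ K, expCoeff (annihilationSeries α) j p = 0 := by
  obtain ⟨K, hK⟩ := exists_lowWeight p
  refine ⟨K, fun j hj => ?_⟩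
  rw [expCoeff, LinearMap.sum_apply]
  refine Finset.sum_eq_zero fun n _ => ?_
  have := annihilation_pow_lowWeight α n j K p hK
  rw [Nat.sub_eq_zero_of_le hj, lowWeight_zero, Submodule.mem_bot] at this
  rw [LinearMap.smul_apply, this, smul_zero]

/-- The coefficient at `z^i`, `i ∈ ℤ`, of `exp(-∑_{n<0} (α_n / n) z^(-n))`. -/
def creationExp {N : ℕ} (α : Lat N) : ℤ → Module.End ℂ (Bos N)
  | Int.ofNat k => expCoeff (creationSeries α) k
  | Int.negSucc _ => 0

/-- The coefficient at `z^t` of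
`exp(-∑_{n<0} (α_n / n) z^(-n)) exp(-∑_{n>0} (α_n / n) z^(-n))` on `S`. -/
def gammaCoeff {N : ℕ} (α : Lat N) (t : ℤ) : Module.End ℂ (Bos N) :=
  locSum (fun j => creationExp α (t + j) * expCoeff (annihilationSeries α) j) fun p => by
    obtain ⟨K, hK⟩ := annihilation_trunc α p
    exact ⟨K, fun j hj => by rw [Module.End.mul_apply, hK j hj, map_zero]⟩

theorem gammaCoeff_trunc {N : ℕ} (α : Lat N) (p : Bos N) :
    ∃ K : ℤ, ∀ n ≥ K, gammaCoeff α (-n) p = 0 := by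
  obtain ⟨K, hK⟩ := annihilation_trunc α p
  refine ⟨K + 1, fun n hn => (finsum_congr fun j => ?_).trans finsum_zero⟩
  by_cases hj : K ≤ j
  · rw [Module.End.mul_apply, hK j hj, map_zero]
  · obtain ⟨l, hl⟩ := Int.eq_negSucc_of_lt_zero (show -n + (j : ℤ) < 0 by omega)
    simp only [hl]
    rfl

/-- The field `e^α(z)`. It sends `u ⊗ e^β` to
`ε(α, β) z^(α, β) exp(-∑_{n<0} (α_n / n) z^(-n)) exp(-∑_{n>0} (α_n / n) z^(-n)) u ⊗ e^(α + β)`;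
the mode with index `n` is the coefficient at `z^(-n-1)`. -/
def expField {N : ℕ} (α : Lat N) : VertexOperator ℂ (VL N) :=
  ofModes (fun n => Finsupp.lsum ℂ fun β : Lat N =>
    cocycle α β • (Finsupp.lsingle (α + β) ∘ₗ
      mapFock 1 (gammaCoeff α (-n - 1 - pairing α β)))) fun v => by
    induction v using Finsupp.induction_linear with
    | zero => exact ⟨0, fun n _ => map_zero _⟩
    | add v w hv hw =>
      obtain ⟨K, hK⟩ := hv
      obtain ⟨K', hK'⟩ := hw
      exact ⟨max K K', fun n hn => by
        rw [map_add, hK n (by omega), hK' n (by omega), add_zero]⟩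
    | single β u =>
      obtain ⟨K, hK⟩ := fock_trunc
        (fun n => mapFock 1 (gammaCoeff α (-n - 1 - pairing α β)))
        (fun x y => by
          obtain ⟨K, hK⟩ := gammaCoeff_trunc α y
          exact ⟨K - 1 - pairing α β, fun n hn => by
            have := hK (n + 1 + pairing α β) (by omega)
            rw [show -(n + 1 + pairing α β) = -n - 1 - pairing α β by ring] at this
            rw [mapFock_pureFock, this, pureFock_zero_right]⟩) u
      exact ⟨K, fun n hn => by simp [hK n hn]⟩

/-! ### The state-field correspondence and the family `V_{L,q}` -/

/-- The basis of `Λ ⊗ S` of monomials in the oscillators, the fermions being multiplied in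
increasing order. -/
def fockBasis (N : ℕ) : Module.Basis (Finset (Osc N) × (Osc N →₀ ℕ)) ℂ (Fock N) :=
  ((Finsupp.basisSingleOne (R := ℂ) (ι := Osc N)).ExteriorAlgebra).tensorProduct
    (MvPolynomial.basisMonomials (Osc N) ℂ)

/-- The divided derivative of a fermionic field attached to the oscillator `o`. -/
def fermOscField {N : ℕ} (o : Osc N) : VertexOperator ℂ (VL N) :=
  divDeriv (ofLex (ofLex o).2).2 (fermField (ofLex o).1 (ofLex (ofLex o).2).1)

/-- The divided derivative of a bosonic field attached to the oscillator `o`. -/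
def bosOscField {N : ℕ} (o : Osc N) : VertexOperator ℂ (VL N) :=
  divDeriv (ofLex (ofLex o).2).2 (bosField (ofLex o).1 (ofLex (ofLex o).2).1)

/-- The field of a monomial state `x^{(1)} x^{(2)} ⋯ x^{(k)} e^α`: the normally ordered product of
the fields of the oscillators and of `e^α(z)`, nested from the right. -/
def monomialField {N : ℕ} (α : Lat N) (s : Finset (Osc N)) (t : Osc N →₀ ℕ) :
    VertexOperator ℂ (VL N) :=
  (s.sort (· ≤ ·)).foldr (fun o => normalOrder (parity N) (fermOscField o))
    (((Finsupp.toMultiset t).sort (· ≤ ·)).foldr (fun o => normalOrder 1 (bosOscField o))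
      (expField α))

/-- The state-field correspondence of `V_L`. -/
def stateField (N : ℕ) : VL N →ₗ[ℂ] VertexOperator ℂ (VL N) :=
  Finsupp.lsum ℂ fun α : Lat N => (fockBasis N).constr ℂ fun st => monomialField α st.1 st.2

/-- The height of `∑ n_i A^i ∈ L_A`: the sum of the coefficients of its unique expression as
`∑_{i ≤ N + 1} c_i ξ_i` with all `c_i ≥ 0` and some `c_i = 0`, where `ξ_i = A^i` for `i ≤ N` and
`ξ_{N+1} = -∑ A^i`. Here `c_{N+1} = max(0, max_i (-n_i))` and `c_i = n_i + c_{N+1}`. -/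
def ht {N : ℕ} (n : Fin N → ℤ) : ℕ :=
  (∑ i, (n i + (Finset.univ.sup fun j => (-n j).toNat : ℕ)).toNat) +
    Finset.univ.sup fun j => (-n j).toNat

/-- Multiplication of `u ⊗ e^β` by `q^(ht α + ht β - ht (α + β))`, the exponent being `≥ 0`. -/
def deform {N : ℕ} (q : ℂ) (α : Lat N) : Module.End ℂ (VL N) :=
  Finsupp.lsum ℂ fun β : Lat N =>
    (q ^ (ht α.1 + ht β.1 - ht (α.1 + β.1))) • Finsupp.lsingle (R := ℂ) (M := Fock N) β

/-- The state-field correspondence of `V_{L,q}`. For `q ≠ 0` it is the transport of that of `V_L`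
along `t_q : u ⊗ e^α ↦ q^(ht α) u ⊗ e^α`; for `q = 0` it is the limit as `q → 0`. -/
def stateFieldQ (N : ℕ) (q : ℂ) : VL N →ₗ[ℂ] VertexOperator ℂ (VL N) :=
  Finsupp.lsum ℂ fun α : Lat N =>
    LinearMap.lcomp ℂ (HahnModule ℤ ℂ (VL N)) (deform q α) ∘ₗ stateField N ∘ₗ Finsupp.lsingle α

/-- The `n`-th product `x_(n) y` of `V_{L,q}`. -/
def nthProd {N : ℕ} (q : ℂ) (n : ℤ) (x y : VL N) : VL N :=
  VertexOperator.ncoeff (stateFieldQ N q x) n y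

/-! ### The differentials and the fermionic charge -/

/-- The state `e^α`. -/
def expState {N : ℕ} (α : Lat N) : VL N := Finsupp.single α (pureFock 1 1)

/-- The element `A^i` of `L`. -/
def latA {N : ℕ} (i : Fin N) : Lat N := (Pi.single i 1, 0)

/-- The element `-A^1 - ⋯ - A^N` of `L`. -/
def latT (N : ℕ) : Lat N := (fun _ => -1, 0)

/-- The state `Ψ^i_{-1} e^α`. -/
def psiState {N : ℕ} (i : Fin N) (α : Lat N) : VL N :=
  Finsupp.single α (pureFock (ExteriorAlgebra.ι ℂ (Finsupp.single (osc true i 0) (1 : ℂ))) 1)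

/-- The state `A^i_{-1} Φ^i_0 e^0`. -/
def aPhiState {N : ℕ} (i : Fin N) : VL N :=
  Finsupp.single 0 (pureFock (ExteriorAlgebra.ι ℂ (Finsupp.single (osc false i 0) (1 : ℂ)))
    (MvPolynomial.X (osc false i 0)))

/-- `D = ∫ ∑_i Ψ^i(z) (e^{A^i} - e^{-∑_j A^j})(z)`, acting on `V_{L,q}`. -/
def D (N : ℕ) (q : ℂ) : Module.End ℂ (VL N) :=
  VertexOperator.ncoeff
    (stateFieldQ N q (∑ i : Fin N, (psiState i (latA i) - psiState i (latT N)))) 0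

/-- `Q_0 = ∫ ∑_i A^i(z) Φ^i(z)`, acting on `V_{L,q}`. -/
def Q0 (N : ℕ) (q : ℂ) : Module.End ℂ (VL N) :=
  VertexOperator.ncoeff (stateFieldQ N q (∑ i : Fin N, aPhiState i)) 0

/-- The fermionic charge of a monomial: the number of `Φ`'s minus the number of `Ψ`'s. -/
def charge {N : ℕ} (s : Finset (Osc N)) : ℤ :=
  ((s.filter fun o => (ofLex o).1 = false).card : ℤ) - (s.filter fun o => (ofLex o).1 = true).card

/-- The filtration of `V_{L,q}` by fermionic charge. -/
def chargeLE (N : ℕ) (n : ℤ) : Submodule ℂ (VL N) :=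
  Submodule.span ℂ {v | ∃ (α : Lat N) (s : Finset (Osc N)) (t : Osc N →₀ ℕ),
    charge s ≤ n ∧ v = Finsupp.single α (fockBasis N (s, t))}

/-- The ring `ℂ[T]/(T^{N+1} - q^{N+1})`. -/
def QuantumRing (N : ℕ) (q : ℂ) : Type :=
  ℂ[X] ⧸ Ideal.span {(Polynomial.X ^ (N + 1) - Polynomial.C (q ^ (N + 1)) : ℂ[X])}

instance (N : ℕ) (q : ℂ) : CommRing (QuantumRing N q) :=
  inferInstanceAs (CommRing (ℂ[X] ⧸ Ideal.span {(_ : ℂ[X])}))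

instance (N : ℕ) (q : ℂ) : Algebra ℂ (QuantumRing N q) :=
  inferInstanceAs (Algebra ℂ (ℂ[X] ⧸ Ideal.span {(_ : ℂ[X])}))

/-- The class of the variable `T`. -/
def quantumT (N : ℕ) (q : ℂ) : QuantumRing N q :=
  Ideal.Quotient.mk (Ideal.span {(Polynomial.X ^ (N + 1) - Polynomial.C (q ^ (N + 1)) : ℂ[X])})
    Polynomial.X

end ChiralPN

end

open ChiralPN

/-!
The total complex of `V_{L,q}` is reduced to a Koszul complex over the deformed group algebra of
`L_A`, by an explicit homotopy for `Q_0` that anticommutes with `D`.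

*Derivations.* The multiplicativity in the first part rests on one fact about the vertex algebra:
the `0`-th modes of homogeneous states are derivations of all products (`stateMode_derivation`,
`qMode_derivation`, `d_derivation`). It is proved without the Borcherds identity. The generating
fields are mutually local, the exponentials by the explicit computation `dif_superComm_em`, and
translation covariant; Dong's lemma (`Loc.comm_zero`, `Loc.normal₂`) extends locality to all fields
of states and to the commutator of `w_(0)` with such a field. This commutator and the field of
`w_(0) u` are thus two local covariant fields that create the same vector from the vacuum, and agree
by Goddard's uniqueness theorem (`eq_zero_of_local`). The deformation by powers of `q` does no harm,
because both sides of the derivation rule acquire the factor with exponent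
`ht α + ht β + ht γ - ht (α + β + γ)`.

*Relations.* In terms of modes, `Q_0 = ∑ Φ^i_k A^i_{-k}`, `D = ∑ Ψ^i_k E^i_{-k}` with `E^i(z)` the
field of `e^{A^i} - e^{-∑ A^j}`, and with these one considers `G = ∑ Ψ^i_k B^i_{-k}` (`expands_Q0`,
`expands_D`, `expands_G`; here `k ∈ ℤ`, up to the indexing of modes). As `L_A` is isotropic, the
squares of `D` and `Q_0` vanish; `D Q_0 + Q_0 D` is the residue of a sum of fields
`:α(z) e^α(z): = ∂ e^α(z)`, hence zero (`em_derivative`, `D_Q0`). Moreover `D G + G D = 0` (`D_G`),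
and `L_0 = Q_0 G + G Q_0` is diagonal in the monomials, with the conformal weights as eigenvalues
(`L0_eq_diagOp`).

*Contraction.* Consequently `G / L_0` contracts `Q_0` away from conformal weight zero. Where the
lattice vector has a nonzero component `m_i` along `B^i`, the conformal weight may vanish, but there
`Ψ^i_0 / m_i` is a homotopy, because `Q_0 Ψ^i_0 + Ψ^i_0 Q_0 = A^i_0`. Together they give the operator
`homotopy`, which contracts `Q_0` onto the core: the span of the `Φ^{i_1}_0 ⋯ Φ^{i_r}_0 e^β` with
`β ∈ L_A`, that is, the image of `coreProj`. It anticommutes with `D` and lowers the charge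
(`Q0_homotopy`, `D_homotopy`, `contraction`). On the core `Q_0` vanishes and all charges are
nonnegative. From such a `Contraction` the convergence, the degeneration at `E_2` and the comparison
of the iterated with the total cohomology follow formally (`Contraction.converges`,
`Contraction.differentialVanishes`, `Contraction.exists_iterated_equiv`).

*The Koszul complex.* On the core, `D` is `∑ Ψ^i_0 (e^{A^i} - e^{-∑ A^j})` (`D_coreProj`), a Koszul
differential over the deformed `ℂ[L_A]`. With `T = e^{-∑ A^j}` and `x_i = e^{A^i} - T`, this algebra
becomes `ℂ[x_1, …, x_N][T] / (T ∏ (T + x_i) - q^{N+1})` (`famEquiv`), which is free over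
`ℂ[x_1, …, x_N]` since the relation is monic in `T`. So the `x_i` form a regular sequence, made
explicit by division operators (`exists_division`), and only cohomology of charge zero survives
(`exists_latInc_add_D`). It is the quotient by the `x_i`, which is `ℂ[T] / (T^{N+1} - q^{N+1})`
(`exists_of_toQuantum_eq_zero`, `cohEquiv`). On representatives in `ℂ[L_A]` the `(-1)`-st product is
the product of the deformed group algebra; that it descends to classes is the derivation property
(`quantumClass_mul`).
-/


open scoped TensorProduct Polynomial

noncomputable section

namespace ChiralPN

/-! ### Finite differences and locality -/

section Differences

variable {W W' : Type*} [AddCommGroup W] [AddCommGroup W']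

/-- Multiplication of a formal distribution in two variables by `z - w`, on the level of its
coefficients. -/
def dif (f : ℤ → ℤ → W) : ℤ → ℤ → W := fun m n => f (m + 1) n - f m (n + 1)

theorem dif_iterate_zero (N : ℕ) : dif^[N] (fun _ _ => (0 : W)) = fun _ _ => 0 := by
  induction N with
  | zero => rfl
  | succ N ih =>
    rw [Function.iterate_succ_apply']
    rw [ih]; funext m n; simp [dif]

theorem dif_iterate_map (φ : W →+ W') (f : ℤ → ℤ → W) (N : ℕ) :
    dif^[N] (fun m n => φ (f m n)) = fun m n => φ ((dif^[N] f) m n) := by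
  induction N with
  | zero => rfl
  | succ N ih =>
    rw [Function.iterate_succ_apply', ih, Function.iterate_succ_apply']
    funext m n; simp [dif]

theorem dif_iterate_sub (f g : ℤ → ℤ → W) (N : ℕ) :
    dif^[N] (fun m n => f m n - g m n) = fun m n => (dif^[N] f) m n - (dif^[N] g) m n := by
  induction N with
  | zero => rfl
  | succ N ih =>
    rw [Function.iterate_succ_apply', ih, Function.iterate_succ_apply',
      Function.iterate_succ_apply']
    funext m n; simp only [dif]; abel

theorem dif_iterate_add (f g : ℤ → ℤ → W) (N : ℕ) :
    dif^[N] (fun m n => f m n + g m n) = fun m n => (dif^[N] f) m n + (dif^[N] g) m n := by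
  induction N with
  | zero => rfl
  | succ N ih =>
    rw [Function.iterate_succ_apply', ih, Function.iterate_succ_apply',
      Function.iterate_succ_apply']
    funext m n; simp only [dif]; abel

theorem dif_iterate_flip (f : ℤ → ℤ → W) (N : ℕ) :
    dif^[N] (fun m n => f n m) = fun m n => (-1 : ℤ) ^ N • (dif^[N] f) n m := by
  induction N with
  | zero => simp
  | succ N ih =>
    rw [Function.iterate_succ_apply', ih, Function.iterate_succ_apply']
    funext m n
    rw [pow_succ, mul_smul]
    simp only [dif, smul_sub, neg_smul, one_smul, smul_neg]
    abel

theorem dif_iterate_eq_zero_of_le {f : ℤ → ℤ → W} {N M : ℕ} (h : N ≤ M)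
    (hf : dif^[N] f = fun _ _ => 0) : dif^[M] f = fun _ _ => 0 := by
  obtain ⟨k, rfl⟩ := Nat.exists_eq_add_of_le h
  rw [add_comm, Function.iterate_add_apply, hf, dif_iterate_zero]

/-- A distribution killed by a power of `z - w` vanishes if it is bounded in one variable. -/
theorem eq_zero_of_dif_iterate {f : ℤ → ℤ → W} {K : ℤ} (hK : ∀ m ≥ K, ∀ n, f m n = 0) {N : ℕ}
    (hf : dif^[N] f = fun _ _ => 0) (m n : ℤ) : f m n = 0 := by
  induction N generalizing f m n with
  | zero => exact congr_fun₂ hf m n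
  | succ N ih =>
    have h1 : ∀ m n, dif f m n = 0 := fun m n =>
      ih (f := dif f) (fun m hm n => by simp [dif, hK m hm, hK (m + 1) (by omega)]) hf m n
    have h2 : ∀ (j : ℕ) (m n : ℤ), f m n = f (m + j) (n - j) := by
      intro j
      induction j with
      | zero => simp
      | succ j ihj =>
        intro m n
        rw [ihj]
        have := sub_eq_zero.mp (h1 (m + j) (n - j - 1))
        rw [show n - j - 1 + 1 = n - (j : ℤ) by ring] at this
        rw [← this]
        congr 1
        · push_cast; ring
        · push_cast; ring
    rw [h2 (K - m).toNat, hK _ (by omega)]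

theorem dif_iterate_shift (f : ℤ → ℤ → W) (a : ℤ) (N : ℕ) :
    dif^[N] (fun m n => f (m + a) n) = fun m n => (dif^[N] f) (m + a) n := by
  induction N with
  | zero => rfl
  | succ N ih =>
    rw [Function.iterate_succ_apply', ih, Function.iterate_succ_apply']
    funext m n
    simp only [dif]
    rw [add_right_comm]

/-- The discrete Leibniz rule: multiplying the coefficients by a polynomial of degree `k` in the
first index, as a `k`-fold derivative does, raises the order of locality by at most `k`. -/
theorem dif_iterate_choose_smul (k N : ℕ) (f : ℤ → ℤ → W) (hf : dif^[N] f = fun _ _ => 0) :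
    dif^[N + k] (fun m n => Ring.choose ((k : ℤ) - m - 1) k • f m n) = fun _ _ => 0 := by
  induction k generalizing N f with
  | zero => simpa using hf
  | succ k ihk =>
    induction N generalizing f with
    | zero =>
      have : f = fun _ _ => 0 := hf
      subst this
      simpa using dif_iterate_zero (W := W) (k + 1)
    | succ N ihN =>
      have h1 : dif (fun m n => Ring.choose (((k + 1 : ℕ) : ℤ) - m - 1) (k + 1) • f m n) =
          fun m n => Ring.choose (((k + 1 : ℕ) : ℤ) - m - 1) (k + 1) • dif f m n
            - Ring.choose ((k : ℤ) - m - 1) k • f (m + 1) n := by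
        funext m n
        have h2 : Ring.choose (((k + 1 : ℕ) : ℤ) - m - 1) (k + 1) =
            Ring.choose ((k : ℤ) - m - 1) k + Ring.choose ((k : ℤ) - m - 1) (k + 1) := by
          rw [← Ring.choose_succ_succ]; congr 1; push_cast; ring
        have h3 : ((k + 1 : ℕ) : ℤ) - (m + 1) - 1 = (k : ℤ) - m - 1 := by push_cast; ring
        simp only [dif]
        rw [h3, h2]
        simp only [add_smul, smul_sub]
        abel
      rw [show N + 1 + (k + 1) = N + (k + 1) + 1 by ring, Function.iterate_succ_apply, h1,
        dif_iterate_sub]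
      rw [ihN (dif f) hf, show N + (k + 1) = N + 1 + k by ring,
        ihk (N + 1) (fun m n => f (m + 1) n)]
      · simp
      · rw [dif_iterate_shift, hf]

end Differences

/-! ### Distributions in three variables -/

section ThreeVariables

variable {W W' : Type*} [AddCommGroup W] [AddCommGroup W']

/-- Multiplication by `z₁ - z₂` on the coefficients of a distribution in `z₁, z₂, z₃`. -/
def dif₁₂ (W : Type*) [AddCommGroup W] : Module.End ℤ (ℤ → ℤ → ℤ → W) where
  toFun f := fun k m n => f (k + 1) m n - f k (m + 1) n
  map_add' f g := by funext k m n; simp only [Pi.add_apply]; abel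
  map_smul' c f := by funext k m n; simp [smul_sub]

/-- Multiplication by `z₂ - z₃` on the coefficients of a distribution in `z₁, z₂, z₃`. -/
def dif₂₃ (W : Type*) [AddCommGroup W] : Module.End ℤ (ℤ → ℤ → ℤ → W) where
  toFun f := fun k m n => f k (m + 1) n - f k m (n + 1)
  map_add' f g := by funext k m n; simp only [Pi.add_apply]; abel
  map_smul' c f := by funext k m n; simp [smul_sub]

theorem commute_dif₁₂_dif₂₃ : Commute (dif₁₂ W) (dif₂₃ W) := by
  ext f k m n
  simp only [Module.End.mul_apply, dif₁₂, dif₂₃, LinearMap.coe_mk, AddHom.coe_mk]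
  abel

theorem dif₁₂_pow_apply (f : ℤ → ℤ → ℤ → W) (N : ℕ) (k m n : ℤ) :
    (dif₁₂ W ^ N) f k m n = (dif^[N] fun k m => f k m n) k m := by
  induction N generalizing k m n with
  | zero => rfl
  | succ N ih =>
    rw [pow_succ', Module.End.mul_apply, Function.iterate_succ_apply']
    simp only [dif₁₂, dif] at ih ⊢
    simp only [LinearMap.coe_mk, AddHom.coe_mk] at ih ⊢
    rw [ih, ih]

theorem dif₂₃_pow_apply (f : ℤ → ℤ → ℤ → W) (N : ℕ) (k m n : ℤ) :
    (dif₂₃ W ^ N) f k m n = (dif^[N] fun m n => f k m n) m n := by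
  induction N generalizing k m n with
  | zero => rfl
  | succ N ih =>
    rw [pow_succ', Module.End.mul_apply, Function.iterate_succ_apply']
    simp only [dif₂₃, dif] at ih ⊢
    simp only [LinearMap.coe_mk, AddHom.coe_mk] at ih ⊢
    rw [ih, ih]

theorem dif₁₃_pow_apply (f : ℤ → ℤ → ℤ → W) (N : ℕ) (k m n : ℤ) :
    ((dif₁₂ W + dif₂₃ W) ^ N) f k m n = (dif^[N] fun k n => f k m n) k n := by
  induction N generalizing k m n with
  | zero => rfl
  | succ N ih =>
    rw [pow_succ', Module.End.mul_apply, Function.iterate_succ_apply']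
    rw [LinearMap.add_apply]
    simp only [Pi.add_apply]
    generalize hg : ((dif₁₂ W + dif₂₃ W) ^ N) f = g at ih ⊢
    simp only [dif, dif₁₂, dif₂₃, LinearMap.coe_mk, AddHom.coe_mk]
    rw [← ih, ← ih]
    abel

/-- The algebraic core of Dong's lemma, `z₁ - z₃ = (z₁ - z₂) + (z₂ - z₃)`. -/
theorem add_pow_apply_eq_zero {M : Type*} [AddCommGroup M] {x y : Module.End ℤ M}
    (h : Commute x y) {N R : ℕ} {v : M} (h1 : (x ^ N) (((x + y) ^ N) v) = 0)
    (h2 : (y ^ R) v = 0) : ((x + y) ^ (N + R + N)) v = 0 := by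
  have hx : Commute x ((x + y) ^ N) := ((Commute.refl x).add_right h).pow_right N
  have hy : Commute y ((x + y) ^ N) := (h.symm.add_right (Commute.refl y)).pow_right N
  rw [pow_add, Module.End.mul_apply, h.add_pow, LinearMap.sum_apply]
  refine Finset.sum_eq_zero fun i hi => ?_
  rw [Module.End.mul_apply, Module.End.mul_apply]
  have hzero : (x ^ i) ((y ^ (N + R - i)) (((x + y) ^ N) v)) = 0 := by
    rcases le_total N i with hN | hN
    · obtain ⟨j, rfl⟩ := Nat.exists_eq_add_of_le hN
      rw [← Module.End.mul_apply, (h.pow_pow _ _).eq, Module.End.mul_apply, add_comm N j, pow_add,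
        Module.End.mul_apply, h1, map_zero, map_zero]
    · obtain ⟨j, hj⟩ := Nat.exists_eq_add_of_le (show R ≤ N + R - i by omega)
      rw [← Module.End.mul_apply (y ^ (N + R - i)), (hy.pow_left _).eq, Module.End.mul_apply, hj,
        add_comm R j, pow_add, Module.End.mul_apply (y ^ j), h2]
      simp
  have hc : ∀ (c : ℕ) (w : M), (c : Module.End ℤ M) w = c • w := fun c w => by simp
  have := congrArg (fun w => (((N + R).choose i : ℕ)) • w) hzero
  simp only [smul_zero] at this
  rw [← this]
  rw [hc]
  simp only [map_nsmul]

end ThreeVariables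

/-! ### Locality and Dong's lemma for commutators -/

section Locality

variable {V : Type*} [AddCommGroup V] [Module ℂ V]

/-- The supercommutator `a_(m) b_(n) ∓ b_(n) a_(m)` of two families of modes. The operator `s` is
`1` if `a` is even, and the parity involution if `a` is odd. -/
def superComm (s : Module.End ℂ V) (a b : ℤ → Module.End ℂ V) (m n : ℤ) : Module.End ℂ V :=
  a m * b n - s * b n * s * a m

/-- Mutual locality `(z - w)^N [a(z), b(w)] = 0`, for a large `N`, of two families of modes. -/
def Loc (s : Module.End ℂ V) (a b : ℤ → Module.End ℂ V) : Prop :=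
  ∃ N : ℕ, dif^[N] (superComm s a b) = fun _ _ => 0

/-- The modes of a field annihilate every vector eventually. -/
def Trunc (a : ℤ → Module.End ℂ V) : Prop := ∀ v, ∃ K : ℤ, ∀ n ≥ K, a n v = 0

theorem Loc.neg {s : Module.End ℂ V} {a b : ℤ → Module.End ℂ V} (h : Loc s a b) :
    Loc s a (fun n => - b n) := by
  obtain ⟨N, hN⟩ := h
  refine ⟨N, ?_⟩
  have : superComm s a (fun n => - b n) = fun m n =>
      (-AddMonoidHom.id (Module.End ℂ V)) (superComm s a b m n) := by
    funext m n; simp [superComm]; abel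
  rw [this, dif_iterate_map, hN]; simp

theorem Loc.zero (s : Module.End ℂ V) (a : ℤ → Module.End ℂ V) : Loc s a (fun _ => 0) :=
  ⟨0, by funext m n; simp [superComm]⟩

theorem Loc.add {s : Module.End ℂ V} {a b c : ℤ → Module.End ℂ V} (h : Loc s a b)
    (h' : Loc s a c) : Loc s a (fun n => b n + c n) := by
  obtain ⟨N, hN⟩ := h
  obtain ⟨M, hM⟩ := h'
  refine ⟨max N M, ?_⟩
  have : superComm s a (fun n => b n + c n) = fun m n =>
      superComm s a b m n + superComm s a c m n := by
    funext m n; simp only [superComm]; noncomm_ring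
  rw [this, dif_iterate_add, dif_iterate_eq_zero_of_le (le_max_left N M) hN,
    dif_iterate_eq_zero_of_le (le_max_right N M) hM]
  simp

theorem Loc.smul {s : Module.End ℂ V} {a b : ℤ → Module.End ℂ V} (r : ℂ) (h : Loc s a b) :
    Loc s a (fun n => r • b n) := by
  obtain ⟨N, hN⟩ := h
  refine ⟨N, ?_⟩
  have : superComm s a (fun n => r • b n) = fun m n =>
      (DistribSMul.toAddMonoidHom (Module.End ℂ V) r) (superComm s a b m n) := by
    funext m n; simp [superComm, smul_sub]
  rw [this, dif_iterate_map, hN]; simp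

/-- Locality is symmetric for families of definite parity; `ε` is the sign of their exchange. -/
theorem Loc.symm {s t : Module.End ℂ V} {a b : ℤ → Module.End ℂ V} {ε : ℂ} (hε : ε * ε = 1)
    (hab : ∀ n, s * b n * s = ε • b n) (hba : ∀ n, t * a n * t = ε • a n)
    (h : Loc s a b) : Loc t b a := by
  obtain ⟨N, hN⟩ := h
  refine ⟨N, ?_⟩
  have : superComm t b a = fun m n => (DistribSMul.toAddMonoidHom (Module.End ℂ V) (-ε))
      (superComm s a b n m) := by
    funext m n
    simp only [superComm, hab, hba, DistribSMul.toAddMonoidHom_apply, smul_sub, smul_mul_assoc,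
      smul_smul, neg_mul, hε, neg_smul, one_smul]
    abel
  rw [this, dif_iterate_map, dif_iterate_flip, hN]
  simp

/-- The `k`-th divided derivative of a local family is local. -/
theorem Loc.divDeriv {s : Module.End ℂ V} {a b : ℤ → Module.End ℂ V} (k : ℕ) (h : Loc s a b) :
    Loc s (fun m => Ring.choose ((k : ℤ) - m - 1) k • a (m - k)) b := by
  obtain ⟨N, hN⟩ := h
  refine ⟨N + k, ?_⟩
  have : superComm s (fun m => Ring.choose ((k : ℤ) - m - 1) k • a (m - k)) b = fun m n =>
      Ring.choose ((k : ℤ) - m - 1) k • superComm s a b (m + -k) n := by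
    funext m n
    simp only [superComm, smul_sub, smul_mul_assoc, mul_smul_comm, ← sub_eq_add_neg]
  rw [this]
  refine dif_iterate_choose_smul k N (fun m n => superComm s a b (m + -k) n) ?_
  rw [dif_iterate_shift, hN]

/-- The supercommutator of `c` with a family in two indices. -/
def superComm₂ (s : Module.End ℂ V) (c : ℤ → Module.End ℂ V) (U : ℤ → ℤ → Module.End ℂ V) :
    ℤ → ℤ → ℤ → Module.End ℂ V :=
  fun k m n => c k * U m n - s * U m n * s * c k

/-- If `(z₁ - z₂)^N (z₁ - z₃)^N` kills the supercommutator of `c(z₁)` with `U(z₂, z₃)`, and a power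
of `z₂ - z₃` kills `U`, then `c` is local to every coefficient of `U` in `z₂`: by
`add_pow_apply_eq_zero` a power of `z₁ - z₃` alone kills the supercommutator. -/
theorem loc_of_triple {s : Module.End ℂ V} {c : ℤ → Module.End ℂ V}
    {U : ℤ → ℤ → Module.End ℂ V} {N R : ℕ} (hR : dif^[R] U = fun _ _ => 0)
    (hN : (dif₁₂ (Module.End ℂ V) ^ N) (((dif₁₂ (Module.End ℂ V) + dif₂₃ (Module.End ℂ V)) ^ N) (superComm₂ s c U)) = 0) (m : ℤ) :
    Loc s c (U m) := by
  refine ⟨N + R + N, ?_⟩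
  have h2 : (dif₂₃ (Module.End ℂ V) ^ R) (superComm₂ s c U) = 0 := by
    funext k m n
    rw [dif₂₃_pow_apply]
    let φ : Module.End ℂ V →+ Module.End ℂ V :=
      AddMonoidHom.mulLeft (c k) - (AddMonoidHom.mulRight (c k)).comp
        ((AddMonoidHom.mulRight s).comp (AddMonoidHom.mulLeft s))
    have : (fun m n => superComm₂ s c U k m n) = fun m n => φ (U m n) := by
      funext m n; simp [φ, superComm₂]
    rw [this, dif_iterate_map, hR]
    simp
  have h3 := add_pow_apply_eq_zero commute_dif₁₂_dif₂₃ hN h2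
  funext k n
  have h4 := congr_fun₃ h3 k m n
  rwa [dif₁₃_pow_apply] at h4

theorem dif₁₂_pow_eq_zero {f : ℤ → ℤ → Module.End ℂ V} {N : ℕ} (hf : dif^[N] f = fun _ _ => 0)
    (φ : ℤ → Module.End ℂ V →+ Module.End ℂ V) :
    (dif₁₂ (Module.End ℂ V) ^ N) (fun k m n => φ n (f k m)) = 0 := by
  funext k m n
  rw [dif₁₂_pow_apply, dif_iterate_map, hf]
  simp

theorem dif₁₃_pow_eq_zero {f : ℤ → ℤ → Module.End ℂ V} {N : ℕ} (hf : dif^[N] f = fun _ _ => 0)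
    (φ : ℤ → Module.End ℂ V →+ Module.End ℂ V) :
    ((dif₁₂ (Module.End ℂ V) + dif₂₃ (Module.End ℂ V)) ^ N) (fun k m n => φ m (f k n)) = 0 := by
  funext k m n
  rw [dif₁₃_pow_apply, dif_iterate_map, hf]
  simp

/-- The product `(z₁ - z₂)^N (z₁ - z₃)^N` kills a sum of which each factor kills one summand. -/
theorem triple_of_add {F G H : ℤ → ℤ → ℤ → Module.End ℂ V} {N : ℕ} (h : F = G + H)
    (hG : (dif₁₂ (Module.End ℂ V) ^ N) G = 0)
    (hH : ((dif₁₂ (Module.End ℂ V) + dif₂₃ (Module.End ℂ V)) ^ N) H = 0) :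
    (dif₁₂ (Module.End ℂ V) ^ N)
      (((dif₁₂ (Module.End ℂ V) + dif₂₃ (Module.End ℂ V)) ^ N) F) = 0 := by
  have hx : Commute (dif₁₂ (Module.End ℂ V) ^ N)
      ((dif₁₂ (Module.End ℂ V) + dif₂₃ (Module.End ℂ V)) ^ N) :=
    ((Commute.refl _).add_right commute_dif₁₂_dif₂₃).pow_pow N N
  rw [h, map_add, hH, add_zero, ← Module.End.mul_apply, hx.eq, Module.End.mul_apply, hG, map_zero]

/-- The hypothesis of `loc_of_triple` for `a(z₂) b(z₃)`, by the Leibniz rule for the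
supercommutator. -/
theorem triple_mul_left {t : Module.End ℂ V} {a b c : ℤ → Module.End ℂ V}
    (ht : t * t = 1) {N : ℕ} (h1 : dif^[N] (superComm t c a) = fun _ _ => 0)
    (h2 : dif^[N] (superComm t c b) = fun _ _ => 0) :
    (dif₁₂ (Module.End ℂ V) ^ N) (((dif₁₂ (Module.End ℂ V) + dif₂₃ (Module.End ℂ V)) ^ N)
      (superComm₂ t c fun m n => a m * b n)) = 0 := by
  refine triple_of_add ?_
    (dif₁₂_pow_eq_zero h1 fun n => AddMonoidHom.mulRight (b n))
    (dif₁₃_pow_eq_zero h2 fun m => AddMonoidHom.mulLeft (t * a m * t))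
  funext k m n
  simp only [superComm₂, superComm, Pi.add_apply, AddMonoidHom.coe_mulRight,
    AddMonoidHom.coe_mulLeft, sub_mul, mul_sub]
  have : t * a m * t * (t * b n * t * c k) = t * a m * (t * t) * b n * t * c k := by noncomm_ring
  rw [this, ht]
  noncomm_ring

/-- The hypothesis of `loc_of_triple` for the product `± b(z₃) a(z₂)` in the opposite order. The
sign is carried by conjugation with `s`. -/
theorem triple_mul_right {s t : Module.End ℂ V} {a b c : ℤ → Module.End ℂ V} {ε : ℂ}
    (hs : s * s = 1) (ht : t * t = 1) (hst : s * t = t * s) (hε : ε * ε = 1)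
    (hc : ∀ n, s * c n * s = ε • c n) {N : ℕ} (h1 : dif^[N] (superComm t c a) = fun _ _ => 0)
    (h2 : dif^[N] (superComm t c b) = fun _ _ => 0) :
    (dif₁₂ (Module.End ℂ V) ^ N) (((dif₁₂ (Module.End ℂ V) + dif₂₃ (Module.End ℂ V)) ^ N)
      (superComm₂ t c fun m n => s * b n * s * a m)) = 0 := by
  refine triple_of_add ?_
    (dif₁₂_pow_eq_zero h1 fun n => AddMonoidHom.mulLeft (t * (s * b n * s) * t))
    (dif₁₃_pow_eq_zero h2 fun m => (DistribSMul.toAddMonoidHom (Module.End ℂ V) ε).comp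
      ((AddMonoidHom.mulRight (s * a m)).comp (AddMonoidHom.mulLeft s)))
  funext k m n
  have hc' : c k = ε • (s * c k * s) := by rw [hc, smul_smul, hε, one_smul]
  have h3 : ε • (s * (c k * b n - t * b n * t * c k) * (s * a m)) =
      c k * (s * b n * s * a m) - t * (s * b n * s) * t * c k * a m := by
    have e1 : s * (c k * b n - t * b n * t * c k) * (s * a m) =
        (s * c k * s) * (s * b n * s * a m)
          - (s * t) * b n * (t * s) * (s * c k * s) * a m := by
      have q1 : (s * c k * s) * (s * b n * s * a m) = s * c k * (s * s) * b n * s * a m := by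
        noncomm_ring
      have q2 : (s * t) * b n * (t * s) * (s * c k * s) * a m =
          (s * t) * b n * t * (s * s) * c k * s * a m := by noncomm_ring
      rw [q1, q2, hs]; noncomm_ring
    rw [e1, smul_sub, ← smul_mul_assoc, ← hc', hst, ← hst]
    congr 1
    rw [← smul_mul_assoc, ← mul_smul_comm, ← hc', hst]
    nth_rewrite 2 [← hst]
    noncomm_ring
  simp only [superComm₂, superComm, Pi.add_apply, AddMonoidHom.coe_mulRight,
    AddMonoidHom.coe_mulLeft, AddMonoidHom.comp_apply, DistribSMul.toAddMonoidHom_apply]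
  rw [h3]
  have q4 : t * (s * b n * s) * t * (c k * a m - t * a m * t * c k) =
      t * (s * b n * s) * t * c k * a m - t * (s * b n * s) * (t * t) * a m * t * c k := by
    noncomm_ring
  rw [q4, ht]
  noncomm_ring

/-- Dong's lemma for the `0`-th product: the supercommutator of `a_(0)` with `b(z)` is local to
every field local to both. -/
theorem Loc.comm_zero {s t : Module.End ℂ V} {a b c : ℤ → Module.End ℂ V} {ε : ℂ}
    (hs : s * s = 1) (ht : t * t = 1) (hst : s * t = t * s) (hε : ε * ε = 1)
    (hc : ∀ n, s * c n * s = ε • c n) (hab : Loc s a b) (hca : Loc t c a) (hcb : Loc t c b) :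
    Loc t c (superComm s a b 0) := by
  obtain ⟨R, hR⟩ := hab
  obtain ⟨N₁, h1⟩ := hca
  obtain ⟨N₂, h2⟩ := hcb
  have h1' := dif_iterate_eq_zero_of_le (le_max_left N₁ N₂) h1
  have h2' := dif_iterate_eq_zero_of_le (le_max_right N₁ N₂) h2
  refine loc_of_triple hR (N := max N₁ N₂) ?_ 0
  have : superComm₂ t c (superComm s a b) = superComm₂ t c (fun m n => a m * b n) -
      superComm₂ t c (fun m n => s * b n * s * a m) := by
    funext k m n
    simp only [superComm₂, superComm, Pi.sub_apply]
    noncomm_ring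
  rw [this, map_sub, map_sub, triple_mul_left ht h1' h2',
    triple_mul_right hs ht hst hε hc h1' h2', sub_zero]

end Locality

/-! ### Dong's lemma for normally ordered products -/

section NormalOrder

variable {V : Type*} [AddCommGroup V] [Module ℂ V]

theorem locSum_eventually {W : Type*} [AddCommGroup W] [Module ℂ W] (f : ℕ → V →ₗ[ℂ] W)
    (hf : ∀ v, ∃ K, ∀ j ≥ K, f j v = 0) (v : V) :
    ∀ᶠ J in Filter.atTop, locSum f hf v = ∑ j ∈ Finset.range J, f j v := by
  obtain ⟨K, hK⟩ := hf v
  filter_upwards [Filter.eventually_ge_atTop K] with J hJ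
  refine finsum_eq_sum_of_support_subset _ fun j hj => ?_
  rw [Finset.coe_range, Set.mem_Iio]
  by_contra hlt
  exact hj (hK j (by omega))

/-- The `j`-th summand of the coefficient `normal₂`. For `m = 0` it is the `j`-th summand of the `n`-th
mode of `:a(z) b(z):`. -/
def normalTerm₂ (s : Module.End ℂ V) (a b : ℤ → Module.End ℂ V) (m n : ℤ) (j : ℕ) :
    Module.End ℂ V :=
  a (m - 1 - j) * b (n + j) + s * b (n - 1 - j) * s * a (m + j)

theorem normalTerm₂_trunc (s : Module.End ℂ V) {a b : ℤ → Module.End ℂ V} (ha : Trunc a)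
    (hb : Trunc b) (m n : ℤ) (v : V) : ∃ K : ℕ, ∀ j ≥ K, normalTerm₂ s a b m n j v = 0 := by
  obtain ⟨K, hK⟩ := ha v
  obtain ⟨K', hK'⟩ := hb v
  refine ⟨(max (K - m) (K' - n)).toNat, fun j hj => ?_⟩
  simp only [normalTerm₂, LinearMap.add_apply, Module.End.mul_apply]
  rw [hK (m + j) (by omega), hK' (n + j) (by omega)]
  simp

/-- The coefficients of the distribution `(z - w)⁻¹ a(z) b(w) - (± (z - w)⁻¹ b(w) a(z))`, where the first
`(z - w)⁻¹` is expanded in `|z| > |w|` and the second in `|w| > |z|`. Its residue in `z` is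
`:a(w) b(w):`. -/
def normal₂ (s : Module.End ℂ V) (a b : ℤ → Module.End ℂ V) (ha : Trunc a) (hb : Trunc b)
    (m n : ℤ) : Module.End ℂ V :=
  locSum (normalTerm₂ s a b m n) (normalTerm₂_trunc s ha hb m n)

theorem ncoeff_normalOrder (s : Module.End ℂ V) (a b : VertexOperator ℂ V) (n : ℤ) :
    VertexOperator.ncoeff (normalOrder s a b) n =
      normal₂ s (VertexOperator.ncoeff a) (VertexOperator.ncoeff b) (ncoeff_trunc a)
        (ncoeff_trunc b) 0 n := by
  rw [normalOrder, ncoeff_ofModes]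
  ext v
  refine finsum_congr fun j => ?_
  simp only [normalTerm, normalTerm₂]
  rw [zero_add, show (0 : ℤ) - 1 - j = -(j : ℤ) - 1 by ring]

/-- `(z - w) U(z, w) = [a(z), b(w)]` for the distribution `U` with residue `:a(w) b(w):`. Hence `U`
is local if `a` and `b` are. The sum over `j` telescopes. -/
theorem dif_normal₂ (s : Module.End ℂ V) (a b : ℤ → Module.End ℂ V) (ha : Trunc a) (hb : Trunc b) :
    dif (normal₂ s a b ha hb) = superComm s a b := by
  funext m n
  ext v
  have h1 := locSum_eventually _ (normalTerm₂_trunc s ha hb (m + 1) n) v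
  have h2 := locSum_eventually _ (normalTerm₂_trunc s ha hb m (n + 1)) v
  obtain ⟨K, hK⟩ := ha v
  obtain ⟨K', hK'⟩ := hb v
  obtain ⟨J, h1, h2, hJ1, hJ2⟩ := (h1.and (h2.and
    ((Filter.eventually_ge_atTop (K - m).toNat).and
      (Filter.eventually_ge_atTop (K' - n).toNat)))).exists
  simp only [dif, LinearMap.sub_apply, normal₂]
  rw [h1, h2, ← Finset.sum_sub_distrib]
  have h3 : ∀ j : ℕ, normalTerm₂ s a b (m + 1) n j v - normalTerm₂ s a b m (n + 1) j v =
      (s (b (n - (j + 1 : ℕ)) (s (a (m + (j + 1 : ℕ)) v))) -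
        a (m - (j + 1 : ℕ)) (b (n + (j + 1 : ℕ)) v)) -
      (s (b (n - j) (s (a (m + j) v))) - a (m - j) (b (n + j) v)) := by
    intro j
    simp only [normalTerm₂, LinearMap.add_apply, Module.End.mul_apply]
    rw [show m + 1 - 1 - (j : ℤ) = m - j by ring, show n + 1 - 1 - (j : ℤ) = n - j by ring,
      show m + 1 + (j : ℤ) = m + (j + 1 : ℕ) by push_cast; ring,
      show n + 1 + (j : ℤ) = n + (j + 1 : ℕ) by push_cast; ring,
      show m - 1 - (j : ℤ) = m - (j + 1 : ℕ) by push_cast; ring,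
      show n - 1 - (j : ℤ) = n - (j + 1 : ℕ) by push_cast; ring]
    abel
  rw [Finset.sum_congr rfl fun j _ => h3 j,
    Finset.sum_range_sub (fun j : ℕ => s (b (n - j) (s (a (m + j) v))) - a (m - j) (b (n + j) v)),
    hK (m + J) (by omega), hK' (n + J) (by omega)]
  simp [superComm]

/-- `g` is the pointwise limit, in the discrete topology, of the sequence `F`. -/
def EventuallyIs {W : Type*} (F : ℕ → ℤ → ℤ → ℤ → W) (g : ℤ → ℤ → ℤ → W) : Prop :=
  ∀ k m n, ∀ᶠ J in Filter.atTop, g k m n = F J k m n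

theorem EventuallyIs.dif₁₂ {W : Type*} [AddCommGroup W]
    {F : ℕ → ℤ → ℤ → ℤ → W} {g : ℤ → ℤ → ℤ → W}
    (h : EventuallyIs F g) (N : ℕ) :
    EventuallyIs (fun J => (dif₁₂ W ^ N) (F J)) ((dif₁₂ W ^ N) g) := by
  induction N with
  | zero => simpa using h
  | succ N ih =>
    intro k m n
    filter_upwards [ih (k + 1) m n, ih k (m + 1) n] with J h1 h2
    simp only [pow_succ', Module.End.mul_apply]
    change (ChiralPN.dif₁₂ W ^ N) g (k + 1) m n - (ChiralPN.dif₁₂ W ^ N) g k (m + 1) n = _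
    rw [h1, h2]; rfl

theorem EventuallyIs.dif₁₃ {W : Type*} [AddCommGroup W]
    {F : ℕ → ℤ → ℤ → ℤ → W} {g : ℤ → ℤ → ℤ → W}
    (h : EventuallyIs F g) (N : ℕ) :
    EventuallyIs (fun J => ((ChiralPN.dif₁₂ W + dif₂₃ W) ^ N) (F J))
      (((ChiralPN.dif₁₂ W + dif₂₃ W) ^ N) g) := by
  induction N with
  | zero => simpa using h
  | succ N ih =>
    intro k m n
    filter_upwards [ih (k + 1) m n, ih k (m + 1) n, ih k m (n + 1)] with J h1 h2 h3
    simp only [pow_succ', Module.End.mul_apply, LinearMap.add_apply]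
    change ((ChiralPN.dif₁₂ W + dif₂₃ W) ^ N) g (k + 1) m n -
      ((ChiralPN.dif₁₂ W + dif₂₃ W) ^ N) g k (m + 1) n +
      (((ChiralPN.dif₁₂ W + dif₂₃ W) ^ N) g k (m + 1) n -
      ((ChiralPN.dif₁₂ W + dif₂₃ W) ^ N) g k m (n + 1)) = _
    rw [h1, h2, h3]; rfl

/-- Multiplication by `(z₁ - z₂)^N (z₁ - z₃)^N` commutes with an additive map of the coefficients,
such as the evaluation at a vector. -/
theorem triple_apply (F : ℤ → ℤ → ℤ → Module.End ℂ V) (φ : Module.End ℂ V →+ V) (N : ℕ)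
    (k m n : ℤ) :
    (dif₁₂ V ^ N) (((dif₁₂ V + dif₂₃ V) ^ N) fun k m n => φ (F k m n)) k m n =
      φ ((dif₁₂ (Module.End ℂ V) ^ N)
        (((dif₁₂ (Module.End ℂ V) + dif₂₃ (Module.End ℂ V)) ^ N) F) k m n) := by
  have h : (((dif₁₂ V + dif₂₃ V) ^ N) fun k m n => φ (F k m n)) = fun k m n =>
      φ (((dif₁₂ (Module.End ℂ V) + dif₂₃ (Module.End ℂ V)) ^ N) F k m n) := by
    funext k m n
    rw [dif₁₃_pow_apply, dif₁₃_pow_apply, dif_iterate_map]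
  rw [h, dif₁₂_pow_apply, dif₁₂_pow_apply, dif_iterate_map]

theorem dif₁₂_pow_shift {W : Type*} [AddCommGroup W] (F : ℤ → ℤ → ℤ → W) (x y : ℤ) (N : ℕ) :
    (dif₁₂ W ^ N) (fun k m n => F k (m + x) (n + y)) =
      fun k m n => (dif₁₂ W ^ N) F k (m + x) (n + y) := by
  induction N with
  | zero => rfl
  | succ N ih =>
    simp only [pow_succ', Module.End.mul_apply]
    rw [ih]
    funext k m n
    simp only [dif₁₂, LinearMap.coe_mk, AddHom.coe_mk]
    rw [add_right_comm]

theorem dif₁₃_pow_shift {W : Type*} [AddCommGroup W] (F : ℤ → ℤ → ℤ → W) (x y : ℤ) (N : ℕ) :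
    ((dif₁₂ W + dif₂₃ W) ^ N) (fun k m n => F k (m + x) (n + y)) =
      fun k m n => ((dif₁₂ W + dif₂₃ W) ^ N) F k (m + x) (n + y) := by
  induction N with
  | zero => rfl
  | succ N ih =>
    simp only [pow_succ', Module.End.mul_apply]
    rw [ih]
    funext k m n
    simp only [dif₁₂, dif₂₃, LinearMap.coe_mk, AddHom.coe_mk, LinearMap.add_apply, Pi.add_apply]
    rw [add_right_comm m, add_right_comm n]

/-- Dong's lemma for normally ordered products. -/
theorem Loc.normal₂ {s t : Module.End ℂ V} {a b c : ℤ → Module.End ℂ V} {ε : ℂ}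
    (hs : s * s = 1) (ht : t * t = 1) (hst : s * t = t * s) (hε : ε * ε = 1)
    (hc : ∀ n, s * c n * s = ε • c n) (ha : Trunc a) (hb : Trunc b)
    (hab : Loc s a b) (hca : Loc t c a) (hcb : Loc t c b) (m : ℤ) :
    Loc t c (ChiralPN.normal₂ s a b ha hb m) := by
  obtain ⟨R, hR⟩ := hab
  obtain ⟨N₁, h1⟩ := hca
  obtain ⟨N₂, h2⟩ := hcb
  have h1' := dif_iterate_eq_zero_of_le (le_max_left N₁ N₂) h1
  have h2' := dif_iterate_eq_zero_of_le (le_max_right N₁ N₂) h2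
  generalize max N₁ N₂ = N at h1' h2'
  refine loc_of_triple (N := N) (R := R + 1) ?_ ?_ m
  · rw [Function.iterate_succ_apply, dif_normal₂, hR]
  -- Every summand of the infinite sum is a translate of one of the two products above.
  have hterm : ∀ j : ℕ, (dif₁₂ (Module.End ℂ V) ^ N)
      (((dif₁₂ (Module.End ℂ V) + dif₂₃ (Module.End ℂ V)) ^ N)
        (superComm₂ t c fun m n => normalTerm₂ s a b m n j)) = 0 := by
    intro j
    have : superComm₂ t c (fun m n => normalTerm₂ s a b m n j) =
        (fun k m n => (superComm₂ t c fun m n => a m * b n) k (m + (-1 - j)) (n + j)) +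
        (fun k m n => (superComm₂ t c fun m n => s * b n * s * a m) k (m + j) (n + (-1 - j))) := by
      funext k m n
      simp only [superComm₂, normalTerm₂, Pi.add_apply]
      rw [show m + (-1 - (j : ℤ)) = m - 1 - j by ring, show n + (-1 - (j : ℤ)) = n - 1 - j by ring]
      noncomm_ring
    rw [this, map_add, map_add, dif₁₃_pow_shift, dif₁₃_pow_shift, dif₁₂_pow_shift,
      dif₁₂_pow_shift, triple_mul_left ht h1' h2', triple_mul_right hs ht hst hε hc h1' h2']
    funext k m n
    simp
  funext k₀ m₀ n₀
  ext v
  let φ : Module.End ℂ V →+ V := (LinearMap.applyₗ v : Module.End ℂ V →ₗ[ℂ] V).toAddMonoidHom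
  have hφ : ∀ X : Module.End ℂ V, X v = φ X := fun X => rfl
  rw [hφ, ← triple_apply]
  have hev : EventuallyIs
      (fun J k m n => φ (∑ j ∈ Finset.range J,
        superComm₂ t c (fun m n => normalTerm₂ s a b m n j) k m n))
      (fun k m n => φ (superComm₂ t c (ChiralPN.normal₂ s a b ha hb) k m n)) := by
    intro k m n
    filter_upwards [locSum_eventually _ (normalTerm₂_trunc s ha hb m n) v,
      locSum_eventually _ (normalTerm₂_trunc s ha hb m n) (t (c k v))] with J e1 e2
    rw [map_sum]
    simp only [← hφ, superComm₂, LinearMap.sub_apply, Module.End.mul_apply, ChiralPN.normal₂]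
    rw [e1, e2, map_sum, map_sum, Finset.sum_sub_distrib]
  obtain ⟨J, hJ⟩ := ((hev.dif₁₃ N).dif₁₂ N k₀ m₀ n₀).exists
  rw [hJ]
  beta_reduce
  rw [triple_apply]
  have : (fun k m n => ∑ j ∈ Finset.range J,
      superComm₂ t c (fun m n => normalTerm₂ s a b m n j) k m n) =
      ∑ j ∈ Finset.range J, superComm₂ t c (fun m n => normalTerm₂ s a b m n j) := by
    funext k m n; simp
  rw [this, map_sum, map_sum, Finset.sum_eq_zero fun j _ => hterm j]
  simp

/-- The case `m = 0` of `Loc.normal₂`. -/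
theorem Loc.normalOrder {s t : Module.End ℂ V} {c : ℤ → Module.End ℂ V}
    {a b : VertexOperator ℂ V} {ε : ℂ}
    (hs : s * s = 1) (ht : t * t = 1) (hst : s * t = t * s) (hε : ε * ε = 1)
    (hc : ∀ n, s * c n * s = ε • c n)
    (hab : Loc s (VertexOperator.ncoeff a) (VertexOperator.ncoeff b))
    (hca : Loc t c (VertexOperator.ncoeff a)) (hcb : Loc t c (VertexOperator.ncoeff b)) :
    Loc t c (VertexOperator.ncoeff (ChiralPN.normalOrder s a b)) := by
  have := Loc.normal₂ hs ht hst hε hc (ncoeff_trunc a) (ncoeff_trunc b) hab hca hcb 0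
  convert this using 1
  funext n
  rw [ncoeff_normalOrder]

theorem normalOrder_eventually (s : Module.End ℂ V) (a b : VertexOperator ℂ V) (n : ℤ) (v : V) :
    ∀ᶠ J in Filter.atTop, VertexOperator.ncoeff (normalOrder s a b) n v =
      ∑ j ∈ Finset.range J, (VertexOperator.ncoeff a (-(j : ℤ) - 1)
        (VertexOperator.ncoeff b (n + j) v) +
        s (VertexOperator.ncoeff b (n - 1 - j) (s (VertexOperator.ncoeff a j v)))) := by
  rw [normalOrder, ncoeff_ofModes]
  exact locSum_eventually _ (normalTerm_trunc s a b n) v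

end NormalOrder

/-! ### Propagation of vanishing along a local field -/

section Uniqueness

variable {V : Type*} [AddCommGroup V] [Module ℂ V]

/-- Goddard's uniqueness argument: if `X(z)` is local to `g(z)` and kills a vector, together with
its image under the parity, then it kills the images of that vector under the modes of `g`. -/
theorem Loc.apply_eq_zero {s : Module.End ℂ V} {g X : ℤ → Module.End ℂ V} (hs : s * s = 1)
    (hg : Trunc g) (h : Loc s g X) {v : V} (hv : ∀ n, X n v = 0) (m n : ℤ) :
    X n (s (g m v)) = 0 := by
  obtain ⟨N, hN⟩ := h
  obtain ⟨K, hK⟩ := hg v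
  have h1 : ∀ w, s (s w) = w := fun w => LinearMap.congr_fun hs w
  let φ : Module.End ℂ V →+ V :=
    ((- s) ∘ₗ (LinearMap.applyₗ v : Module.End ℂ V →ₗ[ℂ] V)).toAddMonoidHom
  have h2 : (fun m n => X n (s (g m v))) = fun m n => φ (superComm s g X m n) := by
    funext m n
    simp [φ, superComm, hv, h1]
  refine eq_zero_of_dif_iterate (f := fun m n => X n (s (g m v))) (K := K) ?_ (N := N) ?_ m n
  · intro m hm n
    simp [hK m hm]
  · rw [h2, dif_iterate_map, hN]
    simp

end Uniqueness

/-! ### The modes of the generating fields -/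

section Operators

variable {N : ℕ}

theorem onFock_mul (f g : Module.End ℂ (Fock N)) : onFock (f * g) = onFock f * onFock g :=
  Finsupp.mapRange.linearMap_comp f g

theorem onFock_one : onFock (1 : Module.End ℂ (Fock N)) = 1 := Finsupp.mapRange.linearMap_id

theorem onFock_add (f g : Module.End ℂ (Fock N)) : onFock (f + g) = onFock f + onFock g := by
  apply Finsupp.lhom_ext
  intro α u
  simp [onFock]

theorem onFock_smul (c : ℂ) (f : Module.End ℂ (Fock N)) : onFock (c • f) = c • onFock f := by
  apply Finsupp.lhom_ext
  intro α u
  simp [onFock]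

theorem onFock_single (f : Module.End ℂ (Fock N)) (α : Lat N) (u : Fock N) :
    onFock f (Finsupp.single α u) = Finsupp.single α (f u) := by
  simp [onFock]

theorem mapFock_mul (f f' : Module.End ℂ (Ferm N)) (g g' : Module.End ℂ (Bos N)) :
    mapFock f g * mapFock f' g' = mapFock (f * f') (g * g') :=
  (TensorProduct.map_mul f f' g g').symm

theorem mapFock_one : mapFock (1 : Module.End ℂ (Ferm N)) (1 : Module.End ℂ (Bos N)) = 1 :=
  TensorProduct.map_one

theorem mapFock_add_left (f f' : Module.End ℂ (Ferm N)) (g : Module.End ℂ (Bos N)) :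
    mapFock (f + f') g = mapFock f g + mapFock f' g := TensorProduct.map_add_left f f' g

theorem mapFock_add_right (f : Module.End ℂ (Ferm N)) (g g' : Module.End ℂ (Bos N)) :
    mapFock f (g + g') = mapFock f g + mapFock f g' := TensorProduct.map_add_right f g g'

theorem mapFock_smul_left (c : ℂ) (f : Module.End ℂ (Ferm N)) (g : Module.End ℂ (Bos N)) :
    mapFock (c • f) g = c • mapFock f g := TensorProduct.map_smul_left c f g

theorem mapFock_smul_right (c : ℂ) (f : Module.End ℂ (Ferm N)) (g : Module.End ℂ (Bos N)) :
    mapFock f (c • g) = c • mapFock f g := TensorProduct.map_smul_right c f g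

/-- An operator on `Λ`, acting on `V_L`. -/
def onFerm (f : Module.End ℂ (Ferm N)) : Module.End ℂ (VL N) := onFock (mapFock f 1)

/-- An operator on `S`, acting on `V_L` identically along `ℂ[L]`. -/
def onBos (g : Module.End ℂ (Bos N)) : Module.End ℂ (VL N) := onFock (mapFock 1 g)

theorem onFerm_mul (f g : Module.End ℂ (Ferm N)) : onFerm (f * g) = onFerm f * onFerm g := by
  rw [onFerm, onFerm, onFerm, ← onFock_mul, mapFock_mul, mul_one]

theorem onFerm_one : onFerm (1 : Module.End ℂ (Ferm N)) = 1 := by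
  rw [onFerm, mapFock_one, onFock_one]

theorem onFerm_add (f g : Module.End ℂ (Ferm N)) : onFerm (f + g) = onFerm f + onFerm g := by
  rw [onFerm, onFerm, onFerm, ← onFock_add, mapFock_add_left]

theorem onFerm_smul (c : ℂ) (f : Module.End ℂ (Ferm N)) : onFerm (c • f) = c • onFerm f := by
  rw [onFerm, onFerm, ← onFock_smul, mapFock_smul_left]

theorem onFerm_zero : onFerm (0 : Module.End ℂ (Ferm N)) = 0 := by
  simpa using onFerm_smul (0 : ℂ) (0 : Module.End ℂ (Ferm N))

theorem onFerm_single (f : Module.End ℂ (Ferm N)) (α : Lat N) (x : Ferm N) (y : Bos N) :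
    onFerm f (Finsupp.single α (pureFock x y)) = Finsupp.single α (pureFock (f x) y) := by
  rw [onFerm, onFock_single, mapFock_pureFock]; rfl

theorem onBos_mul (f g : Module.End ℂ (Bos N)) : onBos (f * g) = onBos f * onBos g := by
  rw [onBos, onBos, onBos, ← onFock_mul, mapFock_mul, mul_one]

theorem onBos_one : onBos (1 : Module.End ℂ (Bos N)) = 1 := by
  rw [onBos, mapFock_one, onFock_one]

theorem onBos_add (f g : Module.End ℂ (Bos N)) : onBos (f + g) = onBos f + onBos g := by
  rw [onBos, onBos, onBos, ← onFock_add, mapFock_add_right]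

theorem onBos_smul (c : ℂ) (f : Module.End ℂ (Bos N)) : onBos (c • f) = c • onBos f := by
  rw [onBos, onBos, ← onFock_smul, mapFock_smul_right]

theorem onBos_zero : onBos (0 : Module.End ℂ (Bos N)) = 0 := by
  simpa using onBos_smul (0 : ℂ) (0 : Module.End ℂ (Bos N))

theorem onBos_sub (f g : Module.End ℂ (Bos N)) : onBos (f - g) = onBos f - onBos g := by
  rw [eq_sub_iff_add_eq, ← onBos_add, sub_add_cancel]

theorem onBos_single (g : Module.End ℂ (Bos N)) (α : Lat N) (x : Ferm N) (y : Bos N) :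
    onBos g (Finsupp.single α (pureFock x y)) = Finsupp.single α (pureFock x (g y)) := by
  rw [onBos, onFock_single, mapFock_pureFock]; rfl

theorem onFerm_onBos (f : Module.End ℂ (Ferm N)) (g : Module.End ℂ (Bos N)) :
    onFerm f * onBos g = onBos g * onFerm f := by
  rw [onBos, onFerm, ← onFock_mul, ← onFock_mul, mapFock_mul, mapFock_mul]
  simp

theorem VL_hom_ext {M : Type*} [AddCommGroup M] [Module ℂ M] {f g : VL N →ₗ[ℂ] M}
    (h : ∀ α x y, f (Finsupp.single α (pureFock x y)) = g (Finsupp.single α (pureFock x y))) :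
    f = g := by
  apply Finsupp.lhom_ext
  intro α u
  induction u using fock_induction with
  | h0 => simp
  | hp x y => exact h α x y
  | ha u v hu hv => rw [Finsupp.single_add, map_add, map_add, hu, hv]

theorem zeroMode_single (b : Bool) (i : Fin N) (β : Lat N) (u : Fock N) :
    zeroMode b i (Finsupp.single β u) =
      ((if b then β.1 i else β.2 i : ℤ) : ℂ) • Finsupp.single β u := by
  cases b <;> simp [zeroMode]

theorem onFock_zeroMode (f : Module.End ℂ (Fock N)) (b : Bool) (i : Fin N) :
    onFock f * zeroMode b i = zeroMode b i * onFock f := by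
  apply Finsupp.lhom_ext
  intro α u
  simp only [Module.End.mul_apply, zeroMode_single, map_smul, onFock_single]

theorem zeroMode_comm (b b' : Bool) (i j : Fin N) :
    zeroMode b i * zeroMode b' j = zeroMode b' j * zeroMode b i := by
  apply Finsupp.lhom_ext
  intro α u
  simp only [Module.End.mul_apply, zeroMode_single, map_smul]
  rw [smul_comm]

end Operators

section Fermions

variable {N : ℕ}

theorem osc_inj {b b' : Bool} {i j : Fin N} {k l : ℕ} :
    osc b i k = osc b' j l ↔ b = b' ∧ i = j ∧ k = l := by
  simp [osc]

theorem fermMode_anticomm (b b' : Bool) (i j : Fin N) (m n : ℤ) :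
    fermMode b i m * fermMode b' j n + fermMode b' j n * fermMode b i m =
      if b' = !b ∧ i = j ∧ m + n = -1 then 1 else 0 := by
  have key : ∀ (b b' : Bool) (i j : Fin N) (k l : ℕ),
      fermMode b i (Int.ofNat k) * fermMode b' j (Int.negSucc l) +
        fermMode b' j (Int.negSucc l) * fermMode b i (Int.ofNat k) =
      if b' = !b ∧ i = j ∧ k = l then 1 else 0 := by
    intro b b' i j k l
    apply LinearMap.ext
    intro x
    simp only [fermMode, LinearMap.add_apply, Module.End.mul_apply, LinearMap.mulLeft_apply]
    erw [CliffordAlgebra.contractLeft_ι_mul]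
    rw [sub_add_cancel]
    simp only [Finsupp.lapply_apply, Finsupp.single_apply, osc_inj]
    rw [if_congr (show (b' = !b ∧ j = i ∧ l = k) ↔ (b' = !b ∧ i = j ∧ k = l) by grind) rfl rfl]
    split_ifs <;> simp
  cases m with
  | ofNat k =>
    cases n with
    | ofNat l =>
      rw [if_neg (by simp; omega)]
      apply LinearMap.ext
      intro x
      simp only [fermMode, LinearMap.add_apply, Module.End.mul_apply]
      rw [CliffordAlgebra.contractLeft_comm]
      simp
    | negSucc l =>
      rw [key]
      refine if_congr ?_ rfl rfl
      refine and_congr_right fun _ => and_congr_right fun _ => ?_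
      simp only [Int.ofNat_eq_natCast]
      omega
  | negSucc k =>
    cases n with
    | ofNat l =>
      rw [add_comm, key]
      refine if_congr ?_ rfl rfl
      simp only [Int.ofNat_eq_natCast, @eq_comm _ j i, @eq_comm _ b (!b')]
      rw [show ((!b') = b) ↔ (b' = !b) by cases b <;> cases b' <;> simp]
      refine and_congr_right fun _ => and_congr_right fun _ => ?_
      omega
    | negSucc l =>
      rw [if_neg (by omega)]
      apply LinearMap.ext
      intro x
      simp only [fermMode, LinearMap.add_apply, Module.End.mul_apply, LinearMap.mulLeft_apply]
      rw [← mul_assoc, ← mul_assoc, ← add_mul]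
      erw [ExteriorAlgebra.ι_add_mul_swap]
      simp

/-- The mode with index `n`, the coefficient of `z^(-n-1)`, of `Φ^i(z)` (`b = false`) or `Ψ^i(z)`
(`b = true`) on `V_L`. Thus `fm true i n` is `Ψ^i_n`, but `fm false i n` is `Φ^i_{n+1}`; in particular
`fm false i (-1)` is `Φ^i_0`. -/
def fm (b : Bool) (i : Fin N) (n : ℤ) : Module.End ℂ (VL N) := onFerm (fermMode b i n)

theorem ncoeff_fermField (b : Bool) (i : Fin N) :
    VertexOperator.ncoeff (fermField b i) = fm b i := by
  funext n
  rw [fermField, ncoeff_ofModes]; rfl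

theorem fm_anticomm (b b' : Bool) (i j : Fin N) (m n : ℤ) :
    fm b i m * fm b' j n + fm b' j n * fm b i m =
      if b' = !b ∧ i = j ∧ m + n = -1 then 1 else 0 := by
  simp only [fm]
  rw [← onFerm_mul, ← onFerm_mul, ← onFerm_add, fermMode_anticomm]
  split_ifs
  · exact onFerm_one
  · exact onFerm_zero

theorem involute_contractLeft (d : Module.Dual ℂ (Osc N →₀ ℂ)) (x : Ferm N) :
    CliffordAlgebra.involute (Q := (0 : QuadraticForm ℂ (Osc N →₀ ℂ)))
      (CliffordAlgebra.contractLeft d x) =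
      - CliffordAlgebra.contractLeft d (CliffordAlgebra.involute x) := by
  induction x using CliffordAlgebra.left_induction with
  | algebraMap r => simp [CliffordAlgebra.contractLeft_algebraMap]
  | add x y hx hy => rw [map_add, map_add, hx, hy, map_add, map_add, neg_add]
  | ι_mul x m hx =>
    rw [CliffordAlgebra.contractLeft_ι_mul, map_sub, map_mul, map_mul, hx, CliffordAlgebra.involute_ι,
      neg_mul, neg_mul, map_neg, CliffordAlgebra.contractLeft_ι_mul, map_smul]
    simp only [mul_neg, neg_neg, neg_sub]

theorem parity_mul_self : parity N * parity N = 1 := by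
  rw [parity, ← onFock_mul, mapFock_mul, one_mul]
  have : (CliffordAlgebra.involute (Q := (0 : QuadraticForm ℂ (Osc N →₀ ℂ)))).toLinearMap *
      (CliffordAlgebra.involute (Q := (0 : QuadraticForm ℂ (Osc N →₀ ℂ)))).toLinearMap = 1 := by
    ext x; simp
  rw [this]
  erw [mapFock_one, onFock_one]

theorem parity_eq : parity N = onFerm
    (CliffordAlgebra.involute (Q := (0 : QuadraticForm ℂ (Osc N →₀ ℂ)))).toLinearMap := rfl

theorem parity_fm (b : Bool) (i : Fin N) (n : ℤ) : parity N * fm b i n * parity N = - fm b i n := by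
  have h : parity N * fm b i n = - (fm b i n * parity N) := by
    rw [parity_eq, fm, ← onFerm_mul, ← onFerm_mul, ← neg_one_smul ℂ, ← onFerm_smul]
    congr 1
    apply LinearMap.ext
    intro x
    cases n with
    | ofNat k =>
      simp only [fermMode, Module.End.mul_apply, LinearMap.smul_apply, neg_one_smul]
      exact involute_contractLeft _ _
    | negSucc k =>
      simp only [fermMode, Module.End.mul_apply, LinearMap.smul_apply, neg_one_smul,
        LinearMap.mulLeft_apply, AlgHom.toLinearMap_apply]
      erw [map_mul, CliffordAlgebra.involute_ι]
      rw [neg_mul]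
  rw [h, neg_mul (fm b i n * parity N), mul_assoc, parity_mul_self, mul_one]

end Fermions

section Bosons

variable {N : ℕ}

theorem pderiv_comm {σ : Type*} (i j : σ) (p : MvPolynomial σ ℂ) :
    MvPolynomial.pderiv i (MvPolynomial.pderiv j p) =
      MvPolynomial.pderiv j (MvPolynomial.pderiv i p) := by
  classical
  have h : ⁅MvPolynomial.pderiv (R := ℂ) i, MvPolynomial.pderiv (R := ℂ) j⁆ = 0 := by
    refine MvPolynomial.derivation_ext fun k => ?_
    rw [Derivation.commutator_apply]
    simp only [MvPolynomial.pderiv_X, Pi.single_apply]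
    split_ifs <;> simp
  have h' := congrArg (fun d : Derivation ℂ (MvPolynomial σ ℂ) (MvPolynomial σ ℂ) => d p) h
  simp only [Derivation.commutator_apply] at h'
  exact sub_eq_zero.mp h'

theorem bosMode_zero (b : Bool) (i : Fin N) : bosMode b i 0 = 0 := rfl

theorem bosMode_comm (b b' : Bool) (i j : Fin N) (m n : ℤ) :
    bosMode b i m * bosMode b' j n - bosMode b' j n * bosMode b i m =
      if b' = !b ∧ i = j ∧ m + n = 0 then (m : ℂ) • 1 else 0 := by
  have key : ∀ (b b' : Bool) (i j : Fin N) (k l : ℕ),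
      bosMode b i (Int.ofNat (k + 1)) * bosMode b' j (Int.negSucc l) -
        bosMode b' j (Int.negSucc l) * bosMode b i (Int.ofNat (k + 1)) =
      if b' = !b ∧ i = j ∧ k = l then ((k : ℂ) + 1) • 1 else 0 := by
    intro b b' i j k l
    apply LinearMap.ext
    intro x
    simp only [bosMode, LinearMap.sub_apply, Module.End.mul_apply, LinearMap.mulLeft_apply,
      LinearMap.smul_apply, Derivation.coeFn_coe, MvPolynomial.pderiv_mul, smul_add,
      mul_smul_comm, MvPolynomial.pderiv_X, Pi.single_apply, osc_inj]
    rw [add_sub_cancel_right]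
    rw [if_congr (show (b' = !b ∧ j = i ∧ l = k) ↔ (b' = !b ∧ i = j ∧ k = l) by grind) rfl rfl]
    split_ifs <;> simp
  cases m with
  | ofNat k =>
    cases k with
    | zero => simp [bosMode]
    | succ k =>
    cases n with
    | ofNat l =>
      cases l with
      | zero => simp [bosMode]; intros; omega
      | succ l =>
      rw [if_neg (by simp; omega)]
      apply LinearMap.ext
      intro x
      simp only [bosMode, LinearMap.sub_apply, Module.End.mul_apply, LinearMap.smul_apply,
        Derivation.coeFn_coe, map_smul]
      rw [smul_comm, pderiv_comm]
      exact sub_self _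
    | negSucc l =>
      rw [key]
      rw [if_congr (show (b' = !b ∧ i = j ∧ Int.ofNat (k + 1) + Int.negSucc l = 0) ↔
        (b' = !b ∧ i = j ∧ k = l) by simp only [Int.ofNat_eq_natCast]; grind) rfl rfl]
      simp
  | negSucc k =>
    cases n with
    | ofNat l =>
      cases l with
      | zero => simp [bosMode]
      | succ l =>
      rw [← neg_sub, key]
      rw [if_congr (show (b' = !b ∧ i = j ∧ Int.negSucc k + Int.ofNat (l + 1) = 0) ↔
        (b = !b' ∧ j = i ∧ l = k) by
          simp only [Int.ofNat_eq_natCast]; cases b <;> cases b' <;> grind) rfl rfl]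
      split_ifs with h
      · obtain ⟨-, -, rfl⟩ := h
        rw [Int.cast_negSucc]
        push_cast
        exact (neg_smul ((l : ℂ) + 1) (1 : Module.End ℂ (Bos N))).symm
      · simp
    | negSucc l =>
      rw [if_neg (by omega)]
      apply LinearMap.ext
      intro x
      simp only [bosMode, LinearMap.sub_apply, Module.End.mul_apply, LinearMap.mulLeft_apply]
      rw [mul_left_comm, sub_self]; rfl

/-- The mode with index `n` of `A^i(z)` (`b = false`) or `B^i(z)` (`b = true`) on `V_L`. -/
def bm (b : Bool) (i : Fin N) (n : ℤ) : Module.End ℂ (VL N) :=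
  onBos (bosMode b i n) + if n = 0 then zeroMode b i else 0

theorem ncoeff_bosField (b : Bool) (i : Fin N) :
    VertexOperator.ncoeff (bosField b i) = bm b i := by
  funext n
  rw [bosField, ncoeff_ofModes]; rfl

theorem bm_of_ne (b : Bool) (i : Fin N) {n : ℤ} (h : n ≠ 0) : bm b i n = onBos (bosMode b i n) := by
  rw [bm, if_neg h, add_zero]

theorem bm_zero (b : Bool) (i : Fin N) : bm b i 0 = zeroMode b i := by
  rw [bm, if_pos rfl, bosMode_zero, onBos_zero, zero_add]

theorem bm_comm (b b' : Bool) (i j : Fin N) (m n : ℤ) :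
    bm b i m * bm b' j n - bm b' j n * bm b i m =
      if b' = !b ∧ i = j ∧ m + n = 0 then (m : ℂ) • 1 else 0 := by
  by_cases hm : m = 0
  · subst hm
    rw [bm_zero]
    have : (if b' = !b ∧ i = j ∧ 0 + n = 0 then ((0 : ℤ) : ℂ) • (1 : Module.End ℂ (VL N)) else 0)
        = 0 := by simp
    rw [this, sub_eq_zero]
    by_cases hn : n = 0
    · subst hn
      rw [bm_zero, zeroMode_comm]
    · rw [bm_of_ne _ _ hn, onBos, onFock_zeroMode]
  · by_cases hn : n = 0
    · subst hn
      rw [if_neg (by simp [hm]), bm_of_ne _ _ hm, bm_zero, onBos, onFock_zeroMode, sub_self]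
    · rw [bm_of_ne _ _ hm, bm_of_ne _ _ hn, ← onBos_mul, ← onBos_mul, ← onBos_sub,
        bosMode_comm]
      split_ifs
      · rw [onBos_smul, onBos_one]
      · exact onBos_zero

theorem onFerm_bm (f : Module.End ℂ (Ferm N)) (b : Bool) (i : Fin N) (n : ℤ) :
    onFerm f * bm b i n = bm b i n * onFerm f := by
  rw [bm, mul_add, add_mul, onFerm_onBos]
  congr 1
  split_ifs
  · exact onFock_zeroMode _ _ _
  · simp

theorem fm_bm (b b' : Bool) (i j : Fin N) (m n : ℤ) : fm b i m * bm b' j n = bm b' j n * fm b i m :=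
  onFerm_bm _ _ _ _

theorem parity_bm (b : Bool) (i : Fin N) (n : ℤ) : parity N * bm b i n * parity N = bm b i n := by
  rw [parity_eq, onFerm_bm, mul_assoc, ← parity_eq, parity_mul_self, mul_one]

end Bosons

/-! ### Exponentials of series of commuting modes -/

theorem coeff_pow_of_lt {E : Type*} [Ring E] {X : PowerSeries E} (hX : PowerSeries.coeff 0 X = 0) {n k : ℕ}
    (h : k < n) : PowerSeries.coeff k (X ^ n) = 0 := by
  induction n generalizing k with
  | zero => omega
  | succ n ih =>
    rw [pow_succ, PowerSeries.coeff_mul]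
    refine Finset.sum_eq_zero fun p hp => ?_
    have := Finset.HasAntidiagonal.mem_antidiagonal.mp hp
    by_cases h1 : p.2 = 0
    · rw [h1, hX, mul_zero]
    · rw [ih (by omega), zero_mul]

section Exponential

variable {E : Type*} [Ring E] [Algebra ℂ E]

/-- The Euler derivation `z d/dz`. -/
def eulerSeries (F : PowerSeries E) : PowerSeries E :=
  PowerSeries.mk fun k => (k : ℂ) • PowerSeries.coeff k F

theorem eulerSeries_mul (F G : PowerSeries E) :
    eulerSeries (F * G) = eulerSeries F * G + F * eulerSeries G := by
  ext k
  simp only [eulerSeries, PowerSeries.coeff_mk, PowerSeries.coeff_mul, map_add, Finset.smul_sum,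
    ← Finset.sum_add_distrib]
  refine Finset.sum_congr rfl fun p hp => ?_
  rw [← Finset.HasAntidiagonal.mem_antidiagonal.mp hp]
  push_cast
  rw [add_smul, smul_mul_assoc, mul_smul_comm]

theorem eulerSeries_pow_succ {X : PowerSeries E} (h : Commute (eulerSeries X) X) (n : ℕ) :
    eulerSeries (X ^ (n + 1)) = (n + 1) • (eulerSeries X * X ^ n) := by
  induction n with
  | zero => simp
  | succ n ih =>
    rw [pow_succ, eulerSeries_mul, ih, (h.symm.pow_left (n + 1)).eq, smul_mul_assoc, mul_assoc,
      ← pow_succ, ← succ_nsmul]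

theorem expCoeff_zero (X : PowerSeries E) : expCoeff X 0 = 1 := by
  simp [expCoeff]

/-- The differential equation `z F' = (z X') F` of `F = exp X`, for commuting coefficients. -/
theorem smul_expCoeff {X : PowerSeries E} (hX : PowerSeries.coeff 0 X = 0)
    (hc : ∀ i j, Commute (PowerSeries.coeff i X) (PowerSeries.coeff j X)) (k : ℕ) :
    (k : ℂ) • expCoeff X k = ∑ p ∈ Finset.HasAntidiagonal.antidiagonal k,
      ((p.1 : ℂ) • PowerSeries.coeff p.1 X) * expCoeff X p.2 := by
  have hcomm : Commute (eulerSeries X) X := by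
    change _ * _ = _ * _
    ext k
    rw [PowerSeries.coeff_mul, PowerSeries.coeff_mul, ← Finset.Nat.sum_antidiagonal_swap]
    refine Finset.sum_congr rfl fun p _ => ?_
    simp only [eulerSeries, PowerSeries.coeff_mk, Prod.fst_swap, Prod.snd_swap]
    rw [smul_mul_assoc, mul_smul_comm, (hc _ _).eq]
  have h1 : (k : ℂ) • expCoeff X k = ∑ n ∈ Finset.range k, ∑ p ∈ Finset.HasAntidiagonal.antidiagonal k,
      ((n.factorial : ℂ)⁻¹) • (((p.1 : ℂ) • PowerSeries.coeff p.1 X) *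
        PowerSeries.coeff p.2 (X ^ n)) := by
    rw [expCoeff, Finset.smul_sum, Finset.sum_range_succ']
    have h0 : (k : ℂ) • ((Nat.factorial 0 : ℂ)⁻¹ • PowerSeries.coeff k (X ^ 0)) = 0 := by
      rw [pow_zero, PowerSeries.coeff_one]
      split_ifs with h
      · simp [h]
      · simp
    rw [h0, add_zero]
    refine Finset.sum_congr rfl fun n _ => ?_
    have h2 := congrArg (PowerSeries.coeff k) (eulerSeries_pow_succ hcomm n)
    rw [map_nsmul, PowerSeries.coeff_mul] at h2
    simp only [eulerSeries, PowerSeries.coeff_mk] at h2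
    rw [smul_comm, h2, ← Finset.smul_sum, ← Nat.cast_smul_eq_nsmul ℂ, smul_smul]
    congr 1
    rw [Nat.factorial_succ]
    have := Nat.cast_ne_zero (R := ℂ).mpr n.factorial_ne_zero
    have : ((n : ℂ) + 1) ≠ 0 := by exact_mod_cast Nat.succ_ne_zero n
    push_cast
    field_simp
  rw [h1, Finset.sum_comm]
  refine Finset.sum_congr rfl fun p hp => ?_
  have hp' := Finset.HasAntidiagonal.mem_antidiagonal.mp hp
  by_cases hi : p.1 = 0
  · simp [hi]
  rw [expCoeff, Finset.mul_sum]
  symm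
  refine Finset.sum_subset_zero_on_sdiff (fun n hn => ?_) (fun n hn => ?_) fun n _ => ?_
  · rw [Finset.mem_range] at hn ⊢; omega
  · rw [Finset.mem_sdiff, Finset.mem_range, Finset.mem_range] at hn
    rw [coeff_pow_of_lt hX (by omega), mul_zero, smul_zero]
  · rw [mul_smul_comm]

theorem expCoeff_commute {X : PowerSeries E} {c : E} (h : ∀ i, Commute c (PowerSeries.coeff i X))
    (k : ℕ) : Commute c (expCoeff X k) := by
  have hp : ∀ n k, Commute c (PowerSeries.coeff k (X ^ n)) := by
    intro n
    induction n with
    | zero =>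
      intro k
      rw [pow_zero, PowerSeries.coeff_one]
      split_ifs
      · exact Commute.one_right c
      · exact Commute.zero_right c
    | succ n ih =>
      intro k
      rw [pow_succ, PowerSeries.coeff_mul]
      exact Commute.sum_right _ _ _ fun p _ => (ih _).mul_right (h _)
  exact Commute.sum_right _ _ _ fun n _ => (hp n k).smul_right _

/-- If `[c, X] = r z^p` is central, then `[c, exp X] = r z^p exp X`. -/
theorem expCoeff_commutator {X : PowerSeries E} (hX : PowerSeries.coeff 0 X = 0)
    (hc : ∀ i j, Commute (PowerSeries.coeff i X) (PowerSeries.coeff j X)) {c : E} {r : ℂ} {p : ℕ}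
    (h : ∀ i, c * PowerSeries.coeff i X - PowerSeries.coeff i X * c = if i = p then r • 1 else 0)
    (k : ℕ) : c * expCoeff X k - expCoeff X k * c = if p ≤ k then r • expCoeff X (k - p) else 0 := by
  have hp : p = 0 → r • (1 : E) = 0 := by
    rintro rfl
    have := h 0
    rw [hX, if_pos rfl] at this
    simpa using this.symm
  induction k using Nat.strong_induction_on with
  | _ k ih =>
  by_cases hk : k = 0
  · subst hk
    rw [expCoeff_zero]
    by_cases hp0 : p = 0
    · simp [hp0, expCoeff_zero, hp hp0]
    · simp [hp0]
  have hk' : (k : ℂ) ≠ 0 := Nat.cast_ne_zero.mpr hk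
  apply smul_right_injective E hk'
  simp only
  rw [smul_sub, ← mul_smul_comm, ← smul_mul_assoc, smul_expCoeff hX hc, Finset.mul_sum,
    Finset.sum_mul, ← Finset.sum_sub_distrib]
  have hterm : ∀ x ∈ Finset.HasAntidiagonal.antidiagonal k,
      c * ((x.1 : ℂ) • PowerSeries.coeff x.1 X * expCoeff X x.2) -
        (x.1 : ℂ) • PowerSeries.coeff x.1 X * expCoeff X x.2 * c =
      (if x.1 = p then ((p : ℂ) * r) • expCoeff X x.2 else 0) +
      ((x.1 : ℂ) • PowerSeries.coeff x.1 X) *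
        (if p ≤ x.2 then r • expCoeff X (x.2 - p) else 0) := by
    intro x hx
    have hx' := Finset.HasAntidiagonal.mem_antidiagonal.mp hx
    by_cases h0 : x.1 = 0
    · rw [h0]
      by_cases hp0 : p = 0
      · subst hp0; simp
      · simp [Ne.symm hp0]
    rw [← ih x.2 (by omega), mul_sub]
    have e1 : (if x.1 = p then ((p : ℂ) * r) • expCoeff X x.2 else 0) =
        ((x.1 : ℂ) • (c * PowerSeries.coeff x.1 X - PowerSeries.coeff x.1 X * c)) *
          expCoeff X x.2 := by
      rw [h]
      split_ifs with h2
      · rw [smul_smul, h2, smul_mul_assoc, one_mul]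
      · simp
    rw [e1]
    simp only [smul_sub, sub_mul, smul_mul_assoc, mul_smul_comm, ← mul_assoc]
    abel
  rw [Finset.sum_congr rfl hterm, Finset.sum_add_distrib]
  by_cases hpk : p ≤ k
  · obtain ⟨l, rfl⟩ := Nat.exists_eq_add_of_le hpk
    rw [if_pos hpk]
    have s1 : ∑ x ∈ Finset.HasAntidiagonal.antidiagonal (p + l),
        (if x.1 = p then ((p : ℂ) * r) • expCoeff X x.2 else 0) = ((p : ℂ) * r) • expCoeff X l := by
      rw [Finset.sum_eq_single (p, l)]
      · simp
      · rintro ⟨a, b⟩ hab hne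
        have := Finset.HasAntidiagonal.mem_antidiagonal.mp hab
        simp only at this ⊢
        rw [if_neg]
        rintro rfl
        apply hne
        rw [Prod.mk.injEq]
        omega
      · simp
    have s2 : ∑ x ∈ Finset.HasAntidiagonal.antidiagonal (p + l), ((x.1 : ℂ) • PowerSeries.coeff x.1 X) *
        (if p ≤ x.2 then r • expCoeff X (x.2 - p) else 0) =
        r • ((l : ℂ) • expCoeff X l) := by
      rw [smul_expCoeff hX hc, Finset.smul_sum]
      symm
      refine Finset.sum_of_injOn (fun x : ℕ × ℕ => (x.1, x.2 + p)) ?_ ?_ ?_ ?_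
      · rintro ⟨a, b⟩ _ ⟨a', b'⟩ _ h
        simp only [Prod.mk.injEq] at h ⊢
        omega
      · rintro ⟨a, b⟩ hab
        have := Finset.HasAntidiagonal.mem_antidiagonal.mp (Finset.mem_coe.mp hab)
        simp only [Finset.mem_coe,
          Finset.HasAntidiagonal.mem_antidiagonal] at this ⊢
        omega
      · rintro ⟨a, b⟩ hab hne
        have hab' := Finset.HasAntidiagonal.mem_antidiagonal.mp hab
        simp only at hab' ⊢
        rw [if_neg, mul_zero]
        intro hb
        apply hne
        refine ⟨(a, b - p), ?_, ?_⟩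
        · rw [Finset.mem_coe, Finset.HasAntidiagonal.mem_antidiagonal]; simp only; omega
        · simp only [Prod.mk.injEq, true_and]; omega
      · rintro ⟨a, b⟩ _
        simp
    rw [s1, s2, Nat.add_sub_cancel_left, smul_smul, smul_smul, ← add_smul]
    congr 1
    push_cast; ring
  · rw [if_neg hpk, smul_zero, Finset.sum_eq_zero, Finset.sum_eq_zero, add_zero]
    · rintro ⟨a, b⟩ hab
      have := Finset.HasAntidiagonal.mem_antidiagonal.mp hab
      simp only at this ⊢
      rw [if_neg (by omega), mul_zero]
    · rintro ⟨a, b⟩ hab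
      have := Finset.HasAntidiagonal.mem_antidiagonal.mp hab
      simp only at this ⊢
      rw [if_neg (by omega)]

end Exponential

/-! ### The exponentials as operators on the symmetric algebra -/

section VertexOperators

variable {N : ℕ}

/-- The pairing of `A^i` (`b = false`) or `B^i` (`b = true`) with `α`. -/
def pairGen (b : Bool) (i : Fin N) (α : Lat N) : ℤ := if b then α.1 i else α.2 i

theorem bosMode_latMode (b : Bool) (i : Fin N) (α : Lat N) (m n : ℤ) :
    bosMode b i m * latMode α n - latMode α n * bosMode b i m =
      if m + n = 0 then ((m : ℂ) * pairGen b i α) • 1 else 0 := by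
  have h : ∀ j, bosMode b i m * ((α.1 j : ℂ) • bosMode false j n + (α.2 j : ℂ) • bosMode true j n) -
      ((α.1 j : ℂ) • bosMode false j n + (α.2 j : ℂ) • bosMode true j n) * bosMode b i m =
      if i = j then (if m + n = 0 then ((m : ℂ) * pairGen b j α) • 1 else 0) else 0 := by
    intro j
    have e : bosMode b i m * ((α.1 j : ℂ) • bosMode false j n + (α.2 j : ℂ) • bosMode true j n) -
      ((α.1 j : ℂ) • bosMode false j n + (α.2 j : ℂ) • bosMode true j n) * bosMode b i m =
      (α.1 j : ℂ) • (bosMode b i m * bosMode false j n - bosMode false j n * bosMode b i m) +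
      (α.2 j : ℂ) • (bosMode b i m * bosMode true j n - bosMode true j n * bosMode b i m) := by
      simp only [mul_add, add_mul, mul_smul_comm, smul_mul_assoc, smul_sub]
      abel
    rw [e, bosMode_comm, bosMode_comm]
    by_cases hij : i = j
    · subst hij
      by_cases hmn : m + n = 0
      · cases b <;> simp [hmn, pairGen, smul_smul, mul_comm]
      · simp [hmn]
    · simp [hij]
  rw [latMode, Finset.mul_sum, Finset.sum_mul, ← Finset.sum_sub_distrib,
    Finset.sum_congr rfl fun j _ => h j, Finset.sum_ite_eq]
  simp

/-- The Heisenberg relations `[α_m, β_n] = m (α, β) δ_{m+n,0}`. -/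
theorem latMode_comm_latMode (α β : Lat N) (m n : ℤ) :
    latMode β m * latMode α n - latMode α n * latMode β m =
      if m + n = 0 then ((m : ℂ) * pairing α β) • 1 else 0 := by
  have h : ∀ j, ((β.1 j : ℂ) • bosMode false j m + (β.2 j : ℂ) • bosMode true j m) * latMode α n -
      latMode α n * ((β.1 j : ℂ) • bosMode false j m + (β.2 j : ℂ) • bosMode true j m) =
      if m + n = 0 then ((m : ℂ) * ((α.1 j * β.2 j + α.2 j * β.1 j : ℤ) : ℂ)) • 1 else 0 := by
    intro j
    have e : ((β.1 j : ℂ) • bosMode false j m + (β.2 j : ℂ) • bosMode true j m) * latMode α n -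
      latMode α n * ((β.1 j : ℂ) • bosMode false j m + (β.2 j : ℂ) • bosMode true j m) =
      (β.1 j : ℂ) • (bosMode false j m * latMode α n - latMode α n * bosMode false j m) +
      (β.2 j : ℂ) • (bosMode true j m * latMode α n - latMode α n * bosMode true j m) := by
      simp only [mul_add, add_mul, mul_smul_comm, smul_mul_assoc, smul_sub]
      abel
    rw [e, bosMode_latMode, bosMode_latMode]
    split_ifs
    · rw [smul_smul, smul_smul, ← add_smul]
      congr 1
      simp only [pairGen, Bool.false_eq_true, if_false, if_true]
      push_cast
      ring
    · simp
  rw [latMode, Finset.sum_mul, Finset.mul_sum, ← Finset.sum_sub_distrib,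
    Finset.sum_congr rfl fun j _ => h j]
  split_ifs
  · rw [← Finset.sum_smul, ← Finset.mul_sum, pairing]
    push_cast
    rfl
  · simp

theorem latMode_commute {α β : Lat N} {m n : ℤ} (h : m + n ≠ 0) :
    Commute (latMode β m) (latMode α n) :=
  sub_eq_zero.mp ((latMode_comm_latMode α β m n).trans (if_neg h))

theorem latMode_zero (α : Lat N) : latMode α 0 = 0 := by
  simp [latMode, bosMode_zero]

theorem coeff_creationSeries (α : Lat N) (k : ℕ) :
    (k : ℂ) • PowerSeries.coeff k (creationSeries α) = latMode α (-(k : ℤ)) := by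
  rw [creationSeries, PowerSeries.coeff_mk]
  split_ifs with h
  · subst h; simp [latMode_zero]
  · rw [smul_smul, mul_inv_cancel₀ (Nat.cast_ne_zero.mpr h), one_smul]

theorem coeff_annihilationSeries (α : Lat N) (k : ℕ) :
    (k : ℂ) • PowerSeries.coeff k (annihilationSeries α) = - latMode α k := by
  rw [annihilationSeries, PowerSeries.coeff_mk]
  split_ifs with h
  · subst h; simp [latMode_zero]
  · rw [smul_smul, mul_neg, mul_inv_cancel₀ (Nat.cast_ne_zero.mpr h), neg_one_smul]

theorem coeff_zero_creationSeries (α : Lat N) : PowerSeries.coeff 0 (creationSeries α) = 0 := by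
  rw [creationSeries, PowerSeries.coeff_mk, if_pos rfl]

theorem coeff_zero_annihilationSeries (α : Lat N) :
    PowerSeries.coeff 0 (annihilationSeries α) = 0 := by
  rw [annihilationSeries, PowerSeries.coeff_mk, if_pos rfl]

theorem commute_creationSeries {α : Lat N} {c : Module.End ℂ (Bos N)}
    (h : ∀ k : ℕ, k ≠ 0 → Commute c (latMode α (-(k : ℤ)))) (i : ℕ) :
    Commute c (PowerSeries.coeff i (creationSeries α)) := by
  rw [creationSeries, PowerSeries.coeff_mk]
  split_ifs with hi
  · exact Commute.zero_right c
  · exact (h i hi).smul_right _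

theorem commute_annihilationSeries {α : Lat N} {c : Module.End ℂ (Bos N)}
    (h : ∀ k : ℕ, k ≠ 0 → Commute c (latMode α k)) (i : ℕ) :
    Commute c (PowerSeries.coeff i (annihilationSeries α)) := by
  rw [annihilationSeries, PowerSeries.coeff_mk]
  split_ifs with hi
  · exact Commute.zero_right c
  · exact (h i hi).smul_right _

theorem creationSeries_comm (α : Lat N) (i j : ℕ) :
    Commute (PowerSeries.coeff i (creationSeries α)) (PowerSeries.coeff j (creationSeries α)) :=
  commute_creationSeries (fun _ _ => (commute_creationSeries
    (fun _ _ => latMode_commute (by omega)) i).symm) j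

theorem annihilationSeries_comm (α : Lat N) (i j : ℕ) :
    Commute (PowerSeries.coeff i (annihilationSeries α))
      (PowerSeries.coeff j (annihilationSeries α)) :=
  commute_annihilationSeries (fun _ _ => (commute_annihilationSeries
    (fun _ _ => latMode_commute (by omega)) i).symm) j

/-- The coefficient at `z^(-j)`, `j ≥ 0`, of `exp(-∑_{n>0} (α_n / n) z^(-n))`. -/
def annihilationExp (α : Lat N) (j : ℕ) : Module.End ℂ (Bos N) := expCoeff (annihilationSeries α) j

theorem creationExp_of_neg (α : Lat N) {t : ℤ} (h : t < 0) : creationExp α t = 0 := by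
  obtain ⟨l, rfl⟩ := Int.eq_negSucc_of_lt_zero h
  rfl

theorem creationExp_natCast (α : Lat N) (k : ℕ) :
    creationExp α k = expCoeff (creationSeries α) k := rfl

theorem creationExp_zero (α : Lat N) : creationExp α 0 = 1 := expCoeff_zero _

theorem annihilationExp_zero (α : Lat N) : annihilationExp α 0 = 1 := expCoeff_zero _

theorem commute_creationExp {α : Lat N} {c : Module.End ℂ (Bos N)}
    (h : ∀ k : ℕ, k ≠ 0 → Commute c (latMode α (-(k : ℤ)))) (t : ℤ) :
    Commute c (creationExp α t) := by
  cases t with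
  | ofNat k => exact expCoeff_commute (commute_creationSeries h) k
  | negSucc k => exact Commute.zero_right c

theorem commute_annihilationExp {α : Lat N} {c : Module.End ℂ (Bos N)}
    (h : ∀ k : ℕ, k ≠ 0 → Commute c (latMode α k)) (j : ℕ) : Commute c (annihilationExp α j) :=
  expCoeff_commute (commute_annihilationSeries h) j

/-- The differential equation of the creation exponential. -/
theorem smul_creationExp (α : Lat N) (t : ℤ) {I : ℕ} (hI : t < I) :
    (t : ℂ) • creationExp α t =
      ∑ i ∈ Finset.range I, latMode α (-(i : ℤ)) * creationExp α (t - i) := by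
  cases t with
  | negSucc k =>
    rw [creationExp_of_neg α (Int.negSucc_lt_zero k), smul_zero, Finset.sum_eq_zero]
    intro i _
    rw [creationExp_of_neg α (by omega), mul_zero]
  | ofNat k =>
    simp only [Int.ofNat_eq_natCast] at hI ⊢
    rw [creationExp_natCast, Int.cast_natCast,
      smul_expCoeff (coeff_zero_creationSeries α) (creationSeries_comm α),
      Finset.Nat.sum_antidiagonal_eq_sum_range_succ_mk]
    refine Finset.sum_subset_zero_on_sdiff (fun n hn => ?_) (fun n hn => ?_) fun n hn => ?_
    · rw [Finset.mem_range] at hn ⊢; omega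
    · rw [Finset.mem_sdiff, Finset.mem_range, Finset.mem_range] at hn
      rw [creationExp_of_neg α (by omega), mul_zero]
    · rw [Finset.mem_range] at hn
      simp only
      rw [coeff_creationSeries, show (k : ℤ) - n = ((k - n : ℕ) : ℤ) by omega, creationExp_natCast]

/-- The differential equation of the annihilation exponential. -/
theorem smul_annihilationExp (α : Lat N) (k : ℕ) :
    (k : ℂ) • annihilationExp α k = - ∑ p ∈ Finset.HasAntidiagonal.antidiagonal k,
      latMode α p.1 * annihilationExp α p.2 := by
  rw [annihilationExp,
    smul_expCoeff (coeff_zero_annihilationSeries α) (annihilationSeries_comm α),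
    ← Finset.sum_neg_distrib]
  refine Finset.sum_congr rfl fun p _ => ?_
  rw [coeff_annihilationSeries]
  exact neg_mul (latMode α p.1) (annihilationExp α p.2)

theorem bosMode_commute_latMode (b : Bool) (i : Fin N) (α : Lat N) {m n : ℤ} (h : m + n ≠ 0) :
    Commute (bosMode b i m) (latMode α n) :=
  sub_eq_zero.mp ((bosMode_latMode b i α m n).trans (if_neg h))

/-- If `[c, α_(-p)] = p r` and `c` commutes with the other creation modes of `α`, then
`[c, e^{α-}(z)] = r z^p e^{α-}(z)` for the creation exponential `e^{α-}(z)`. -/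
theorem creationExp_commutator {α : Lat N} {c : Module.End ℂ (Bos N)} {p : ℕ} (hp : p ≠ 0) {r : ℂ}
    (h : ∀ k : ℕ, c * latMode α (-(k : ℤ)) - latMode α (-(k : ℤ)) * c =
      if k = p then ((p : ℂ) * r) • 1 else 0) (t : ℤ) :
    c * creationExp α t - creationExp α t * c = r • creationExp α (t - p) := by
  cases t with
  | negSucc k =>
    rw [creationExp_of_neg α (Int.negSucc_lt_zero k), creationExp_of_neg α (by omega)]
    simp
  | ofNat k =>
    simp only [Int.ofNat_eq_natCast]
    rw [creationExp_natCast, expCoeff_commutator (r := r) (p := p) (coeff_zero_creationSeries α)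
      (creationSeries_comm α)]
    · split_ifs with hk
      · rw [show (k : ℤ) - p = ((k - p : ℕ) : ℤ) by omega, creationExp_natCast]
      · rw [creationExp_of_neg α (by omega), smul_zero]
    · intro j
      rw [creationSeries, PowerSeries.coeff_mk]
      by_cases hj : j = 0
      · simp [hj, Ne.symm hp]
      · rw [if_neg hj, mul_smul_comm, smul_mul_assoc]
        refine (smul_sub _ _ _).symm.trans ?_
        rw [h]
        split_ifs with hjp
        · subst hjp
          rw [smul_smul, ← mul_assoc, inv_mul_cancel₀ (Nat.cast_ne_zero.mpr hj), one_mul]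
        · rw [smul_zero]

/-- The counterpart of `creationExp_commutator` for a creation mode `c` with `[c, α_p] = - p r`. -/
theorem annihilationExp_commutator {α : Lat N} {c : Module.End ℂ (Bos N)} {p : ℕ} (hp : p ≠ 0)
    {r : ℂ} (h : ∀ k : ℕ, c * latMode α k - latMode α k * c =
      if k = p then (-(p : ℂ) * r) • 1 else 0) (j : ℕ) :
    c * annihilationExp α j - annihilationExp α j * c =
      if p ≤ j then r • annihilationExp α (j - p) else 0 := by
  refine expCoeff_commutator (r := r) (p := p) (coeff_zero_annihilationSeries α)
      (annihilationSeries_comm α) (fun j => ?_) j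
  rw [annihilationSeries, PowerSeries.coeff_mk]
  by_cases hj : j = 0
  · simp [hj, Ne.symm hp]
  · rw [if_neg hj, mul_smul_comm, smul_mul_assoc]
    refine (smul_sub _ _ _).symm.trans ?_
    rw [h]
    split_ifs with hjp
    · subst hjp
      rw [smul_smul, neg_mul, neg_mul, mul_neg, neg_neg, ← mul_assoc,
        inv_mul_cancel₀ (Nat.cast_ne_zero.mpr hj), one_mul]
    · rw [smul_zero]

/-- On a given vector the infinite sum defining `gammaCoeff` is finite. -/
theorem gammaCoeff_eq_sum (α : Lat N) {p : Bos N} {J : ℕ}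
    (hJ : ∀ j ≥ J, annihilationExp α j p = 0) (t : ℤ) :
    gammaCoeff α t p = ∑ j ∈ Finset.range J, creationExp α (t + j) (annihilationExp α j p) := by
  refine finsum_eq_sum_of_support_subset _ fun j hj => ?_
  rw [Finset.coe_range, Set.mem_Iio]
  by_contra hlt
  apply hj
  simp only [Module.End.mul_apply]
  rw [show expCoeff (annihilationSeries α) j p = 0 from hJ j (by omega), map_zero]

theorem annihilationExp_trunc (α : Lat N) (p : Bos N) :
    ∃ J, ∀ j ≥ J, annihilationExp α j p = 0 := annihilation_trunc α p

theorem exists_annihilation_bound₂ (α : Lat N) (p p' : Bos N) :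
    ∃ J, (∀ j ≥ J, annihilationExp α j p = 0) ∧ ∀ j ≥ J, annihilationExp α j p' = 0 := by
  obtain ⟨J, hJ⟩ := annihilationExp_trunc α p
  obtain ⟨J', hJ'⟩ := annihilationExp_trunc α p'
  exact ⟨max J J', fun j hj => hJ j (by omega), fun j hj => hJ' j (by omega)⟩

theorem bosMode_gammaCoeff_pos (b : Bool) (i : Fin N) (α : Lat N) {k : ℕ} (hk : k ≠ 0) (t : ℤ) :
    bosMode b i k * gammaCoeff α t - gammaCoeff α t * bosMode b i k =
      (pairGen b i α : ℂ) • gammaCoeff α (t - k) := by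
  apply LinearMap.ext
  intro p
  obtain ⟨J, hJ, hJ'⟩ := exists_annihilation_bound₂ α p (bosMode b i k p)
  simp only [LinearMap.sub_apply, Module.End.mul_apply, LinearMap.smul_apply]
  rw [gammaCoeff_eq_sum α hJ, gammaCoeff_eq_sum α hJ', gammaCoeff_eq_sum α hJ, map_sum,
    ← Finset.sum_sub_distrib, Finset.smul_sum]
  refine Finset.sum_congr rfl fun j _ => ?_
  have h1 : annihilationExp α j (bosMode b i k p) = bosMode b i k (annihilationExp α j p) :=
    LinearMap.congr_fun (commute_annihilationExp (c := bosMode b i k)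
      (fun l hl => bosMode_commute_latMode b i α (by omega)) j).symm p
  have h2 := LinearMap.congr_fun (creationExp_commutator (α := α) (c := bosMode b i k) hk
    (r := pairGen b i α) (fun l => by
      rw [bosMode_latMode]
      by_cases h : l = k
      · simp [h]
      · rw [if_neg (by omega), if_neg h]) (t + j)) (annihilationExp α j p)
  simp only [LinearMap.sub_apply, Module.End.mul_apply, LinearMap.smul_apply] at h2
  rw [h1, h2, show t + j - k = t - k + (j : ℤ) by ring]

theorem bosMode_gammaCoeff_neg (b : Bool) (i : Fin N) (α : Lat N) {k : ℕ} (hk : k ≠ 0) (t : ℤ) :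
    bosMode b i (-k) * gammaCoeff α t - gammaCoeff α t * bosMode b i (-k) =
      (pairGen b i α : ℂ) • gammaCoeff α (t + k) := by
  apply LinearMap.ext
  intro p
  obtain ⟨J, hJ, hJ'⟩ := exists_annihilation_bound₂ α p (bosMode b i (-k) p)
  simp only [LinearMap.sub_apply, Module.End.mul_apply, LinearMap.smul_apply]
  rw [gammaCoeff_eq_sum α (J := k + J) fun j hj => hJ j (by omega),
    gammaCoeff_eq_sum α (J := k + J) fun j hj => hJ' j (by omega), gammaCoeff_eq_sum α hJ, map_sum,
    ← Finset.sum_sub_distrib, Finset.smul_sum]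
  have h3 : ∀ j : ℕ, bosMode b i (-k) (creationExp α (t + j) (annihilationExp α j p)) -
      creationExp α (t + j) (annihilationExp α j (bosMode b i (-k) p)) =
      if k ≤ j then (pairGen b i α : ℂ) • creationExp α (t + j) (annihilationExp α (j - k) p)
        else 0 := by
    intro j
    have h1 : ∀ x, bosMode b i (-k) (creationExp α (t + j) x) =
        creationExp α (t + j) (bosMode b i (-k) x) :=
      LinearMap.congr_fun (commute_creationExp (c := bosMode b i (-k))
        (fun l hl => bosMode_commute_latMode b i α (by omega)) (t + j))
    have h2 := LinearMap.congr_fun (annihilationExp_commutator (α := α) (c := bosMode b i (-k)) hk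
      (r := pairGen b i α) (fun l => by
        rw [bosMode_latMode]
        by_cases h : l = k
        · simp [h]
        · rw [if_neg (by omega), if_neg h]) j) p
    simp only [LinearMap.sub_apply, Module.End.mul_apply] at h2
    rw [h1, ← map_sub, h2]
    split_ifs <;> simp
  rw [Finset.sum_congr rfl fun j _ => h3 j, Finset.sum_range_add, Finset.sum_eq_zero, zero_add]
  · refine Finset.sum_congr rfl fun j _ => ?_
    rw [if_pos (by omega), Nat.add_sub_cancel_left]
    congr 3
    push_cast; ring
  · intro j hj
    rw [Finset.mem_range] at hj
    rw [if_neg (by omega)]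

/-- `[A^i_k, Γ_α(z)] = (A^i, α) z^k Γ_α(z)`, and similarly for `B^i`, where `k ≠ 0`. -/
theorem bosMode_gammaCoeff (b : Bool) (i : Fin N) (α : Lat N) {k : ℤ} (hk : k ≠ 0) (t : ℤ) :
    bosMode b i k * gammaCoeff α t - gammaCoeff α t * bosMode b i k =
      (pairGen b i α : ℂ) • gammaCoeff α (t - k) := by
  rcases lt_or_gt_of_ne hk with h | h
  · obtain ⟨l, rfl⟩ : ∃ l : ℕ, k = -l := ⟨(-k).toNat, by omega⟩
    rw [bosMode_gammaCoeff_neg b i α (by omega), sub_neg_eq_add]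
  · obtain ⟨l, rfl⟩ : ∃ l : ℕ, k = l := ⟨k.toNat, by omega⟩
    rw [bosMode_gammaCoeff_pos b i α (by omega)]

theorem sum_antidiagonal_eq_sum_range {M : Type*} [AddCommMonoid M] (f : ℕ → ℕ → M) {I J : ℕ}
    (hI : ∀ i ≥ I, ∀ j, f i j = 0) (hJ : ∀ i, ∀ j ≥ J, f i j = 0) :
    ∑ n ∈ Finset.range (I + J), ∑ p ∈ Finset.HasAntidiagonal.antidiagonal n, f p.1 p.2 =
      ∑ i ∈ Finset.range I, ∑ j ∈ Finset.range J, f i j := by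
  rw [← Finset.sum_product', ← Finset.sum_fiberwise_of_maps_to (g := fun p : ℕ × ℕ => p.1 + p.2)
    (t := Finset.range (I + J))]
  · refine Finset.sum_congr rfl fun n _ => ?_
    symm
    refine Finset.sum_subset_zero_on_sdiff (fun p hp => ?_) (fun p hp => ?_) fun _ _ => rfl
    · exact Finset.HasAntidiagonal.mem_antidiagonal.mpr (Finset.mem_filter.mp hp).2
    · rw [Finset.mem_sdiff, Finset.HasAntidiagonal.mem_antidiagonal, Finset.mem_filter, Finset.mem_product,
        Finset.mem_range, Finset.mem_range] at hp
      by_cases h1 : I ≤ p.1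
      · exact hI _ h1 _
      · exact hJ _ _ (by by_contra h2; exact hp.2 ⟨⟨by omega, by omega⟩, hp.1⟩)
  · intro p hp
    rw [Finset.mem_product, Finset.mem_range, Finset.mem_range] at hp
    rw [Finset.mem_range]; omega

theorem bosMode_trunc_nat (b : Bool) (i : Fin N) (p : Bos N) :
    ∀ᶠ k : ℕ in Filter.atTop, bosMode b i k p = 0 := by
  obtain ⟨K, hK⟩ := bosMode_trunc b i p
  filter_upwards [Filter.eventually_ge_atTop K.toNat] with k hk
  exact hK k (by omega)

theorem latMode_trunc (α : Lat N) (p : Bos N) :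
    ∃ J : ℕ, ∀ j ≥ J, latMode α j p = 0 := by
  have h : ∀ᶠ k : ℕ in Filter.atTop, ∀ i : Fin N,
      bosMode false i k p = 0 ∧ bosMode true i k p = 0 :=
    Filter.eventually_all.mpr fun i => (bosMode_trunc_nat false i p).and (bosMode_trunc_nat true i p)
  obtain ⟨J, hJ⟩ := Filter.eventually_atTop.mp h
  refine ⟨J, fun j hj => ?_⟩
  rw [latMode, LinearMap.sum_apply]
  refine Finset.sum_eq_zero fun i _ => ?_
  simp [hJ j hj i]

/-- The differential equation `z ∂ Γ_α(z) = :α(z) Γ_α(z):` without zero modes. -/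
theorem smul_gammaCoeff (α : Lat N) (t : ℤ) (p : Bos N) :
    ∀ᶠ J in Filter.atTop, (t : ℂ) • gammaCoeff α t p =
      ∑ k ∈ Finset.range J, latMode α (-(k : ℤ)) (gammaCoeff α (t - k) p) +
      ∑ k ∈ Finset.range J, gammaCoeff α (t + k) (latMode α k p) := by
  obtain ⟨J₁, hJ₁⟩ := annihilationExp_trunc α p
  obtain ⟨J₂, hJ₂⟩ := latMode_trunc α p
  filter_upwards [Filter.eventually_ge_atTop J₁, Filter.eventually_ge_atTop J₂,
    Filter.eventually_ge_atTop (t + J₁).toNat] with J h1 h2 h3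
  have hJ : ∀ j ≥ J, annihilationExp α j p = 0 := fun j hj => hJ₁ j (by omega)
  have hcomm : ∀ i j : ℕ, annihilationExp α j (latMode α i p) =
      latMode α i (annihilationExp α j p) := fun i j =>
    LinearMap.congr_fun (commute_annihilationExp (c := latMode α i)
      (fun l hl => latMode_commute (by omega)) j).symm p
  have e1 : ∀ j : ℕ, ((t + j : ℤ) : ℂ) • creationExp α (t + j) (annihilationExp α j p) =
      ∑ k ∈ Finset.range J, latMode α (-(k : ℤ))
        (creationExp α (t - k + j) (annihilationExp α j p)) := by
    intro j
    by_cases hj : j < J₁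
    · have := LinearMap.congr_fun (smul_creationExp α (t + j) (I := J) (by omega))
        (annihilationExp α j p)
      rw [LinearMap.smul_apply, LinearMap.sum_apply] at this
      rw [this]
      refine Finset.sum_congr rfl fun k _ => ?_
      rw [Module.End.mul_apply, show t + (j : ℤ) - k = t - k + j by ring]
    · rw [hJ₁ j (by omega)]
      simp
  have e2 : ∑ k ∈ Finset.range J, gammaCoeff α (t + k) (latMode α k p) =
      - ∑ j ∈ Finset.range (J + J), (j : ℂ) • creationExp α (t + j) (annihilationExp α j p) := by
    have a1 : ∀ k ∈ Finset.range J, gammaCoeff α (t + k) (latMode α k p) =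
        ∑ j ∈ Finset.range J, creationExp α (t + (k + j : ℕ))
          (latMode α k (annihilationExp α j p)) := by
      intro k _
      rw [gammaCoeff_eq_sum α (J := J) fun j hj => by rw [hcomm, hJ j hj, map_zero]]
      refine Finset.sum_congr rfl fun j _ => ?_
      rw [hcomm]
      congr 2
      push_cast; ring
    rw [Finset.sum_congr rfl a1, ← sum_antidiagonal_eq_sum_range (fun k j =>
      creationExp α (t + (k + j : ℕ)) (latMode α k (annihilationExp α j p))),
      ← Finset.sum_neg_distrib]
    · refine Finset.sum_congr rfl fun n _ => ?_
      have := LinearMap.congr_fun (smul_annihilationExp α n) p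
      rw [LinearMap.smul_apply] at this
      rw [← map_smul, this, LinearMap.neg_apply, map_neg, neg_neg, LinearMap.sum_apply, map_sum]
      refine Finset.sum_congr rfl fun x hx => ?_
      rw [Finset.HasAntidiagonal.mem_antidiagonal.mp hx, Module.End.mul_apply]
    · intro i hi j
      rw [← hcomm, hJ₂ i (by omega), map_zero, map_zero]
    · intro i j hj
      rw [hJ j hj, map_zero, map_zero]
  have e3 : ∑ j ∈ Finset.range (J + J), (j : ℂ) • creationExp α (t + j) (annihilationExp α j p) =
      ∑ j ∈ Finset.range J, (j : ℂ) • creationExp α (t + j) (annihilationExp α j p) := by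
    rw [Finset.sum_range_add, add_eq_left]
    refine Finset.sum_eq_zero fun j _ => ?_
    rw [hJ _ (by omega), map_zero, smul_zero]
  have e4 : ∑ k ∈ Finset.range J, latMode α (-(k : ℤ)) (gammaCoeff α (t - k) p) =
      ∑ j ∈ Finset.range J, ((t + j : ℤ) : ℂ) • creationExp α (t + j) (annihilationExp α j p) := by
    rw [Finset.sum_congr rfl fun j _ => e1 j, Finset.sum_comm]
    refine Finset.sum_congr rfl fun k _ => ?_
    rw [gammaCoeff_eq_sum α hJ, map_sum]
  rw [e2, e3, e4, gammaCoeff_eq_sum α hJ, ← sub_eq_add_neg, ← Finset.sum_sub_distrib,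
    Finset.smul_sum]
  refine Finset.sum_congr rfl fun j _ => ?_
  rw [← sub_smul]
  congr 1
  push_cast; ring

theorem latMode_one (α : Lat N) (k : ℕ) : latMode α k (1 : Bos N) = 0 := by
  rw [latMode, LinearMap.sum_apply]
  refine Finset.sum_eq_zero fun i _ => ?_
  cases k with
  | zero => simp [bosMode_zero]
  | succ k =>
    have : ∀ b, bosMode b i ((k + 1 : ℕ) : ℤ) (1 : Bos N) = 0 := fun b => by
      change bosMode b i (Int.ofNat (k + 1)) (1 : Bos N) = 0
      simp [bosMode]
    simp only [LinearMap.add_apply, LinearMap.smul_apply]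
    rw [this, this]; simp

theorem annihilationExp_one (α : Lat N) {j : ℕ} (hj : j ≠ 0) : annihilationExp α j (1 : Bos N) = 0 := by
  have h : (j : ℂ) • annihilationExp α j (1 : Bos N) = 0 := by
    rw [← LinearMap.smul_apply, smul_annihilationExp, LinearMap.neg_apply, LinearMap.sum_apply,
      neg_eq_zero]
    refine Finset.sum_eq_zero fun p _ => ?_
    rw [(commute_annihilationExp (c := latMode α p.1) (fun l hl => latMode_commute (by omega))
      p.2).eq, Module.End.mul_apply, latMode_one, map_zero]
  exact (smul_eq_zero.mp h).resolve_left (Nat.cast_ne_zero.mpr hj)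

theorem gammaCoeff_one (α : Lat N) (t : ℤ) : gammaCoeff α t (1 : Bos N) = creationExp α t 1 := by
  rw [gammaCoeff_eq_sum α (J := 1) fun j hj => annihilationExp_one α (by omega)]
  simp [annihilationExp_zero]

end VertexOperators

/-! ### The modes of the lattice fields -/

section ExpModes

variable {N : ℕ}

/-- The mode with index `n` of the field `e^α(z)`. -/
def em (α : Lat N) (n : ℤ) : Module.End ℂ (VL N) := VertexOperator.ncoeff (expField α) n

theorem em_single (α : Lat N) (n : ℤ) (β : Lat N) (x : Ferm N) (y : Bos N) :
    em α n (Finsupp.single β (pureFock x y)) = cocycle α β •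
      Finsupp.single (α + β) (pureFock x (gammaCoeff α (-n - 1 - pairing α β) y)) := by
  rw [em, expField, ncoeff_ofModes]
  simp [mapFock_pureFock]

theorem onFerm_em (f : Module.End ℂ (Ferm N)) (α : Lat N) (n : ℤ) :
    onFerm f * em α n = em α n * onFerm f := by
  apply VL_hom_ext
  intro β x y
  simp only [Module.End.mul_apply, em_single, onFerm_single, map_smul]

theorem fm_em (b : Bool) (i : Fin N) (m : ℤ) (α : Lat N) (n : ℤ) :
    fm b i m * em α n = em α n * fm b i m := onFerm_em _ _ _

theorem parity_em (α : Lat N) (n : ℤ) : parity N * em α n * parity N = em α n := by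
  rw [parity_eq, onFerm_em, mul_assoc, ← parity_eq, parity_mul_self, mul_one]

theorem pairGen_add (b : Bool) (i : Fin N) (α β : Lat N) :
    pairGen b i (α + β) = pairGen b i α + pairGen b i β := by
  cases b <;> simp [pairGen]

theorem bm_single_of_ne (b : Bool) (i : Fin N) {k : ℤ} (hk : k ≠ 0) (β : Lat N) (x : Ferm N)
    (y : Bos N) : bm b i k (Finsupp.single β (pureFock x y)) =
      Finsupp.single β (pureFock x (bosMode b i k y)) := by
  rw [bm_of_ne b i hk, onBos_single]

theorem bm_zero_single (b : Bool) (i : Fin N) (β : Lat N) (u : Fock N) :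
    bm b i 0 (Finsupp.single β u) = (pairGen b i β : ℂ) • Finsupp.single β u := by
  rw [bm_zero, zeroMode_single, pairGen]

theorem pureFock_sub_right (x : Ferm N) (y y' : Bos N) :
    pureFock x (y - y') = pureFock x y - pureFock x y' := TensorProduct.tmul_sub x y y'

theorem pureFock_add_right (x : Ferm N) (y y' : Bos N) :
    pureFock x (y + y') = pureFock x y + pureFock x y' := TensorProduct.tmul_add x y y'

theorem pureFock_add_left (x x' : Ferm N) (y : Bos N) :
    pureFock (x + x') y = pureFock x y + pureFock x' y := TensorProduct.add_tmul x x' y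

theorem pureFock_smul_right (c : ℂ) (x : Ferm N) (y : Bos N) :
    pureFock x (c • y) = c • pureFock x y := TensorProduct.tmul_smul c x y

theorem pureFock_smul_left (c : ℂ) (x : Ferm N) (y : Bos N) :
    pureFock (c • x) y = c • pureFock x y := TensorProduct.smul_tmul' c x y

/-- `y ↦ x ⊗ y ⊗ e^β`. -/
def embedBos (β : Lat N) (x : Ferm N) : Bos N →ₗ[ℂ] VL N where
  toFun y := Finsupp.single β (pureFock x y)
  map_add' y y' := by rw [pureFock_add_right, Finsupp.single_add]
  map_smul' c y := by rw [pureFock_smul_right, ← Finsupp.smul_single]; rfl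

theorem embedBos_apply (β : Lat N) (x : Ferm N) (y : Bos N) :
    embedBos β x y = Finsupp.single β (pureFock x y) := rfl

/-- `[A^i_k, e^α(z)] = (A^i, α) z^k e^α(z)`, and similarly for `B^i`. -/
theorem bm_em (b : Bool) (i : Fin N) (k : ℤ) (α : Lat N) (n : ℤ) :
    bm b i k * em α n - em α n * bm b i k = (pairGen b i α : ℂ) • em α (n + k) := by
  apply VL_hom_ext
  intro β x y
  simp only [LinearMap.sub_apply, Module.End.mul_apply, LinearMap.smul_apply]
  by_cases hk : k = 0
  · subst hk
    rw [bm_zero_single, map_smul, em_single, map_smul, bm_zero_single, pairGen_add, add_zero,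
      em_single, smul_comm _ (cocycle α β), smul_comm _ (cocycle α β), ← smul_sub, ← sub_smul]
    congr 2
    push_cast; ring
  · rw [bm_single_of_ne b i hk, em_single, em_single, em_single, map_smul, bm_single_of_ne b i hk,
      ← smul_sub, smul_comm _ (cocycle α β)]
    congr 1
    rw [← Finsupp.single_sub, ← pureFock_sub_right, Finsupp.smul_single, ← pureFock_smul_right]
    have := LinearMap.congr_fun (bosMode_gammaCoeff b i α hk (-n - 1 - pairing α β)) y
    simp only [LinearMap.sub_apply, Module.End.mul_apply, LinearMap.smul_apply] at this
    rw [this]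
    congr 5
    ring

/-- The mode `α_k` on `V_L`. -/
def lm (α : Lat N) (k : ℤ) : Module.End ℂ (VL N) :=
  ∑ i, ((α.1 i : ℂ) • bm false i k + (α.2 i : ℂ) • bm true i k)

theorem lm_single_of_ne (α : Lat N) {k : ℤ} (hk : k ≠ 0) (β : Lat N) (x : Ferm N)
    (y : Bos N) : lm α k (Finsupp.single β (pureFock x y)) =
      Finsupp.single β (pureFock x (latMode α k y)) := by
  rw [← embedBos_apply, ← embedBos_apply, lm, latMode, LinearMap.sum_apply, LinearMap.sum_apply,
    map_sum]
  refine Finset.sum_congr rfl fun i _ => ?_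
  simp only [LinearMap.add_apply, LinearMap.smul_apply, map_add, map_smul, embedBos_apply]
  rw [bm_single_of_ne _ _ hk, bm_single_of_ne _ _ hk]

theorem lm_zero_single (α β : Lat N) (u : Fock N) :
    lm α 0 (Finsupp.single β u) = (pairing α β : ℂ) • Finsupp.single β u := by
  rw [lm, LinearMap.sum_apply, pairing]
  push_cast
  rw [Finset.sum_smul]
  refine Finset.sum_congr rfl fun i _ => ?_
  simp only [LinearMap.add_apply, LinearMap.smul_apply, bm_zero_single, pairGen, smul_smul,
    ← add_smul]
  simp

/-- A statement about vectors that holds eventually may be checked on pure tensors `x ⊗ y ⊗ e^β`. -/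
theorem Lat_eventually {p : VL N → ℕ → Prop} (h0 : ∀ J, p 0 J)
    (hadd : ∀ v w J, p v J → p w J → p (v + w) J)
    (h : ∀ β x y, ∀ᶠ J in Filter.atTop, p (Finsupp.single β (pureFock x y)) J) (v : VL N) :
    ∀ᶠ J in Filter.atTop, p v J := by
  induction v using Finsupp.induction_linear with
  | zero => exact Filter.Eventually.of_forall h0
  | add v w hv hw => filter_upwards [hv, hw] with J h1 h2 using hadd v w J h1 h2
  | single β u =>
    induction u using fock_induction with
    | h0 => rw [Finsupp.single_zero]; exact Filter.Eventually.of_forall h0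
    | hp x y => exact h β x y
    | ha u w hu hw =>
      filter_upwards [hu, hw] with J h1 h2
      rw [Finsupp.single_add]
      exact hadd _ _ J h1 h2

/-- The differential equation `∂ e^α(z) = :α(z) e^α(z):`. -/
theorem em_derivative (α : Lat N) (n : ℤ) (v : VL N) :
    ∀ᶠ J in Filter.atTop, -(n : ℂ) • em α (n - 1) v =
      ∑ k ∈ Finset.range J, (lm α (-(k : ℤ) - 1) (em α (n + k) v) +
        em α (n - 1 - k) (lm α k v)) := by
  refine Lat_eventually (p := fun v J => -(n : ℂ) • em α (n - 1) v =
      ∑ k ∈ Finset.range J, (lm α (-(k : ℤ) - 1) (em α (n + k) v) +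
        em α (n - 1 - k) (lm α k v))) (fun J => by simp) (fun v w J h1 h2 => ?_) (fun β x y => ?_) v
  · simp only [map_add, smul_add]
    rw [h1, h2, ← Finset.sum_add_distrib]
    refine Finset.sum_congr rfl fun k _ => ?_
    abel
  · obtain ⟨J₀, hJ₀⟩ := latMode_trunc α y
    have h := (Filter.tendsto_add_atTop_nat 1).eventually
      (smul_gammaCoeff α (-n - pairing α β) y)
    filter_upwards [h, Filter.eventually_ge_atTop (J₀ + 1)] with J h hJ
    obtain ⟨J, rfl⟩ := Nat.exists_eq_succ_of_ne_zero (show J ≠ 0 by omega)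
    rw [Finset.sum_range_succ' _ (J + 1), Finset.sum_range_succ _ (J + 1), hJ₀ (J + 1) (by omega),
      map_zero, add_zero, Nat.cast_zero, neg_zero, latMode_zero, LinearMap.zero_apply, add_zero]
      at h
    have hf : ∀ k : ℕ, lm α (-(k : ℤ) - 1) (em α (n + k) (Finsupp.single β (pureFock x y))) =
        cocycle α β • embedBos (α + β) x (latMode α (-((k + 1 : ℕ) : ℤ))
          (gammaCoeff α (-n - pairing α β - (k + 1 : ℕ)) y)) := by
      intro k
      rw [em_single, map_smul, lm_single_of_ne α (by omega), embedBos_apply]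
      congr 5
      · push_cast; ring
      · congr 1; push_cast; ring
    have hs : ∀ k : ℕ, em α (n - 1 - k) (lm α k (Finsupp.single β (pureFock x y))) =
        cocycle α β • embedBos (α + β) x (gammaCoeff α (-n - pairing α β + k) (latMode α k y)) +
        if k = 0 then (pairing α β : ℂ) • em α (n - 1) (Finsupp.single β (pureFock x y)) else 0 := by
      intro k
      by_cases hk : k = 0
      · subst hk
        rw [if_pos rfl, Nat.cast_zero, latMode_zero, lm_zero_single, map_smul]
        simp
      · rw [if_neg hk, add_zero, lm_single_of_ne α (by omega), em_single, embedBos_apply]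
        congr 4
        ring_nf
    rw [Finset.sum_congr rfl fun k _ => by rw [hf k, hs k]]
    rw [← Finset.sum_congr rfl fun k _ => add_assoc _ _ _, Finset.sum_add_distrib,
      Finset.sum_ite_eq', if_pos (by simp), Finset.sum_congr rfl fun k _ => (smul_add _ _ _).symm,
      ← Finset.smul_sum, Finset.sum_add_distrib, ← map_sum, ← map_sum, ← map_add, ← h,
      map_smul, em_single, embedBos_apply, show -(n - 1) - 1 - pairing α β = -n - pairing α β by ring,
      smul_comm (cocycle α β), ← add_smul]
    congr 1
    push_cast; ring

/-- `V_L` is generated from the vectors `e^β` by the creation modes. -/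
theorem VL_generated (p : Submodule ℂ (VL N)) (h0 : ∀ β, expState β ∈ p)
    (hf : ∀ b i (k : ℕ) v, v ∈ p → fm b i (-(k : ℤ) - 1) v ∈ p)
    (hb : ∀ b i (k : ℕ) v, v ∈ p → bm b i (-(k : ℤ) - 1) v ∈ p) (v : VL N) : v ∈ p := by
  have hk : ∀ k : ℕ, -(k : ℤ) - 1 = Int.negSucc k := fun k => by rw [Int.negSucc_eq]; ring
  have ho : ∀ o : Osc N, ∃ b i k, o = osc b i k := fun o =>
    ⟨(ofLex o).1, (ofLex (ofLex o).2).1, (ofLex (ofLex o).2).2, rfl⟩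
  have h1 : ∀ β (y : Bos N), Finsupp.single β (pureFock 1 y) ∈ p := by
    intro β y
    induction y using MvPolynomial.induction_on with
    | C a =>
      have : (MvPolynomial.C a : Bos N) = a • 1 := by
        rw [MvPolynomial.smul_eq_C_mul, mul_one]
      rw [this, pureFock_smul_right, ← Finsupp.smul_single]
      exact p.smul_mem _ (h0 β)
    | add y y' hy hy' => rw [pureFock_add_right, Finsupp.single_add]; exact p.add_mem hy hy'
    | mul_X y o hy =>
      obtain ⟨b, i, k, rfl⟩ := ho o
      have := hb b i k _ hy
      rw [bm_single_of_ne b i (by omega), hk] at this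
      rwa [mul_comm]
  have h2 : ∀ β x (y : Bos N), Finsupp.single β (pureFock x y) ∈ p := by
    intro β x y
    induction x using CliffordAlgebra.left_induction with
    | algebraMap r =>
      have : (algebraMap ℂ (Ferm N) r) = r • 1 := Algebra.algebraMap_eq_smul_one r
      erw [this]
      rw [pureFock_smul_left, ← Finsupp.smul_single]
      exact p.smul_mem _ (h1 β y)
    | add x x' hx hx' => erw [pureFock_add_left, Finsupp.single_add]; exact p.add_mem hx hx'
    | ι_mul x m hx =>
      induction m using Finsupp.induction_linear with
      | zero => rw [map_zero, zero_mul]; erw [pureFock_zero_left]; simp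
      | add m m' hm hm' =>
        rw [map_add, add_mul]
        erw [pureFock_add_left, Finsupp.single_add]
        exact p.add_mem hm hm'
      | single o r =>
        obtain ⟨b, i, k, rfl⟩ := ho o
        have := p.smul_mem r (hf b i k _ hx)
        rw [fm, onFerm_single, hk, Finsupp.smul_single, ← pureFock_smul_left] at this
        have e : CliffordAlgebra.ι (0 : QuadraticForm ℂ (Osc N →₀ ℂ))
            (Finsupp.single (osc b i k) r) * x = r • fermMode b i (Int.negSucc k) x := by
          have : Finsupp.single (osc b i k) r = r • Finsupp.single (osc b i k) (1 : ℂ) := by simp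
          rw [this, map_smul, smul_mul_assoc]
          rfl
        rw [e]
        exact this
  induction v using Finsupp.induction_linear with
  | zero => exact p.zero_mem
  | add v w hv hw => exact p.add_mem hv hw
  | single β u =>
    induction u using fock_induction with
    | h0 => rw [Finsupp.single_zero]; exact p.zero_mem
    | hp x y => exact h2 β x y
    | ha u w hu hw => rw [Finsupp.single_add]; exact p.add_mem hu hw

end ExpModes

/-! ### Locality of the lattice fields -/

section ExpLocality

variable {N : ℕ}

/-- `(-1)^k choose(c, k)`, the coefficients of `(1 - x)^c`. -/
def altChoose (c : ℤ) (k : ℕ) : ℤ := (-1) ^ k * Ring.choose c k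

theorem altChoose_zero (c : ℤ) : altChoose c 0 = 1 := by simp [altChoose]

theorem altChoose_succ (c : ℤ) (k : ℕ) :
    ((k : ℤ) + 1) * altChoose c (k + 1) = -((c - k) * altChoose c k) := by
  have h := Ring.choose_smul_choose c (Nat.le_succ k)
  rw [Nat.choose_succ_self_right, Nat.succ_eq_add_one, Nat.add_sub_cancel_left,
    Ring.choose_one_right, nsmul_eq_mul] at h
  push_cast at h
  rw [altChoose, altChoose, pow_succ]
  linear_combination -(-1) ^ k * h

theorem altChoose_pascal (c : ℤ) (k : ℕ) :
    altChoose (c + 1) (k + 1) = altChoose c (k + 1) - altChoose c k := by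
  rw [altChoose, altChoose, altChoose, Ring.choose_succ_succ, pow_succ]
  ring

theorem sum_altChoose (c : ℤ) (k : ℕ) :
    c * ∑ j ∈ Finset.range (k + 1), altChoose c j = -(((k : ℤ) + 1) * altChoose c (k + 1)) := by
  induction k with
  | zero => simp [altChoose]
  | succ k ih =>
    rw [Finset.sum_range_succ, mul_add, ih, altChoose_succ c (k + 1)]
    push_cast
    ring

theorem pairing_comm (α β : Lat N) : pairing α β = pairing β α := by
  rw [pairing, pairing]
  refine Finset.sum_congr rfl fun i _ => ?_
  ring

theorem latMode_natCast_one (α : Lat N) (k : ℕ) : latMode α k 1 = 0 := latMode_one α k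

/-- The operators `α_i`, `i > 0`, on the exponential state. -/
theorem latMode_creationExp_one (α β : Lat N) {i : ℕ} (hi : i ≠ 0) (t : ℤ) :
    latMode α i (creationExp β t 1) = (pairing α β : ℂ) • creationExp β (t - i) 1 := by
  have h := LinearMap.congr_fun (creationExp_commutator (α := β) (c := latMode α i) hi
    (r := pairing β α) (fun k => by
      rw [latMode_comm_latMode]
      by_cases hk : k = i
      · subst hk; simp
      · rw [if_neg hk, if_neg (by omega)]) t) 1
  have hp : pairing β α = pairing α β := pairing_comm β α
  rw [LinearMap.sub_apply, Module.End.mul_apply, Module.End.mul_apply, latMode_natCast_one,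
    map_zero, sub_zero, hp] at h
  exact h

/-- The operator product of two exponentials on the vacuum. -/
theorem annihilationExp_creationExp_one (α β : Lat N) (k : ℕ) (t : ℤ) :
    annihilationExp α k (creationExp β t 1) =
      (altChoose (pairing α β) k : ℂ) • creationExp β (t - k) 1 := by
  induction k using Nat.strong_induction_on generalizing t with
  | _ k ih =>
    cases k with
    | zero => simp [annihilationExp_zero, altChoose_zero]
    | succ k =>
      have h := LinearMap.congr_fun (smul_annihilationExp α (k + 1)) (creationExp β t 1)
      rw [Finset.Nat.antidiagonal_succ, Finset.sum_cons, Finset.sum_map,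
        ← Finset.Nat.sum_antidiagonal_swap] at h
      simp only [Nat.cast_zero, latMode_zero, zero_mul, zero_add, LinearMap.neg_apply,
        LinearMap.sum_apply, LinearMap.smul_apply, Module.End.mul_apply] at h
      have h2 : ∀ p ∈ Finset.HasAntidiagonal.antidiagonal k,
          latMode α ((p.2 + 1 : ℕ) : ℤ) (annihilationExp α p.1 (creationExp β t 1)) =
          ((pairing α β * altChoose (pairing α β) p.1 : ℤ) : ℂ) •
            creationExp β (t - (k + 1 : ℕ)) 1 := by
        rintro ⟨i, j⟩ hij
        rw [Finset.HasAntidiagonal.mem_antidiagonal] at hij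
        simp only at hij ⊢
        rw [ih i (by omega), map_smul, latMode_creationExp_one α β (Nat.succ_ne_zero j), smul_smul,
          show t - (i : ℤ) - ((j + 1 : ℕ) : ℤ) = t - ((k + 1 : ℕ) : ℤ) by omega]
        congr 1; push_cast; ring
      have h3 : ((k + 1 : ℕ) : ℂ) • annihilationExp α (k + 1) (creationExp β t 1) =
          -∑ p ∈ Finset.HasAntidiagonal.antidiagonal k,
          latMode α ((p.2 + 1 : ℕ) : ℤ) (annihilationExp α p.1 (creationExp β t 1)) := h
      rw [Finset.sum_congr rfl h2, ← Finset.sum_smul, ← Int.cast_sum,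
        Finset.Nat.sum_antidiagonal_eq_sum_range_succ
          (fun i _ => pairing α β * altChoose (pairing α β) i), ← Finset.mul_sum,
        sum_altChoose] at h3
      have hk : ((k + 1 : ℕ) : ℂ) ≠ 0 := Nat.cast_ne_zero.mpr (Nat.succ_ne_zero k)
      rw [← smul_right_inj hk, h3, smul_smul, ← neg_smul]
      congr 1; push_cast; ring

/-- `e^{α-}(s) e^{β-}(t) 1`. -/
def expPair (α β : Lat N) (s t : ℤ) : Bos N := creationExp α s (creationExp β t 1)

theorem expPair_comm (α β : Lat N) (s t : ℤ) : expPair α β s t = expPair β α t s := by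
  have h : Commute (creationExp α s) (creationExp β t) :=
    commute_creationExp (fun j _ => (commute_creationExp (fun k _ => latMode_commute
      (by omega)) s).symm) t
  exact LinearMap.congr_fun h.eq 1

theorem expPair_of_neg (α β : Lat N) (s : ℤ) {t : ℤ} (ht : t < 0) : expPair α β s t = 0 := by
  rw [expPair, creationExp_of_neg β ht, LinearMap.zero_apply, map_zero]

/-- The coefficients of `(1 - w/z)^c e^{α-}(z) e^{β-}(w) 1`. -/
def expProd (α β : Lat N) (c s t : ℤ) : Bos N :=
  ∑ k ∈ Finset.range (t + 1).toNat, altChoose c k • expPair α β (s + k) (t - k)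

theorem expProd_eq (α β : Lat N) (c s t : ℤ) {J : ℕ} (hJ : t < J) :
    expProd α β c s t = ∑ k ∈ Finset.range J, altChoose c k • expPair α β (s + k) (t - k) := by
  refine Finset.sum_subset (Finset.range_mono (by omega)) fun k _ hk => ?_
  rw [Finset.mem_range] at hk
  rw [expPair_of_neg _ _ _ (by omega), smul_zero]

theorem expProd_natCast (α β : Lat N) (R : ℕ) (s t : ℤ) :
    expProd α β R s t =
      ∑ k ∈ Finset.range (R + 1), altChoose R k • expPair α β (s + k) (t - k) := by
  rw [expProd_eq α β R s t (J := (t + 1).toNat + (R + 1)) (by omega)]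
  refine (Finset.sum_subset (Finset.range_mono (by omega)) fun k _ hk => ?_).symm
  rw [Finset.mem_range] at hk
  rw [altChoose, Ring.choose_natCast, Nat.choose_eq_zero_of_lt (by omega)]
  simp

/-- `(z - w)^R e^{α-}(z) e^{β-}(w) 1` is symmetric in the two factors, up to the sign
`(-1)^R`. -/
theorem expProd_flip (α β : Lat N) (R : ℕ) (s t : ℤ) :
    expProd β α R (t - R) s = (-1 : ℤ) ^ R • expProd α β R (s - R) t := by
  rw [expProd_natCast, expProd_natCast, ← Finset.sum_range_reflect, Finset.smul_sum]
  refine Finset.sum_congr rfl fun k hk => ?_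
  rw [Finset.mem_range] at hk
  have hk' : k ≤ R := by omega
  rw [Nat.add_sub_cancel, expPair_comm, smul_smul, altChoose, altChoose, Ring.choose_natCast,
    Ring.choose_natCast, Nat.choose_symm hk', Nat.cast_sub hk',
    show s - ((R : ℤ) - k) = s - R + k by ring, show t - (R : ℤ) + (R - k) = t - k by ring,
    ← mul_assoc]
  congr 2
  obtain ⟨j, rfl⟩ := Nat.exists_eq_add_of_le hk'
  rw [Nat.add_sub_cancel_left, pow_add]
  have := Even.neg_one_pow (α := ℤ) (Even.add_self k)
  rw [pow_add] at this
  linear_combination (-(-1) ^ j : ℤ) * this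

theorem expProd_pascal (α β : Lat N) (c s t : ℤ) :
    expProd α β c (s - 1) t - expProd α β c s (t - 1) = expProd α β (c + 1) (s - 1) t := by
  have hJ : t < ((t + 1).toNat + 1 : ℕ) := by omega
  rw [expProd_eq _ _ _ _ _ hJ, expProd_eq _ _ _ _ _ hJ,
    expProd_eq α β c s (t - 1) (J := (t + 1).toNat) (by omega), Finset.sum_range_succ',
    Finset.sum_range_succ', add_sub_right_comm, ← Finset.sum_sub_distrib, altChoose_zero,
    altChoose_zero]
  congr 1
  refine Finset.sum_congr rfl fun k _ => ?_
  rw [altChoose_pascal, sub_smul]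
  congr 3 <;> (push_cast; ring)

/-- Multiplication by `(z - w)^M` raises the exponent of `1 - w/z` by `M`. -/
theorem dif_iterate_expProd (α β : Lat N) (c s t : ℤ) (M : ℕ) :
    dif^[M] (fun m n => expProd α β c (s - m) (t - n)) =
      fun m n => expProd α β (c + M) (s - m - M) (t - n) := by
  induction M with
  | zero => simp
  | succ M ih =>
    rw [Function.iterate_succ_apply', ih]
    funext m n
    have := expProd_pascal α β (c + M) (s - m - M) (t - n)
    rw [dif]
    push_cast
    rw [show c + ((M : ℤ) + 1) = c + M + 1 by ring, show s - m - ((M : ℤ) + 1) = s - m - M - 1 by ring,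
      ← this]
    congr 2 <;> ring

/-- The product `e^α(z) e^β(w) e^γ`, up to sign and powers of `z`, `w`, is the expansion of
`(1 - w/z)^(α, β)` times a product of creation exponentials. -/
theorem em_em_expState (α β γ : Lat N) (m n : ℤ) :
    em α m (em β n (expState γ)) = (cocycle β γ * cocycle α (β + γ)) •
      embedBos (α + (β + γ)) 1 (expProd α β (pairing α β)
        (-m - 1 - pairing α (β + γ)) (-n - 1 - pairing β γ)) := by
  rw [expState, em_single, map_smul, em_single, smul_smul, gammaCoeff_one, embedBos_apply]
  congr 3
  set s := -m - 1 - pairing α (β + γ)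
  set t := -n - 1 - pairing β γ
  have h0 : ∀ k ≥ (t + 1).toNat, annihilationExp α k (creationExp β t 1) = 0 := by
    intro k hk
    rw [annihilationExp_creationExp_one, creationExp_of_neg β (by omega), LinearMap.zero_apply,
      smul_zero]
  rw [gammaCoeff_eq_sum α h0, expProd]
  refine Finset.sum_congr rfl fun k _ => ?_
  rw [annihilationExp_creationExp_one, map_smul, expPair, ← Int.cast_smul_eq_zsmul ℂ]

theorem pairing_add_right (α β γ : Lat N) : pairing α (β + γ) = pairing α β + pairing α γ := by
  rw [pairing, pairing, pairing, ← Finset.sum_add_distrib]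
  refine Finset.sum_congr rfl fun i _ => ?_
  simp only [Prod.fst_add, Prod.snd_add, Pi.add_apply]
  ring

theorem cocycle_add_right (α β γ : Lat N) : cocycle α (β + γ) = cocycle α β * cocycle α γ := by
  rw [cocycle, cocycle, cocycle, ← zpow_add₀ (by norm_num), ← Finset.sum_add_distrib]
  congr 1
  refine Finset.sum_congr rfl fun i _ => ?_
  simp only [Prod.fst_add, Pi.add_apply]
  ring

/-- `ε(α, β) = (-1)^(α, β) ε(β, α)`. The lattice is even, so the `e^α(z)` are mutually local
with commutators. -/
theorem cocycle_symm (α β : Lat N) :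
    cocycle α β = (-1 : ℂ) ^ (pairing α β) * cocycle β α := by
  rw [cocycle, cocycle, ← zpow_add₀ (by norm_num), pairing, ← Finset.sum_add_distrib]
  have h : ∑ i, ((α.1 i * β.2 i + α.2 i * β.1 i) + β.2 i * α.1 i) =
      ∑ i, α.2 i * β.1 i + 2 * ∑ i, β.2 i * α.1 i := by
    rw [Finset.mul_sum, ← Finset.sum_add_distrib]
    exact Finset.sum_congr rfl fun i _ => by ring
  rw [h, zpow_add₀ (by norm_num), zpow_mul]
  norm_num

theorem superComm_one (α β : Lat N) (m n : ℤ) :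
    superComm 1 (em α) (em β) m n = em α m * em β n - em β n * em α m := by
  rw [superComm, one_mul, mul_one]

/-- Locality on the states `e^γ`: multiplied by `(z - w)^M`, with `M + (α, β) ≥ 0`, the two
products become, up to sign, the same expression without negative powers of `z - w`, and the cocycle
makes the signs agree. -/
theorem dif_superComm_expState (α β γ : Lat N) (M R : ℕ) (h : (M : ℤ) + pairing α β = R)
    (m n : ℤ) : (dif^[M] (superComm 1 (em α) (em β))) m n (expState γ) = 0 := by
  have h1 : (fun m n => superComm 1 (em α) (em β) m n (expState γ)) = fun m n =>
      ((cocycle β γ * cocycle α (β + γ)) • embedBos (α + (β + γ)) 1)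
        (expProd α β (pairing α β) (-1 - pairing α (β + γ) - m) (-1 - pairing β γ - n)) -
      ((cocycle α γ * cocycle β (α + γ)) • embedBos (α + (β + γ)) 1)
        (expProd β α (pairing α β) (-1 - pairing β (α + γ) - n) (-1 - pairing α γ - m)) := by
    funext m n
    rw [superComm_one, LinearMap.sub_apply, Module.End.mul_apply, Module.End.mul_apply,
      em_em_expState, em_em_expState, pairing_comm β α, show β + (α + γ) = α + (β + γ) by abel]
    simp only [LinearMap.smul_apply]
    congr 4 <;> ring
  have h2 := dif_iterate_map ((LinearMap.applyₗ (expState γ) :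
    Module.End ℂ (VL N) →ₗ[ℂ] VL N).toAddMonoidHom) (superComm 1 (em α) (em β)) M
  have h3 := congr_fun₂ h2 m n
  refine h3.symm.trans ?_
  change (dif^[M] (fun m n => superComm 1 (em α) (em β) m n (expState γ))) m n = 0
  rw [h1, dif_iterate_sub, dif_iterate_flip (fun m n => ((cocycle α γ * cocycle β (α + γ)) •
    embedBos (α + (β + γ)) 1) (expProd β α (pairing α β) (-1 - pairing β (α + γ) - m)
      (-1 - pairing α γ - n)))]
  have h4 := dif_iterate_map (((cocycle β γ * cocycle α (β + γ)) •
    embedBos (α + (β + γ)) 1).toAddMonoidHom) (fun m n => (expProd α β (pairing α β)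
      (-1 - pairing α (β + γ) - m) (-1 - pairing β γ - n))) M
  have h5 := dif_iterate_map (((cocycle α γ * cocycle β (α + γ)) •
    embedBos (α + (β + γ)) 1).toAddMonoidHom) (fun m n => (expProd β α (pairing α β)
      (-1 - pairing β (α + γ) - m) (-1 - pairing α γ - n))) M
  have h4' := congr_fun₂ h4 m n
  have h5' := congr_fun₂ h5 n m
  refine (congrArg₂ (fun x y => x - (-1 : ℤ) ^ M • y) h4' h5').trans ?_
  rw [dif_iterate_expProd, dif_iterate_expProd, show pairing α β + (M : ℤ) = R by omega]
  simp only [LinearMap.toAddMonoidHom_coe, LinearMap.smul_apply]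
  rw [pairing_add_right, pairing_add_right,
    show -1 - (pairing β α + pairing β γ) - n - (M : ℤ) = (-1 - pairing β γ - n) - R by
      rw [pairing_comm β α]; omega,
    show -1 - (pairing α β + pairing α γ) - m - (M : ℤ) = (-1 - pairing α γ - m) - R by omega,
    expProd_flip α β R, map_zsmul, cocycle_add_right, cocycle_add_right, cocycle_symm α β,
    ← Int.cast_smul_eq_zsmul ℂ, ← Int.cast_smul_eq_zsmul ℂ, smul_smul, smul_smul, ← sub_smul]
  have h6 : (-1 : ℂ) ^ (pairing α β) = (-1 : ℂ) ^ M * (-1) ^ R := by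
    rw [show pairing α β = (R : ℤ) - M by omega, zpow_sub₀ (by norm_num), zpow_natCast,
      zpow_natCast, div_eq_mul_inv, ← inv_pow, show (-1 : ℂ)⁻¹ = -1 by norm_num, mul_comm]
  rw [h6]
  push_cast
  refine (congrArg (· • _) ?_).trans (zero_smul ℂ _)
  ring

/-- Locality of the fields `e^α(z)` and `e^β(z)`, of any order `M ≥ -(α, β)`. -/
theorem dif_superComm_em (α β : Lat N) (M : ℕ) (h : 0 ≤ (M : ℤ) + pairing α β) :
    dif^[M] (superComm 1 (em α) (em β)) = fun _ _ => 0 := by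
  obtain ⟨R, hR⟩ := Int.eq_ofNat_of_zero_le h
  set F := dif^[M] (superComm 1 (em α) (em β)) with hF
  -- The creation modes have scalar commutators with both exponentials, up to a shift of the modes,
  -- so the vectors on which `F` vanishes are stable under them, and the states `e^γ` generate.
  have hcomm : ∀ (o : Module.End ℂ (VL N)) (x y : ℂ) (k : ℤ),
      (∀ n, o * em α n - em α n * o = x • em α (n + k)) →
      (∀ n, o * em β n - em β n * o = y • em β (n + k)) → ∀ m n,
      o * F m n = F m n * o + x • F (m + k) n + y • F m (n + k) := by
    intro o x y k hα hβ m n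
    have h1 : (fun m n => o * superComm 1 (em α) (em β) m n) = fun m n =>
        superComm 1 (em α) (em β) m n * o + x • superComm 1 (em α) (em β) (m + k) n +
          y • superComm 1 (em α) (em β) m (n + k) := by
      funext m n
      simp only [superComm_one]
      have e1 := hα m
      have e2 := hβ n
      rw [sub_eq_iff_eq_add] at e1 e2
      rw [mul_sub, ← mul_assoc, ← mul_assoc, e1, e2, add_mul, add_mul, mul_assoc _ o,
        mul_assoc _ o, e1, e2, smul_sub, smul_sub]
      simp only [sub_mul, mul_add, smul_mul_assoc, mul_smul_comm, mul_assoc]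
      abel
    have h2 := congrArg (fun f => (dif^[M] f) m n) h1
    have e1 := congr_fun₂ (dif_iterate_map (AddMonoidHom.mulLeft o)
      (superComm 1 (em α) (em β)) M) m n
    have e2 := congr_fun₂ (dif_iterate_map (AddMonoidHom.mulRight o)
      (superComm 1 (em α) (em β)) M) m n
    have e3 := congr_fun₂ (dif_iterate_map (DistribSMul.toAddMonoidHom (Module.End ℂ (VL N)) x)
      (fun m n => superComm 1 (em α) (em β) (m + k) n) M) m n
    have e4 := congr_fun₂ (dif_iterate_map (DistribSMul.toAddMonoidHom (Module.End ℂ (VL N)) y)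
      (fun m n => superComm 1 (em α) (em β) m (n + k)) M) m n
    rw [dif_iterate_shift] at e3
    have e5 : dif^[M] (fun m n => superComm 1 (em α) (em β) m (n + k)) =
        fun m n => F m (n + k) := by
      have := dif_iterate_flip (fun m n => superComm 1 (em α) (em β) n (m + k)) M
      rw [this, dif_iterate_shift (fun m n => superComm 1 (em α) (em β) n m), dif_iterate_flip]
      funext m n
      simp only [smul_smul, ← mul_pow]
      simp [hF]
    rw [e5] at e4
    simp only [AddMonoidHom.coe_mulLeft, AddMonoidHom.coe_mulRight,
      DistribSMul.toAddMonoidHom_apply] at e1 e2 e3 e4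
    simp only [dif_iterate_add, e1, e2, e3, e4] at h2
    exact h2
  let p : Submodule ℂ (VL N) := ⨅ m, ⨅ n, LinearMap.ker (F m n)
  have hp : ∀ v, v ∈ p ↔ ∀ m n, F m n v = 0 := by
    intro v; simp [p, Submodule.mem_iInf]
  have hstep : ∀ (o : Module.End ℂ (VL N)) (x y : ℂ) (k : ℤ),
      (∀ n, o * em α n - em α n * o = x • em α (n + k)) →
      (∀ n, o * em β n - em β n * o = y • em β (n + k)) → ∀ v ∈ p, o v ∈ p := by
    intro o x y k hα hβ v hv
    rw [hp] at hv ⊢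
    intro m n
    have := LinearMap.congr_fun (hcomm o x y k hα hβ m n) v
    simp only [LinearMap.add_apply, Module.End.mul_apply, LinearMap.smul_apply, hv, map_zero,
      smul_zero, add_zero] at this
    exact this.symm
  have hall := VL_generated p (fun γ => (hp _).mpr (dif_superComm_expState α β γ M R hR))
    (fun b i k => hstep _ 0 0 0 (fun n => by rw [fm_em, sub_self, zero_smul])
      fun n => by rw [fm_em, sub_self, zero_smul])
    (fun b i k => hstep _ _ _ _ (fun n => bm_em b i _ α n) (fun n => bm_em b i _ β n))
  funext m n
  exact LinearMap.ext fun v => (hp v).mp (hall v) m n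

theorem loc_em_em (α β : Lat N) : Loc 1 (em α) (em β) :=
  ⟨(-pairing α β).toNat, dif_superComm_em α β _ (by omega)⟩

/-- Orthogonal exponentials commute. -/
theorem em_comm_em {α β : Lat N} (h : pairing α β = 0) (m n : ℤ) :
    em α m * em β n = em β n * em α m := by
  have h1 := congr_fun₂ (dif_superComm_em α β 0 (by rw [h]; rfl)) m n
  rw [Function.iterate_zero, id, superComm_one] at h1
  exact sub_eq_zero.mp h1

end ExpLocality

/-! ### Translation covariance -/

section Covariance

variable {V : Type*} [AddCommGroup V] [Module ℂ V]

/-- Translation covariance `[T, a(z)] = ∂ a(z)` of a family of modes. -/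
def Cov (T : Module.End ℂ V) (a : ℤ → Module.End ℂ V) : Prop :=
  ∀ n, T * a n - a n * T = (-(n : ℂ)) • a (n - 1)

theorem Cov.apply {T : Module.End ℂ V} {a : ℤ → Module.End ℂ V} (h : Cov T a) (n : ℤ) (v : V) :
    T (a n v) = a n (T v) + (-(n : ℂ)) • a (n - 1) v := by
  have := LinearMap.congr_fun (h n) v
  simp only [LinearMap.sub_apply, Module.End.mul_apply, LinearMap.smul_apply] at this
  rw [← this]; abel

theorem cov_of_apply {T : Module.End ℂ V} {a : ℤ → Module.End ℂ V}
    (h : ∀ n v, T (a n v) = a n (T v) + (-(n : ℂ)) • a (n - 1) v) : Cov T a := fun n => by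
  ext v
  simp only [LinearMap.sub_apply, Module.End.mul_apply, LinearMap.smul_apply]
  rw [h]; abel

theorem choose_absorb (r : ℤ) (k : ℕ) :
    r * Ring.choose (r - 1) k = (r - k) * Ring.choose r k := by
  have h1 := Ring.choose_smul_choose r (Nat.le_add_left 1 k)
  have h2 := Ring.choose_smul_choose r (Nat.le_succ k)
  rw [Nat.choose_one_right, Ring.choose_one_right, Nat.add_sub_cancel, nsmul_eq_mul] at h1
  rw [Nat.succ_eq_add_one, Nat.choose_succ_self_right, Nat.add_sub_cancel_left,
    Ring.choose_one_right, nsmul_eq_mul] at h2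
  rw [h1] at h2
  push_cast at h2
  rw [h2]; ring

/-- Divided derivatives of covariant fields are covariant. -/
theorem Cov.divDeriv {T : Module.End ℂ V} {a : VertexOperator ℂ V}
    (h : Cov T (VertexOperator.ncoeff a)) (k : ℕ) :
    Cov T (VertexOperator.ncoeff (divDeriv k a)) := by
  refine cov_of_apply fun n v => ?_
  simp only [ChiralPN.divDeriv, ncoeff_ofModes, LinearMap.smul_apply, map_zsmul]
  rw [h.apply, smul_add, ← Int.cast_smul_eq_zsmul ℂ, ← Int.cast_smul_eq_zsmul ℂ,
    ← Int.cast_smul_eq_zsmul ℂ, smul_smul, smul_smul, show n - 1 - (k : ℤ) = n - k - 1 by ring]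
  congr 2
  have := choose_absorb ((k : ℤ) - n) k
  rw [show (k : ℤ) - (n - 1) - 1 = k - n by ring, ← Int.cast_neg, ← Int.cast_neg, ← Int.cast_mul,
    ← Int.cast_mul]
  congr 1
  linear_combination this

/-- Normally ordered products of covariant fields are covariant. On a vector the sums are finite;
the terms by which `[T, -]` differs from `∂` telescope. -/
theorem Cov.normalOrder {T s : Module.End ℂ V} {a b : VertexOperator ℂ V} (hT : T * s = s * T)
    (ha : Cov T (VertexOperator.ncoeff a)) (hb : Cov T (VertexOperator.ncoeff b)) :
    Cov T (VertexOperator.ncoeff (normalOrder s a b)) := by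
  have hs : ∀ v, T (s v) = s (T v) := LinearMap.congr_fun hT
  refine cov_of_apply fun n v => ?_
  obtain ⟨K, hK⟩ := ncoeff_trunc a v
  obtain ⟨K', hK'⟩ := ncoeff_trunc b v
  obtain ⟨J, h1, h2, h3, hJ⟩ := ((normalOrder_eventually s a b n v).and
    ((normalOrder_eventually s a b n (T v)).and ((normalOrder_eventually s a b (n - 1) v).and
    (Filter.eventually_ge_atTop ((max K (K' - n)).toNat + 1))))).exists
  rw [h1, h2, h3]
  clear h1 h2 h3
  obtain ⟨J, rfl⟩ := Nat.exists_eq_succ_of_ne_zero (show J ≠ 0 by omega)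
  set a' := VertexOperator.ncoeff a
  set b' := VertexOperator.ncoeff b
  have e : ∀ j : ℕ, T (a' (-(j : ℤ) - 1) (b' (n + j) v) + s (b' (n - 1 - j) (s (a' j v)))) =
      (a' (-(j : ℤ) - 1) (b' (n + j) (T v)) + s (b' (n - 1 - j) (s (a' j (T v))))) +
      (-(n : ℂ)) • (a' (-(j : ℤ) - 1) (b' (n - 1 + j) v) + s (b' (n - 1 - 1 - j) (s (a' j v)))) +
      (((((j + 1 : ℕ) : ℂ) • a' (-((j + 1 : ℕ) : ℤ) - 1) (b' (n - 1 + (j + 1 : ℕ)) v)) -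
        ((j : ℂ) • a' (-(j : ℤ) - 1) (b' (n - 1 + j) v))) +
      ((((j + 1 : ℕ) : ℂ) • s (b' (n - 1 - (j + 1 : ℕ)) (s (a' (((j + 1 : ℕ) : ℤ) - 1) v))) -
        (j : ℂ) • s (b' (n - 1 - j) (s (a' ((j : ℤ) - 1) v)))))) := by
    intro j
    rw [map_add, ha.apply, hb.apply, hs, hb.apply, hs, ha.apply]
    simp only [map_add, map_smul]
    rw [show -((j + 1 : ℕ) : ℤ) - 1 = -(j : ℤ) - 1 - 1 by push_cast; ring,
      show n - 1 + ((j + 1 : ℕ) : ℤ) = n + j by push_cast; ring,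
      show ((j + 1 : ℕ) : ℤ) - 1 = j by push_cast; ring,
      show n - 1 - ((j + 1 : ℕ) : ℤ) = n - 1 - j - 1 by push_cast; ring,
      show n - 1 + (j : ℤ) = n + j - 1 by ring,
      show n - 1 - 1 - (j : ℤ) = n - 1 - j - 1 by ring]
    push_cast
    module
  rw [map_sum, Finset.sum_congr rfl fun j _ => e j, Finset.sum_add_distrib, Finset.sum_add_distrib,
    ← Finset.smul_sum]
  refine add_eq_left.mpr ?_
  rw [Finset.sum_add_distrib, Finset.sum_range_sub (fun j : ℕ => (j : ℂ) • a' (-(j : ℤ) - 1) (b' (n - 1 + j) v)),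
    Finset.sum_range_sub (fun j : ℕ => (j : ℂ) • s (b' (n - 1 - j) (s (a' ((j : ℤ) - 1) v)))),
    hK' _ (by omega), hK _ (by omega)]
  simp

end Covariance

/-! ### The generating fields and their locality -/

section Generators

variable {N : ℕ}

/-- Labels of the generating fields of `V_L`. -/
inductive Gen (N : ℕ) : Type
  | ferm (b : Bool) (i : Fin N) : Gen N
  | bos (b : Bool) (i : Fin N) : Gen N
  | exp (α : Lat N) : Gen N

/-- The generating fields. -/
def Gen.field : Gen N → VertexOperator ℂ (VL N)
  | ferm b i => fermField b i
  | bos b i => bosField b i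
  | exp α => expField α

/-- The modes of the generating fields. -/
def Gen.mode (g : Gen N) : ℤ → Module.End ℂ (VL N) := VertexOperator.ncoeff g.field

/-- Whether a generating field is odd. -/
def Gen.odd : Gen N → Bool
  | ferm _ _ => true
  | _ => false

theorem Gen.mode_ferm (b : Bool) (i : Fin N) : (Gen.ferm b i).mode = fm b i := ncoeff_fermField b i

theorem Gen.mode_bos (b : Bool) (i : Fin N) : (Gen.bos b i).mode = bm b i := by
  exact ncoeff_bosField b i

theorem Gen.mode_exp (α : Lat N) : (Gen.exp α).mode = em α := rfl

variable (N) in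
/-- The involution entering the sign rule for a field of parity `p`. -/
def signOp (p : Bool) : Module.End ℂ (VL N) := if p then parity N else 1

theorem signOp_false : signOp N false = 1 := rfl

theorem signOp_true : signOp N true = parity N := rfl

theorem signOp_mul_self (p : Bool) : signOp N p * signOp N p = 1 := by
  cases p
  · exact one_mul 1
  · exact parity_mul_self

theorem signOp_comm (p p' : Bool) : signOp N p * signOp N p' = signOp N p' * signOp N p := by
  cases p <;> cases p' <;> simp [signOp]

/-- The sign of the exchange of two fields of given parities. -/
def exchangeSign (p p' : Bool) : ℂ := if p && p' then -1 else 1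

theorem exchangeSign_comm (p p' : Bool) : exchangeSign p p' = exchangeSign p' p := by
  rw [exchangeSign, exchangeSign, Bool.and_comm]

theorem exchangeSign_mul_self (p p' : Bool) : exchangeSign p p' * exchangeSign p p' = 1 := by
  rw [exchangeSign]; split_ifs <;> norm_num

/-- The modes are homogeneous of parity `p`. -/
def HasParity (p : Bool) (a : ℤ → Module.End ℂ (VL N)) : Prop :=
  ∀ n, parity N * a n * parity N = exchangeSign true p • a n

theorem HasParity.conj {p : Bool} {a : ℤ → Module.End ℂ (VL N)} (h : HasParity p a)
    (p' : Bool) (n : ℤ) : signOp N p' * a n * signOp N p' = exchangeSign p' p • a n := by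
  cases p'
  · simp [signOp_false, exchangeSign]
  · exact h n

theorem Gen.hasParity (g : Gen N) : HasParity g.odd g.mode := by
  intro n
  cases g with
  | ferm b i => rw [mode_ferm, parity_fm]; exact (neg_one_smul ℂ _).symm
  | bos b i => rw [mode_bos, parity_bm]; simp [exchangeSign, Gen.odd]
  | exp α => rw [mode_exp, parity_em]; simp [exchangeSign, Gen.odd]

theorem loc_of_comm {s : Module.End ℂ (VL N)} {a b : ℤ → Module.End ℂ (VL N)}
    (hs : ∀ n, s * b n * s = b n) (h : ∀ m n, a m * b n = b n * a m) : Loc s a b :=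
  ⟨0, by funext m n; rw [Function.iterate_zero, id, superComm, hs, h, sub_self]⟩

theorem loc_bm_em (b : Bool) (i : Fin N) (α : Lat N) : Loc 1 (bm b i) (em α) := by
  refine ⟨1, ?_⟩
  have : superComm 1 (bm b i) (em α) = fun m n => (pairGen b i α : ℂ) • em α (n + m) := by
    funext m n
    rw [superComm, one_mul, mul_one, bm_em]
  rw [this]
  funext m n
  rw [Function.iterate_one, dif, show n + (m + 1) = n + 1 + m by ring, sub_self]

/-- The generating fields are mutually local. -/
theorem Gen.loc (g h : Gen N) : Loc (signOp N g.odd) g.mode h.mode := by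
  cases g with
  | ferm b i =>
    rw [mode_ferm]
    cases h with
    | ferm b' j =>
      rw [mode_ferm]
      refine ⟨1, ?_⟩
      have : superComm (signOp N (Gen.ferm b i).odd) (fm b i) (fm b' j) = fun m n =>
          if b' = !b ∧ i = j ∧ m + n = -1 then 1 else 0 := by
        funext m n
        rw [← fm_anticomm]
        refine LinearMap.ext fun v => ?_
        have h := LinearMap.congr_fun (parity_fm b' j n) (fm b i m v)
        simp only [Module.End.mul_apply, LinearMap.neg_apply] at h
        simp only [superComm, LinearMap.sub_apply, LinearMap.add_apply, Module.End.mul_apply,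
          Gen.odd, signOp_true]
        rw [h, sub_neg_eq_add]
      rw [this]
      funext m n
      rw [Function.iterate_one, dif, show m + 1 + n = m + (n + 1) by ring, sub_self]
    | bos b' j =>
      rw [mode_bos]
      exact loc_of_comm (fun n => parity_bm b' j n) fun m n => fm_bm b b' i j m n
    | exp α =>
      rw [mode_exp]
      exact loc_of_comm (fun n => parity_em α n) fun m n => fm_em b i m α n
  | bos b i =>
    rw [mode_bos]
    cases h with
    | ferm b' j =>
      rw [mode_ferm]
      exact loc_of_comm (fun n => by simp [signOp, Gen.odd]) fun m n => (fm_bm b' b j i n m).symm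
    | bos b' j =>
      rw [mode_bos]
      refine ⟨2, ?_⟩
      have : superComm (signOp N (Gen.bos b i).odd) (bm b i) (bm b' j) = fun m n : ℤ =>
          if b' = !b ∧ i = j ∧ m + n = 0 then (m : ℂ) • 1 else 0 := by
        funext m n
        rw [← bm_comm, superComm]
        simp [signOp, Gen.odd]
      rw [this]
      funext m n
      simp only [Function.iterate_succ, Function.iterate_zero, Function.comp, id, dif]
      rw [show m + 1 + 1 + n = m + n + 2 by ring, show m + 1 + (n + 1) = m + n + 2 by ring,
        show m + (n + 1 + 1) = m + n + 2 by ring]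
      split_ifs
      · push_cast; module
      · simp
    | exp α => exact loc_bm_em b i α
  | exp α =>
    rw [mode_exp]
    cases h with
    | ferm b' j =>
      rw [mode_ferm]
      exact loc_of_comm (fun n => by simp [signOp, Gen.odd]) fun m n => (fm_em b' j n α m).symm
    | bos b' j =>
      rw [mode_bos]
      exact (loc_bm_em b' j α).symm (ε := 1) (one_mul 1) (fun n => by simp)
        (fun n => by simp [signOp, Gen.odd])
    | exp β => exact loc_em_em α β

/-- A homogeneous family of modes local to all generating fields. -/
structure GenLocal (p : Bool) (a : ℤ → Module.End ℂ (VL N)) : Prop where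
  parity : HasParity p a
  loc : ∀ g : Gen N, Loc (signOp N g.odd) g.mode a

theorem Gen.genLocal (g : Gen N) : GenLocal g.odd g.mode := ⟨g.hasParity, fun h => h.loc g⟩

/-- `Loc.symm` for families of given parities. -/
theorem Loc.swap {p p' : Bool} {a b : ℤ → Module.End ℂ (VL N)} (ha : HasParity p a)
    (hb : HasParity p' b) (h : Loc (signOp N p) a b) : Loc (signOp N p') b a :=
  h.symm (exchangeSign_mul_self p p') (hb.conj p) fun n => by
    rw [ha.conj, exchangeSign_comm]

theorem ncoeff_divDeriv (k : ℕ) (a : VertexOperator ℂ (VL N)) (m : ℤ) :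
    VertexOperator.ncoeff (divDeriv k a) m =
      Ring.choose ((k : ℤ) - m - 1) k • VertexOperator.ncoeff a (m - k) := by
  rw [divDeriv, ncoeff_ofModes]

theorem HasParity.divDeriv {p : Bool} {a : VertexOperator ℂ (VL N)}
    (h : HasParity p (VertexOperator.ncoeff a)) (k : ℕ) :
    HasParity p (VertexOperator.ncoeff (divDeriv k a)) := by
  intro n
  rw [ncoeff_divDeriv, mul_smul_comm, smul_mul_assoc, h, smul_comm]

theorem HasParity.normalOrder {p p' : Bool} {a b : VertexOperator ℂ (VL N)}
    (ha : HasParity p (VertexOperator.ncoeff a)) (hb : HasParity p' (VertexOperator.ncoeff b)) :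
    HasParity (xor p p') (VertexOperator.ncoeff (normalOrder (signOp N p) a b)) := by
  have hx : exchangeSign true (xor p p') = exchangeSign true p * exchangeSign true p' := by
    cases p <;> cases p' <;> simp [exchangeSign]
  have key : ∀ {q : Bool} {c : ℤ → Module.End ℂ (VL N)}, HasParity q c → ∀ n v,
      parity N (c n v) = exchangeSign true q • c n (parity N v) := by
    intro q c hc n v
    have h1 := LinearMap.congr_fun (hc n) (parity N v)
    have h2 := LinearMap.congr_fun (parity_mul_self (N := N)) v
    simp only [Module.End.mul_apply, Module.End.one_apply, LinearMap.smul_apply] at h1 h2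
    rwa [h2] at h1
  have hs : ∀ v, parity N (signOp N p v) = signOp N p (parity N v) :=
    LinearMap.congr_fun (signOp_comm true p)
  intro n
  refine LinearMap.ext fun v => ?_
  simp only [Module.End.mul_apply, LinearMap.smul_apply]
  obtain ⟨J, h1, h2⟩ := ((normalOrder_eventually (signOp N p) a b n v).and
    (normalOrder_eventually (signOp N p) a b n (parity N v))).exists
  have h3 := LinearMap.congr_fun (parity_mul_self (N := N)) v
  simp only [Module.End.mul_apply, Module.End.one_apply] at h3
  rw [h1, h2, map_sum, Finset.smul_sum]
  refine Finset.sum_congr rfl fun j _ => ?_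
  rw [map_add, key ha, key hb, hs, key hb, hs, key ha, h3, hx]
  simp only [map_smul, smul_smul, smul_add]
  rw [mul_comm (exchangeSign true p') (exchangeSign true p)]

end Generators

/-! ### The translation operator -/

section Translation

variable {N : ℕ}

variable (N) in
/-- The `k`-th summand of the translation operator. -/
def transTerm (k : ℕ) : Module.End ℂ (VL N) :=
  ∑ i, ((bm false i (-(k : ℤ) - 1) * bm true i k + bm true i (-(k : ℤ) - 1) * bm false i k) +
    ((k : ℂ) + 1) • (fm false i (-(k : ℤ) - 2) * fm true i k +
      fm true i (-(k : ℤ) - 2) * fm false i k))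

theorem fm_trunc (b : Bool) (i : Fin N) : Trunc (fm b i) := by
  rw [← ncoeff_fermField]; exact ncoeff_trunc _

theorem bm_trunc (b : Bool) (i : Fin N) : Trunc (bm b i) := by
  rw [← ncoeff_bosField]; exact ncoeff_trunc _

theorem transTerm_trunc (v : VL N) : ∃ K, ∀ k ≥ K, transTerm N k v = 0 := by
  have h : ∀ (i : Fin N), ∃ K : ℤ, ∀ k ≥ K, (∀ b, bm b i k v = 0) ∧ ∀ b, fm b i k v = 0 := by
    intro i
    obtain ⟨K₁, h₁⟩ := bm_trunc false i v
    obtain ⟨K₂, h₂⟩ := bm_trunc true i v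
    obtain ⟨K₃, h₃⟩ := fm_trunc false i v
    obtain ⟨K₄, h₄⟩ := fm_trunc true i v
    refine ⟨max (max K₁ K₂) (max K₃ K₄), fun k hk => ⟨fun b => ?_, fun b => ?_⟩⟩ <;> cases b
    · exact h₁ k (by omega)
    · exact h₂ k (by omega)
    · exact h₃ k (by omega)
    · exact h₄ k (by omega)
  choose K hK using h
  obtain ⟨M, hM⟩ := (Finset.univ.image K).bddAbove
  refine ⟨M.toNat, fun k hk => ?_⟩
  rw [transTerm, LinearMap.sum_apply]
  refine Finset.sum_eq_zero fun i _ => ?_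
  have hi : K i ≤ M := hM (Finset.mem_coe.mpr (Finset.mem_image_of_mem K (Finset.mem_univ i)))
  obtain ⟨h1, h2⟩ := hK i k (by omega)
  simp [Module.End.mul_apply, h1, h2]

variable (N) in
/-- The translation operator `T = ∑_i :A^i B^i:_(0) + :∂Φ^i Ψ^i:_(0)`. -/
def transOp : Module.End ℂ (VL N) := locSum (transTerm N) transTerm_trunc

/-- Covariance can be checked summand by summand of the translation operator. -/
theorem cov_of_eventually {a : ℤ → Module.End ℂ (VL N)}
    (h : ∀ n v, ∀ᶠ J in Filter.atTop, ∑ k ∈ Finset.range J,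
      (transTerm N k * a n - a n * transTerm N k) v = (-(n : ℂ)) • a (n - 1) v) :
    Cov (transOp N) a := by
  intro n
  refine LinearMap.ext fun v => ?_
  obtain ⟨J, h1, h2, h3⟩ := ((h n v).and ((locSum_eventually _ transTerm_trunc (a n v)).and
    (locSum_eventually _ transTerm_trunc v))).exists
  rw [LinearMap.sub_apply, Module.End.mul_apply, Module.End.mul_apply, transOp, h2, h3,
    LinearMap.smul_apply, ← h1, map_sum, ← Finset.sum_sub_distrib]
  rfl

theorem mul_anticomm_sub {R : Type*} [Ring R] (u v x : R) :
    u * v * x - x * (u * v) = u * (v * x + x * v) - (u * x + x * u) * v := by noncomm_ring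

theorem mul_comm_sub {R : Type*} [Ring R] (u v x : R) :
    u * v * x - x * (u * v) = u * (v * x - x * v) + (u * x - x * u) * v := by noncomm_ring

theorem transTerm_fm (k : ℕ) (b : Bool) (i : Fin N) (n : ℤ) :
    transTerm N k * fm b i n - fm b i n * transTerm N k =
      ((k : ℂ) + 1) • ((if n = -(k : ℤ) - 1 then fm b i (-(k : ℤ) - 2) else 0) -
        if n = k + 1 then fm b i k else 0) := by
  have e1 := mul_anticomm_sub (R := Module.End ℂ (VL N))
  have e2 : ∀ u v x : Module.End ℂ (VL N), x * u = u * x → x * v = v * x →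
      u * v * x - x * (u * v) = 0 := by
    intro u v x h1 h2
    rw [← mul_assoc, h1, mul_assoc, mul_assoc, h2, sub_self]
  have hj : ∀ j, ((bm false j (-(k : ℤ) - 1) * bm true j k +
      bm true j (-(k : ℤ) - 1) * bm false j k) +
      ((k : ℂ) + 1) • (fm false j (-(k : ℤ) - 2) * fm true j k +
        fm true j (-(k : ℤ) - 2) * fm false j k)) * fm b i n -
      fm b i n * ((bm false j (-(k : ℤ) - 1) * bm true j k +
      bm true j (-(k : ℤ) - 1) * bm false j k) +
      ((k : ℂ) + 1) • (fm false j (-(k : ℤ) - 2) * fm true j k +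
        fm true j (-(k : ℤ) - 2) * fm false j k)) =
      if j = i then ((k : ℂ) + 1) • ((if n = -(k : ℤ) - 1 then fm b i (-(k : ℤ) - 2) else 0) -
        if n = k + 1 then fm b i k else 0) else 0 := by
    intro j
    have b1 := e2 (bm false j (-(k : ℤ) - 1)) (bm true j k) (fm b i n) (fm_bm _ _ _ _ _ _)
      (fm_bm _ _ _ _ _ _)
    have b2 := e2 (bm true j (-(k : ℤ) - 1)) (bm false j k) (fm b i n) (fm_bm _ _ _ _ _ _)
      (fm_bm _ _ _ _ _ _)
    have f1 := e1 (fm false j (-(k : ℤ) - 2)) (fm true j k) (fm b i n)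
    have f2 := e1 (fm true j (-(k : ℤ) - 2)) (fm false j k) (fm b i n)
    rw [fm_anticomm, fm_anticomm] at f1 f2
    rw [sub_eq_zero] at b1 b2
    rw [sub_eq_iff_eq_add] at f1 f2
    rw [add_mul, mul_add, add_mul, mul_add, b1, b2, smul_mul_assoc, mul_smul_comm, add_mul,
      mul_add, f1, f2, add_sub_add_left_eq_sub]
    refine (smul_sub _ _ _).symm.trans ?_
    have c1 : (k : ℤ) + n = -1 ↔ n = -(k : ℤ) - 1 := by omega
    have c2 : -(k : ℤ) - 2 + n = -1 ↔ n = k + 1 := by omega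
    by_cases hji : j = i
    · subst hji
      rw [if_pos rfl]
      congr 1
      cases b
      · simp only [Bool.not_true, Bool.not_false, c1, c2, true_and, reduceCtorEq, false_and,
          if_false, mul_ite, ite_mul, mul_one, one_mul, mul_zero, zero_mul]
        abel
      · simp only [Bool.not_true, Bool.not_false, c1, c2, true_and, reduceCtorEq, false_and,
          if_false, mul_ite, ite_mul, mul_one, one_mul, mul_zero, zero_mul]
        abel
    · simp only [hji, false_and, and_false, if_false, mul_zero, zero_mul]
      simp
  rw [transTerm, Finset.sum_mul, Finset.mul_sum, ← Finset.sum_sub_distrib,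
    Finset.sum_congr rfl fun j _ => hj j]
  simp

theorem transTerm_bm (k : ℕ) (b : Bool) (i : Fin N) (n : ℤ) :
    transTerm N k * bm b i n - bm b i n * transTerm N k =
      (if n = -(k : ℤ) then (k : ℂ) • bm b i (-(k : ℤ) - 1) else 0) +
        if n = k + 1 then (-(k : ℂ) - 1) • bm b i k else 0 := by
  have e1 := mul_comm_sub (R := Module.End ℂ (VL N))
  have e2 : ∀ u v x : Module.End ℂ (VL N), u * x = x * u → v * x = x * v →
      u * v * x - x * (u * v) = 0 := by
    intro u v x h1 h2
    rw [← mul_assoc, ← h1, mul_assoc, mul_assoc, h2, sub_self]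
  have hj : ∀ j, ((bm false j (-(k : ℤ) - 1) * bm true j k +
      bm true j (-(k : ℤ) - 1) * bm false j k) +
      ((k : ℂ) + 1) • (fm false j (-(k : ℤ) - 2) * fm true j k +
        fm true j (-(k : ℤ) - 2) * fm false j k)) * bm b i n -
      bm b i n * ((bm false j (-(k : ℤ) - 1) * bm true j k +
      bm true j (-(k : ℤ) - 1) * bm false j k) +
      ((k : ℂ) + 1) • (fm false j (-(k : ℤ) - 2) * fm true j k +
        fm true j (-(k : ℤ) - 2) * fm false j k)) =
      if j = i then (if n = -(k : ℤ) then (k : ℂ) • bm b i (-(k : ℤ) - 1) else 0) +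
        (if n = k + 1 then (-(k : ℂ) - 1) • bm b i k else 0) else 0 := by
    intro j
    have b1 := e2 (fm false j (-(k : ℤ) - 2)) (fm true j k) (bm b i n) (fm_bm _ _ _ _ _ _)
      (fm_bm _ _ _ _ _ _)
    have b2 := e2 (fm true j (-(k : ℤ) - 2)) (fm false j k) (bm b i n) (fm_bm _ _ _ _ _ _)
      (fm_bm _ _ _ _ _ _)
    have f1 := e1 (bm false j (-(k : ℤ) - 1)) (bm true j k) (bm b i n)
    have f2 := e1 (bm true j (-(k : ℤ) - 1)) (bm false j k) (bm b i n)
    rw [bm_comm, bm_comm] at f1 f2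
    rw [sub_eq_zero] at b1 b2
    rw [sub_eq_iff_eq_add] at f1 f2
    rw [add_mul, mul_add, smul_mul_assoc, mul_smul_comm, add_mul (fm false j _ * _),
      mul_add _ (fm false j _ * _), b1, b2, add_sub_add_right_eq_sub, add_mul, mul_add, f1, f2]
    have c1 : (k : ℤ) + n = 0 ↔ n = -(k : ℤ) := by omega
    have c2 : -(k : ℤ) - 1 + n = 0 ↔ n = k + 1 := by omega
    by_cases hji : j = i
    · subst hji
      rw [if_pos rfl]
      cases b
      · simp only [Bool.not_true, Bool.not_false, c1, c2, true_and, reduceCtorEq, false_and,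
          if_false, mul_ite, ite_mul, mul_zero, zero_mul, smul_mul_assoc,
          mul_smul_comm, mul_one, one_mul]
        push_cast
        abel
      · simp only [Bool.not_true, Bool.not_false, c1, c2, true_and, reduceCtorEq, false_and,
          if_false, mul_ite, ite_mul, mul_zero, zero_mul, smul_mul_assoc,
          mul_smul_comm, mul_one, one_mul]
        push_cast
        abel
    · simp only [hji, false_and, and_false, if_false, mul_zero, zero_mul]
      abel
  rw [transTerm, Finset.sum_mul, Finset.mul_sum, ← Finset.sum_sub_distrib,
    Finset.sum_congr rfl fun j _ => hj j]
  simp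

/-- Summed over `k`, the right-hand side is the mode of `:α(z) e^α(z):`, and covariance of
`e^α(z)` becomes `em_derivative`. -/
theorem transTerm_em (k : ℕ) (α : Lat N) (n : ℤ) :
    transTerm N k * em α n - em α n * transTerm N k =
      lm α (-(k : ℤ) - 1) * em α (n + k) + em α (n - 1 - k) * lm α k := by
  have e1 := mul_comm_sub (R := Module.End ℂ (VL N))
  have e2 : ∀ u v x : Module.End ℂ (VL N), u * x = x * u → v * x = x * v →
      u * v * x - x * (u * v) = 0 := by
    intro u v x h1 h2
    rw [← mul_assoc, ← h1, mul_assoc, mul_assoc, h2, sub_self]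
  rw [transTerm, Finset.sum_mul, Finset.mul_sum, ← Finset.sum_sub_distrib, lm, lm, Finset.sum_mul,
    Finset.mul_sum, ← Finset.sum_add_distrib]
  refine Finset.sum_congr rfl fun j _ => ?_
  have b1 := e2 (fm false j (-(k : ℤ) - 2)) (fm true j k) (em α n) (fm_em _ _ _ _ _)
    (fm_em _ _ _ _ _)
  have b2 := e2 (fm true j (-(k : ℤ) - 2)) (fm false j k) (em α n) (fm_em _ _ _ _ _)
    (fm_em _ _ _ _ _)
  have f1 := e1 (bm false j (-(k : ℤ) - 1)) (bm true j k) (em α n)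
  have f2 := e1 (bm true j (-(k : ℤ) - 1)) (bm false j k) (em α n)
  rw [bm_em, bm_em] at f1 f2
  rw [sub_eq_zero] at b1 b2
  rw [sub_eq_iff_eq_add] at f1 f2
  rw [add_mul, mul_add, smul_mul_assoc, mul_smul_comm, add_mul (fm false j _ * _),
    mul_add _ (fm false j _ * _), b1, b2, add_sub_add_right_eq_sub, add_mul, mul_add, f1, f2,
    show n + (-(k : ℤ) - 1) = n - 1 - k by ring]
  simp only [pairGen, if_true, Bool.false_eq_true, if_false, add_mul, mul_add, smul_mul_assoc,
    mul_smul_comm]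
  abel

/-- The generating fields are translation covariant. -/
theorem Gen.cov (g : Gen N) : Cov (transOp N) g.mode := by
  refine cov_of_eventually fun n v => ?_
  cases g with
  | ferm b i =>
    simp only [mode_ferm, transTerm_fm]
    filter_upwards [Filter.eventually_gt_atTop n.natAbs] with J hJ
    rw [← LinearMap.sum_apply]
    rcases lt_trichotomy n 0 with h | rfl | h
    · obtain ⟨m, rfl⟩ := Int.eq_negSucc_of_lt_zero h
      rw [Finset.sum_eq_single m]
      · rw [if_pos (by omega), if_neg (by omega), sub_zero, LinearMap.smul_apply]
        congr 2
        · push_cast [Int.negSucc_eq]; ring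
        · rw [Int.negSucc_eq]; ring_nf
      · intro k _ hk
        rw [if_neg (by omega), if_neg (by omega), sub_zero, smul_zero]
      · intro hm
        rw [Finset.mem_range] at hm
        omega
    · rw [Finset.sum_eq_zero]
      · simp
      · intro k _
        rw [if_neg (by omega), if_neg (by omega), sub_zero, smul_zero]
    · obtain ⟨m, rfl⟩ : ∃ m : ℕ, n = m + 1 := ⟨(n - 1).toNat, by omega⟩
      rw [Finset.sum_eq_single m]
      · rw [if_neg (by omega), if_pos rfl, zero_sub, LinearMap.smul_apply, LinearMap.neg_apply,
          smul_neg, neg_smul, add_sub_cancel_right]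
        push_cast
        rfl
      · intro k _ hk
        rw [if_neg (by omega), if_neg (by omega), sub_zero, smul_zero]
      · intro hm
        rw [Finset.mem_range] at hm
        omega
  | bos b i =>
    simp only [mode_bos, transTerm_bm]
    filter_upwards [Filter.eventually_gt_atTop n.natAbs] with J hJ
    rw [← LinearMap.sum_apply]
    rcases le_or_gt n 0 with h | h
    · obtain ⟨m, rfl⟩ : ∃ m : ℕ, n = -m := ⟨(-n).toNat, by omega⟩
      rw [Finset.sum_eq_single m]
      · rw [if_pos rfl, if_neg (by omega), add_zero, LinearMap.smul_apply]
        push_cast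
        rw [neg_neg]
      · intro k _ hk
        rw [if_neg (by omega), if_neg (by omega), add_zero]
      · intro hm
        rw [Finset.mem_range] at hm
        omega
    · obtain ⟨m, rfl⟩ : ∃ m : ℕ, n = m + 1 := ⟨(n - 1).toNat, by omega⟩
      rw [Finset.sum_eq_single m]
      · rw [if_neg (by omega), if_pos rfl, zero_add, LinearMap.smul_apply, add_sub_cancel_right]
        congr 1
        push_cast
        ring
      · intro k _ hk
        rw [if_neg (by omega), if_neg (by omega), add_zero]
      · intro hm
        rw [Finset.mem_range] at hm
        omega
  | exp α =>
    simp only [mode_exp, transTerm_em]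
    filter_upwards [em_derivative α n v] with J hJ
    exact hJ.symm

end Translation

/-! ### The fields of the monomial states -/

section States

variable {N : ℕ}

/-- The vertex operator `a(z)`, of parity `p`, has the properties of the field of the state `u`:
homogeneity, locality, translation covariance and the creation property. -/
structure IsFieldOf (p : Bool) (a : VertexOperator ℂ (VL N)) (u : VL N) : Prop where
  parity : HasParity p (VertexOperator.ncoeff a)
  loc : ∀ p' b, GenLocal p' b → Loc (signOp N p') b (VertexOperator.ncoeff a)
  cov : Cov (transOp N) (VertexOperator.ncoeff a)
  vac : ∀ n ≥ 0, VertexOperator.ncoeff a n (expState 0) = 0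
  create : VertexOperator.ncoeff a (-1) (expState 0) = u

theorem IsFieldOf.genLocal {p : Bool} {a : VertexOperator ℂ (VL N)} {u : VL N}
    (h : IsFieldOf p a u) : GenLocal p (VertexOperator.ncoeff a) :=
  ⟨h.parity, fun g => h.loc _ _ g.genLocal⟩

theorem cocycle_zero_right (α : Lat N) : cocycle α 0 = 1 := by simp [cocycle]

theorem pairing_zero_right (α : Lat N) : pairing α 0 = 0 := by simp [pairing]

theorem em_vac (α : Lat N) (n : ℤ) : em α n (expState 0) =
    Finsupp.single α (pureFock 1 (creationExp α (-n - 1) 1)) := by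
  rw [expState, em_single, cocycle_zero_right, pairing_zero_right, sub_zero, one_smul, add_zero,
    gammaCoeff_one]

theorem isFieldOf_expField (α : Lat N) : IsFieldOf false (expField α) (expState α) where
  parity := (Gen.exp α).hasParity
  loc p' b hb := by
    have h := Loc.swap (p' := p') (Gen.exp α).hasParity hb.parity (hb.loc (Gen.exp α))
    exact h
  cov := (Gen.exp α).cov
  vac n hn := by
    change em α n _ = 0
    rw [em_vac, creationExp_of_neg α (by omega), LinearMap.zero_apply, pureFock_zero_right,
      Finsupp.single_zero]
  create := by
    change em α (-1) _ = _
    rw [em_vac, expState, neg_neg, sub_self, creationExp_zero, Module.End.one_apply]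

theorem transOp_parity : transOp N * parity N = parity N * transOp N := by
  -- Each term of `T` has an even number of fermionic modes.
  have h : ∀ k, transTerm N k * parity N = parity N * transTerm N k := by
    intro k
    have hf : ∀ b i n, fm b i n * parity N = -(parity N * fm b i n) := by
      intro b i n
      have := congrArg (parity N * ·) (parity_fm b i n)
      simp only [← mul_assoc, parity_mul_self, one_mul] at this
      have h2 := LinearMap.congr_fun this
      refine LinearMap.ext fun v => ?_
      rw [h2]
      simp only [Module.End.mul_apply, LinearMap.neg_apply, map_neg]
    have hbm : ∀ b i n, bm b i n * parity N = parity N * bm b i n := fun b i n =>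
      (onFerm_bm _ b i n).symm
    rw [transTerm, Finset.sum_mul, Finset.mul_sum]
    refine Finset.sum_congr rfl fun i _ => LinearMap.ext fun v => ?_
    have hf' := fun b i n v => LinearMap.congr_fun (hf b i n) v
    have hb' := fun b i n v => LinearMap.congr_fun (hbm b i n) v
    simp only [Module.End.mul_apply, LinearMap.neg_apply] at hf' hb'
    simp only [Module.End.mul_apply, LinearMap.add_apply, LinearMap.smul_apply, hb', hf',
      map_neg, map_add, map_smul, neg_neg]
  refine LinearMap.ext fun v => ?_
  obtain ⟨J, h1, h2⟩ := ((locSum_eventually _ transTerm_trunc (parity N v)).and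
    (locSum_eventually _ transTerm_trunc v)).exists
  rw [Module.End.mul_apply, Module.End.mul_apply, transOp, h1, h2, map_sum]
  exact Finset.sum_congr rfl fun k _ => LinearMap.congr_fun (h k) v

/-- The inductive step in the construction of fields of states: if `b(z)` is the field of `u`, the
normally ordered product of a divided derivative `∂^k g(z) / k!` with `b(z)` is the field of
`g_(-k-1) u`. -/
theorem isFieldOf_normalOrder (g : Gen N) (hg : ∀ n ≥ 0, g.mode n (expState 0) = 0) (k : ℕ)
    {p : Bool} {b : VertexOperator ℂ (VL N)} {u : VL N} (hb : IsFieldOf p b u) :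
    IsFieldOf (xor g.odd p) (normalOrder (signOp N g.odd) (divDeriv k g.field) b)
      (g.mode (-(k : ℤ) - 1) u) where
  parity := (g.hasParity.divDeriv k).normalOrder hb.parity
  loc p' c hc := by
    have hd : VertexOperator.ncoeff (divDeriv k g.field) =
        fun m => Ring.choose ((k : ℤ) - m - 1) k • g.mode (m - k) := by
      funext m; rw [ncoeff_divDeriv]; rfl
    have h1 : ∀ {q : Bool} {c : ℤ → Module.End ℂ (VL N)}, Loc (signOp N g.odd) g.mode c →
        Loc (signOp N g.odd) (VertexOperator.ncoeff (divDeriv k g.field)) c := by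
      intro q c h
      rw [hd]
      exact h.divDeriv k
    exact Loc.normalOrder (signOp_mul_self _) (signOp_mul_self _) (signOp_comm _ _)
      (exchangeSign_mul_self g.odd p') (hc.parity.conj g.odd)
      (h1 (q := p) (hb.loc _ _ g.genLocal))
      ((h1 (q := p') (hc.loc g)).swap (g.hasParity.divDeriv k) hc.parity) (hb.loc _ _ hc)
  cov := by
    refine Cov.normalOrder ?_ (g.cov.divDeriv k) hb.cov
    cases g with
    | ferm b i =>
      exact transOp_parity
    | bos b i => exact (mul_one _).trans (one_mul _).symm
    | exp α => exact (mul_one _).trans (one_mul _).symm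
  vac n hn := by
    have hz : ∀ j : ℕ, VertexOperator.ncoeff (divDeriv k g.field) j (expState 0) = 0 := by
      intro j
      rw [ncoeff_divDeriv, LinearMap.smul_apply]
      by_cases hj : k ≤ j
      · rw [show VertexOperator.ncoeff g.field = g.mode from rfl, hg _ (by omega), smul_zero]
      · rw [show (k : ℤ) - j - 1 = ((k - j - 1 : ℕ) : ℤ) by omega, Ring.choose_natCast,
          Nat.choose_eq_zero_of_lt (by omega), Nat.cast_zero, zero_smul]
    obtain ⟨J, h⟩ := (normalOrder_eventually (signOp N g.odd) (divDeriv k g.field) b n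
      (expState 0)).exists
    rw [h]
    refine Finset.sum_eq_zero fun j _ => ?_
    rw [hz, hb.vac _ (by omega)]
    simp
  create := by
    have hz : ∀ j : ℕ, VertexOperator.ncoeff (divDeriv k g.field) j (expState 0) = 0 := by
      intro j
      rw [ncoeff_divDeriv, LinearMap.smul_apply]
      by_cases hj : k ≤ j
      · rw [show VertexOperator.ncoeff g.field = g.mode from rfl, hg _ (by omega), smul_zero]
      · rw [show (k : ℤ) - j - 1 = ((k - j - 1 : ℕ) : ℤ) by omega, Ring.choose_natCast,
          Nat.choose_eq_zero_of_lt (by omega), Nat.cast_zero, zero_smul]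
    obtain ⟨J, h, hJ⟩ := ((normalOrder_eventually (signOp N g.odd) (divDeriv k g.field) b (-1)
      (expState 0)).and (Filter.eventually_gt_atTop 0)).exists
    rw [h, Finset.sum_eq_single 0]
    · rw [hz, Nat.cast_zero, neg_zero, zero_sub, add_zero, hb.create, map_zero, map_zero, map_zero,
        add_zero, ncoeff_divDeriv, show (k : ℤ) - -1 - 1 = (k : ℕ) by ring, Ring.choose_natCast,
        Nat.choose_self, Nat.cast_one, one_smul]
      rw [show VertexOperator.ncoeff g.field = g.mode from rfl]
      congr 2; ring
    · intro j _ hj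
      rw [hz, hb.vac _ (by omega)]
      simp
    · intro h0
      simp at h0
      omega

theorem fm_vac (b : Bool) (i : Fin N) {n : ℤ} (hn : n ≥ 0) (α : Lat N) :
    fm b i n (expState α) = 0 := by
  obtain ⟨k, rfl⟩ := Int.eq_ofNat_of_zero_le hn
  rw [expState, fm, onFerm_single]
  have : fermMode b i (k : ℤ) (1 : Ferm N) = 0 :=
    CliffordAlgebra.contractLeft_one (Q := (0 : QuadraticForm ℂ (Osc N →₀ ℂ)))
      (Finsupp.lapply (osc (!b) i k))
  rw [this, pureFock_zero_left, Finsupp.single_zero]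

theorem bosMode_one (b : Bool) (i : Fin N) (k : ℕ) : bosMode b i k (1 : Bos N) = 0 := by
  cases k with
  | zero => rfl
  | succ k =>
    change ((k : ℂ) + 1) • MvPolynomial.pderiv (osc (!b) i k) (1 : Bos N) = 0
    rw [MvPolynomial.pderiv_one, smul_zero]

theorem bm_vac (b : Bool) (i : Fin N) {n : ℤ} (hn : n > 0) (α : Lat N) :
    bm b i n (expState α) = 0 := by
  obtain ⟨k, rfl⟩ := Int.eq_ofNat_of_zero_le hn.le
  rw [expState, bm_single_of_ne b i (by omega), bosMode_one b i k, pureFock_zero_right,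
    Finsupp.single_zero]

theorem bm_vac_zero (b : Bool) (i : Fin N) {n : ℤ} (hn : n ≥ 0) :
    bm b i n (expState 0) = 0 := by
  rcases hn.lt_or_eq with h | h
  · exact bm_vac b i h 0
  · rw [← h, expState, bm_zero_single]
    simp [pairGen]

theorem fm_creation (b : Bool) (i : Fin N) (k : ℕ) (α : Lat N) (x : Ferm N) (y : Bos N) :
    fm b i (-(k : ℤ) - 1) (Finsupp.single α (pureFock x y)) = Finsupp.single α
      (pureFock (ExteriorAlgebra.ι ℂ (Finsupp.single (osc b i k) (1 : ℂ)) * x) y) := by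
  rw [show -(k : ℤ) - 1 = Int.negSucc k by rw [Int.negSucc_eq]; ring, fm, onFerm_single]
  rfl

theorem bm_creation (b : Bool) (i : Fin N) (k : ℕ) (α : Lat N) (x : Ferm N) (y : Bos N) :
    bm b i (-(k : ℤ) - 1) (Finsupp.single α (pureFock x y)) = Finsupp.single α
      (pureFock x (MvPolynomial.X (osc b i k) * y)) := by
  rw [bm_single_of_ne b i (by omega), show -(k : ℤ) - 1 = Int.negSucc k by
    rw [Int.negSucc_eq]; ring]
  rfl

/-- The case of monomials without fermions. -/
theorem isFieldOf_bosons (l : List (Osc N)) (α : Lat N) :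
    IsFieldOf false (l.foldr (fun o => normalOrder 1 (bosOscField o)) (expField α))
      (Finsupp.single α (pureFock 1 (l.map MvPolynomial.X).prod)) := by
  induction l with
  | nil => exact isFieldOf_expField α
  | cons o l ih =>
    have := isFieldOf_normalOrder (Gen.bos (ofLex o).1 (ofLex (ofLex o).2).1)
      (fun n hn => by rw [Gen.mode_bos]; exact bm_vac_zero _ _ hn) (ofLex (ofLex o).2).2 ih
    rw [Gen.mode_bos, bm_creation] at this
    exact this

/-- Multiplication by fermionic oscillators. -/
theorem isFieldOf_fermions (l : List (Osc N)) {a : VertexOperator ℂ (VL N)} {α : Lat N} {p : Bool}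
    {x : Ferm N} {y : Bos N} (h : IsFieldOf p a (Finsupp.single α (pureFock x y))) :
    ∃ p', IsFieldOf p' (l.foldr (fun o => normalOrder (ChiralPN.parity N) (fermOscField o)) a)
      (Finsupp.single α (pureFock
        ((l.map fun o => ExteriorAlgebra.ι ℂ (Finsupp.single o (1 : ℂ))).prod * x) y)) := by
  induction l with
  | nil => exact ⟨p, by simpa using h⟩
  | cons o l ih =>
    obtain ⟨p', ih⟩ := ih
    have := isFieldOf_normalOrder (Gen.ferm (ofLex o).1 (ofLex (ofLex o).2).1)
      (fun n hn => by rw [Gen.mode_ferm]; exact fm_vac _ _ hn 0) (ofLex (ofLex o).2).2 ih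
    rw [Gen.mode_ferm, fm_creation] at this
    refine ⟨xor true p', ?_⟩
    rw [List.map_cons, List.prod_cons, mul_assoc]
    exact this

theorem exteriorBasis_apply (s : Finset (Osc N)) :
    (Finsupp.basisSingleOne (R := ℂ) (ι := Osc N)).ExteriorAlgebra s =
      ((s.sort (· ≤ ·)).map fun o => ExteriorAlgebra.ι ℂ (Finsupp.single o (1 : ℂ))).prod := by
  rw [ExteriorAlgebra.basis_apply_ofCard _ rfl, ExteriorAlgebra.ιMulti_family,
    ExteriorAlgebra.ιMulti_apply,
    Set.powersetCard.ofFinEmbEquiv_symm_apply, List.ofFn_eq_map,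
    ← Finset.listMap_orderEmbOfFin_finRange s rfl, List.map_map]
  rfl

theorem fockBasis_apply (s : Finset (Osc N)) (t : Osc N →₀ ℕ) :
    fockBasis N (s, t) = pureFock
      ((s.sort (· ≤ ·)).map fun o => ExteriorAlgebra.ι ℂ (Finsupp.single o (1 : ℂ))).prod
      (MvPolynomial.monomial t 1) := by
  rw [← exteriorBasis_apply, ← show MvPolynomial.basisMonomials (Osc N) ℂ t = _ from
    congr_fun (MvPolynomial.coe_basisMonomials _ _) t]
  exact Module.Basis.tensorProduct_apply _ _ _ _

theorem monomial_eq_prod_sort (t : Osc N →₀ ℕ) :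
    (((Finsupp.toMultiset t).sort (· ≤ ·)).map MvPolynomial.X).prod =
      (MvPolynomial.monomial t 1 : Bos N) := by
  rw [← Multiset.prod_coe, ← Multiset.map_coe, Multiset.sort_eq, MvPolynomial.monomial_eq,
    MvPolynomial.C_1, one_mul]
  induction t using Finsupp.induction_linear with
  | zero => simp
  | add f g hf hg =>
    rw [map_add, Multiset.map_add, Multiset.prod_add, hf, hg, Finsupp.prod_add_index']
    · simp
    · intro a b c; exact pow_add _ _ _
  | single o k =>
    rw [Finsupp.toMultiset_single, Multiset.map_nsmul, Multiset.map_singleton,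
      Multiset.prod_nsmul, Multiset.prod_singleton, Finsupp.prod_single_index]
    exact pow_zero _

/-- Homogeneity, locality, covariance and creation for the fields of the monomial states. -/
theorem isFieldOf_monomialField (α : Lat N) (s : Finset (Osc N)) (t : Osc N →₀ ℕ) :
    ∃ p, IsFieldOf p (monomialField α s t) (Finsupp.single α (fockBasis N (s, t))) := by
  obtain ⟨p, hp⟩ := isFieldOf_fermions (s.sort (· ≤ ·))
    (isFieldOf_bosons ((Finsupp.toMultiset t).sort (· ≤ ·)) α)
  refine ⟨p, ?_⟩
  rwa [mul_one, monomial_eq_prod_sort, ← fockBasis_apply] at hp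

theorem stateField_single (α : Lat N) (s : Finset (Osc N)) (t : Osc N →₀ ℕ) :
    stateField N (Finsupp.single α (fockBasis N (s, t))) = monomialField α s t := by
  rw [stateField, Finsupp.lsum_single]
  exact (fockBasis N).constr_basis ℂ _ (s, t)

end States

/-! ### Uniqueness of fields and the derivation property -/

section Derivation

variable {N : ℕ}

variable (N) in
/-- The modes of the field of a state of `V_L`. -/
def stateMode : VL N →ₗ[ℂ] ℤ → Module.End ℂ (VL N) := VertexOperator.ncoeff ∘ₗ stateField N

theorem fock_basis_induction {p : Submodule ℂ (Fock N)} (h : ∀ s t, fockBasis N (s, t) ∈ p)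
    (u : Fock N) : u ∈ p := by
  have : Submodule.span ℂ (Set.range (fockBasis N)) ≤ p := by
    rw [Submodule.span_le]
    rintro _ ⟨⟨s, t⟩, rfl⟩
    exact h s t
  exact this (by rw [(fockBasis N).span_eq]; trivial)

theorem VL_basis_induction {p : Submodule ℂ (VL N)}
    (h : ∀ α s t, Finsupp.single α (fockBasis N (s, t)) ∈ p) (v : VL N) : v ∈ p := by
  induction v using Finsupp.induction_linear with
  | zero => exact p.zero_mem
  | add v w hv hw => exact p.add_mem hv hw
  | single α u => exact fock_basis_induction (p := p.comap (Finsupp.lsingle α)) (h α) u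

theorem VL_basis_hom_ext {M : Type*} [AddCommGroup M] [Module ℂ M] {f g : VL N →ₗ[ℂ] M}
    (h : ∀ α s t, f (Finsupp.single α (fockBasis N (s, t))) =
      g (Finsupp.single α (fockBasis N (s, t)))) : f = g :=
  LinearMap.ext fun v => VL_basis_induction (p := LinearMap.eqLocus f g) h v

theorem exists_isFieldOf (α : Lat N) (s : Finset (Osc N)) (t : Osc N →₀ ℕ) :
    ∃ p, IsFieldOf p (stateField N (Finsupp.single α (fockBasis N (s, t))))
      (Finsupp.single α (fockBasis N (s, t))) := by
  rw [stateField_single]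
  exact isFieldOf_monomialField α s t

/-- The field of any state, homogeneous or not, is local to the generating fields. -/
theorem loc_stateMode (g : Gen N) (v : VL N) : Loc (signOp N g.odd) g.mode (stateMode N v) := by
  refine VL_basis_induction (p :=
    { carrier := {v | Loc (signOp N g.odd) g.mode (stateMode N v)}
      zero_mem' := by rw [Set.mem_ofPred, map_zero]; exact Loc.zero _ _
      add_mem' := fun ha hb => by rw [Set.mem_ofPred, map_add]; exact Loc.add ha hb
      smul_mem' := fun c x hx => by rw [Set.mem_ofPred, map_smul]; exact Loc.smul c hx })
    (fun α s t => ?_) v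
  obtain ⟨p, hp⟩ := exists_isFieldOf α s t
  exact hp.loc _ _ g.genLocal

theorem cov_stateMode (v : VL N) : Cov (transOp N) (stateMode N v) := by
  refine VL_basis_induction (p :=
    { carrier := {v | Cov (transOp N) (stateMode N v)}
      zero_mem' := by
        refine cov_of_apply fun n w => ?_
        simp
      add_mem' := fun ha hb => by
        refine cov_of_apply fun n w => ?_
        have h1 := Cov.apply ha n w
        have h2 := Cov.apply hb n w
        simp only [map_add, Pi.add_apply, LinearMap.add_apply, h1, h2, smul_add]
        abel
      smul_mem' := fun c x hx => by
        refine cov_of_apply fun n w => ?_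
        have h1 := Cov.apply hx n w
        simp only [map_smul, Pi.smul_apply, LinearMap.smul_apply, h1, smul_add]
        rw [smul_comm c] })
    (fun α s t => ?_) v
  obtain ⟨p, hp⟩ := exists_isFieldOf α s t
  exact hp.cov

/-- Fields applied to the vacuum have no singular part. -/
theorem stateMode_vac (v : VL N) {n : ℤ} (hn : n ≥ 0) : stateMode N v n (expState 0) = 0 := by
  have : LinearMap.applyₗ (expState 0) ∘ₗ LinearMap.proj n ∘ₗ stateMode N = 0 :=
    VL_basis_hom_ext fun α s t => by
      obtain ⟨p, hp⟩ := exists_isFieldOf α s t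
      exact hp.vac n hn
  exact LinearMap.congr_fun this v

theorem stateMode_neg_one_vac (v : VL N) : stateMode N v (-1) (expState 0) = v := by
  have : LinearMap.applyₗ (expState 0) ∘ₗ LinearMap.proj (-1) ∘ₗ stateMode N = LinearMap.id :=
    VL_basis_hom_ext fun α s t => by
      obtain ⟨p, hp⟩ := exists_isFieldOf α s t
      exact hp.create
  exact LinearMap.congr_fun this v

theorem transOp_vac : transOp N (expState 0) = 0 := by
  obtain ⟨J, h⟩ := (locSum_eventually _ transTerm_trunc (expState (0 : Lat N))).exists
  rw [transOp, h]
  refine Finset.sum_eq_zero fun k _ => ?_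
  rw [transTerm, LinearMap.sum_apply]
  refine Finset.sum_eq_zero fun i _ => ?_
  simp only [LinearMap.add_apply, LinearMap.smul_apply, Module.End.mul_apply]
  rw [bm_vac_zero _ _ (by omega), bm_vac_zero _ _ (by omega), fm_vac _ _ (by omega),
    fm_vac _ _ (by omega)]
  simp

theorem parity_expState (β : Lat N) : parity N (expState β) = expState β := by
  rw [expState, parity_eq, onFerm_single]
  congr 2
  exact map_one (CliffordAlgebra.involute (Q := (0 : QuadraticForm ℂ (Osc N →₀ ℂ))))

/-- Goddard's uniqueness theorem: a translation covariant field local to all generating fields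
vanishes if it creates `0` from the vacuum. -/
theorem eq_zero_of_local {X : ℤ → Module.End ℂ (VL N)}
    (hl : ∀ g : Gen N, Loc (signOp N g.odd) g.mode X) (hc : Cov (transOp N) X)
    (hv : ∀ n ≥ -1, X n (expState 0) = 0) (n : ℤ) : X n = 0 := by
  -- Covariance and `T 1 = 0` determine `X(z) 1` by its constant term.
  have h0 : ∀ n, X n (expState 0) = 0 := by
    have h1 : ∀ k : ℕ, X (-(k : ℤ) - 1) (expState 0) = 0 := by
      intro k
      induction k with
      | zero => exact hv _ (by simp)
      | succ k ih =>
        have := hc.apply (-(k : ℤ) - 1) (expState 0)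
        rw [ih, transOp_vac, map_zero, map_zero, zero_add] at this
        have hne : (-((-(k : ℤ) - 1 : ℤ) : ℂ)) ≠ 0 := by
          push_cast
          rw [neg_sub, sub_neg_eq_add, add_comm]
          exact Nat.cast_add_one_ne_zero k
        have h2 := (smul_eq_zero.mp this.symm).resolve_left hne
        rw [← h2]
        congr 2; push_cast; ring
    intro n
    rcases le_or_gt (-1) n with h | h
    · exact hv n h
    · rw [show n = -((-n - 1).toNat : ℤ) - 1 by omega]
      exact h1 _
  -- The condition on `parity N v` is needed for the sign rule with the odd generators.
  let p : Submodule ℂ (VL N) :=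
    (⨅ m, LinearMap.ker (X m)) ⊓ (⨅ m, LinearMap.ker (X m)).comap (parity N)
  have hp : ∀ v, v ∈ p ↔ (∀ m, X m v = 0) ∧ ∀ m, X m (parity N v) = 0 := by
    intro v; simp [p, Submodule.mem_iInf]
  have hg : ∀ (g : Gen N) v, v ∈ p → ∀ k, g.mode k v ∈ p := by
    intro g v hv' k
    rw [hp] at hv' ⊢
    obtain ⟨hv1, hv2⟩ := hv'
    have ht : Trunc g.mode := ncoeff_trunc _
    have hpp := LinearMap.congr_fun (parity_mul_self (N := N))
    have hpar : parity N (g.mode k v) = exchangeSign true g.odd • g.mode k (parity N v) := by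
      have h1 := LinearMap.congr_fun (g.hasParity k) (parity N v)
      have h2 := hpp v
      simp only [Module.End.mul_apply, Module.End.one_apply, LinearMap.smul_apply] at h1 h2
      rwa [h2] at h1
    have hX : ∀ w, (∀ m, X m w = 0) → (∀ m, X m (parity N w) = 0) → ∀ m, X m (g.mode k w) = 0 := by
      intro w hw1 hw2 m
      cases hgo : g.odd with
      | false =>
        have := Loc.apply_eq_zero (signOp_mul_self g.odd) ht (hl g) hw1 k m
        rwa [hgo] at this
      | true =>
        have h3 := Loc.apply_eq_zero (signOp_mul_self g.odd) ht (hl g) hw2 k m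
        rw [hgo, signOp_true] at h3
        have h4 := LinearMap.congr_fun (g.hasParity k) w
        simp only [Module.End.mul_apply, LinearMap.smul_apply] at h4
        rw [h4, map_smul, hgo] at h3
        simpa [exchangeSign] using h3
    refine ⟨hX v hv1 hv2, fun m => ?_⟩
    rw [hpar, map_smul, hX _ hv2 (fun m => ?_), smul_zero]
    have := hpp v
    rw [Module.End.mul_apply, Module.End.one_apply] at this
    rw [this]; exact hv1 m
  have hvac : expState 0 ∈ p := (hp _).mpr ⟨h0, fun m => by rw [parity_expState]; exact h0 m⟩
  refine LinearMap.ext fun v => ((hp v).mp (VL_generated p (fun β => ?_) (fun b i k v hv => ?_)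
    (fun b i k v hv => ?_) v)).1 n
  · have := hg (Gen.exp β) _ hvac (-1)
    rwa [show (Gen.exp β).mode (-1) (expState 0) = expState β from
      (isFieldOf_expField β).create] at this
  · rw [← Gen.mode_ferm]; exact hg _ _ hv _
  · rw [← Gen.mode_bos]; exact hg _ _ hv _

/-- The `0`-th mode of the field of a homogeneous state `w` is a derivation of all products. -/
theorem stateMode_derivation {p : Bool} {w : VL N} (hw : IsFieldOf p (stateField N w) w) (u : VL N)
    (n : ℤ) : stateMode N w 0 * stateMode N u n -
      signOp N p * stateMode N u n * signOp N p * stateMode N w 0 =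
      stateMode N (stateMode N w 0 u) n := by
  suffices h : (LinearMap.mulLeft ℂ (stateMode N w 0) - (LinearMap.mulRight ℂ (stateMode N w 0)) ∘ₗ
      LinearMap.mulRight ℂ (signOp N p) ∘ₗ LinearMap.mulLeft ℂ (signOp N p)) ∘ₗ
      LinearMap.proj n ∘ₗ stateMode N = LinearMap.proj n ∘ₗ stateMode N ∘ₗ stateMode N w 0 from
    LinearMap.congr_fun h u
  refine VL_basis_hom_ext fun α s t => ?_
  set u := Finsupp.single α (fockBasis N (s, t))
  obtain ⟨p', hu⟩ := exists_isFieldOf α s t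
  change superComm (signOp N p) (stateMode N w) (stateMode N u) 0 n = _
  change _ = stateMode N (stateMode N w 0 u) n
  have hT : transOp N * signOp N p = signOp N p * transOp N := by
    cases p
    · exact (mul_one _).trans (one_mul _).symm
    · exact transOp_parity
  have hTw : ∀ v, transOp N (stateMode N w 0 v) = stateMode N w 0 (transOp N v) := fun v => by
    rw [(cov_stateMode w).apply]; simp
  have hTs : ∀ v, transOp N (signOp N p v) = signOp N p (transOp N v) := LinearMap.congr_fun hT
  have hsv : signOp N p (expState 0) = expState 0 := by
    cases p
    · rfl
    · exact parity_expState 0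
  have hw0 := stateMode_vac w le_rfl
  refine sub_eq_zero.mp (eq_zero_of_local (X := fun n => superComm (signOp N p) (stateMode N w)
    (stateMode N u) 0 n - stateMode N (stateMode N w 0 u) n) (fun g => ?_) ?_ (fun m hm => ?_) n)
  · have h1 := Loc.comm_zero (signOp_mul_self p) (signOp_mul_self g.odd) (signOp_comm _ _)
      (exchangeSign_mul_self p g.odd) (g.hasParity.conj p) (hu.loc _ _ hw.genLocal)
      (loc_stateMode g w) (loc_stateMode g u)
    have h2 := h1.add (loc_stateMode g (stateMode N w 0 u)).neg
    refine (congrArg (Loc (signOp N g.odd) g.mode) ?_).mp h2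
    funext m
    exact (sub_eq_add_neg _ _).symm
  · refine cov_of_apply fun m v => ?_
    simp only [superComm, LinearMap.sub_apply, Module.End.mul_apply, map_sub, hTw, hTs,
      (cov_stateMode _).apply, map_add, map_smul]
    simp only [smul_sub]
    abel
  · simp only [superComm, LinearMap.sub_apply, Module.End.mul_apply, hw0, map_zero, sub_zero]
    rcases hm.lt_or_eq with h | h
    · rw [stateMode_vac u (by omega), stateMode_vac _ (by omega), map_zero, sub_zero]
    · rw [← h, stateMode_neg_one_vac, stateMode_neg_one_vac, sub_self]

end Derivation

/-! ### The lattice grading and the deformation by the height -/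

section Deformation

variable {N : ℕ}

/-- The summand of `V_L` attached to `β ∈ L`. -/
def sector (β : Lat N) : Submodule ℂ (VL N) := LinearMap.range (Finsupp.lsingle β)

theorem single_mem_sector (β : Lat N) (u : Fock N) : Finsupp.single β u ∈ sector β := ⟨u, rfl⟩

/-- The operator `f` shifts the grading by the lattice by `α`. -/
def IsShift (α : Lat N) (f : Module.End ℂ (VL N)) : Prop :=
  ∀ β v, v ∈ sector β → f v ∈ sector (α + β)

theorem IsShift.of_pure {α : Lat N} {f : Module.End ℂ (VL N)}
    (h : ∀ β x y, f (Finsupp.single β (pureFock x y)) ∈ sector (α + β)) : IsShift α f := by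
  rintro β _ ⟨u, rfl⟩
  induction u using fock_induction with
  | h0 => rw [map_zero, map_zero]; exact Submodule.zero_mem _
  | hp x y => exact h β x y
  | ha u v hu hv => rw [map_add, map_add]; exact Submodule.add_mem _ hu hv

theorem isShift_fm (b : Bool) (i : Fin N) (n : ℤ) : IsShift 0 (fm b i n) :=
  IsShift.of_pure fun β x y => by
    rw [fm, onFerm_single, zero_add]; exact single_mem_sector _ _

theorem isShift_bm (b : Bool) (i : Fin N) (n : ℤ) : IsShift 0 (bm b i n) :=
  IsShift.of_pure fun β x y => by
    rw [zero_add]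
    by_cases hn : n = 0
    · subst hn
      rw [bm_zero_single]
      exact Submodule.smul_mem _ _ (single_mem_sector _ _)
    · rw [bm_single_of_ne _ _ hn]; exact single_mem_sector _ _

theorem isShift_em (α : Lat N) (n : ℤ) : IsShift α (em α n) :=
  IsShift.of_pure fun β x y => by
    rw [em_single]
    exact Submodule.smul_mem _ _ (single_mem_sector _ _)

theorem isShift_signOp (p : Bool) : IsShift 0 (signOp N p) :=
  IsShift.of_pure fun β x y => by
    rw [zero_add]
    cases p
    · exact single_mem_sector _ _
    · rw [signOp_true, parity_eq, onFerm_single]; exact single_mem_sector _ _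

theorem Gen.isShift {g : Gen N} (hg : ∀ α, g ≠ Gen.exp α) (n : ℤ) : IsShift 0 (g.mode n) := by
  cases g with
  | ferm b i => rw [mode_ferm]; exact isShift_fm b i n
  | bos b i => rw [mode_bos]; exact isShift_bm b i n
  | exp α => exact absurd rfl (hg α)

theorem isShift_normalOrder {α : Lat N} {g : Gen N} (hg : ∀ α, g ≠ Gen.exp α) (k : ℕ)
    {b : VertexOperator ℂ (VL N)} (hb : ∀ n, IsShift α (VertexOperator.ncoeff b n)) (n : ℤ) :
    IsShift α (VertexOperator.ncoeff
      (normalOrder (signOp N g.odd) (divDeriv k g.field) b) n) := by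
  have ha : ∀ n, IsShift 0 (VertexOperator.ncoeff (divDeriv k g.field) n) := fun n β v hv => by
    rw [ncoeff_divDeriv, LinearMap.smul_apply, ← Int.cast_smul_eq_zsmul ℂ]
    exact Submodule.smul_mem _ _ (Gen.isShift hg _ β v hv)
  intro β v hv
  obtain ⟨J, h⟩ := (normalOrder_eventually (signOp N g.odd) (divDeriv k g.field) b n v).exists
  rw [h]
  refine Submodule.sum_mem _ fun j _ => Submodule.add_mem _ ?_ ?_
  · have := ha (-(j : ℤ) - 1) _ _ (hb (n + j) _ _ hv)
    rwa [zero_add] at this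
  · have := isShift_signOp g.odd _ _ (hb (n - 1 - j) _ _ (isShift_signOp g.odd _ _
      (ha j _ _ hv)))
    simpa only [zero_add] using this

/-- The field of a state in the summand of `α` shifts the lattice grading by `α`. -/
theorem isShift_stateMode (α : Lat N) (u : Fock N) (n : ℤ) :
    IsShift α (stateMode N (Finsupp.single α u) n) := by
  intro β v hv
  refine fock_basis_induction (p := (sector (α + β)).comap
    (LinearMap.applyₗ v ∘ₗ LinearMap.proj n ∘ₗ stateMode N ∘ₗ Finsupp.lsingle α))
    (fun s t => ?_) u
  change VertexOperator.ncoeff (stateField N (Finsupp.single α (fockBasis N (s, t)))) n v ∈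
    sector (α + β)
  rw [stateField_single]
  have h1 : ∀ (l : List (Osc N)) n, IsShift α (VertexOperator.ncoeff
      (l.foldr (fun o => normalOrder 1 (bosOscField o)) (expField α)) n) := by
    intro l
    induction l with
    | nil => exact isShift_em α
    | cons o l ih =>
      exact fun n => isShift_normalOrder (g := Gen.bos (ofLex o).1 (ofLex (ofLex o).2).1)
        (fun _ => by simp) (ofLex (ofLex o).2).2 ih n
  have h2 : ∀ (l l' : List (Osc N)) n, IsShift α (VertexOperator.ncoeff
      (l.foldr (fun o => normalOrder (parity N) (fermOscField o))
        (l'.foldr (fun o => normalOrder 1 (bosOscField o)) (expField α))) n) := by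
    intro l l'
    induction l with
    | nil => exact h1 l'
    | cons o l ih =>
      exact fun n => isShift_normalOrder (g := Gen.ferm (ofLex o).1 (ofLex (ofLex o).2).1)
        (fun _ => by simp) (ofLex (ofLex o).2).2 ih n
  exact h2 _ _ n _ _ hv

/-- The coefficient of `ξ_{N+1}` in the expression defining the height. -/
def htTail (n : Fin N → ℤ) : ℕ := Finset.univ.sup fun j => (-n j).toNat

theorem neg_le_htTail (n : Fin N → ℤ) (i : Fin N) : -n i ≤ htTail n := by
  have : (-n i).toNat ≤ htTail n :=
    Finset.le_sup (f := fun j => (-n j).toNat) (Finset.mem_univ i)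
  omega

theorem ht_eq (n : Fin N → ℤ) : ht n = ∑ i, (n i + htTail n).toNat + htTail n := rfl

/-- The height is linear up to a multiple of `N + 1`, because `∑ ξ_i = 0` is a sum of `N + 1`
vectors. -/
theorem ht_cast (n : Fin N → ℤ) : (ht n : ℤ) = ∑ i, n i + (N + 1) * htTail n := by
  have h : ∀ i, (((n i + htTail n).toNat : ℕ) : ℤ) = n i + htTail n := fun i =>
    Int.toNat_of_nonneg (by have := neg_le_htTail n i; omega)
  rw [ht_eq, Nat.cast_add, Nat.cast_sum, Finset.sum_congr rfl fun i _ => h i,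
    Finset.sum_add_distrib, Finset.sum_const, Finset.card_univ, Fintype.card_fin, nsmul_eq_mul]
  ring

theorem htTail_add (m n : Fin N → ℤ) : htTail (m + n) ≤ htTail m + htTail n := by
  refine Finset.sup_le fun j _ => ?_
  have h1 := neg_le_htTail m j
  have h2 := neg_le_htTail n j
  rw [Pi.add_apply]
  omega

/-- The height is subadditive, so that the exponents of `q` are honest natural numbers and
subtraction in `ℕ` does not truncate. -/
theorem ht_add_le (m n : Fin N → ℤ) : ht (m + n) ≤ ht m + ht n := by
  have h : (htTail (m + n) : ℤ) ≤ htTail m + htTail n := by exact_mod_cast htTail_add m n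
  suffices h' : (ht (m + n) : ℤ) ≤ ht m + ht n by exact_mod_cast h'
  have h2 : ∑ i, (m + n) i = ∑ i, m i + ∑ i, n i := Finset.sum_add_distrib
  rw [ht_cast, ht_cast, ht_cast, h2]
  nlinarith

theorem ht_zero : ht (0 : Fin N → ℤ) = 0 := by
  have : htTail (0 : Fin N → ℤ) = 0 := by
    rw [htTail]; simp
  rw [ht_eq, this]; simp

theorem deform_single (q : ℂ) (α β : Lat N) (u : Fock N) :
    deform q α (Finsupp.single β u) =
      (q ^ (ht α.1 + ht β.1 - ht (α.1 + β.1))) • Finsupp.single β u := by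
  simp [deform]

theorem deform_sector (q : ℂ) (α β : Lat N) {v : VL N} (hv : v ∈ sector β) :
    deform q α v = (q ^ (ht α.1 + ht β.1 - ht (α.1 + β.1))) • v := by
  obtain ⟨u, rfl⟩ := hv
  exact deform_single q α β u

theorem deform_comm {f : Module.End ℂ (VL N)} (hf : IsShift 0 f) (q : ℂ) (α : Lat N) :
    f * deform q α = deform q α * f := by
  apply Finsupp.lhom_ext
  intro β u
  have h := hf β _ (single_mem_sector β u)
  rw [zero_add] at h
  rw [Module.End.mul_apply, Module.End.mul_apply, deform_single, map_smul, deform_sector q α β h]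

theorem deform_zero (q : ℂ) : deform q (0 : Lat N) = 1 := by
  apply Finsupp.lhom_ext
  intro β u
  rw [deform_single, Prod.fst_zero, ht_zero, zero_add, zero_add, Nat.sub_self, pow_zero, one_smul,
    Module.End.one_apply]

theorem VL_sector_ext {M : Type*} [AddCommGroup M] [Module ℂ M] {f g : VL N →ₗ[ℂ] M}
    (h : ∀ β, ∀ v ∈ sector β, f v = g v) : f = g := by
  apply Finsupp.lhom_ext
  exact fun β u => h β _ (single_mem_sector β u)

/-- The modes of the field of a state of `V_{L,q}`. -/
def qMode (q : ℂ) : VL N →ₗ[ℂ] ℤ → Module.End ℂ (VL N) :=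
  VertexOperator.ncoeff ∘ₗ stateFieldQ N q

theorem qMode_sector (q : ℂ) {α : Lat N} {x : VL N} (hx : x ∈ sector α) (n : ℤ) :
    qMode q x n = stateMode N x n * deform q α := by
  obtain ⟨u, rfl⟩ := hx
  have h : stateFieldQ N q (Finsupp.single α u) =
      stateField N (Finsupp.single α u) ∘ₗ deform q α := by
    rw [stateFieldQ, Finsupp.lsum_single]
    rfl
  change VertexOperator.ncoeff (stateFieldQ N q (Finsupp.single α u)) n = _
  rw [h]
  rfl

theorem stateMode_mem_sector {α β : Lat N} {x v : VL N} (hx : x ∈ sector α) (hv : v ∈ sector β)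
    (n : ℤ) : stateMode N x n v ∈ sector (α + β) := by
  obtain ⟨u, rfl⟩ := hx
  exact isShift_stateMode α u n β v hv

theorem qMode_apply (q : ℂ) {α β : Lat N} {x v : VL N} (hx : x ∈ sector α) (hv : v ∈ sector β)
    (n : ℤ) : qMode q x n v = (q ^ (ht α.1 + ht β.1 - ht (α.1 + β.1))) • stateMode N x n v := by
  rw [qMode_sector q hx, Module.End.mul_apply, deform_sector q α β hv, map_smul]

/-- The operators `D` and `Q_0` are made of `0`-th modes of odd states, which act on `V_{L,q}` by
odd derivations of all products. -/
theorem qMode_derivation (q : ℂ) {α : Lat N} {w : VL N} (hα : w ∈ sector α)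
    (hw : IsFieldOf true (stateField N w) w) (x : VL N) (n : ℤ) :
    qMode q w 0 * qMode q x n - parity N * qMode q x n * parity N * qMode q w 0 =
      qMode q (qMode q w 0 x) n := by
  suffices h : (LinearMap.mulLeft ℂ (qMode q w 0) - (LinearMap.mulRight ℂ (qMode q w 0)) ∘ₗ
      LinearMap.mulRight ℂ (parity N) ∘ₗ LinearMap.mulLeft ℂ (parity N)) ∘ₗ
      LinearMap.proj n ∘ₗ qMode q = LinearMap.proj n ∘ₗ qMode q ∘ₗ qMode q w 0 from
    LinearMap.congr_fun h x
  refine VL_sector_ext fun β x hx => ?_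
  change qMode q w 0 * qMode q x n - parity N * qMode q x n * parity N * qMode q w 0 =
      qMode q (qMode q w 0 x) n
  refine VL_sector_ext fun γ v hv => ?_
  have hder := LinearMap.congr_fun (stateMode_derivation hw x n) v
  have hwx := stateMode_mem_sector hα hx 0
  have hp : ∀ {δ : Lat N} {u : VL N}, u ∈ sector δ → parity N u ∈ sector δ := by
    intro δ u hu
    have := isShift_signOp true δ u hu
    rwa [zero_add] at this
  -- The height inequalities let the truncated exponents of `q` be added and compared.
  have e1 := ht_add_le α.1 (β.1 + γ.1)
  have e2 := ht_add_le β.1 γ.1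
  have e3 := ht_add_le α.1 γ.1
  have e4 := ht_add_le α.1 β.1
  have e5 := ht_add_le β.1 (α.1 + γ.1)
  have e6 := ht_add_le (α.1 + β.1) γ.1
  simp only [LinearMap.sub_apply, Module.End.mul_apply]
  rw [qMode_apply q hα hx, map_smul, Pi.smul_apply, LinearMap.smul_apply, qMode_apply q hwx hv,
    qMode_apply q hx hv, map_smul, qMode_apply q hα (stateMode_mem_sector hx hv n),
    qMode_apply q hα hv, map_smul, map_smul, map_smul,
    qMode_apply q hx (hp (stateMode_mem_sector hα hv 0)), map_smul, smul_smul, smul_smul,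
    smul_smul]
  simp only [← pow_add, Prod.fst_add]
  have hc : β.1 + (α.1 + γ.1) = α.1 + (β.1 + γ.1) := by abel
  rw [hc] at e5 ⊢
  rw [add_assoc] at e6 ⊢
  rw [show ht β.1 + ht γ.1 - ht (β.1 + γ.1) + (ht α.1 + ht (β.1 + γ.1) -
      ht (α.1 + (β.1 + γ.1))) = ht α.1 + ht β.1 - ht (α.1 + β.1) +
      (ht (α.1 + β.1) + ht γ.1 - ht (α.1 + (β.1 + γ.1))) by omega,
    show ht α.1 + ht γ.1 - ht (α.1 + γ.1) + (ht β.1 + ht (α.1 + γ.1) -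
      ht (α.1 + (β.1 + γ.1))) = ht α.1 + ht β.1 - ht (α.1 + β.1) +
      (ht (α.1 + β.1) + ht γ.1 - ht (α.1 + (β.1 + γ.1))) by omega, ← smul_sub]
  congr 1

end Deformation

/-! ### Operators given by infinite sums of modes -/

section Expansions

variable {N : ℕ}

/-- The operator `X` is the sum over `i` and over all `k ∈ ℤ` of the operators `a i k`, summed
symmetrically and pointwise finitely. -/
def Expands (X : Module.End ℂ (VL N)) (a : Fin N → ℤ → Module.End ℂ (VL N)) : Prop :=
  ∀ v, ∀ᶠ J : ℕ in Filter.atTop, X v = ∑ i, ∑ k ∈ Finset.Ico (-(J : ℤ)) J, a i k v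

theorem sum_Ico_symm {M : Type*} [AddCommMonoid M] (f : ℤ → M) (J : ℕ) :
    ∑ k ∈ Finset.Ico (-(J : ℤ)) J, f k = ∑ j ∈ Finset.range J, (f (-(j : ℤ) - 1) + f j) := by
  induction J with
  | zero => simp
  | succ J ih =>
    rw [Finset.sum_range_succ, ← ih]
    have h : Finset.Ico (-((J + 1 : ℕ) : ℤ)) (J + 1 : ℕ) =
        insert (-(J : ℤ) - 1) (insert (J : ℤ) (Finset.Ico (-(J : ℤ)) J)) := by
      ext x
      simp only [Finset.mem_Ico, Finset.mem_insert]
      omega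
    rw [h, Finset.sum_insert, Finset.sum_insert]
    · rw [← add_assoc, add_comm]
    · simp
    · simp only [Finset.mem_Ico, Finset.mem_insert]
      omega

/-- The (anti)commutator of `X` with `Y`, computed term by term, when a single term contributes. -/
theorem Expands.eq_add {X Y Z : Module.End ℂ (VL N)} {a : Fin N → ℤ → Module.End ℂ (VL N)}
    (h : Expands X a) (s : ℂ) {i₀ : Fin N} {k₀ : ℤ}
    (hY : ∀ i k, a i k * Y = s • (Y * a i k) + if i = i₀ ∧ k = k₀ then Z else 0) :
    X * Y = s • (Y * X) + Z := by
  refine LinearMap.ext fun v => ?_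
  obtain ⟨J, h1, h2, hJ⟩ := ((h v).and ((h (Y v)).and
    (Filter.eventually_gt_atTop k₀.natAbs))).exists
  simp only [Module.End.mul_apply, LinearMap.add_apply, LinearMap.smul_apply]
  have hY' : ∀ i k, a i k (Y v) = s • Y (a i k v) + if i = i₀ ∧ k = k₀ then Z v else 0 := by
    intro i k
    have := LinearMap.congr_fun (hY i k) v
    simp only [Module.End.mul_apply, LinearMap.add_apply, LinearMap.smul_apply] at this
    rw [this]
    split_ifs <;> rfl
  rw [h1, h2, map_sum, Finset.smul_sum]
  simp only [hY', map_sum, Finset.smul_sum, Finset.sum_add_distrib]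
  congr 1
  rw [Finset.sum_eq_single i₀]
  · rw [Finset.sum_eq_single k₀]
    · simp
    · intro k _ hk; rw [if_neg (by tauto)]
    · intro hk
      rw [Finset.mem_Ico] at hk
      omega
  · intro i _ hi
    exact Finset.sum_eq_zero fun k _ => if_neg (by tauto)
  · simp

/-- The (anti)commutator of `X` with `Y`, when no term contributes. -/
theorem Expands.eq_smul {X Y : Module.End ℂ (VL N)} {a : Fin N → ℤ → Module.End ℂ (VL N)}
    (h : Expands X a) (s : ℂ) (hY : ∀ i k, a i k * Y = s • (Y * a i k)) : X * Y = s • (Y * X) := by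
  refine LinearMap.ext fun v => ?_
  obtain ⟨J, h1, h2⟩ := ((h v).and (h (Y v))).exists
  have hY' : ∀ i k, a i k (Y v) = s • Y (a i k v) := fun i k => LinearMap.congr_fun (hY i k) v
  simp only [Module.End.mul_apply, LinearMap.smul_apply]
  rw [h1, h2, map_sum, Finset.smul_sum]
  simp only [hY', map_sum, Finset.smul_sum]

/-- Anticommutators are double sums over the same finite range in both indices. As the range is
symmetric in the two expansions, the summands may be rearranged. -/
theorem Expands.anticomm_apply {X Y : Module.End ℂ (VL N)}
    {a b : Fin N → ℤ → Module.End ℂ (VL N)} (hX : Expands X a) (hY : Expands Y b) (v : VL N) :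
    ∀ᶠ J : ℕ in Filter.atTop, (X * Y + Y * X) v =
      ∑ x ∈ Finset.univ ×ˢ Finset.Ico (-(J : ℤ)) J, ∑ y ∈ Finset.univ ×ˢ Finset.Ico (-(J : ℤ)) J,
        (a x.1 x.2 * b y.1 y.2 + b y.1 y.2 * a x.1 x.2) v := by
  filter_upwards [hX v, hY v, hX (Y v), hY (X v)] with J h1 h2 h3 h4
  rw [← Finset.sum_product'] at h1 h2 h3 h4
  simp only [LinearMap.add_apply, Module.End.mul_apply, Finset.sum_add_distrib]
  rw [h3, h4]
  congr 1
  · refine Finset.sum_congr rfl fun x _ => ?_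
    rw [h2, map_sum]
  · refine (Finset.sum_congr rfl fun y _ => ?_).trans Finset.sum_comm
    rw [h1, map_sum]

/-- An anticommutator vanishes if its terms are antisymmetric in the two pairs of indices. -/
theorem Expands.anticomm_eq_zero {X Y : Module.End ℂ (VL N)}
    {a b : Fin N → ℤ → Module.End ℂ (VL N)} (hX : Expands X a) (hY : Expands Y b)
    (h : ∀ i k j l, (a i k * b j l + b j l * a i k) + (a j l * b i k + b i k * a j l) = 0) :
    X * Y + Y * X = 0 := by
  refine LinearMap.ext fun v => ?_
  obtain ⟨J, hJ⟩ := (hX.anticomm_apply hY v).exists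
  rw [hJ, LinearMap.zero_apply]
  -- Exchanging the names of the indices gives `S = -S`.
  set S := ∑ x ∈ Finset.univ ×ˢ Finset.Ico (-(J : ℤ)) J,
    ∑ y ∈ Finset.univ ×ˢ Finset.Ico (-(J : ℤ)) J,
      (a x.1 x.2 * b y.1 y.2 + b y.1 y.2 * a x.1 x.2) v with hS
  have h2 : S + S = 0 := by
    nth_rw 2 [hS]
    rw [Finset.sum_comm, hS, ← Finset.sum_add_distrib]
    refine Finset.sum_eq_zero fun x _ => ?_
    rw [← Finset.sum_add_distrib]
    refine Finset.sum_eq_zero fun y _ => ?_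
    rw [← LinearMap.add_apply, h, LinearMap.zero_apply]
  rw [← two_smul ℂ] at h2
  exact (smul_eq_zero.mp h2).resolve_left two_ne_zero

theorem Expands.mul_self_eq_zero {X : Module.End ℂ (VL N)}
    {a : Fin N → ℤ → Module.End ℂ (VL N)} (hX : Expands X a)
    (h : ∀ i k j l, a i k * a j l + a j l * a i k = 0) : X * X = 0 := by
  have h2 := hX.anticomm_eq_zero hX fun i k j l => by
    rw [h, h, add_zero]
  rw [← two_smul ℂ] at h2
  exact (smul_eq_zero.mp h2).resolve_left two_ne_zero

theorem Expands.sum {X : Fin N → Module.End ℂ (VL N)} {a : Fin N → ℤ → Module.End ℂ (VL N)}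
    (h : ∀ i v, ∀ᶠ J : ℕ in Filter.atTop, X i v = ∑ k ∈ Finset.Ico (-(J : ℤ)) J, a i k v) :
    Expands (∑ i, X i) a := by
  intro v
  filter_upwards [Filter.eventually_all.mpr fun i => h i v] with J hJ
  rw [LinearMap.sum_apply]
  exact Finset.sum_congr rfl fun i _ => hJ i

/-- The `0`-th mode of `:ψ(z) c(z):` for a fermion `ψ` and an even field `c` that commutes with
it; no reordering is then needed. -/
theorem normalOrder_ferm_zero (b : Bool) (i : Fin N) {c : VertexOperator ℂ (VL N)}
    (hc : HasParity false (VertexOperator.ncoeff c))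
    (hf : ∀ m n, fm b i m * VertexOperator.ncoeff c n = VertexOperator.ncoeff c n * fm b i m)
    (v : VL N) : ∀ᶠ J : ℕ in Filter.atTop, VertexOperator.ncoeff
      (normalOrder (parity N) (divDeriv 0 (fermField b i)) c) 0 v =
      ∑ k ∈ Finset.Ico (-(J : ℤ)) J, fm b i k (VertexOperator.ncoeff c (-1 - k) v) := by
  filter_upwards [normalOrder_eventually (parity N) (divDeriv 0 (fermField b i)) c 0 v] with J hJ
  rw [hJ, sum_Ico_symm]
  refine Finset.sum_congr rfl fun j _ => ?_
  have hd : ∀ m, VertexOperator.ncoeff (divDeriv 0 (fermField b i)) m = fm b i m := fun m => by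
    rw [ncoeff_divDeriv, ncoeff_fermField]; simp
  have hp := LinearMap.congr_fun (hc (0 - 1 - j)) (fm b i j v)
  have he : exchangeSign true false = 1 := rfl
  simp only [Module.End.mul_apply, he, one_smul] at hp
  rw [hd, hd, hp, show -1 - (-(j : ℤ) - 1) = 0 + j by ring, show 0 - 1 - (j : ℤ) = -1 - j by ring]
  congr 1
  exact (LinearMap.congr_fun (hf j (-1 - j)) v).symm

end Expansions

/-! ### Mode expansions of `D`, `Q_0` and `G` -/

section Operators

variable {N : ℕ}

/-- The modes of the field of `e^α` in `V_{L,q}`. -/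
def eQ (q : ℂ) (α : Lat N) (n : ℤ) : Module.End ℂ (VL N) := em α n * deform q α

/-- The modes of the field of `e^{A^i} - e^{-A^1-⋯-A^N}` in `V_{L,q}`. -/
def diffMode (q : ℂ) (i : Fin N) (n : ℤ) : Module.End ℂ (VL N) :=
  eQ q (latA i) n - eQ q (latT N) n

theorem psiState_eq (i : Fin N) (α : Lat N) :
    psiState i α = Finsupp.single α (fockBasis N ({osc true i 0}, 0)) := by
  rw [psiState, fockBasis_apply]
  simp

theorem stateField_psiState (i : Fin N) (α : Lat N) : stateField N (psiState i α) =
    normalOrder (parity N) (divDeriv 0 (fermField true i)) (expField α) := by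
  rw [psiState_eq, stateField_single, monomialField]
  simp [fermOscField, osc]

theorem isFieldOf_psiState (i : Fin N) (α : Lat N) :
    IsFieldOf true (stateField N (psiState i α)) (psiState i α) := by
  have h := isFieldOf_normalOrder (Gen.ferm true i)
    (fun n hn => by rw [Gen.mode_ferm]; exact fm_vac _ _ hn 0) 0 (isFieldOf_expField α)
  rw [Gen.mode_ferm, expState, fm_creation, mul_one] at h
  rw [stateField_psiState]
  exact h

theorem aPhiState_eq (i : Fin N) : aPhiState i =
    Finsupp.single 0 (fockBasis N ({osc false i 0}, Finsupp.single (osc false i 0) 1)) := by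
  rw [aPhiState, fockBasis_apply]
  simp [MvPolynomial.X]

theorem stateField_aPhiState (i : Fin N) : stateField N (aPhiState i) =
    normalOrder (parity N) (divDeriv 0 (fermField false i))
      (normalOrder 1 (divDeriv 0 (bosField false i)) (expField 0)) := by
  rw [aPhiState_eq, stateField_single, monomialField]
  simp [fermOscField, bosOscField, osc]

theorem isFieldOf_bosState (i : Fin N) : IsFieldOf false
    (normalOrder 1 (divDeriv 0 (bosField false i)) (expField 0))
    (Finsupp.single 0 (pureFock 1 (MvPolynomial.X (osc false i 0)))) := by
  have h := isFieldOf_normalOrder (Gen.bos false i)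
    (fun n hn => by rw [Gen.mode_bos]; exact bm_vac_zero _ _ hn) 0 (isFieldOf_expField 0)
  rw [Gen.mode_bos, expState, bm_creation, mul_one] at h
  exact h

theorem isFieldOf_aPhiState (i : Fin N) :
    IsFieldOf true (stateField N (aPhiState i)) (aPhiState i) := by
  have h := isFieldOf_normalOrder (Gen.ferm false i)
    (fun n hn => by rw [Gen.mode_ferm]; exact fm_vac _ _ hn 0) 0 (isFieldOf_bosState i)
  rw [Gen.mode_ferm, fm_creation, mul_one] at h
  rw [stateField_aPhiState]
  exact h

/-- The field of the state `A^i_{-1}` is `A^i(z)`. -/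
theorem ncoeff_bosState (i : Fin N) : VertexOperator.ncoeff
    (normalOrder 1 (divDeriv 0 (bosField false i)) (expField 0)) = bm false i := by
  have h := isFieldOf_bosState i
  funext n
  refine sub_eq_zero.mp (eq_zero_of_local (X := fun n => VertexOperator.ncoeff
    (normalOrder 1 (divDeriv 0 (bosField false i)) (expField 0)) n - bm false i n)
    (fun g => ?_) ?_ (fun m hm => ?_) n)
  · have h2 := (h.loc _ _ g.genLocal).add (g.loc (Gen.bos false i)).neg
    rw [Gen.mode_bos] at h2
    refine (congrArg (Loc (signOp N g.odd) g.mode) ?_).mp h2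
    funext m
    exact (sub_eq_add_neg _ _).symm
  · have h2 := (Gen.bos false i).cov
    rw [Gen.mode_bos] at h2
    refine cov_of_apply fun m v => ?_
    simp only [LinearMap.sub_apply, map_sub, h.cov.apply, h2.apply, smul_sub]
    abel
  · rw [LinearMap.sub_apply]
    rcases hm.lt_or_eq with hm | hm
    · rw [h.vac _ (by omega), bm_vac_zero _ _ (by omega), sub_zero]
    · have h3 := bm_creation false i 0 0 (1 : Ferm N) 1
      rw [mul_one] at h3
      rw [← hm, h.create, expState]
      exact sub_eq_zero.mpr h3.symm

theorem psiState_mem_sector (i : Fin N) (α : Lat N) : psiState i α ∈ sector α :=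
  single_mem_sector _ _

theorem aPhiState_mem_sector (i : Fin N) : aPhiState i ∈ sector 0 := single_mem_sector _ _

theorem D_eq (q : ℂ) : D N q =
    ∑ i, (qMode q (psiState i (latA i)) 0 - qMode q (psiState i (latT N)) 0) := by
  change qMode q _ 0 = _
  rw [map_sum, Finset.sum_apply]
  refine Finset.sum_congr rfl fun i _ => ?_
  rw [map_sub]; rfl

theorem Q0_eq (q : ℂ) : Q0 N q = ∑ i, qMode q (aPhiState i) 0 := by
  change qMode q _ 0 = _
  rw [map_sum, Finset.sum_apply]

/-- `D = ∑_i ∑_k Ψ^i_(k) E^i_(-1-k)`, with `E^i(z)` the deformed field of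
`e^{A^i} - e^{-A^1-⋯-A^N}`. -/
theorem expands_D (q : ℂ) :
    Expands (D N q) fun i k => fm true i k * diffMode q i (-1 - k) := by
  rw [D_eq]
  refine Expands.sum fun i v => ?_
  have h : ∀ α v, ∀ᶠ J : ℕ in Filter.atTop, qMode q (psiState i α) 0 v =
      ∑ k ∈ Finset.Ico (-(J : ℤ)) J, fm true i k (eQ q α (-1 - k) v) := by
    intro α v
    rw [qMode_sector q (psiState_mem_sector i α)]
    have := normalOrder_ferm_zero true i (Gen.exp α).hasParity
      (fun m n => fm_em true i m α n) (deform q α v)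
    filter_upwards [this] with J hJ
    rw [Module.End.mul_apply]
    change VertexOperator.ncoeff (stateField N (psiState i α)) 0 _ = _
    rw [stateField_psiState]
    exact hJ
  filter_upwards [h (latA i) v, h (latT N) v] with J h1 h2
  rw [LinearMap.sub_apply, h1, h2, ← Finset.sum_sub_distrib]
  refine Finset.sum_congr rfl fun k _ => ?_
  rw [Module.End.mul_apply, diffMode, LinearMap.sub_apply, map_sub]

/-- `Q_0 = ∑_i ∑_k Φ^i_(k) A^i_(-1-k)`. The modes are indexed by the coefficients of `z^(-k-1)`, so that
`Φ^i_(k)` is `Φ^i_{k+1}`. -/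
theorem expands_Q0 (q : ℂ) :
    Expands (Q0 N q) fun i k => fm false i k * bm false i (-1 - k) := by
  rw [Q0_eq]
  refine Expands.sum fun i v => ?_
  rw [qMode_sector q (aPhiState_mem_sector i), deform_zero]
  have hc := (isFieldOf_bosState i).parity
  have := normalOrder_ferm_zero false i hc
      (fun m n => by rw [ncoeff_bosState]; exact fm_bm _ _ _ _ _ _) v
  filter_upwards [this] with J hJ
  rw [ncoeff_bosState] at hJ
  rw [Module.End.mul_apply, Module.End.one_apply]
  change VertexOperator.ncoeff (stateField N (aPhiState i)) 0 _ = _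
  rw [stateField_aPhiState]
  exact hJ

/-- The terms of `∑_k Ψ^i_k B^i_{-k}` with `k = -j - 1` and `k = j`. -/
def psiB (i : Fin N) (j : ℕ) : Module.End ℂ (VL N) :=
  fm true i (-(j : ℤ) - 1) * bm true i (-(-(j : ℤ) - 1)) + fm true i j * bm true i (-(j : ℤ))

theorem psiB_trunc (i : Fin N) (v : VL N) : ∃ K, ∀ j ≥ K, psiB i j v = 0 := by
  obtain ⟨K, hK⟩ := fm_trunc true i v
  obtain ⟨K', hK'⟩ := bm_trunc true i v
  refine ⟨(max K K').toNat, fun j hj => ?_⟩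
  rw [psiB, LinearMap.add_apply, fm_bm _ _ _ _ (j : ℤ), Module.End.mul_apply, Module.End.mul_apply,
    hK j (by omega), hK' _ (by omega), map_zero, map_zero, add_zero]

variable (N) in
/-- The mode `∑_i ∑_k Ψ^i_k B^i_{-k}` of the field `∑_i Ψ^i(z) B^i(z)`. -/
def G : Module.End ℂ (VL N) := ∑ i, locSum (psiB i) (psiB_trunc i)

theorem expands_G : Expands (G N) fun i k => fm true i k * bm true i (-k) := by
  refine Expands.sum fun i v => (locSum_eventually (psiB i) (psiB_trunc i) v).mono fun J hJ => ?_
  rw [hJ, sum_Ico_symm]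
  rfl

end Operators

/-! ### Commutation relations of `D`, `Q_0` and `G` -/

section Relations

variable {N : ℕ}

theorem fm_fm (b b' : Bool) (i j : Fin N) (m n : ℤ) :
    fm b i m * fm b' j n = (-1 : ℂ) • (fm b' j n * fm b i m) +
      if b' = !b ∧ i = j ∧ m + n = -1 then 1 else 0 := by
  rw [← fm_anticomm]
  module

theorem bm_bm (b b' : Bool) (i j : Fin N) (m n : ℤ) :
    bm b i m * bm b' j n = bm b' j n * bm b i m +
      if b' = !b ∧ i = j ∧ m + n = 0 then (m : ℂ) • 1 else 0 := by
  rw [← bm_comm]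
  abel

/-- Moving `Y` across a product `a b`, of which `b` commutes and `a` (anti)commutes with `Y` up to
remainders. -/
theorem mul_mul_eq {E : Type*} [Ring E] [Algebra ℂ E] {a b Y c c' : E} {s : ℂ}
    (ha : a * Y = s • (Y * a) + c) (hb : b * Y = Y * b + c') :
    a * b * Y = s • (Y * (a * b)) + (c * b + a * c') := by
  rw [mul_assoc, hb, mul_add, ← mul_assoc, ha, add_mul, smul_mul_assoc, mul_assoc, add_assoc]

/-- The commutator of `A B + B A`, for odd `A` and `B`, with an odd element `x`, from the
anticommutators with `x`: the super Jacobi identity. -/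
theorem anticomm_mul_odd {E : Type*} [Ring E] [Algebra ℂ E] {A B x z₁ z₂ y₁ y₂ : E}
    (hA : A * x = (-1 : ℂ) • (x * A) + z₁) (hB : B * x = (-1 : ℂ) • (x * B) + z₂)
    (h₁ : A * z₂ = z₂ * A + y₂) (h₂ : B * z₁ = z₁ * B + y₁) :
    (A * B + B * A) * x = x * (A * B + B * A) + (y₁ + y₂) := by
  rw [add_mul, mul_assoc, mul_assoc, hA, hB, mul_add, mul_add, mul_smul_comm, mul_smul_comm,
    ← mul_assoc A, ← mul_assoc B, hA, hB, h₁, h₂]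
  simp only [neg_smul, one_smul]
  noncomm_ring

/-- The commutator of `A B + B A`, for odd `A` and `B`, with an even element `x`. -/
theorem anticomm_mul_even {E : Type*} [Ring E] [Algebra ℂ E] {A B x z₁ z₂ y₁ y₂ : E}
    (hA : A * x = x * A + z₁) (hB : B * x = x * B + z₂)
    (h₁ : A * z₂ = (-1 : ℂ) • (z₂ * A) + y₂) (h₂ : B * z₁ = (-1 : ℂ) • (z₁ * B) + y₁) :
    (A * B + B * A) * x = x * (A * B + B * A) + (y₁ + y₂) := by
  rw [add_mul, mul_assoc, mul_assoc, hA, hB, mul_add, mul_add,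
    ← mul_assoc A, ← mul_assoc B, hA, hB, h₁, h₂]
  simp only [neg_smul, one_smul]
  noncomm_ring

theorem Q0_fm_false (q : ℂ) (i : Fin N) (n : ℤ) :
    Q0 N q * fm false i n = (-1 : ℂ) • (fm false i n * Q0 N q) :=
  (expands_Q0 q).eq_smul _ fun j k =>
    (mul_mul_eq (c' := 0) (fm_fm _ _ _ _ _ _)
      ((fm_bm _ _ _ _ _ _).symm.trans (add_zero _).symm)).trans (by
        rw [if_neg (by simp), zero_mul, mul_zero, add_zero, add_zero])

theorem Q0_fm_true (q : ℂ) (i : Fin N) (n : ℤ) :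
    Q0 N q * fm true i n = (-1 : ℂ) • (fm true i n * Q0 N q) + bm false i n :=
  (expands_Q0 q).eq_add _ (i₀ := i) (k₀ := -1 - n) fun j k =>
    (mul_mul_eq (c' := 0) (fm_fm _ _ _ _ _ _)
      ((fm_bm _ _ _ _ _ _).symm.trans (add_zero _).symm)).trans (by
        congr 1
        rw [mul_zero, add_zero]
        by_cases h : j = i ∧ k = -1 - n
        · obtain ⟨rfl, rfl⟩ := h
          rw [if_pos ⟨rfl, rfl, by omega⟩, if_pos ⟨rfl, rfl⟩, one_mul]
          congr 1; ring
        · rw [if_neg (by rintro ⟨-, h1, h2⟩; exact h ⟨h1, by omega⟩), if_neg h, zero_mul])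

theorem Q0_bm_false (q : ℂ) (i : Fin N) (n : ℤ) :
    Q0 N q * bm false i n = bm false i n * Q0 N q := by
  have := (expands_Q0 q).eq_smul (Y := bm false i n) 1 fun j k =>
    (mul_mul_eq (c := 0) ((fm_bm _ _ _ _ _ _).trans (by rw [one_smul, add_zero]))
      (bm_bm _ _ _ _ _ _)).trans (by simp)
  rwa [one_smul] at this

theorem Q0_bm_true (q : ℂ) (i : Fin N) (n : ℤ) :
    Q0 N q * bm true i n = bm true i n * Q0 N q + (-(n : ℂ)) • fm false i (n - 1) := by
  have := (expands_Q0 q).eq_add (Y := bm true i n) (Z := (-(n : ℂ)) • fm false i (n - 1)) 1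
    (i₀ := i) (k₀ := n - 1) fun j k =>
    (mul_mul_eq (c := 0) ((fm_bm _ _ _ _ _ _).trans (by rw [one_smul, add_zero]))
      (bm_bm _ _ _ _ _ _)).trans (by
        congr 1
        rw [zero_mul, zero_add]
        by_cases h : j = i ∧ k = n - 1
        · obtain ⟨rfl, rfl⟩ := h
          rw [if_pos ⟨rfl, rfl, by omega⟩, if_pos ⟨rfl, rfl⟩, mul_smul_comm, mul_one]
          congr 1; push_cast; ring
        · rw [if_neg (by rintro ⟨-, h1, h2⟩; exact h ⟨h1, by omega⟩), if_neg h, mul_zero])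
  rwa [one_smul] at this

theorem G_fm_true (i : Fin N) (n : ℤ) : G N * fm true i n = (-1 : ℂ) • (fm true i n * G N) :=
  expands_G.eq_smul _ fun j k =>
    (mul_mul_eq (c' := 0) (fm_fm _ _ _ _ _ _)
      ((fm_bm _ _ _ _ _ _).symm.trans (add_zero _).symm)).trans (by
        rw [if_neg (by simp), zero_mul, mul_zero, add_zero, add_zero])

theorem G_fm_false (i : Fin N) (n : ℤ) :
    G N * fm false i n = (-1 : ℂ) • (fm false i n * G N) + bm true i (n + 1) :=
  expands_G.eq_add _ (i₀ := i) (k₀ := -1 - n) fun j k =>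
    (mul_mul_eq (c' := 0) (fm_fm _ _ _ _ _ _)
      ((fm_bm _ _ _ _ _ _).symm.trans (add_zero _).symm)).trans (by
        congr 1
        rw [mul_zero, add_zero]
        by_cases h : j = i ∧ k = -1 - n
        · obtain ⟨rfl, rfl⟩ := h
          rw [if_pos ⟨rfl, rfl, by omega⟩, if_pos ⟨rfl, rfl⟩, one_mul]
          congr 1; ring
        · rw [if_neg (by rintro ⟨-, h1, h2⟩; exact h ⟨h1, by omega⟩), if_neg h, zero_mul])

theorem G_bm_true (i : Fin N) (n : ℤ) : G N * bm true i n = bm true i n * G N := by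
  have := expands_G.eq_smul (Y := bm true i n) 1 fun j k =>
    (mul_mul_eq (c := 0) ((fm_bm _ _ _ _ _ _).trans (by rw [one_smul, add_zero]))
      (bm_bm _ _ _ _ _ _)).trans (by simp)
  rwa [one_smul] at this

theorem G_bm_false (i : Fin N) (n : ℤ) :
    G N * bm false i n = bm false i n * G N + (-(n : ℂ)) • fm true i n := by
  have := expands_G.eq_add (Y := bm false i n) (Z := (-(n : ℂ)) • fm true i n) 1
    (i₀ := i) (k₀ := n) fun j k =>
    (mul_mul_eq (c := 0) ((fm_bm _ _ _ _ _ _).trans (by rw [one_smul, add_zero]))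
      (bm_bm _ _ _ _ _ _)).trans (by
        congr 1
        rw [zero_mul, zero_add]
        by_cases h : j = i ∧ k = n
        · obtain ⟨rfl, rfl⟩ := h
          rw [if_pos ⟨rfl, rfl, by omega⟩, if_pos ⟨rfl, rfl⟩, mul_smul_comm, mul_one]
          congr 1; push_cast; ring
        · rw [if_neg (by rintro ⟨-, h1, h2⟩; exact h ⟨h1, by omega⟩), if_neg h, mul_zero])
  rwa [one_smul] at this

theorem fm_eQ (q : ℂ) (b : Bool) (i : Fin N) (m : ℤ) (α : Lat N) (n : ℤ) :
    fm b i m * eQ q α n = eQ q α n * fm b i m := by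
  rw [eQ, ← mul_assoc, fm_em, mul_assoc, deform_comm (isShift_fm b i m), mul_assoc]

theorem bm_eQ (q : ℂ) (b : Bool) (i : Fin N) (k : ℤ) (α : Lat N) (n : ℤ) :
    bm b i k * eQ q α n = eQ q α n * bm b i k + (pairGen b i α : ℂ) • eQ q α (n + k) := by
  have h := bm_em b i k α n
  rw [sub_eq_iff_eq_add] at h
  rw [eQ, eQ, ← mul_assoc, h, add_mul, smul_mul_assoc, mul_assoc, deform_comm (isShift_bm b i k),
    mul_assoc, add_comm]

theorem fm_diffMode (q : ℂ) (b : Bool) (i : Fin N) (m : ℤ) (j : Fin N) (n : ℤ) :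
    fm b i m * diffMode q j n = diffMode q j n * fm b i m := by
  rw [diffMode, mul_sub, sub_mul, fm_eQ, fm_eQ]

theorem pairGen_latA_false (i j : Fin N) : pairGen false i (latA j) = 0 := by
  simp [pairGen, latA]

theorem pairGen_latT_false (i : Fin N) : pairGen false i (latT N) = 0 := by
  simp [pairGen, latT]

theorem bm_false_diffMode (q : ℂ) (i : Fin N) (m : ℤ) (j : Fin N) (n : ℤ) :
    bm false i m * diffMode q j n = diffMode q j n * bm false i m := by
  rw [diffMode, mul_sub, sub_mul, bm_eQ, bm_eQ, pairGen_latA_false, pairGen_latT_false]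
  simp

theorem bm_true_diffMode (q : ℂ) (i : Fin N) (m : ℤ) (j : Fin N) (n : ℤ) :
    bm true i m * diffMode q j n = diffMode q j n * bm true i m +
      ((if i = j then eQ q (latA j) (n + m) else 0) + eQ q (latT N) (n + m)) := by
  have h1 : pairGen true i (latA j) = if i = j then 1 else 0 := by
    simp [pairGen, latA, Pi.single_apply]
  have h2 : pairGen true i (latT N) = -1 := by simp [pairGen, latT]
  rw [diffMode, mul_sub, sub_mul, bm_eQ, bm_eQ, h1, h2]
  split_ifs
  · push_cast; module
  · push_cast; module

theorem D_fm_true (q : ℂ) (i : Fin N) (n : ℤ) :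
    D N q * fm true i n = (-1 : ℂ) • (fm true i n * D N q) :=
  (expands_D q).eq_smul _ fun j k =>
    (mul_mul_eq (c' := 0) (fm_fm _ _ _ _ _ _)
      ((fm_diffMode _ _ _ _ _ _).symm.trans (add_zero _).symm)).trans (by
        rw [if_neg (by simp), zero_mul, mul_zero, add_zero, add_zero])

theorem D_fm_false (q : ℂ) (i : Fin N) (n : ℤ) :
    D N q * fm false i n = (-1 : ℂ) • (fm false i n * D N q) + diffMode q i n :=
  (expands_D q).eq_add _ (i₀ := i) (k₀ := -1 - n) fun j k =>
    (mul_mul_eq (c' := 0) (fm_fm _ _ _ _ _ _)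
      ((fm_diffMode _ _ _ _ _ _).symm.trans (add_zero _).symm)).trans (by
        congr 1
        rw [mul_zero, add_zero]
        by_cases h : j = i ∧ k = -1 - n
        · obtain ⟨rfl, rfl⟩ := h
          rw [if_pos ⟨rfl, rfl, by omega⟩, if_pos ⟨rfl, rfl⟩, one_mul]
          congr 1; ring
        · rw [if_neg (by rintro ⟨-, h1, h2⟩; exact h ⟨h1, by omega⟩), if_neg h, zero_mul])

theorem D_bm_false (q : ℂ) (i : Fin N) (n : ℤ) :
    D N q * bm false i n = bm false i n * D N q := by
  have := (expands_D q).eq_smul (Y := bm false i n) 1 fun j k =>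
    (mul_mul_eq (c := 0) (c' := 0) ((fm_bm _ _ _ _ _ _).trans (by rw [one_smul, add_zero]))
      ((bm_false_diffMode _ _ _ _ _).symm.trans (add_zero _).symm)).trans (by simp)
  rwa [one_smul] at this

theorem fm_swap {b : Bool} {i j : Fin N} {m n : ℤ} :
    fm b i m * fm b j n = (-1 : ℂ) • (fm b j n * fm b i m) := by
  rw [fm_fm, if_neg (by simp), add_zero]

theorem mul_mul_anticomm {E : Type*} [Ring E] [Algebra ℂ E] {a b c d : E}
    (hac : a * c = (-1 : ℂ) • (c * a)) (hbc : b * c = c * b) (had : d * a = a * d)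
    (hbd : b * d = d * b) : a * b * (c * d) + c * d * (a * b) = 0 := by
  have e1 : a * b * (c * d) = a * c * (b * d) := by
    rw [mul_assoc, ← mul_assoc b, hbc]; noncomm_ring
  have e2 : c * d * (a * b) = c * a * (b * d) := by
    rw [mul_assoc, ← mul_assoc d, had, hbd]; noncomm_ring
  rw [e1, e2, hac, ← add_mul]
  simp

theorem Q0_sq (q : ℂ) : Q0 N q * Q0 N q = 0 :=
  (expands_Q0 q).mul_self_eq_zero fun _ _ _ _ =>
    mul_mul_anticomm fm_swap (fm_bm _ _ _ _ _ _).symm (fm_bm _ _ _ _ _ _).symm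
      ((bm_bm _ _ _ _ _ _).trans (by simp))

theorem pairing_eq_zero {α β : Lat N} (hα : α.2 = 0) (hβ : β.2 = 0) : pairing α β = 0 := by
  simp [pairing, hα, hβ]

theorem eQ_single (q : ℂ) (α : Lat N) (n : ℤ) (β : Lat N) (x : Ferm N) (y : Bos N) :
    eQ q α n (Finsupp.single β (pureFock x y)) =
      (q ^ (ht α.1 + ht β.1 - ht (α.1 + β.1))) • em α n (Finsupp.single β (pureFock x y)) := by
  rw [eQ, Module.End.mul_apply, deform_single, map_smul]

/-- The deformed exponentials of vectors of `L_A` commute: on `e^γ` both products acquire the factor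
with exponent `ht α + ht β + ht γ - ht (α + β + γ)`, and `L_A` is isotropic. -/
theorem eQ_comm (q : ℂ) {α β : Lat N} (hα : α.2 = 0) (hβ : β.2 = 0) (m n : ℤ) :
    eQ q α m * eQ q β n = eQ q β n * eQ q α m := by
  refine VL_sector_ext fun γ v hv => ?_
  have h : ∀ α β m n, eQ q α m (eQ q β n v) =
      (q ^ ((ht β.1 + ht γ.1 - ht (β.1 + γ.1)) +
        (ht α.1 + ht (β.1 + γ.1) - ht (α.1 + (β.1 + γ.1))))) • em α m (em β n v) := by
    intro α β m n
    rw [eQ, eQ, Module.End.mul_apply, Module.End.mul_apply, deform_sector q β γ hv, map_smul,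
      map_smul, map_smul, deform_sector q α (β + γ) (isShift_em β n γ v hv), map_smul, smul_smul,
      pow_add]
    rfl
  rw [Module.End.mul_apply, Module.End.mul_apply, h, h]
  have e1 := ht_add_le α.1 (β.1 + γ.1)
  have e2 := ht_add_le β.1 γ.1
  have e3 := ht_add_le α.1 γ.1
  have e5 := ht_add_le β.1 (α.1 + γ.1)
  have hc : β.1 + (α.1 + γ.1) = α.1 + (β.1 + γ.1) := by abel
  rw [hc] at e5 ⊢
  rw [show ∀ x y z w u : ℕ, z ≤ y + x → w ≤ u + z → (x + y - z) + (u + z - w) = x + y + u - w by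
    intros; omega, show ∀ x y z w u : ℕ, z ≤ y + x → w ≤ u + z → (x + y - z) + (u + z - w) =
      x + y + u - w by intros; omega]
  · congr 1
    · congr 1; omega
    · exact LinearMap.congr_fun (em_comm_em (pairing_eq_zero hα hβ) m n) v
  all_goals omega

theorem diffMode_comm (q : ℂ) (i j : Fin N) (m n : ℤ) :
    diffMode q i m * diffMode q j n = diffMode q j n * diffMode q i m := by
  have hA : ∀ i : Fin N, (latA i).2 = 0 := fun _ => rfl
  have hT : (latT N).2 = 0 := rfl
  rw [diffMode, diffMode, sub_mul, mul_sub, mul_sub, sub_mul, mul_sub, mul_sub,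
    eQ_comm q (hA i) (hA j), eQ_comm q (hA i) hT, eQ_comm q hT (hA j), eQ_comm q hT hT m n]
  abel

theorem D_sq (q : ℂ) : D N q * D N q = 0 :=
  (expands_D q).mul_self_eq_zero fun _ _ _ _ =>
    mul_mul_anticomm fm_swap (fm_diffMode _ _ _ _ _ _).symm (fm_diffMode _ _ _ _ _ _).symm
      (diffMode_comm _ _ _ _ _)

/-- The terms `Ψ^j Ψ^i [B^j, E^i]` cancel in pairs: `[B^j, E^i]` is symmetric in `i` and `j` apart
from a summand with `i = j`, and the fermions anticommute. -/
theorem D_G (q : ℂ) : D N q * G N + G N * D N q = 0 := by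
  refine (expands_D q).anticomm_eq_zero expands_G fun i k j l => ?_
  have key : ∀ (i j : Fin N) (k l : ℤ),
      fm true i k * diffMode q i (-1 - k) * (fm true j l * bm true j (-l)) +
      fm true j l * bm true j (-l) * (fm true i k * diffMode q i (-1 - k)) =
      fm true j l * fm true i k * ((if j = i then eQ q (latA i) (-1 - k - l) else 0) +
        eQ q (latT N) (-1 - k - l)) := by
    intro i j k l
    have e1 : fm true i k * diffMode q i (-1 - k) * (fm true j l * bm true j (-l)) =
        fm true i k * fm true j l * (diffMode q i (-1 - k) * bm true j (-l)) := by
      rw [mul_assoc, ← mul_assoc (diffMode _ _ _), ← fm_diffMode]; simp only [mul_assoc]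
    have e2 : fm true j l * bm true j (-l) * (fm true i k * diffMode q i (-1 - k)) =
        fm true j l * fm true i k * (bm true j (-l) * diffMode q i (-1 - k)) := by
      rw [mul_assoc, ← mul_assoc (bm _ _ _), ← fm_bm]; simp only [mul_assoc]
    rw [e1, e2, fm_swap (i := i) (j := j), bm_true_diffMode, smul_mul_assoc, mul_add, ← add_assoc]
    rw [show -1 - k + -l = -1 - k - l by ring]
    module
  rw [key, key, fm_swap (i := i) (j := j), show -1 - l - k = -1 - k - l by ring]
  by_cases hij : i = j
  · subst hij
    simp only [if_true, smul_mul_assoc]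
    module
  · rw [if_neg hij, if_neg (Ne.symm hij), smul_mul_assoc]
    module

/-- The residue of `:α(z) e^α(z): = ∂ e^α(z)` vanishes. For `α ∈ L_A` the modes of `α(z)` and
`e^α(z)` commute, so no normal ordering is visible. -/
theorem sum_lm_eQ_eq_zero (q : ℂ) {α : Lat N} (v : VL N) (hα : α.2 = 0) :
    ∀ᶠ J : ℕ in Filter.atTop,
      ∑ k ∈ Finset.Ico (-(J : ℤ)) J, lm α k (eQ q α (-1 - k) v) = 0 := by
  filter_upwards [em_derivative α 0 (deform q α v)] with J hJ
  have hc : ∀ k n, lm α k * em α n = em α n * lm α k := by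
    intro k n
    rw [lm, Finset.sum_mul, Finset.mul_sum]
    refine Finset.sum_congr rfl fun i _ => ?_
    have h1 := bm_em false i k α n
    have h2 : pairGen false i α = 0 := by simp [pairGen, hα]
    rw [h2, Int.cast_zero, zero_smul, sub_eq_zero] at h1
    rw [hα, Pi.zero_apply, Int.cast_zero, zero_smul, add_zero, smul_mul_assoc, mul_smul_comm, h1]
  rw [sum_Ico_symm]
  rw [Int.cast_zero, neg_zero, zero_smul] at hJ
  rw [hJ]
  refine Finset.sum_congr rfl fun j _ => ?_
  have h3 := LinearMap.congr_fun (hc j (-1 - j)) (deform q α v)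
  rw [Module.End.mul_apply, Module.End.mul_apply] at h3
  rw [eQ, eQ, Module.End.mul_apply, Module.End.mul_apply, h3]
  rw [show (0 : ℤ) - 1 - j = -1 - j by ring, show -1 - (-(j : ℤ) - 1) = 0 + j by ring]

/-- The anticommutator contracts each `Ψ^i` with `Φ^i`, and leaves the residue of
`∑_i A^i(z) e^{A^i}(z) - (∑_i A^i(z)) e^{-∑ A^j}(z)`, a sum of derivatives. -/
theorem D_Q0 (q : ℂ) : D N q * Q0 N q + Q0 N q * D N q = 0 := by
  refine LinearMap.ext fun v => ?_
  have hA : ∀ i : Fin N, (latA i).2 = 0 := fun _ => rfl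
  have hT : (latT N).2 = 0 := rfl
  have h1 := Filter.eventually_all.mpr fun i => sum_lm_eQ_eq_zero q (α := latA i) v (hA i)
  -- One truncation `J` serves all sums involved.
  obtain ⟨J, hJ, hJA, hJT⟩ := (((expands_D q).anticomm_apply (expands_Q0 q) v).and
    (h1.and (sum_lm_eQ_eq_zero q (α := latT N) v hT))).exists
  rw [hJ, LinearMap.zero_apply]
  have key : ∀ (i j : Fin N) (k l : ℤ),
      fm true i k * diffMode q i (-1 - k) * (fm false j l * bm false j (-1 - l)) +
      fm false j l * bm false j (-1 - l) * (fm true i k * diffMode q i (-1 - k)) =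
      if i = j ∧ l = -1 - k then bm false i k * diffMode q i (-1 - k) else 0 := by
    intro i j k l
    have e1 : fm true i k * diffMode q i (-1 - k) * (fm false j l * bm false j (-1 - l)) =
        fm true i k * fm false j l * (bm false j (-1 - l) * diffMode q i (-1 - k)) := by
      rw [mul_assoc, ← mul_assoc (diffMode _ _ _), ← fm_diffMode, bm_false_diffMode]
      simp only [mul_assoc]
    have e2 : fm false j l * bm false j (-1 - l) * (fm true i k * diffMode q i (-1 - k)) =
        fm false j l * fm true i k * (bm false j (-1 - l) * diffMode q i (-1 - k)) := by
      rw [mul_assoc, ← mul_assoc (bm _ _ _), ← fm_bm]; simp only [mul_assoc]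
    rw [e1, e2, ← add_mul, fm_anticomm]
    by_cases h : i = j ∧ l = -1 - k
    · obtain ⟨rfl, rfl⟩ := h
      rw [if_pos ⟨rfl, rfl, by omega⟩, if_pos ⟨rfl, rfl⟩, one_mul,
        show -1 - (-1 - k) = k by ring]
    · rw [if_neg (by rintro ⟨-, h1, h2⟩; exact h ⟨h1, by omega⟩), if_neg h, zero_mul]
  have hsum : ∀ x ∈ Finset.univ ×ˢ Finset.Ico (-(J : ℤ)) J,
      ∑ y ∈ Finset.univ ×ˢ Finset.Ico (-(J : ℤ)) J,
        (fm true x.1 x.2 * diffMode q x.1 (-1 - x.2) * (fm false y.1 y.2 * bm false y.1 (-1 - y.2)) +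
        fm false y.1 y.2 * bm false y.1 (-1 - y.2) * (fm true x.1 x.2 * diffMode q x.1 (-1 - x.2)) :
          Module.End ℂ (VL N)) v = bm false x.1 x.2 (diffMode q x.1 (-1 - x.2) v) := by
    rintro ⟨i, k⟩ hx
    simp only [Finset.mem_product, Finset.mem_univ, true_and, Finset.mem_Ico] at hx
    rw [Finset.sum_eq_single (i, -1 - k)]
    · simp only
      rw [key, if_pos ⟨rfl, rfl⟩]
      rfl
    · rintro ⟨j, l⟩ _ hne
      simp only
      rw [key, if_neg, LinearMap.zero_apply]
      rintro ⟨rfl, rfl⟩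
      exact hne rfl
    · intro hn
      exfalso
      apply hn
      simp only [Finset.mem_product, Finset.mem_univ, true_and, Finset.mem_Ico]
      omega
  have hlA : ∀ (i : Fin N) k, lm (latA i) k = bm false i k := by
    intro i k
    rw [lm, Finset.sum_eq_single i]
    · simp [latA]
    · intro j _ hj
      simp [latA, hj]
    · simp
  have hlT : ∀ k w, lm (latT N) k w = -∑ i, bm false i k w := by
    intro k w
    rw [lm, LinearMap.sum_apply, ← Finset.sum_neg_distrib]
    refine Finset.sum_congr rfl fun i _ => ?_
    simp [latT]
  rw [Finset.sum_congr rfl hsum, Finset.sum_product]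
  simp only [diffMode, LinearMap.sub_apply, map_sub, Finset.sum_sub_distrib]
  simp only [hlA] at hJA
  simp only [hlT, Finset.sum_neg_distrib, neg_eq_zero] at hJT
  rw [Finset.sum_eq_zero fun i _ => hJA i, Finset.sum_comm, hJT, sub_zero]

end Relations

/-! ### Diagonal operators -/

section Diagonal

variable {I V : Type*} [AddCommGroup V] [Module ℂ V] (b : Module.Basis I ℂ V)

/-- The operator with eigenvalue `f a` on the basis vector `b a`. -/
def diagOp (f : I → ℂ) : Module.End ℂ V := b.constr ℂ fun a => f a • b a

theorem diagOp_basis (f : I → ℂ) (a : I) : diagOp b f (b a) = f a • b a := b.constr_basis _ _ _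

theorem diagOp_repr (f : I → ℂ) (x : V) (a : I) :
    b.repr (diagOp b f x) a = f a * b.repr x a := by
  classical
  have h : (Finsupp.lapply a).comp (b.repr.toLinearMap.comp (diagOp b f)) =
      f a • (Finsupp.lapply a).comp b.repr.toLinearMap := by
    refine b.ext fun c => ?_
    simp only [LinearMap.comp_apply, diagOp_basis, LinearMap.smul_apply, map_smul,
      LinearEquiv.coe_coe, Module.Basis.repr_self, Finsupp.lapply_apply, Finsupp.single_apply]
    split_ifs with h
    · rw [h]
    · rw [smul_zero, smul_zero]
  exact LinearMap.congr_fun h x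

theorem diagOp_mul (f g : I → ℂ) : diagOp b f * diagOp b g = diagOp b fun a => f a * g a := by
  refine b.ext fun a => ?_
  rw [Module.End.mul_apply, diagOp_basis, map_smul, diagOp_basis, diagOp_basis, smul_smul, mul_comm]

theorem diagOp_eq {X : Module.End ℂ V} {f : I → ℂ} (h : ∀ a, X (b a) = f a • b a) :
    X = diagOp b f := b.ext fun a => by rw [h, diagOp_basis]

/-- An operator that intertwines two diagonal operators has matrix entries only between equal
eigenvalues. -/
theorem eq_of_mul_diagOp {X : Module.End ℂ V} {f g : I → ℂ}
    (h : X * diagOp b f = diagOp b g * X) {a c : I} (hac : b.repr (X (b a)) c ≠ 0) : f a = g c := by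
  have h1 := congrArg (fun x => b.repr x c) (LinearMap.congr_fun h (b a))
  simp only [Module.End.mul_apply, diagOp_basis, diagOp_repr, map_smul, Finsupp.smul_apply,
    smul_eq_mul] at h1
  exact mul_right_cancel₀ hac h1

/-- The converse of `eq_of_mul_diagOp`. -/
theorem mul_diagOp_of {X : Module.End ℂ V} {f g : I → ℂ}
    (h : ∀ a c, b.repr (X (b a)) c ≠ 0 → f a = g c) : X * diagOp b f = diagOp b g * X := by
  refine b.ext fun a => b.repr.injective (Finsupp.ext fun c => ?_)
  simp only [Module.End.mul_apply, diagOp_basis, diagOp_repr, map_smul, Finsupp.smul_apply,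
    smul_eq_mul]
  by_cases h0 : b.repr (X (b a)) c = 0
  · rw [h0, mul_zero, mul_zero]
  · rw [h a c h0]

/-- The image of a diagonal projection. -/
theorem diagOp_eq_self_iff (p : I → Prop) [DecidablePred p] (x : V) :
    diagOp b (fun a => if p a then 1 else 0) x = x ↔ ∀ a, b.repr x a ≠ 0 → p a := by
  constructor
  · intro h a ha
    by_contra hp
    have h1 := diagOp_repr b (fun a => if p a then (1 : ℂ) else 0) x a
    rw [h, if_neg hp, zero_mul] at h1
    exact ha h1
  · refine fun h => b.repr.injective (Finsupp.ext fun a => ?_)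
    rw [diagOp_repr]
    by_cases h0 : b.repr x a = 0
    · rw [h0, mul_zero]
    · rw [if_pos (h a h0), one_mul]

end Diagonal

/-! ### The monomial basis and conformal weights -/

section Weights

variable {N : ℕ}

/-- Labels of the monomials `x ⊗ e^β`, forming a basis of `V_L`. -/
abbrev Idx (N : ℕ) : Type := Σ _ : Lat N, Finset (Osc N) × (Osc N →₀ ℕ)

variable (N) in
/-- The basis of `V_L` of the monomials `x ⊗ e^β`. -/
def vlBasis : Module.Basis (Idx N) ℂ (VL N) := Finsupp.basis fun _ : Lat N => fockBasis N

theorem vlBasis_apply (β : Lat N) (s : Finset (Osc N)) (t : Osc N →₀ ℕ) :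
    vlBasis N ⟨β, (s, t)⟩ = Finsupp.single β (fockBasis N (s, t)) := by
  rw [vlBasis, Finsupp.coe_basis]

theorem vlBasis_vac (β : Lat N) : vlBasis N ⟨β, (∅, 0)⟩ = expState β := by
  rw [vlBasis_apply, fockBasis_apply]
  simp [expState]

/-- The eigenvalue on a monomial of an operator that has the exponentials as eigenvectors and whose
commutators with the creation operators are multiples of these. -/
theorem eigen_monomial {X : Module.End ℂ (VL N)} {c c' : Osc N → ℂ} {β : Lat N} {e : ℂ}
    (hf : ∀ b i (k : ℕ), X * fm b i (-(k : ℤ) - 1) =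
      fm b i (-(k : ℤ) - 1) * X + c (osc b i k) • fm b i (-(k : ℤ) - 1))
    (hb : ∀ b i (k : ℕ), X * bm b i (-(k : ℤ) - 1) =
      bm b i (-(k : ℤ) - 1) * X + c' (osc b i k) • bm b i (-(k : ℤ) - 1))
    (h0 : X (expState β) = e • expState β) (s : Finset (Osc N)) (t : Osc N →₀ ℕ) :
    X (vlBasis N ⟨β, (s, t)⟩) = (e + ((Finsupp.toMultiset t).map c').sum + ∑ o ∈ s, c o) •
      vlBasis N ⟨β, (s, t)⟩ := by
  have key : ∀ {o : Osc N} {Y : Module.End ℂ (VL N)} {d d' : ℂ} {u : VL N},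
      X * Y = Y * X + d • Y → X u = d' • u → X (Y u) = (d + d') • Y u := by
    intro o Y d d' u h hu
    have h1 := LinearMap.congr_fun h u
    simp only [Module.End.mul_apply, LinearMap.add_apply, LinearMap.smul_apply] at h1
    rw [h1, hu, map_smul, add_smul, add_comm]
  have hbos : ∀ l : List (Osc N), X (Finsupp.single β (pureFock 1 (l.map MvPolynomial.X).prod)) =
      (e + (l.map c').sum) • Finsupp.single β (pureFock 1 (l.map MvPolynomial.X).prod) := by
    intro l
    induction l with
    | nil => simpa [expState] using h0
    | cons o l ih =>
      have h1 := key (o := o) (hb (ofLex o).1 (ofLex (ofLex o).2).1 (ofLex (ofLex o).2).2) ih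
      rw [bm_creation] at h1
      rw [List.map_cons, List.map_cons, List.prod_cons, List.sum_cons, add_left_comm]
      exact h1
  have hferm : ∀ l : List (Osc N), X (Finsupp.single β (pureFock
      (l.map fun o => ExteriorAlgebra.ι ℂ (Finsupp.single o (1 : ℂ))).prod
      (MvPolynomial.monomial t 1))) =
      (e + ((Finsupp.toMultiset t).map c').sum + (l.map c).sum) •
        Finsupp.single β (pureFock
          (l.map fun o => ExteriorAlgebra.ι ℂ (Finsupp.single o (1 : ℂ))).prod
          (MvPolynomial.monomial t 1)) := by
    intro l
    induction l with
    | nil =>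
      have h1 := hbos ((Finsupp.toMultiset t).sort (· ≤ ·))
      rw [monomial_eq_prod_sort, ← Multiset.sum_coe, ← Multiset.map_coe, Multiset.sort_eq] at h1
      rw [List.map_nil, List.map_nil, List.prod_nil, List.sum_nil, add_zero]
      exact h1
    | cons o l ih =>
      have h1 := key (o := o) (hf (ofLex o).1 (ofLex (ofLex o).2).1 (ofLex (ofLex o).2).2) ih
      rw [fm_creation] at h1
      rw [List.map_cons, List.map_cons, List.prod_cons, List.sum_cons, add_left_comm]
      exact h1
  have h1 := hferm (s.sort (· ≤ ·))
  rw [← fockBasis_apply, ← vlBasis_apply, ← Multiset.sum_coe, ← Multiset.map_coe,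
    Finset.sort_eq] at h1
  exact h1

variable (N) in
/-- The operator `Q_0 G + G Q_0`. It is diagonal, and its eigenvalues are the conformal weights. -/
def L0 (q : ℂ) : Module.End ℂ (VL N) := Q0 N q * G N + G N * Q0 N q

/-- The conformal weight of a fermionic oscillator: `Φ^i_{-k}` has weight `k`, `Ψ^i_{-k-1}` has
weight `k + 1`. -/
def fermWeight (o : Osc N) : ℕ := (ofLex (ofLex o).2).2 + if (ofLex o).1 then 1 else 0

/-- The conformal weight of the oscillators in a monomial. -/
def weight (a : Idx N) : ℕ :=
  ((Finsupp.toMultiset a.2.2).map oscWeight).sum + ∑ o ∈ a.2.1, fermWeight o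

/-- The conformal weight of a monomial `x ⊗ e^β`. -/
def confWeight (a : Idx N) : ℤ := ∑ i, a.1.1 i * a.1.2 i + weight a

end Weights

/-! ### The diagonal operators `L_0`, `A^i_0` and `Φ^i_0 Ψ^i_0` -/

section Weights

variable {N : ℕ}

theorem L0_fm_false (q : ℂ) (i : Fin N) (n : ℤ) : L0 N q * fm false i n =
    fm false i n * L0 N q + (-((n : ℂ) + 1)) • fm false i n := by
  have h1 : G N * (0 : Module.End ℂ (VL N)) = 0 * G N + 0 := by simp
  have h2 := Q0_bm_true q i (n + 1)
  have h := anticomm_mul_odd (A := G N) (B := Q0 N q) (G_fm_false i n)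
    ((Q0_fm_false q i n).trans (add_zero _).symm) h1 h2
  rw [L0, add_comm (Q0 N q * G N), h]
  push_cast
  rw [add_zero, add_sub_cancel_right]

theorem L0_fm_true (q : ℂ) (i : Fin N) (n : ℤ) : L0 N q * fm true i n =
    fm true i n * L0 N q + (-(n : ℂ)) • fm true i n := by
  have h1 : Q0 N q * (0 : Module.End ℂ (VL N)) = 0 * Q0 N q + 0 := by simp
  have h := anticomm_mul_odd (A := Q0 N q) (B := G N) (Q0_fm_true q i n)
    ((G_fm_true i n).trans (add_zero _).symm) h1 (G_bm_false i n)
  rw [L0, h, add_zero]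

theorem L0_bm_false (q : ℂ) (i : Fin N) (n : ℤ) : L0 N q * bm false i n =
    bm false i n * L0 N q + (-(n : ℂ)) • bm false i n := by
  have h1 : G N * (0 : Module.End ℂ (VL N)) = (-1 : ℂ) • (0 * G N) + 0 := by simp
  have h2 : Q0 N q * ((-(n : ℂ)) • fm true i n) =
      (-1 : ℂ) • ((-(n : ℂ)) • fm true i n * Q0 N q) + (-(n : ℂ)) • bm false i n := by
    rw [mul_smul_comm, Q0_fm_true, smul_add, smul_mul_assoc, smul_comm]
  have h := anticomm_mul_even (A := Q0 N q) (B := G N)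
    ((Q0_bm_false q i n).trans (add_zero _).symm) (G_bm_false i n) h2 h1
  rw [L0, h, zero_add]

theorem L0_bm_true (q : ℂ) (i : Fin N) (n : ℤ) : L0 N q * bm true i n =
    bm true i n * L0 N q + (-(n : ℂ)) • bm true i n := by
  have h1 : Q0 N q * (0 : Module.End ℂ (VL N)) = (-1 : ℂ) • (0 * Q0 N q) + 0 := by simp
  have h2 : G N * ((-(n : ℂ)) • fm false i (n - 1)) =
      (-1 : ℂ) • ((-(n : ℂ)) • fm false i (n - 1) * G N) + (-(n : ℂ)) • bm true i n := by
    rw [mul_smul_comm, G_fm_false, smul_add, smul_mul_assoc, smul_comm, sub_add_cancel]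
  have h := anticomm_mul_even (A := Q0 N q) (B := G N) (Q0_bm_true q i n)
    ((G_bm_true i n).trans (add_zero _).symm) h1 h2
  rw [L0, h, add_zero]

theorem G_expState (β : Lat N) : G N (expState β) = 0 := by
  obtain ⟨J, hJ⟩ := (expands_G (N := N) (expState β)).exists
  rw [hJ]
  refine Finset.sum_eq_zero fun i _ => Finset.sum_eq_zero fun k _ => ?_
  beta_reduce
  by_cases hk : 0 ≤ k
  · rw [fm_bm, Module.End.mul_apply, fm_vac _ _ hk, map_zero]
  · rw [Module.End.mul_apply, bm_vac _ _ (by omega), map_zero]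

/-- `Q_0 e^β = ∑_i m_i Φ^i_0 e^β`, where `β` has coefficients `m_i` at the `B^i`. -/
theorem Q0_expState (q : ℂ) (β : Lat N) :
    Q0 N q (expState β) = ∑ i, (β.2 i : ℂ) • fm false i (-1) (expState β) := by
  obtain ⟨J, hJ, hJ1⟩ := ((expands_Q0 q (expState β)).and (Filter.eventually_ge_atTop 1)).exists
  rw [hJ]
  refine Finset.sum_congr rfl fun i _ => ?_
  rw [Finset.sum_eq_single (-1)]
  · beta_reduce
    rw [show (-1 : ℤ) - -1 = 0 by ring, Module.End.mul_apply, expState, bm_zero_single, map_smul]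
    rfl
  · intro k _ hk
    beta_reduce
    by_cases hk' : 0 ≤ k
    · rw [fm_bm, Module.End.mul_apply, fm_vac _ _ hk', map_zero]
    · rw [Module.End.mul_apply, bm_vac _ _ (by omega), map_zero]
  · intro hn
    exfalso
    exact hn (Finset.mem_Ico.mpr ⟨by omega, by omega⟩)

/-- The conformal weight of `e^β` is `(β, β) / 2`. -/
theorem L0_expState (q : ℂ) (β : Lat N) :
    L0 N q (expState β) = ((∑ i, β.1 i * β.2 i : ℤ) : ℂ) • expState β := by
  rw [L0, LinearMap.add_apply, Module.End.mul_apply, Module.End.mul_apply, G_expState, map_zero,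
    zero_add, Q0_expState, map_sum, Int.cast_sum, Finset.sum_smul]
  refine Finset.sum_congr rfl fun i _ => ?_
  have h := LinearMap.congr_fun (G_fm_false i (-1)) (expState β)
  simp only [Module.End.mul_apply, LinearMap.add_apply, LinearMap.smul_apply, G_expState, map_zero,
    smul_zero, zero_add, neg_add_cancel] at h
  rw [map_smul, h, expState, bm_zero_single, smul_smul, Int.cast_mul, mul_comm]
  rfl

theorem L0_eq_diagOp (q : ℂ) : L0 N q = diagOp (vlBasis N) fun a => (confWeight a : ℂ) := by
  refine diagOp_eq _ fun ⟨β, s, t⟩ => ?_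
  rw [eigen_monomial (c := fun o => (fermWeight o : ℂ)) (c' := fun o => (oscWeight o : ℂ))
    (fun b i k => ?_) (fun b i k => ?_) (L0_expState q β)]
  · congr 1
    have h : ((Finsupp.toMultiset t).map fun o => (oscWeight o : ℂ)).sum =
        (((Finsupp.toMultiset t).map oscWeight).sum : ℕ) := by
      rw [Nat.cast_multiset_sum, Multiset.map_map]; rfl
    rw [h, confWeight, weight, Int.cast_add, Int.cast_natCast, Nat.cast_add, Nat.cast_sum]
    ring
  · cases b
    · rw [L0_fm_false]
      congr 2
      simp [fermWeight, osc]
    · rw [L0_fm_true]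
      congr 2
      simp [fermWeight, osc, add_comm]
  · have h : -((-(k : ℤ) - 1 : ℤ) : ℂ) = (oscWeight (osc b i k) : ℂ) := by
      simp [oscWeight, osc, add_comm]
    rw [← h]
    cases b
    · exact L0_bm_false q i _
    · exact L0_bm_true q i _

/-- The zero modes `A^i_0` and `B^i_0` are diagonal. -/
theorem bm_zero_eq_diagOp (b : Bool) (i : Fin N) :
    bm b i 0 = diagOp (vlBasis N) fun a => (pairGen b i a.1 : ℂ) :=
  diagOp_eq _ fun ⟨β, s, t⟩ => by rw [vlBasis_apply, bm_zero_single]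

/-- The operator counting the factors `Φ^i_0`. -/
theorem fm_mul_fm_eq_diagOp (i : Fin N) : fm false i (-1) * fm true i 0 =
    diagOp (vlBasis N) fun a => if osc false i 0 ∈ a.2.1 then 1 else 0 := by
  classical
  refine diagOp_eq _ fun ⟨β, s, t⟩ => ?_
  rw [eigen_monomial (c := fun o => if o = osc false i 0 then 1 else 0) (c' := fun _ => 0)
    (e := 0) (fun b j k => ?_) (fun b j k => ?_) ?_]
  · congr 1
    simp
  · rw [Module.End.mul_apply, fm_vac _ _ le_rfl, map_zero, zero_smul]
  · have h1 := fm_fm false b i j (-1) (-(k : ℤ) - 1)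
    rw [if_neg (by omega), add_zero] at h1
    have h2 := fm_fm true b i j 0 (-(k : ℤ) - 1)
    rw [mul_assoc, h2, mul_add, mul_smul_comm, ← mul_assoc, h1, smul_mul_assoc, smul_smul,
      mul_assoc, neg_mul_neg, one_mul, one_smul]
    congr 1
    by_cases hc : b = false ∧ i = j ∧ k = 0
    · obtain ⟨rfl, rfl, rfl⟩ := hc
      simp
    · rw [if_neg, if_neg, mul_zero, zero_smul]
      · rw [osc_inj]
        rintro ⟨h1, h2, h3⟩
        exact hc ⟨h1, h2.symm, h3⟩
      · rintro ⟨h1, h2, h3⟩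
        exact hc ⟨by simpa using h1, h2, by omega⟩
  · rw [zero_smul, add_zero, mul_assoc, fm_bm, ← mul_assoc, fm_bm, mul_assoc]

end Weights

/-! ### The fermionic charge -/

section Charge

variable {N : ℕ}

/-- The charge of an oscillator. -/
def oscCharge (o : Osc N) : ℤ := if (ofLex o).1 then -1 else 1

theorem charge_eq_sum (s : Finset (Osc N)) : charge s = ∑ o ∈ s, oscCharge o := by
  rw [charge, Finset.card_filter, Finset.card_filter, Nat.cast_sum, Nat.cast_sum,
    ← Finset.sum_sub_distrib]
  refine Finset.sum_congr rfl fun o _ => ?_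
  cases h : (ofLex o).1 <;> simp [oscCharge, h]

/-- Multiplication of each fermionic oscillator by `2` to the power of its charge. -/
def scaleOsc : (Osc N →₀ ℂ) →ₗ[ℂ] (Osc N →₀ ℂ) :=
  diagOp Finsupp.basisSingleOne fun o => (2 : ℂ) ^ oscCharge o

variable (N) in
/-- The operator of multiplication by `2` to the power of the charge. -/
def chargeScale : Module.End ℂ (VL N) :=
  onFerm (ExteriorAlgebra.map (scaleOsc (N := N))).toLinearMap

theorem scaleOsc_single (o : Osc N) : scaleOsc (Finsupp.single o (1 : ℂ)) =
    (2 : ℂ) ^ oscCharge o • Finsupp.single o 1 := by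
  have := diagOp_basis (Finsupp.basisSingleOne (R := ℂ) (ι := Osc N))
    (fun o => (2 : ℂ) ^ oscCharge o) o
  rwa [Finsupp.coe_basisSingleOne] at this

theorem scaleOsc_apply (m : Osc N →₀ ℂ) (o : Osc N) :
    scaleOsc m o = (2 : ℂ) ^ oscCharge o * m o :=
  diagOp_repr (Finsupp.basisSingleOne (R := ℂ) (ι := Osc N)) (fun o => (2 : ℂ) ^ oscCharge o) m o

/-- The induced automorphism of the exterior algebra rescales contraction by the dual
oscillators. -/
theorem map_scaleOsc_contractLeft (o : Osc N) (x : Ferm N) :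
    CliffordAlgebra.contractLeft (Q := (0 : QuadraticForm ℂ (Osc N →₀ ℂ))) (Finsupp.lapply o)
      (ExteriorAlgebra.map scaleOsc x) = (2 : ℂ) ^ oscCharge o •
    ExteriorAlgebra.map scaleOsc (CliffordAlgebra.contractLeft
      (Q := (0 : QuadraticForm ℂ (Osc N →₀ ℂ))) (Finsupp.lapply o) x) := by
  induction x using CliffordAlgebra.left_induction with
  | algebraMap r =>
    rw [CliffordAlgebra.contractLeft_algebraMap, map_zero, smul_zero]
    exact (congrArg _ (AlgHom.commutes _ r)).trans (CliffordAlgebra.contractLeft_algebraMap _ _ r)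
  | add x y hx hy => simp only [map_add, smul_add, hx, hy]
  | ι_mul x m hx =>
    have h1 : ExteriorAlgebra.map scaleOsc (ExteriorAlgebra.ι ℂ m * x) =
        ExteriorAlgebra.ι ℂ (scaleOsc m) * ExteriorAlgebra.map scaleOsc x := by
      rw [map_mul, ExteriorAlgebra.map_apply_ι]
    refine (congrArg _ h1).trans ?_
    refine (CliffordAlgebra.contractLeft_ι_mul _ _ _).trans ?_
    rw [hx, CliffordAlgebra.contractLeft_ι_mul, map_sub, smul_sub, map_smul]
    congr 1
    · rw [Finsupp.lapply_apply, Finsupp.lapply_apply, scaleOsc_apply, smul_smul]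
    · rw [mul_smul_comm]
      congr 1
      exact ((map_mul _ _ _).trans (by rw [ExteriorAlgebra.map_apply_ι])).symm

/-- `Φ^i_k` raises the charge by one, and `Ψ^i_k` lowers it. -/
theorem fm_chargeScale (b : Bool) (i : Fin N) (n : ℤ) : fm b i n * chargeScale N =
    (2 : ℂ) ^ (if b then 1 else -1 : ℤ) • (chargeScale N * fm b i n) := by
  rw [fm, chargeScale, ← onFerm_mul, ← onFerm_mul, ← onFerm_smul]
  congr 1
  refine LinearMap.ext fun x => ?_
  cases n with
  | ofNat k =>
    refine (map_scaleOsc_contractLeft _ x).trans ?_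
    cases b <;> rfl
  | negSucc k =>
    have h1 : ExteriorAlgebra.map scaleOsc
        (ExteriorAlgebra.ι ℂ (Finsupp.single (osc b i k) (1 : ℂ)) * x) =
        (2 : ℂ) ^ oscCharge (osc b i k) •
          (ExteriorAlgebra.ι ℂ (Finsupp.single (osc b i k) (1 : ℂ)) *
            ExteriorAlgebra.map scaleOsc x) := by
      rw [map_mul, ExteriorAlgebra.map_apply_ι, scaleOsc_single, map_smul, smul_mul_assoc]
    have h2 : (if b then 1 else -1 : ℤ) + oscCharge (osc b i k) = 0 := by
      cases b <;> simp [oscCharge, osc]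
    have h3 := congrArg (fun y => (2 : ℂ) ^ (if b then 1 else -1 : ℤ) • y) h1
    simp only [smul_smul, ← zpow_add₀ (two_ne_zero (α := ℂ)), h2, zpow_zero, one_smul] at h3
    exact h3.symm

theorem chargeScale_eq_diagOp :
    chargeScale N = diagOp (vlBasis N) fun a => (2 : ℂ) ^ charge a.2.1 := by
  refine diagOp_eq _ fun ⟨β, s, t⟩ => ?_
  rw [vlBasis_apply, fockBasis_apply, chargeScale, onFerm_single]
  have key : ∀ l : List (Osc N), ExteriorAlgebra.map scaleOsc
      (l.map fun o => ExteriorAlgebra.ι ℂ (Finsupp.single o (1 : ℂ))).prod =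
      (2 : ℂ) ^ (l.map oscCharge).sum •
        (l.map fun o => ExteriorAlgebra.ι ℂ (Finsupp.single o (1 : ℂ))).prod := by
    intro l
    induction l with
    | nil => simp
    | cons o l ih =>
      rw [List.map_cons, List.prod_cons, map_mul, ih, ExteriorAlgebra.map_apply_ι, scaleOsc_single,
        map_smul, smul_mul_smul_comm, List.map_cons, List.sum_cons, zpow_add₀ two_ne_zero]
  have h2 : charge s = ((s.sort (· ≤ ·)).map oscCharge).sum := by
    rw [charge_eq_sum, ← Multiset.sum_coe, ← Multiset.map_coe, Finset.sort_eq]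
    rfl
  rw [AlgHom.toLinearMap_apply, key, ← h2, pureFock_smul_left, ← Finsupp.smul_single]

end Charge

/-! ### Operators of definite charge and the charge filtration -/

section Charge

variable {N : ℕ}

theorem chargeScale_bm (b : Bool) (i : Fin N) (n : ℤ) :
    chargeScale N * bm b i n = bm b i n * chargeScale N := onFerm_bm _ _ _ _

theorem onFerm_eQ (f : Module.End ℂ (Ferm N)) (q : ℂ) (α : Lat N) (n : ℤ) :
    onFerm f * eQ q α n = eQ q α n * onFerm f := by
  have h : IsShift 0 (onFerm f) := IsShift.of_pure fun β x y => by
    rw [onFerm_single, zero_add]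
    exact single_mem_sector _ _
  rw [eQ, ← mul_assoc, onFerm_em, mul_assoc, deform_comm h, mul_assoc]

theorem chargeScale_diffMode (q : ℂ) (i : Fin N) (n : ℤ) :
    chargeScale N * diffMode q i n = diffMode q i n * chargeScale N := by
  rw [diffMode, mul_sub, sub_mul, chargeScale, onFerm_eQ, onFerm_eQ]

/-- `X` changes the charge of a homogeneous vector by `k`. -/
def ShiftsCharge (X : Module.End ℂ (VL N)) (k : ℤ) : Prop :=
  ∀ a c, (vlBasis N).repr (X (vlBasis N a)) c ≠ 0 → charge a.2.1 = charge c.2.1 - k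

/-- The charge is recovered from `2` to the power of the charge, since `2` is not a root of
unity. -/
theorem ShiftsCharge.of_chargeScale {X : Module.End ℂ (VL N)} {k : ℤ}
    (h : X * chargeScale N = (2 : ℂ) ^ (-k) • (chargeScale N * X)) : ShiftsCharge X k := by
  intro a c hac
  have h1 : X * diagOp (vlBasis N) (fun a => (2 : ℂ) ^ charge a.2.1) =
      diagOp (vlBasis N) (fun a => (2 : ℂ) ^ (charge a.2.1 - k)) * X := by
    rw [← chargeScale_eq_diagOp, h, ← smul_mul_assoc]
    congr 1
    refine diagOp_eq _ fun a => ?_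
    rw [LinearMap.smul_apply, chargeScale_eq_diagOp, diagOp_basis, smul_smul,
      ← zpow_add₀ two_ne_zero, add_comm, sub_eq_add_neg]
  have h2 := eq_of_mul_diagOp _ h1 hac
  -- The exponents are compared through absolute values, as `zpow` is injective on positive reals.
  have h3 : (2 : ℝ) ^ charge a.2.1 = 2 ^ (charge c.2.1 - k) := by
    simpa only [norm_zpow, Complex.norm_ofNat] using congrArg norm h2
  exact zpow_right_injective₀ two_pos (by norm_num) h3

/-- An operator whose terms contain one fermionic mode each has the charge of that mode. -/
theorem Expands.chargeScale {X : Module.End ℂ (VL N)} {b : Bool}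
    {c : Fin N → ℤ → Module.End ℂ (VL N)} {e : Fin N → ℤ → Module.End ℂ (VL N)}
    (hX : Expands X e) (he : ∀ i k, e i k = fm b i k * c i k)
    (hc : ∀ i k, chargeScale N * c i k = c i k * chargeScale N) :
    X * ChiralPN.chargeScale N = (2 : ℂ) ^ (if b then 1 else -1 : ℤ) •
      (ChiralPN.chargeScale N * X) :=
  hX.eq_smul _ fun i k => by
    rw [he, mul_assoc, ← hc, ← mul_assoc, fm_chargeScale, smul_mul_assoc, mul_assoc]

theorem shiftsCharge_D (q : ℂ) : ShiftsCharge (D N q) (-1) :=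
  .of_chargeScale <| (expands_D q).chargeScale (b := true) (fun _ _ => rfl)
    fun _ _ => chargeScale_diffMode _ _ _

theorem shiftsCharge_G : ShiftsCharge (G N) (-1) :=
  .of_chargeScale <| expands_G.chargeScale (b := true) (fun _ _ => rfl)
    fun _ _ => chargeScale_bm _ _ _

theorem shiftsCharge_fm_true (i : Fin N) (n : ℤ) : ShiftsCharge (fm true i n) (-1) :=
  .of_chargeScale (fm_chargeScale true i n)

theorem ShiftsCharge.add {X Y : Module.End ℂ (VL N)} {k : ℤ} (hX : ShiftsCharge X k)
    (hY : ShiftsCharge Y k) : ShiftsCharge (X + Y) k := by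
  intro a c hac
  rw [LinearMap.add_apply, map_add, Finsupp.add_apply] at hac
  by_cases h : (vlBasis N).repr (X (vlBasis N a)) c = 0
  · exact hY a c (by rwa [h, zero_add] at hac)
  · exact hX a c h

theorem ShiftsCharge.sum {ι : Type*} (s : Finset ι) {X : ι → Module.End ℂ (VL N)} {k : ℤ}
    (hX : ∀ i, ShiftsCharge (X i) k) : ShiftsCharge (∑ i ∈ s, X i) k := by
  classical
  induction s using Finset.induction_on with
  | empty =>
    intro a c hac
    simp at hac
  | insert i s hi ih => rw [Finset.sum_insert hi]; exact (hX i).add ih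

theorem ShiftsCharge.mul_diagOp {X : Module.End ℂ (VL N)} {k : ℤ} (hX : ShiftsCharge X k)
    (f : Idx N → ℂ) : ShiftsCharge (X * diagOp (vlBasis N) f) k := by
  intro a c hac
  rw [Module.End.mul_apply, diagOp_basis, map_smul, map_smul, Finsupp.smul_apply, smul_ne_zero_iff]
    at hac
  exact hX a c hac.2

variable (N) in
/-- The projection onto the span of the monomials of charge at most `n`. -/
def chargeProj (n : ℤ) : Module.End ℂ (VL N) :=
  diagOp (vlBasis N) fun a => if charge a.2.1 ≤ n then 1 else 0

theorem ShiftsCharge.chargeProj {X : Module.End ℂ (VL N)} {k : ℤ} (hX : ShiftsCharge X k) (n : ℤ) :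
    X * chargeProj N n = ChiralPN.chargeProj N (n + k) * X :=
  mul_diagOp_of _ fun a c hac => by
    have := hX a c hac
    congr 1
    rw [eq_iff_iff]
    omega

theorem mem_chargeLE_iff_repr {n : ℤ} {x : VL N} :
    x ∈ chargeLE N n ↔ ∀ a, (vlBasis N).repr x a ≠ 0 → charge a.2.1 ≤ n := by
  have h : {v | ∃ (α : Lat N) (s : Finset (Osc N)) (t : Osc N →₀ ℕ),
      charge s ≤ n ∧ v = Finsupp.single α (fockBasis N (s, t))} =
      vlBasis N '' {a | charge a.2.1 ≤ n} := by
    ext v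
    constructor
    · rintro ⟨α, s, t, hs, rfl⟩
      exact ⟨⟨α, (s, t)⟩, hs, vlBasis_apply α s t⟩
    · rintro ⟨⟨α, s, t⟩, hs, rfl⟩
      exact ⟨α, s, t, hs, vlBasis_apply α s t⟩
  rw [chargeLE, h, Module.Basis.mem_span_image]
  exact ⟨fun h a ha => h (Finsupp.mem_support_iff.mpr ha),
    fun h a ha => h a (Finsupp.mem_support_iff.mp ha)⟩

theorem mem_chargeLE {n : ℤ} {x : VL N} : x ∈ chargeLE N n ↔ chargeProj N n x = x :=
  mem_chargeLE_iff_repr.trans (diagOp_eq_self_iff _ _ _).symm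

theorem exists_mem_chargeLE (x : VL N) : ∃ n, x ∈ chargeLE N n := by
  obtain ⟨M, hM⟩ := (((vlBasis N).repr x).support.image fun a => charge a.2.1).bddAbove
  refine ⟨M, mem_chargeLE_iff_repr.mpr fun a ha => hM ?_⟩
  exact Finset.mem_coe.mpr (Finset.mem_image_of_mem _ (Finsupp.mem_support_iff.mpr ha))

theorem chargeLE_mono {m n : ℤ} (h : m ≤ n) : chargeLE N m ≤ chargeLE N n := fun _ hx =>
  mem_chargeLE_iff_repr.mpr fun a ha => (mem_chargeLE_iff_repr.mp hx a ha).trans h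

theorem ShiftsCharge.mem_chargeLE {X : Module.End ℂ (VL N)} {k : ℤ} (hX : ShiftsCharge X k)
    {n : ℤ} {x : VL N} (hx : x ∈ chargeLE N n) : X x ∈ chargeLE N (n + k) := by
  rw [ChiralPN.mem_chargeLE] at hx ⊢
  have := LinearMap.congr_fun (hX.chargeProj n) x
  rw [Module.End.mul_apply, Module.End.mul_apply, hx] at this
  exact this.symm

end Charge

/-! ### The contracting homotopy of `Q_0` -/

section Homotopy

variable {N : ℕ}

/-- `X` preserves the `L_B`-component of the lattice vector and the conformal weight. -/
def Neutral (q : ℂ) (X : Module.End ℂ (VL N)) : Prop :=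
  (∀ i, X * bm false i 0 = bm false i 0 * X) ∧ X * L0 N q = L0 N q * X

theorem Neutral.mul_diagOp {q : ℂ} {X : Module.End ℂ (VL N)} (hX : Neutral q X)
    (g : (Fin N → ℤ) → ℤ → ℂ) :
    X * diagOp (vlBasis N) (fun a => g a.1.2 (confWeight a)) =
      diagOp (vlBasis N) (fun a => g a.1.2 (confWeight a)) * X := by
  refine mul_diagOp_of _ fun a c hac => ?_
  have h1 : a.1.2 = c.1.2 := funext fun i => by
    have h := hX.1 i
    rw [bm_zero_eq_diagOp] at h
    exact_mod_cast eq_of_mul_diagOp _ h hac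
  have h2 : confWeight a = confWeight c := by
    have h := hX.2
    rw [L0_eq_diagOp] at h
    exact_mod_cast eq_of_mul_diagOp _ h hac
  rw [h1, h2]

theorem mul_anticomm_comm {E : Type*} [Ring E] {X A B : E} (hA : X * A + A * X = 0)
    (hB : X * B + B * X = 0) : X * (A * B + B * A) = (A * B + B * A) * X := by
  have h : X * (A * B + B * A) - (A * B + B * A) * X =
      (X * A + A * X) * B - A * (X * B + B * X) + (X * B + B * X) * A - B * (X * A + A * X) := by
    noncomm_ring
  rw [hA, hB] at h
  simpa [sub_eq_zero] using h

theorem neg_smul_add_mul {E : Type*} [Ring E] [Algebra ℂ E] (x y d : E) :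
    ((-1 : ℂ) • x + y + x) * d = y * d := by
  rw [neg_one_smul, neg_add_cancel_comm]

/-- `D` commutes with `L_0 = Q_0 G + G Q_0`, because it anticommutes with both factors. -/
theorem neutral_D (q : ℂ) : Neutral q (D N q) :=
  ⟨fun i => D_bm_false q i 0, mul_anticomm_comm (D_Q0 q) (D_G q)⟩

theorem neutral_Q0 (q : ℂ) : Neutral q (Q0 N q) := by
  refine ⟨fun i => Q0_bm_false q i 0, ?_⟩
  rw [L0, mul_add, add_mul, ← mul_assoc, Q0_sq, zero_mul, zero_add, mul_assoc (G N), Q0_sq,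
    mul_zero, add_zero, mul_assoc]

theorem neutral_fm_false (q : ℂ) (i : Fin N) : Neutral q (fm false i (-1)) := by
  refine ⟨fun j => fm_bm _ _ _ _ _ _, ?_⟩
  rw [L0_fm_false, Int.cast_neg, Int.cast_one, neg_add_cancel, neg_zero, zero_smul, add_zero]

variable (N) in
/-- The projection onto the span of the monomials of conformal weight `0` whose lattice vector lies
in `L_A`, namely the `Φ^{i_1}_0 ⋯ Φ^{i_r}_0 e^β` with `β ∈ L_A`. -/
def coreProj : Module.End ℂ (VL N) :=
  diagOp (vlBasis N) fun a => if a.1.2 = 0 ∧ confWeight a = 0 then 1 else 0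

/-- `1 / m_i` if `m_i` is the first non-zero component of `m`, and `0` otherwise. -/
def leadInv (m : Fin N → ℤ) (i : Fin N) : ℂ :=
  if m i ≠ 0 ∧ ∀ j < i, m j = 0 then (m i : ℂ)⁻¹ else 0

/-- The `leadInv m i` express `1` as a combination of the components of a nonzero vector. -/
theorem sum_mul_leadInv (m : Fin N → ℤ) :
    ∑ i, (m i : ℂ) * leadInv m i = if m = 0 then 0 else 1 := by
  split_ifs with h
  · simp [h]
  · obtain ⟨i, hi, hmin⟩ := WellFounded.has_min (wellFounded_lt (α := Fin N)) {i | m i ≠ 0}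
      (Function.ne_iff.mp h)
    have hi' : m i ≠ 0 := hi
    have hl : ∀ j < i, m j = 0 := fun j hj => by
      by_contra h0
      exact hmin j h0 hj
    rw [Finset.sum_eq_single i]
    · rw [leadInv, if_pos ⟨hi', hl⟩, mul_inv_cancel₀ (Int.cast_ne_zero.mpr hi')]
    · intro j _ hj
      rcases lt_or_gt_of_ne hj with h1 | h1
      · rw [hl j h1, Int.cast_zero, zero_mul]
      · rw [leadInv, if_neg fun h2 => hi' (h2.2 i h1), mul_zero]
    · simp

variable (N) in
/-- The contracting homotopy of `Q_0` onto the image of `coreProj`: it is `G / L_0` where the lattice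
vector lies in `L_A`, and `Ψ^i_0 / m_i`, where `m_i` is the first non-zero coefficient of the `B^i`,
elsewhere. -/
def homotopy : Module.End ℂ (VL N) :=
  G N * diagOp (vlBasis N) (fun a => if a.1.2 = 0 then (confWeight a : ℂ)⁻¹ else 0) +
    ∑ i, fm true i 0 * diagOp (vlBasis N) fun a => leadInv a.1.2 i

theorem shiftsCharge_homotopy : ShiftsCharge (homotopy N) (-1) :=
  (shiftsCharge_G.mul_diagOp _).add
    (ShiftsCharge.sum _ fun i => (shiftsCharge_fm_true i 0).mul_diagOp _)

theorem Neutral.coreProj {q : ℂ} {X : Module.End ℂ (VL N)} (hX : Neutral q X) :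
    X * coreProj N = ChiralPN.coreProj N * X :=
  hX.mul_diagOp fun m l => if m = 0 ∧ l = 0 then 1 else 0

theorem coreProj_mul_self : coreProj N * coreProj N = coreProj N := by
  rw [coreProj, diagOp_mul]
  congr 1
  funext a
  split_ifs <;> simp

/-- The anticommutator of a neutral operator with `homotopy`: the diagonal factors are functions of
conserved quantities and come out. -/
theorem anticomm_homotopy {q : ℂ} {X : Module.End ℂ (VL N)} (hX : Neutral q X) :
    X * homotopy N + homotopy N * X =
      (X * G N + G N * X) *
        diagOp (vlBasis N) (fun a => if a.1.2 = 0 then (confWeight a : ℂ)⁻¹ else 0) +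
      ∑ i, (X * fm true i 0 + fm true i 0 * X) *
        diagOp (vlBasis N) fun a => leadInv a.1.2 i := by
  have h1 := hX.mul_diagOp fun m l => if m = 0 then (l : ℂ)⁻¹ else 0
  have h2 := fun i => hX.mul_diagOp fun m _ => leadInv m i
  rw [homotopy, mul_add, add_mul, Finset.mul_sum, Finset.sum_mul, add_add_add_comm,
    ← Finset.sum_add_distrib]
  congr 1
  · rw [mul_assoc (G N), ← h1, add_mul, mul_assoc, mul_assoc]
  · refine Finset.sum_congr rfl fun i _ => ?_
    rw [mul_assoc (fm _ _ _), ← h2, add_mul, mul_assoc, mul_assoc]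

theorem D_homotopy (q : ℂ) : D N q * homotopy N + homotopy N * D N q = 0 := by
  rw [anticomm_homotopy (neutral_D q), D_G, zero_mul, zero_add]
  refine Finset.sum_eq_zero fun i _ => ?_
  rw [D_fm_true, ← add_zero ((-1 : ℂ) • _)]
  exact (neg_smul_add_mul _ _ _).trans (zero_mul _)

theorem Q0_homotopy (q : ℂ) : Q0 N q * homotopy N + homotopy N * Q0 N q = 1 - coreProj N := by
  rw [anticomm_homotopy (neutral_Q0 q), eq_sub_iff_add_eq]
  change L0 N q * _ + _ + _ = _
  have h : ∀ i, (Q0 N q * fm true i 0 + fm true i 0 * Q0 N q) *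
      diagOp (vlBasis N) (fun a => leadInv a.1.2 i) =
      diagOp (vlBasis N) fun a => (a.1.2 i : ℂ) * leadInv a.1.2 i := by
    intro i
    rw [Q0_fm_true, ← diagOp_mul, show diagOp (vlBasis N) (fun a => (a.1.2 i : ℂ)) = bm false i 0
      from (bm_zero_eq_diagOp false i).symm]
    exact neg_smul_add_mul _ _ _
  refine (vlBasis N).ext fun a => ?_
  simp only [h, LinearMap.add_apply, LinearMap.sum_apply, L0_eq_diagOp, diagOp_mul, diagOp_basis,
    coreProj, Module.End.one_apply]
  rw [← Finset.sum_smul, sum_mul_leadInv, ← add_smul, ← add_smul]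
  by_cases hm : a.1.2 = 0
  · by_cases hl : confWeight a = 0
    · simp [hm, hl]
    · have : (confWeight a : ℂ) ≠ 0 := Int.cast_ne_zero.mpr hl
      simp [hm, hl, this]
  · simp [hm]

/-- The monomials on which `coreProj` does not vanish involve only the oscillators `Φ^i_0`. -/
theorem core_index {a : Idx N} (h : a.1.2 = 0 ∧ confWeight a = 0) :
    a.2.2 = 0 ∧ ∀ o ∈ a.2.1, ∃ i, o = osc false i 0 := by
  have hw : weight a = 0 := by
    have := h.2
    rw [confWeight, h.1] at this
    simpa using this
  rw [weight, add_eq_zero, Finset.sum_eq_zero_iff] at hw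
  constructor
  · have h1 := hw.1
    by_contra h0
    have hne : Finsupp.toMultiset a.2.2 ≠ 0 := fun h2 =>
      h0 (by rw [← Finsupp.toMultiset_toFinsupp a.2.2, h2, map_zero])
    obtain ⟨o, ho⟩ := Multiset.exists_mem_of_ne_zero hne
    have h2 := Multiset.le_sum_of_mem (Multiset.mem_map_of_mem oscWeight ho)
    rw [h1, oscWeight] at h2
    omega
  · intro o ho
    have h1 := hw.2 o ho
    rw [fermWeight, add_eq_zero] at h1
    refine ⟨(ofLex (ofLex o).2).1, ?_⟩
    have h2 : (ofLex o).1 = false := by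
      by_contra h3
      rw [Bool.not_eq_false] at h3
      simp [h3] at h1
    have h3 : o = osc (ofLex o).1 (ofLex (ofLex o).2).1 (ofLex (ofLex o).2).2 := rfl
    rw [h2, h1.1] at h3
    exact h3

/-- The core has no component of negative charge. -/
theorem coreProj_mul_chargeProj : coreProj N * chargeProj N (-1) = 0 := by
  rw [coreProj, chargeProj, diagOp_mul]
  refine (vlBasis N).ext fun a => ?_
  rw [diagOp_basis, LinearMap.zero_apply]
  by_cases h : a.1.2 = 0 ∧ confWeight a = 0
  · have h1 : ¬ charge a.2.1 ≤ -1 := by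
      have h2 : (a.2.1.filter fun o => (ofLex o).1 = true) = ∅ := by
        refine Finset.filter_eq_empty_iff.mpr fun o ho h2 => ?_
        obtain ⟨i, rfl⟩ := (core_index h).2 o ho
        simp [osc] at h2
      rw [charge, h2, Finset.card_empty]
      omega
    rw [if_neg h1, mul_zero, zero_smul]
  · rw [if_neg h, zero_mul, zero_smul]

/-- The states `e^β`, `β ∈ L_A`, lie in the core. -/
theorem coreProj_expState {β : Lat N} (hβ : β.2 = 0) : coreProj N (expState β) = expState β := by
  have h : confWeight (⟨β, (∅, 0)⟩ : Idx N) = 0 := by simp [confWeight, weight, hβ]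
  rw [← vlBasis_vac, coreProj, diagOp_basis, if_pos ⟨hβ, h⟩, one_smul]

/-- To prove an equality of operators on the image of `coreProj`, it suffices to check the
exponentials `e^β` with `β ∈ L_A` and to propagate along the `Φ^i_0`. -/
theorem core_ext {X Y : Module.End ℂ (VL N)}
    (h0 : ∀ β : Lat N, β.2 = 0 → X (expState β) = Y (expState β))
    (hf : ∀ i v, coreProj N v = v → X v = Y v → X (fm false i (-1) v) = Y (fm false i (-1) v)) :
    X * coreProj N = Y * coreProj N := by
  refine (vlBasis N).ext fun a => ?_
  rw [Module.End.mul_apply, Module.End.mul_apply, coreProj, diagOp_basis]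
  by_cases h : a.1.2 = 0 ∧ confWeight a = 0
  · rw [if_pos h, one_smul]
    obtain ⟨h1, h2⟩ := core_index h
    obtain ⟨β, s, t⟩ := a
    obtain rfl : t = 0 := h1
    have key : ∀ l : List (Osc N), (∀ o ∈ l, ∃ i, o = osc false i 0) →
        coreProj N (Finsupp.single β (pureFock
          (l.map fun o => ExteriorAlgebra.ι ℂ (Finsupp.single o (1 : ℂ))).prod 1)) =
        Finsupp.single β (pureFock
          (l.map fun o => ExteriorAlgebra.ι ℂ (Finsupp.single o (1 : ℂ))).prod 1) ∧
        X (Finsupp.single β (pureFock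
          (l.map fun o => ExteriorAlgebra.ι ℂ (Finsupp.single o (1 : ℂ))).prod 1)) =
        Y (Finsupp.single β (pureFock
          (l.map fun o => ExteriorAlgebra.ι ℂ (Finsupp.single o (1 : ℂ))).prod 1)) := by
      intro l hl
      induction l with
      | nil => exact ⟨coreProj_expState h.1, h0 β h.1⟩
      | cons o l ih =>
        obtain ⟨i, rfl⟩ := hl o List.mem_cons_self
        obtain ⟨h5, h6⟩ := ih fun o ho => hl o (List.mem_cons_of_mem _ ho)
        have h3 := hf i _ h5 h6
        have h7 := LinearMap.congr_fun (neutral_fm_false 0 i).coreProj (Finsupp.single β (pureFock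
          (l.map fun o => ExteriorAlgebra.ι ℂ (Finsupp.single o (1 : ℂ))).prod 1))
        rw [Module.End.mul_apply, Module.End.mul_apply, h5] at h7
        have h4 := fm_creation false i 0 β
          (l.map fun o => ExteriorAlgebra.ι ℂ (Finsupp.single o (1 : ℂ))).prod 1
        rw [show -((0 : ℕ) : ℤ) - 1 = -1 by simp] at h4
        rw [h4] at h3 h7
        exact ⟨h7.symm, h3⟩
    have h3 := And.right <| key (s.sort (· ≤ ·)) fun o ho => h2 o (by simpa using ho)
    rw [vlBasis_apply, fockBasis_apply]
    exact h3
  · rw [if_neg h, zero_smul, map_zero, map_zero]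

theorem Q0_coreProj (q : ℂ) : Q0 N q * coreProj N = 0 := by
  have h := core_ext (X := Q0 N q) (Y := 0) (fun β hβ => ?_) fun i v _ hv => ?_
  · rw [h, zero_mul]
  · rw [Q0_expState, hβ]
    simp
  · have h1 := LinearMap.congr_fun (Q0_fm_false q i (-1)) v
    rw [Module.End.mul_apply, LinearMap.smul_apply, Module.End.mul_apply, hv] at h1
    rw [h1]
    simp

end Homotopy

/-! ### The spectral sequence of a contraction -/

section Perturbation

variable {V : Type*} [AddCommGroup V] [Module ℂ V]

/-- A bicomplex of differentials `Q`, `D` with a homotopy `H` that contracts `Q` onto the image of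
the projection `P` and anticommutes with `D`, together with an exhaustive filtration `F n`, the image
of the projection `T n`. The operator `D` lowers the filtration degree by one and `F (-1)` does not
meet the image of `P`. -/
structure Contraction (D Q H P : Module.End ℂ V) (F : ℤ → Submodule ℂ V)
    (T : ℤ → Module.End ℂ V) : Prop where
  D_sq : ∀ x, D (D x) = 0
  Q_sq : ∀ x, Q (Q x) = 0
  D_Q : ∀ x, D (Q x) + Q (D x) = 0
  D_H : ∀ x, D (H x) + H (D x) = 0
  Q_H : ∀ x, Q (H x) + H (Q x) = x - P x
  P_sq : ∀ x, P (P x) = P x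
  D_P : ∀ x, D (P x) = P (D x)
  Q_P : ∀ x, Q (P x) = 0
  P_Q : ∀ x, P (Q x) = 0
  mono : ∀ {m n}, m ≤ n → F m ≤ F n
  exhaust : ∀ x, ∃ n, x ∈ F n
  mem_iff : ∀ {n x}, x ∈ F n ↔ T n x = x
  P_T : ∀ n x, P (T n x) = T n (P x)
  D_T : ∀ n x, D (T (n + 1) x) = T n (D x)
  T_mem : ∀ n x, T n x ∈ F n
  H_mem : ∀ {n x}, x ∈ F n → H x ∈ F (n - 1)
  P_neg : ∀ {x}, x ∈ F (-1) → P x = 0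

namespace Contraction

variable {D Q H P : Module.End ℂ V} {F : ℤ → Submodule ℂ V} {T : ℤ → Module.End ℂ V}
  (h : Contraction D Q H P F T)
include h

theorem d_sq (x : V) : (D + Q) ((D + Q) x) = 0 := by
  simp only [LinearMap.add_apply, map_add]
  have h1 := h.D_Q x
  rw [h.D_sq, h.Q_sq, zero_add, add_zero, add_comm]
  exact h1

/-- `H` is also a homotopy for the total differential, since it anticommutes with `D`. -/
theorem eq_homotopy (x : V) : x = P x + ((D + Q) (H x) + H ((D + Q) x)) := by
  have h1 := h.D_H x
  have h2 := h.Q_H x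
  simp only [LinearMap.add_apply, map_add]
  rw [add_add_add_comm, h1, h2, zero_add, add_sub_cancel]

theorem P_d (x : V) : P ((D + Q) x) = D (P x) := by
  rw [LinearMap.add_apply, map_add, h.P_Q, add_zero, h.D_P]

theorem d_P (x : V) : (D + Q) (P x) = D (P x) := by
  rw [LinearMap.add_apply, h.Q_P, add_zero]

/-- A total cocycle is cohomologous to its projection. -/
theorem eq_of_cocycle {x : V} (hx : (D + Q) x = 0) : x = P x + (D + Q) (H x) := by
  have := h.eq_homotopy x
  rwa [hx, map_zero, add_zero] at this

/-- If `d y` has charge at most `-1`, then `P (d y) = 0`, and `d y = d (H d y)` with a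
correction `H d y` of charge less than that of `y`. So the approximate cocycles of a late page are
cocycles up to lower charge. -/
theorem converges : Converges (D + Q) F where
  exhaustive x hx := by
    obtain ⟨n, hn⟩ := h.exhaust x
    exact ⟨n, Submodule.mem_sup_left ⟨hn, hx⟩⟩
  separated x _ hF := by
    -- A cocycle of charge at most `-1` is a coboundary, since its projection vanishes.
    obtain ⟨y, ⟨hy, hdy⟩, z, hz, rfl⟩ := Submodule.mem_sup.mp (hF (-1))
    refine Submodule.add_mem _ ?_ hz
    rw [h.eq_of_cocycle hdy, h.P_neg hy, zero_add]
    exact ⟨_, rfl⟩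
  cycles n := by
    refine le_antisymm (fun x hx => ?_) (le_iInf fun r => sup_le_sup_right ?_ _)
    · rw [Submodule.mem_iInf] at hx
      -- This page is late enough that `d y` has charge at most `-1` and `H (d y)` at most `n - 1`.
      obtain ⟨y, ⟨hy, hdy⟩, z, hz, rfl⟩ := Submodule.mem_sup.mp (hx ((n + 2).toNat + 1))
      have hdy' : (D + Q) y ∈ F _ := hdy
      have hw := h.eq_of_cocycle (h.d_sq y)
      rw [h.P_neg (h.mono (by omega) hdy'), zero_add] at hw
      have hH : H ((D + Q) y) ∈ F (n - 1) := h.mono (by omega) (h.H_mem hdy')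
      rw [show y + z = (y - H ((D + Q) y)) + (H ((D + Q) y) + z) by abel]
      refine Submodule.add_mem_sup ⟨Submodule.sub_mem _ hy (h.mono (by omega) hH), ?_⟩
        (Submodule.add_mem _ hH hz)
      rw [SetLike.mem_coe, LinearMap.mem_ker, map_sub, ← hw, sub_self]
    · rintro x ⟨hx, hdx⟩
      refine ⟨hx, ?_⟩
      change (D + Q) x ∈ F _
      rw [LinearMap.mem_ker.mp hdx]
      exact Submodule.zero_mem _
  boundaries n := by
    refine le_antisymm (iSup_le fun r => sup_le_sup_right
      (inf_le_inf_left _ LinearMap.map_le_range) _) (fun x hx => ?_)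
    obtain ⟨y, ⟨hy, z, rfl⟩, w, hw, rfl⟩ := Submodule.mem_sup.mp hx
    obtain ⟨m, hm⟩ := h.exhaust z
    refine Submodule.mem_iSup_of_mem (m - n + 3).toNat ?_
    exact Submodule.add_mem_sup ⟨hy, z, h.mono (by omega) hm, rfl⟩ hw

/-- The class of `d x` has as a primitive the part of `P x` of low charge, corrected by the
homotopy: on the image of `P` the differential is `D`, which is homogeneous. -/
theorem differentialVanishes {r : ℕ} (hr : 2 ≤ r) : DifferentialVanishes (D + Q) F r := by
  intro n x _ hw
  refine Submodule.mem_sup_left ⟨hw, T (n + 1 - 2 * r + 1) (P x) + H ((D + Q) x),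
    Submodule.add_mem _ (h.mono (by omega) (h.T_mem _ _)) (h.mono (by omega) (h.H_mem hw)), ?_⟩
  have h1 := h.eq_of_cocycle (h.d_sq x)
  rw [map_add, ← h.P_T, h.d_P, h.P_T, h.D_T, ← h.P_d, ← h.P_T, h.mem_iff.mp hw, ← h1]

theorem anticomm : Q * D + D * Q = 0 := LinearMap.ext fun x => (add_comm _ _).trans (h.D_Q x)

end Contraction

/-! ### Cohomology classes and their representatives -/

section Comparison

variable {D Q H P : Module.End ℂ V} {F : ℤ → Submodule ℂ V} {T : ℤ → Module.End ℂ V}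

theorem Represents.mem_ker {d : Module.End ℂ V} {x : V} {c : Coh d} (h : Represents d x c) :
    d x = 0 := h.1

theorem exists_represents {d : Module.End ℂ V} (c : Coh d) : ∃ x, Represents d x c := by
  obtain ⟨⟨x, hx⟩, rfl⟩ := Submodule.mkQ_surjective _ c
  exact ⟨x, hx, rfl⟩

/-- The representatives of a class form a coset of the coboundaries. -/
theorem represents_iff_sub {d : Module.End ℂ V} {x y : V} {c : Coh d} (hx : Represents d x c) :
    Represents d y c ↔ d y = 0 ∧ ∃ z, y = x + d z := by
  obtain ⟨hx, rfl⟩ := hx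
  constructor
  · rintro ⟨hy, h⟩
    refine ⟨hy, ?_⟩
    obtain ⟨z, hz⟩ := (Submodule.Quotient.eq _).mp h
    exact ⟨z, by rw [show d z = y - x from hz, add_sub_cancel]⟩
  · rintro ⟨hy, z, hz⟩
    refine ⟨hy, (Submodule.Quotient.eq _).mpr ⟨z, ?_⟩⟩
    change d z = y - x
    rw [hz, add_sub_cancel_left]

/-- A cocycle represents only one class. -/
theorem Represents.unique {d : Module.End ℂ V} {x : V} {c c' : Coh d} (h : Represents d x c)
    (h' : Represents d x c') : c = c' := by
  obtain ⟨_, rfl⟩ := h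
  obtain ⟨_, rfl⟩ := h'
  rfl

theorem represents_mk {d : Module.End ℂ V} {x : V} (hx : d x = 0) :
    Represents d x (Coh.mk d ⟨x, hx⟩) := ⟨hx, rfl⟩

theorem Represents.induced {d e : Module.End ℂ V} (h : d * e + e * d = 0) {x : V} {c : Coh d}
    (hx : Represents d x c) : Represents d (e x) (Coh.induced d e h c) := by
  obtain ⟨hx, rfl⟩ := hx
  exact ⟨mem_ker_of_anticomm h hx, rfl⟩

end Comparison

section CommonCocycles

variable {D Q : Module.End ℂ V} (h : Q * D + D * Q = 0)

/-- The class in the cohomology of `D + Q` of a common cocycle of `D` and `Q`. -/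
def totalClass (D Q : Module.End ℂ V) :
    (LinearMap.ker D ⊓ LinearMap.ker Q : Submodule ℂ V) →ₗ[ℂ] Coh (D + Q) :=
  Coh.mk (D + Q) ∘ₗ Submodule.inclusion fun x hx => by
    rw [LinearMap.mem_ker, LinearMap.add_apply, LinearMap.mem_ker.mp hx.1,
      LinearMap.mem_ker.mp hx.2, add_zero]

include h in
theorem induced_mk_eq_zero (x : (LinearMap.ker D ⊓ LinearMap.ker Q : Submodule ℂ V)) :
    Coh.induced Q D h (Coh.mk Q ⟨x.1, x.2.2⟩) = 0 := by
  have h1 := (represents_mk (d := Q) x.2.2).induced h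
  have h2 : D x.1 = 0 := x.2.1
  rw [h2] at h1
  exact h1.unique ⟨Submodule.zero_mem _, map_zero _⟩

/-- The class in the cohomology of `D` on the cohomology of `Q` of a common cocycle of `D`
and `Q`. -/
def iteratedClass : (LinearMap.ker D ⊓ LinearMap.ker Q : Submodule ℂ V) →ₗ[ℂ]
    Coh (Coh.induced Q D h) :=
  Coh.mk _ ∘ₗ (Coh.mk Q ∘ₗ Submodule.inclusion inf_le_right).codRestrict _ (induced_mk_eq_zero h)

theorem totalClass_eq_zero_iff (x : (LinearMap.ker D ⊓ LinearMap.ker Q : Submodule ℂ V)) :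
    totalClass D Q x = 0 ↔ ∃ z, x.1 = (D + Q) z :=
  (Submodule.Quotient.mk_eq_zero _).trans ⟨fun ⟨z, hz⟩ => ⟨z, hz.symm⟩, fun ⟨z, hz⟩ => ⟨z, hz.symm⟩⟩

/-- For a common cocycle, representing a class of the iterated cohomology through its class in the
cohomology of `Q` is the same as mapping to it under `iteratedClass`. -/
theorem represents_induced_iff {x : V} {u : Coh Q} {c : Coh (Coh.induced Q D h)} (hD : D x = 0)
    (hQ : Represents Q x u) :
    Represents (Coh.induced Q D h) u c ↔ iteratedClass h ⟨x, hD, hQ.mem_ker⟩ = c := by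
  obtain ⟨hx, rfl⟩ := hQ
  exact ⟨fun h1 => h1.2, fun h1 => ⟨induced_mk_eq_zero h ⟨x, hD, hx⟩, h1⟩⟩

/-- A common cocycle is trivial in the iterated cohomology if it is `D` of a cocycle of `Q`, up to
a coboundary of `Q`. -/
theorem iteratedClass_eq_zero_iff (x : (LinearMap.ker D ⊓ LinearMap.ker Q : Submodule ℂ V)) :
    iteratedClass h x = 0 ↔ ∃ y z, Q y = 0 ∧ x.1 = D y + Q z := by
  refine (Submodule.Quotient.mk_eq_zero _).trans ?_
  constructor
  · rintro ⟨u, hu⟩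
    obtain ⟨y, hy⟩ := exists_represents u
    have h1 : Represents Q (D y) (Coh.mk Q ⟨x.1, x.2.2⟩) := by
      have := hy.induced h
      rwa [show Coh.induced Q D h u = Coh.mk Q ⟨x.1, x.2.2⟩ from hu] at this
    obtain ⟨_, z, hz⟩ := (represents_iff_sub h1).mp (represents_mk x.2.2)
    exact ⟨y, z, hy.mem_ker, hz⟩
  · rintro ⟨y, z, hy, hz⟩
    refine ⟨Coh.mk Q ⟨y, hy⟩, ?_⟩
    exact ((represents_iff_sub ((represents_mk hy).induced h)).mpr ⟨x.2.2, z, hz⟩).unique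
      (represents_mk x.2.2)

end CommonCocycles

namespace Contraction

variable {D Q H P : Module.End ℂ V} {F : ℤ → Submodule ℂ V} {T : ℤ → Module.End ℂ V}
  (h : Contraction D Q H P F T)
include h

/-- Every class of the total cohomology contains a common cocycle, in the image of `P`. -/
theorem totalClass_surjective : Function.Surjective (totalClass D Q) := by
  intro c
  obtain ⟨x, hx⟩ := exists_represents c
  have h1 := h.eq_of_cocycle hx.mem_ker
  have h2 : D (P x) = 0 := by rw [← h.P_d, hx.mem_ker, map_zero]
  refine ⟨⟨P x, h2, h.Q_P x⟩, ?_⟩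
  refine Represents.unique (x := P x) ⟨_, rfl⟩ ((represents_iff_sub hx).mpr ⟨?_, -H x, ?_⟩)
  · rw [h.d_P, h2]
  · rw [map_neg, ← sub_eq_add_neg, eq_sub_iff_add_eq, ← h1]

/-- Every class of the iterated cohomology contains a common cocycle, in the image of `P`. -/
theorem iteratedClass_surjective : Function.Surjective (iteratedClass h.anticomm) := by
  intro c
  obtain ⟨u, hu⟩ := exists_represents c
  obtain ⟨y, hy⟩ := exists_represents u
  have h1 := h.Q_H y
  rw [hy.mem_ker, map_zero, add_zero] at h1
  have h2 : D (P y) = 0 := by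
    have h3 := hy.induced h.anticomm
    rw [hu.mem_ker] at h3
    obtain ⟨_, z, hz⟩ := (represents_iff_sub
      (show Represents Q 0 0 from ⟨Submodule.zero_mem _, map_zero _⟩)).mp h3
    rw [h.D_P, hz, zero_add, h.P_Q]
  have h4 : Represents Q (P y) u :=
    (represents_iff_sub hy).mpr ⟨h.Q_P y, -H y, by rw [map_neg, h1]; abel⟩
  exact ⟨⟨P y, h2, h.Q_P y⟩, (represents_induced_iff h.anticomm h2 h4).mp hu⟩

/-- In both cases a common cocycle `x` is trivial if and only if `P x` is `D` of an element of the
image of `P`. -/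
theorem ker_iteratedClass :
    LinearMap.ker (iteratedClass h.anticomm) = LinearMap.ker (totalClass D Q) := by
  ext x
  rw [LinearMap.mem_ker, LinearMap.mem_ker, iteratedClass_eq_zero_iff, totalClass_eq_zero_iff]
  have hD : D x.1 = 0 := x.2.1
  have hQ : Q x.1 = 0 := x.2.2
  have h1 := h.eq_of_cocycle (x := x.1) (by rw [LinearMap.add_apply, hD, hQ, add_zero])
  have h2 := h.Q_H x.1
  rw [hQ, map_zero, add_zero] at h2
  constructor
  · rintro ⟨y, z, -, hx⟩
    have h3 : P x.1 = (D + Q) (P y) := by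
      rw [hx, map_add, h.P_Q, add_zero, h.d_P, h.D_P]
    exact ⟨P y + H x.1, by rw [map_add, ← h3]; exact h1⟩
  · rintro ⟨z, hx⟩
    refine ⟨P z, H x.1, h.Q_P z, ?_⟩
    rw [h2, ← h.P_d, ← hx, add_sub_cancel]

/-- The cohomology of `D` on the cohomology of `Q` agrees with that of `D + Q`: both are quotients
of the space of common cocycles by the same subspace. -/
theorem exists_iterated_equiv :
    ∃ ψ : Coh (Coh.induced Q D h.anticomm) ≃ₗ[ℂ] Coh (D + Q),
      (∀ c, ∃ (x : V) (u : Coh Q), D x = 0 ∧ Represents Q x u ∧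
        Represents (Coh.induced Q D h.anticomm) u c) ∧
      ∀ (c) (x : V) (u : Coh Q), D x = 0 → Represents Q x u →
        Represents (Coh.induced Q D h.anticomm) u c → Represents (D + Q) x (ψ c) := by
  refine ⟨((iteratedClass h.anticomm).quotKerEquivOfSurjective h.iteratedClass_surjective).symm ≪≫ₗ
    (Submodule.quotEquivOfEq _ _ h.ker_iteratedClass ≪≫ₗ
      (totalClass D Q).quotKerEquivOfSurjective h.totalClass_surjective), fun c => ?_,
    fun c x u hD hQ hc => ?_⟩
  · obtain ⟨x, rfl⟩ := h.iteratedClass_surjective c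
    exact ⟨x, _, x.2.1, represents_mk x.2.2,
      (represents_induced_iff h.anticomm x.2.1 (represents_mk x.2.2)).mpr rfl⟩
  · rw [represents_induced_iff h.anticomm hD hQ] at hc
    rw [← hc, LinearEquiv.trans_apply, LinearEquiv.trans_apply,
      show ((iteratedClass h.anticomm).quotKerEquivOfSurjective h.iteratedClass_surjective).symm
        (iteratedClass h.anticomm ⟨x, hD, hQ.mem_ker⟩) = Submodule.Quotient.mk ⟨x, hD, hQ.mem_ker⟩
        from (LinearEquiv.symm_apply_eq _).mpr rfl]
    exact ⟨_, rfl⟩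

end Contraction

end Perturbation

/-! ### The contraction of `V_{L,q}` -/

section Contraction

variable {N : ℕ}

theorem coreProj_chargeProj_comm (n : ℤ) :
    coreProj N * chargeProj N n = chargeProj N n * coreProj N := by
  rw [coreProj, chargeProj, diagOp_mul, diagOp_mul]
  simp only [mul_comm]

theorem chargeProj_mem (n : ℤ) (x : VL N) : chargeProj N n x ∈ chargeLE N n := by
  refine mem_chargeLE_iff_repr.mpr fun a ha => ?_
  by_contra h
  rw [chargeProj, diagOp_repr, if_neg h, zero_mul] at ha
  exact ha rfl

theorem coreProj_eq_zero {x : VL N} (hx : x ∈ chargeLE N (-1)) : coreProj N x = 0 := by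
  have h := LinearMap.congr_fun (coreProj_mul_chargeProj (N := N)) x
  rwa [Module.End.mul_apply, mem_chargeLE.mp hx] at h

/-- The contraction of `V_{L,q}` onto the core, with the truncations by the charge. -/
theorem contraction (q : ℂ) :
    Contraction (D N q) (Q0 N q) (homotopy N) (coreProj N) (chargeLE N) (chargeProj N) where
  D_sq := LinearMap.congr_fun (D_sq q)
  Q_sq := LinearMap.congr_fun (Q0_sq q)
  D_Q := LinearMap.congr_fun (D_Q0 q)
  D_H := LinearMap.congr_fun (D_homotopy q)
  Q_H := LinearMap.congr_fun (Q0_homotopy q)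
  P_sq := LinearMap.congr_fun coreProj_mul_self
  D_P := LinearMap.congr_fun (neutral_D q).coreProj
  Q_P := LinearMap.congr_fun (Q0_coreProj q)
  P_Q := LinearMap.congr_fun ((neutral_Q0 q).coreProj.symm.trans (Q0_coreProj q))
  mono := chargeLE_mono
  exhaust := exists_mem_chargeLE
  mem_iff := mem_chargeLE
  P_T n x := LinearMap.congr_fun (coreProj_chargeProj_comm n) x
  D_T n x := by
    have := LinearMap.congr_fun ((shiftsCharge_D q).chargeProj (n + 1)) x
    rwa [add_neg_cancel_right] at this
  T_mem := chargeProj_mem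
  H_mem hx := shiftsCharge_homotopy.mem_chargeLE hx
  P_neg := coreProj_eq_zero

end Contraction

/-! ### The deformed group algebra of `L_A` -/

section LatticeMonomials

variable {N : ℕ}

/-- The space `ℂ[L_A]`, with basis the `e^n`, `n ∈ L_A`. -/
abbrev LatA (N : ℕ) : Type := (Fin N → ℤ) →₀ ℂ

/-- Multiplication by `e^α` in the deformed group algebra of `L_A`. -/
def xOp (q : ℂ) (α : Fin N → ℤ) : Module.End ℂ (LatA N) :=
  Finsupp.lsum ℂ fun n => q ^ (ht α + ht n - ht (α + n)) • Finsupp.lsingle (α + n)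

theorem xOp_single (q : ℂ) (α n : Fin N → ℤ) (c : ℂ) : xOp q α (Finsupp.single n c) =
    q ^ (ht α + ht n - ht (α + n)) • Finsupp.single (α + n) c := by
  simp [xOp]

theorem htTail_le_of {n : Fin N → ℤ} {k : ℕ} (h : ∀ i, -n i ≤ k) : htTail n ≤ k :=
  Finset.sup_le fun i _ => Int.toNat_le.mpr (h i)

variable {R : Type*} [CommRing R] [Algebra ℂ R]

/-- The monomial `∏ y_i^(n_i + k) T^k`, for `k` large enough. -/
def latMon (y : Fin N → R) (T : R) (n : Fin N → ℤ) (k : ℕ) : R :=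
  (∏ i, y i ^ (n i + k).toNat) * T ^ k

/-- The monomial `∏ y_i^{c_i} T^{c_{N+1}}`, where the `c_i ≥ 0` are the coefficients of the reduced
expression of `n` in terms of the `ξ_i`. -/
def redMon (y : Fin N → R) (T : R) (n : Fin N → ℤ) : R := latMon y T n (htTail n)

variable {q : ℂ} {y : Fin N → R} {T : R}

omit [Algebra ℂ R] in
theorem latMon_mul {m n : Fin N → ℤ} {k l : ℕ} (hk : htTail m ≤ k) (hl : htTail n ≤ l) :
    latMon y T m k * latMon y T n l = latMon y T (m + n) (k + l) := by
  rw [latMon, latMon, latMon, mul_mul_mul_comm, ← Finset.prod_mul_distrib, pow_add]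
  congr 1
  refine Finset.prod_congr rfl fun i _ => ?_
  rw [← pow_add]
  congr 1
  have h1 := neg_le_htTail m i
  have h2 := neg_le_htTail n i
  rw [Pi.add_apply]
  omega

/-- Raising the number of factors `T` multiplies by a power of `T ∏ y_i = q^{N+1}`. -/
theorem latMon_add (hT : T * ∏ i, y i = algebraMap ℂ R (q ^ (N + 1))) {n : Fin N → ℤ} {k : ℕ}
    (hk : htTail n ≤ k) (j : ℕ) :
    latMon y T n (k + j) = (q ^ (N + 1)) ^ j • latMon y T n k := by
  have h1 : latMon y T 0 j = algebraMap ℂ R ((q ^ (N + 1)) ^ j) := by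
    rw [map_pow, ← hT, mul_pow, latMon, mul_comm, ← Finset.prod_pow]
    simp
  have h0 : htTail (0 : Fin N → ℤ) ≤ j := htTail_le_of fun i => by simp
  rw [← add_zero n, ← latMon_mul hk h0, h1, add_zero, mul_comm, Algebra.smul_def]

/-- The reduced monomials multiply as the `e^n` in the deformed group algebra. The exponent of `q`
is `N + 1` times the excess of `htTail`. -/
theorem redMon_mul (hT : T * ∏ i, y i = algebraMap ℂ R (q ^ (N + 1))) (m n : Fin N → ℤ) :
    redMon y T m * redMon y T n = q ^ (ht m + ht n - ht (m + n)) • redMon y T (m + n) := by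
  have h := htTail_add m n
  rw [redMon, redMon, redMon, latMon_mul le_rfl le_rfl, ← Nat.add_sub_cancel' h,
    latMon_add hT le_rfl, ← pow_mul]
  congr 2
  have h1 := ht_cast m
  have h2 := ht_cast n
  have h3 := ht_cast (m + n)
  simp only [Pi.add_apply, Finset.sum_add_distrib] at h3
  have h4 := ht_add_le m n
  zify [h, h4]
  rw [h1, h2, h3]
  ring

omit [Algebra ℂ R] in
theorem redMon_zero : redMon y T 0 = 1 := by
  have h : htTail (0 : Fin N → ℤ) = 0 := Nat.le_zero.mp (htTail_le_of fun i => by simp)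
  simp [redMon, latMon, h]

omit [Algebra ℂ R] in
theorem redMon_single (i : Fin N) : redMon y T (Pi.single i 1) = y i := by
  classical
  have h : htTail (Pi.single i 1 : Fin N → ℤ) = 0 := Nat.le_zero.mp (htTail_le_of fun j => by
    rw [Pi.single_apply]; split_ifs <;> simp)
  rw [redMon, h, latMon, pow_zero, mul_one, Finset.prod_eq_single i]
  · simp
  · intro j _ hj
    simp [hj]
  · simp

omit [Algebra ℂ R] in
theorem redMon_neg_one (hN : 1 ≤ N) : redMon y T (fun _ => -1) = T := by
  have h : htTail (fun _ : Fin N => (-1 : ℤ)) = 1 :=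
    le_antisymm (htTail_le_of fun i => by simp)
      (by have := neg_le_htTail (fun _ : Fin N => (-1 : ℤ)) ⟨0, hN⟩; omega)
  rw [redMon, h, latMon]
  simp

/-- The linear map `ℂ[L_A] → R` that sends `A^i` to `y_i` and `-∑ A^i` to `T`. -/
def evalMon (y : Fin N → R) (T : R) : LatA N →ₗ[ℂ] R := Finsupp.linearCombination ℂ (redMon y T)

theorem evalMon_single (n : Fin N → ℤ) : evalMon y T (Finsupp.single n 1) = redMon y T n := by
  rw [evalMon, Finsupp.linearCombination_single, one_smul]

/-- `evalMon` is multiplicative for the deformed product. -/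
theorem evalMon_xOp (hT : T * ∏ i, y i = algebraMap ℂ R (q ^ (N + 1))) (α : Fin N → ℤ)
    (c : LatA N) : evalMon y T (xOp q α c) = redMon y T α * evalMon y T c := by
  induction c using Finsupp.induction_linear with
  | zero => simp
  | add c c' h h' => rw [map_add, map_add, h, h', map_add, mul_add]
  | single n c =>
    rw [xOp_single, map_smul, evalMon, Finsupp.linearCombination_single,
      Finsupp.linearCombination_single, mul_smul_comm, redMon_mul hT, smul_comm]

/-- The image of `evalMon` is the subalgebra generated by `T` and the `y_i`. -/
theorem range_evalMon (hN : 1 ≤ N) (hT : T * ∏ i, y i = algebraMap ℂ R (q ^ (N + 1)))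
    {S : Subalgebra ℂ R} (hS : S = Algebra.adjoin ℂ (insert T (Set.range y))) (x : R) (hx : x ∈ S) :
    ∃ c, evalMon y T c = x := by
  subst hS
  -- The image is closed under products by `evalMon_xOp`.
  have h1 : ∀ c c', ∃ e, evalMon y T e = evalMon y T c * evalMon y T c' := by
    intro c c'
    induction c using Finsupp.induction_linear with
    | zero => exact ⟨0, by simp⟩
    | add a b ha hb =>
      obtain ⟨e, he⟩ := ha
      obtain ⟨f, hf⟩ := hb
      exact ⟨e + f, by rw [map_add, he, hf, map_add, add_mul]⟩
    | single n a =>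
      refine ⟨a • xOp q n c', ?_⟩
      rw [map_smul, evalMon_xOp hT, evalMon, Finsupp.linearCombination_single, smul_mul_assoc]
  induction hx using Algebra.adjoin_induction with
  | mem x hx =>
    rcases hx with rfl | ⟨i, rfl⟩
    · exact ⟨_, (evalMon_single _).trans (redMon_neg_one hN)⟩
    · exact ⟨_, (evalMon_single _).trans (redMon_single i)⟩
  | algebraMap r =>
    exact ⟨r • Finsupp.single 0 1, by
      rw [map_smul, evalMon_single, redMon_zero, Algebra.algebraMap_eq_smul_one]⟩
  | add x y _ _ hx hy =>
    obtain ⟨e, rfl⟩ := hx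
    obtain ⟨f, rfl⟩ := hy
    exact ⟨e + f, map_add _ _ _⟩
  | mul x y _ _ hx hy =>
    obtain ⟨e, rfl⟩ := hx
    obtain ⟨f, rfl⟩ := hy
    exact h1 e f

end LatticeMonomials

/-! ### The family ring -/

section FamilyRing

open MvPolynomial in
/-- The polynomial `X ∏ (X + x_i) - q^{N+1}` over `ℂ[x_1, …, x_N]`. -/
def relPoly (N : ℕ) (q : ℂ) : Polynomial (MvPolynomial (Fin N) ℂ) :=
  Polynomial.X * ∏ i, (Polynomial.X + Polynomial.C (X i)) - Polynomial.C (C (q ^ (N + 1)))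

variable {N : ℕ} (q : ℂ)

/-- The relation is monic in `T`, so the family ring is free over `ℂ[x_1, …, x_N]`. -/
theorem relPoly_monic : (relPoly N q).Monic := by
  have h : (Polynomial.X * ∏ i : Fin N, (Polynomial.X +
      Polynomial.C (MvPolynomial.X i : MvPolynomial (Fin N) ℂ))).Monic :=
    Polynomial.monic_X.mul (Polynomial.monic_prod_of_monic _ _ fun i _ => Polynomial.monic_X_add_C _)
  refine h.sub_of_left (Polynomial.degree_C_le.trans_lt ?_)
  rw [Polynomial.degree_mul, Polynomial.degree_X, Polynomial.degree_prod]
  simp only [Polynomial.degree_X_add_C]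
  rw [Finset.sum_const, Finset.card_univ, Fintype.card_fin, nsmul_one]
  exact_mod_cast Nat.zero_lt_of_lt (Nat.lt_one_add_iff.mpr (Nat.zero_le N))

variable (N) in
/-- The free extension `ℂ[x_1, …, x_N][T] / (T ∏ (T + x_i) - q^{N+1})` of `ℂ[x_1, …, x_N]`. -/
abbrev FamilyRing : Type := AdjoinRoot (relPoly N q)

variable (N) in
/-- The element `T` of the family ring. -/
def famT : FamilyRing N q := AdjoinRoot.root (relPoly N q)

/-- The element `x_i` of the family ring. -/
def famX (i : Fin N) : FamilyRing N q := AdjoinRoot.of (relPoly N q) (MvPolynomial.X i)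

theorem famT_mul_prod : famT N q * ∏ i, (famT N q + famX q i) =
    algebraMap ℂ (FamilyRing N q) (q ^ (N + 1)) := by
  have h := AdjoinRoot.mk_self (f := relPoly N q)
  rw [relPoly, map_sub, map_mul, map_prod, sub_eq_zero, AdjoinRoot.mk_X, AdjoinRoot.mk_C] at h
  simp only [map_add, AdjoinRoot.mk_X, AdjoinRoot.mk_C] at h
  exact h

theorem evalMon_family_surjective (hN : 1 ≤ N) : Function.Surjective
    (evalMon (fun i => famT N q + famX q i) (famT N q)) := by
  intro b
  refine range_evalMon hN (famT_mul_prod q) rfl b ?_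
  set S := Algebra.adjoin ℂ (insert (famT N q) (Set.range fun i => famT N q + famX q i))
  have hT : famT N q ∈ S := Algebra.subset_adjoin (Set.mem_insert _ _)
  have hX : ∀ i, famX q i ∈ S := fun i => by
    have h : famT N q + famX q i ∈ S :=
      Algebra.subset_adjoin (Set.mem_insert_of_mem _ ⟨i, rfl⟩)
    simpa using S.sub_mem h hT
  have hA : ∀ a, AdjoinRoot.of (relPoly N q) a ∈ S := by
    intro a
    induction a using MvPolynomial.induction_on with
    | C c => exact S.algebraMap_mem c
    | add a b ha hb => rw [map_add]; exact S.add_mem ha hb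
    | mul_X a i ha => rw [map_mul]; exact S.mul_mem ha (hX i)
  induction b using AdjoinRoot.induction_on with
  | ih p =>
    induction p using Polynomial.induction_on with
    | C a => rw [AdjoinRoot.mk_C]; exact hA a
    | add p p' h h' => rw [map_add]; exact S.add_mem h h'
    | monomial n a _ =>
      rw [map_mul, map_pow, AdjoinRoot.mk_C, AdjoinRoot.mk_X]
      exact S.mul_mem (hA a) (S.pow_mem hT _)

end FamilyRing

/-! ### The group algebra as the family ring, and division by its parameters -/

section FamilyBasis

variable {N : ℕ} (q : ℂ)

/-- The lattice vector of the monomial `∏ X_i^{d_i} X_0^{d_0}` in variables `X_1, …, X_N, X_0`. -/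
def offset (d : Option (Fin N) →₀ ℕ) (i : Fin N) : ℤ := d (some i) - d none

/-- The linear map on polynomials in `X_1, …, X_N, X_0` that replaces a monomial by a power of
`q^{N+1}` times the corresponding element of `ℂ[L_A]`; it inverts `evalMon`. -/
def readMon : MvPolynomial (Option (Fin N)) ℂ →ₗ[ℂ] LatA N :=
  (MvPolynomial.basisMonomials _ ℂ).constr ℂ fun d =>
    (q ^ (N + 1)) ^ (d none - htTail (offset d)) • Finsupp.single (offset d) 1

theorem readMon_monomial (d : Option (Fin N) →₀ ℕ) : readMon q (MvPolynomial.monomial d 1) =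
    (q ^ (N + 1)) ^ (d none - htTail (offset d)) • Finsupp.single (offset d) 1 := by
  rw [← show MvPolynomial.basisMonomials _ ℂ d = _ from
    congr_fun (MvPolynomial.coe_basisMonomials _ _) d, readMon, Module.Basis.constr_basis]

theorem monomial_option (d : Option (Fin N) →₀ ℕ) :
    (∏ i, MvPolynomial.X (some i) ^ d (some i)) * MvPolynomial.X none ^ d none =
      MvPolynomial.monomial d (1 : ℂ) := by
  rw [MvPolynomial.monomial_eq, MvPolynomial.C_1, one_mul, Finsupp.prod_fintype _ _ (by simp),
    Fintype.prod_option, mul_comm]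

theorem readMon_evalMon (c : LatA N) : readMon q
    (evalMon (fun i => MvPolynomial.X (some i)) (MvPolynomial.X none) c) = c := by
  induction c using Finsupp.induction_linear with
  | zero => simp
  | add c c' h h' => rw [map_add, map_add, h, h']
  | single n c =>
    rw [← mul_one c, ← smul_eq_mul, ← Finsupp.smul_single, map_smul, map_smul, evalMon_single]
    congr 1
    -- The exponents of the reduced monomial of `n`.
    let d : Option (Fin N) →₀ ℕ := Finsupp.equivFunOnFinite.symm fun o =>
      o.elim (htTail n) fun i => (n i + htTail n).toNat
    have hd : offset d = n := funext fun i => by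
      have := neg_le_htTail n i
      change (((n i + htTail n).toNat : ℕ) : ℤ) - htTail n = n i
      omega
    have h1 := monomial_option d
    rw [redMon, latMon]
    refine (congrArg _ h1).trans ?_
    rw [readMon_monomial, hd, show d none = htTail n from rfl, Nat.sub_self, pow_zero, one_smul]

/-- `readMon` kills the ideal generated by `X_0 ∏ X_i - q^{N+1}`, so that it is defined on the
quotient. -/
theorem readMon_relation (r : MvPolynomial (Option (Fin N)) ℂ) :
    readMon q ((MvPolynomial.X none * ∏ i, MvPolynomial.X (some i) -
      MvPolynomial.C (q ^ (N + 1))) * r) = 0 := by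
  let e : Option (Fin N) →₀ ℕ := Finsupp.equivFunOnFinite.symm fun _ => 1
  have he : (MvPolynomial.X none * ∏ i, MvPolynomial.X (some i) :
      MvPolynomial (Option (Fin N)) ℂ) = MvPolynomial.monomial e 1 := by
    rw [← monomial_option, mul_comm]
    simp [e]
  have : (readMon (N := N) q) ∘ₗ LinearMap.mulLeft ℂ (MvPolynomial.X none *
      ∏ i : Fin N, MvPolynomial.X (some i) - MvPolynomial.C (q ^ (N + 1))) = 0 := by
    refine (MvPolynomial.basisMonomials _ ℂ).ext fun d => ?_
    rw [MvPolynomial.coe_basisMonomials, LinearMap.comp_apply, LinearMap.mulLeft_apply, sub_mul, he,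
      MvPolynomial.monomial_mul, MvPolynomial.C_mul', map_sub, map_smul, one_mul, readMon_monomial,
      readMon_monomial, LinearMap.zero_apply]
    have h1 : offset (e + d) = offset d := funext fun i => by simp [offset, e]
    have h2 : htTail (offset d) ≤ d none := htTail_le_of fun i => by simp [offset]
    have h3 : (e + d) none = 1 + d none := rfl
    rw [h1, h3, Nat.add_sub_assoc h2, add_comm 1, pow_succ', mul_smul, sub_self]
  exact LinearMap.congr_fun this r

/-- `evalMon` is natural in the algebra. -/
theorem map_evalMon {R S : Type*} [CommRing R] [Algebra ℂ R] [CommRing S] [Algebra ℂ S]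
    (f : R →ₐ[ℂ] S) (y : Fin N → R) (T : R) (c : LatA N) :
    f (evalMon y T c) = evalMon (fun i => f (y i)) (f T) c := by
  induction c using Finsupp.induction_linear with
  | zero => simp
  | add c c' h h' => rw [map_add, map_add, h, h', map_add]
  | single n c =>
    rw [evalMon, evalMon, Finsupp.linearCombination_single, Finsupp.linearCombination_single,
      map_smul, redMon, redMon, latMon, latMon]
    simp only [map_mul, map_prod, map_pow]

theorem eval_relPoly {S : Type*} [CommRing S] [Algebra ℂ S] (x : Fin N → S) (T : S)
    (h : T * ∏ i, (T + x i) = algebraMap ℂ S (q ^ (N + 1))) :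
    Polynomial.eval₂ ((MvPolynomial.aeval x : MvPolynomial (Fin N) ℂ →ₐ[ℂ] S) :
      MvPolynomial (Fin N) ℂ →+* S) T (relPoly N q) = 0 := by
  rw [relPoly, Polynomial.eval₂_sub, Polynomial.eval₂_mul, Polynomial.eval₂_finsetProd,
    Polynomial.eval₂_X, Polynomial.eval₂_C, sub_eq_zero]
  simp only [Polynomial.eval₂_add, Polynomial.eval₂_X, Polynomial.eval₂_C, RingHom.coe_coe,
    MvPolynomial.aeval_X]
  rw [h]
  exact (MvPolynomial.aeval_C x _).symm

/-- The homomorphism from the family ring with prescribed values at the `x_i` and `T`. -/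
def famLift {S : Type*} [CommRing S] [Algebra ℂ S] (x : Fin N → S) (T : S)
    (h : T * ∏ i, (T + x i) = algebraMap ℂ S (q ^ (N + 1))) : FamilyRing N q →ₐ[ℂ] S :=
  AdjoinRoot.liftAlgHom _ (MvPolynomial.aeval x) T (eval_relPoly q x T h)

section
variable {S : Type*} [CommRing S] [Algebra ℂ S] (x : Fin N → S) (T : S)
    (h : T * ∏ i, (T + x i) = algebraMap ℂ S (q ^ (N + 1)))

theorem famLift_famT : famLift q x T h (famT N q) = T := AdjoinRoot.liftAlgHom_root _ _ _ _

theorem famLift_famX (i : Fin N) : famLift q x T h (famX q i) = x i := by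
  rw [famLift, famX, AdjoinRoot.liftAlgHom_of, MvPolynomial.aeval_X]

end

/-- An element of the kernel is mapped by the universal property of the family ring to `0` in
`ℂ[X_1, …, X_N, X_0] / (X_0 ∏ X_i - q^{N+1})`, where `readMon` recovers it. -/
theorem evalMon_family_injective : Function.Injective
    (evalMon (fun i => famT N q + famX q i) (famT N q)) := by
  rw [← LinearMap.ker_eq_bot, LinearMap.ker_eq_bot']
  intro c hc
  let g : MvPolynomial (Option (Fin N)) ℂ :=
    MvPolynomial.X none * ∏ i, MvPolynomial.X (some i) - MvPolynomial.C (q ^ (N + 1))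
  let π := Ideal.Quotient.mkₐ ℂ (Ideal.span {g})
  have hg : π g = 0 := Ideal.Quotient.eq_zero_iff_mem.mpr (Ideal.mem_span_singleton_self g)
  have h0 : π (MvPolynomial.X none) * ∏ i, (π (MvPolynomial.X none) +
      (π (MvPolynomial.X (some i)) - π (MvPolynomial.X none))) =
      algebraMap ℂ _ (q ^ (N + 1)) := by
    simp only [add_sub_cancel]
    rw [← map_prod, ← map_mul, ← π.commutes, ← sub_eq_zero, ← map_sub]
    exact hg
  have h1 := congrArg (famLift q _ _ h0) hc
  rw [map_evalMon, map_zero, famLift_famT] at h1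
  simp only [map_add, famLift_famT, famLift_famX, add_sub_cancel] at h1
  rw [← map_evalMon] at h1
  obtain ⟨r, hr⟩ := Ideal.mem_span_singleton.mp (Ideal.Quotient.eq_zero_iff_mem.mp h1)
  rw [← readMon_evalMon q c, hr]
  exact readMon_relation q r

variable {q} in
/-- The linear isomorphism of `ℂ[L_A]` with the family ring that sends `A^i` to `T + x_i` and
`-∑ A^i` to `T`. -/
def famEquiv (hN : 1 ≤ N) : LatA N ≃ₗ[ℂ] FamilyRing N q :=
  LinearEquiv.ofBijective _ ⟨evalMon_family_injective q, evalMon_family_surjective q hN⟩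

theorem famEquiv_apply (hN : 1 ≤ N) (c : LatA N) : famEquiv (q := q) hN c =
    evalMon (fun i => famT N q + famX q i) (famT N q) c := rfl

/-- The operator `e^{A^i} - e^{-∑ A^j}` on `ℂ[L_A]`. -/
def diffOp (i : Fin N) : Module.End ℂ (LatA N) := xOp q (Pi.single i 1) - xOp q fun _ => -1

/-- Under `famEquiv` the operator `e^{A^i} - e^{-∑ A^j}` becomes multiplication by `x_i`. -/
theorem famEquiv_diffOp (hN : 1 ≤ N) (i : Fin N) (c : LatA N) :
    famEquiv hN (diffOp q i c) = famX q i * famEquiv hN c := by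
  rw [diffOp, LinearMap.sub_apply, map_sub, famEquiv_apply, famEquiv_apply,
    evalMon_xOp (famT_mul_prod q), evalMon_xOp (famT_mul_prod q), redMon_single,
    redMon_neg_one hN, ← sub_mul, add_sub_cancel_left, famEquiv_apply]

/-- Division by the variable `x_i`, with remainder, on polynomials. -/
def divX (i : Fin N) : Module.End ℂ (MvPolynomial (Fin N) ℂ) where
  toFun p := p.divMonomial (Finsupp.single i 1)
  map_add' p r := MvPolynomial.add_divMonomial _ _ _
  map_smul' c p := by
    ext s
    simp [MvPolynomial.coeff_divMonomial]

theorem divX_mul_self (i : Fin N) (p : MvPolynomial (Fin N) ℂ) :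
    divX i (MvPolynomial.X i * p) = p := MvPolynomial.X_mul_divMonomial i p

theorem divX_mul_of_ne {i j : Fin N} (hij : i ≠ j) (p : MvPolynomial (Fin N) ℂ) :
    divX i (MvPolynomial.X j * p) = MvPolynomial.X j * divX i p := by
  classical
  ext s
  change MvPolynomial.coeff s (MvPolynomial.divMonomial _ _) =
    MvPolynomial.coeff s (_ * MvPolynomial.divMonomial _ _)
  rw [MvPolynomial.coeff_divMonomial, MvPolynomial.coeff_X_mul', MvPolynomial.coeff_X_mul']
  have h : j ∈ (Finsupp.single i 1 + s).support ↔ j ∈ s.support := by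
    simp [hij]
  simp only [h]
  split_ifs with hj
  · rw [MvPolynomial.coeff_divMonomial]
    congr 1
    refine add_tsub_assoc_of_le (Finsupp.single_le_iff.mpr ?_) _
    exact Nat.one_le_iff_ne_zero.mpr (Finsupp.mem_support_iff.mp hj)
  · rfl

/-- Division by `x_i` on the family ring, coefficientwise in a basis over `ℂ[x_1, …, x_N]`. -/
def famDiv (i : Fin N) : Module.End ℂ (FamilyRing N q) :=
  let e := (AdjoinRoot.powerBasis' (relPoly_monic (N := N) q)).basis.equivFun.restrictScalars ℂ
  e.symm.toLinearMap ∘ₗ (divX i).compLeft _ ∘ₗ e.toLinearMap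

theorem famX_mul (i : Fin N) (b : FamilyRing N q) :
    famX q i * b = (MvPolynomial.X i : MvPolynomial (Fin N) ℂ) • b :=
  (Algebra.smul_def _ _).symm

theorem famDiv_mul_self (i : Fin N) (b : FamilyRing N q) : famDiv q i (famX q i * b) = b := by
  rw [famX_mul, famDiv]
  set e := (AdjoinRoot.powerBasis' (relPoly_monic (N := N) q)).basis.equivFun
  change e.symm (fun k => divX i (e ((MvPolynomial.X i : MvPolynomial (Fin N) ℂ) • b) k)) = b
  rw [map_smul]
  exact (congrArg e.symm (funext fun k => divX_mul_self i _)).trans (e.symm_apply_apply b)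

theorem famDiv_mul_of_ne {i j : Fin N} (hij : i ≠ j) (b : FamilyRing N q) :
    famDiv q i (famX q j * b) = famX q j * famDiv q i b := by
  rw [famX_mul, famX_mul, famDiv]
  set e := (AdjoinRoot.powerBasis' (relPoly_monic (N := N) q)).basis.equivFun
  change e.symm (fun k => divX i (e ((MvPolynomial.X j : MvPolynomial (Fin N) ℂ) • b) k)) =
    (MvPolynomial.X j : MvPolynomial (Fin N) ℂ) • e.symm (fun k => divX i (e b k))
  rw [map_smul, ← map_smul e.symm]
  exact congrArg e.symm (funext fun k => divX_mul_of_ne hij _)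

/-- Division by `e^{A^i} - e^{-∑ A^j}` on `ℂ[L_A]`: operators that are left inverse to the `i`-th of these
multiplications and commute with the others, as division by a variable does for polynomials. -/
theorem exists_division (hN : 1 ≤ N) : ∃ δ : Fin N → Module.End ℂ (LatA N),
    (∀ i, δ i * diffOp q i = 1) ∧ ∀ i j, i ≠ j → δ i * diffOp q j = diffOp q j * δ i := by
  let Θ := famEquiv (q := q) hN
  refine ⟨fun i => Θ.symm.toLinearMap ∘ₗ famDiv q i ∘ₗ Θ.toLinearMap, fun i => ?_,
    fun i j hij => ?_⟩
  · refine LinearMap.ext fun c => ?_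
    change Θ.symm (famDiv q i (Θ (diffOp q i c))) = c
    rw [famEquiv_diffOp, famDiv_mul_self, LinearEquiv.symm_apply_apply]
  · refine LinearMap.ext fun c => Θ.injective ?_
    change Θ (Θ.symm (famDiv q i (Θ (diffOp q j c)))) =
      Θ (diffOp q j (Θ.symm (famDiv q i (Θ c))))
    rw [famEquiv_diffOp, famEquiv_diffOp, LinearEquiv.apply_symm_apply,
      LinearEquiv.apply_symm_apply, famDiv_mul_of_ne q hij]

end FamilyBasis

/-! ### The quotient `ℂ[T]/(T^{N+1} - q^{N+1})` -/

section Quantum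

variable {N : ℕ} (q : ℂ)

variable (N) in
/-- The projection of `ℂ[T]` onto `ℂ[T]/(T^{N+1} - q^{N+1})`. -/
def quantumMk : ℂ[X] →ₐ[ℂ] QuantumRing N q :=
  Ideal.Quotient.mkₐ ℂ (Ideal.span {(Polynomial.X ^ (N + 1) - Polynomial.C (q ^ (N + 1)) : ℂ[X])})

theorem quantumMk_X : quantumMk N q Polynomial.X = quantumT N q := rfl

theorem quantumMk_C (a : ℂ) : quantumMk N q (Polynomial.C a) = algebraMap ℂ _ a :=
  (quantumMk N q).commutes a

theorem quantumT_pow : quantumT N q ^ (N + 1) = algebraMap ℂ (QuantumRing N q) (q ^ (N + 1)) := by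
  have h : quantumMk N q (Polynomial.X ^ (N + 1) - Polynomial.C (q ^ (N + 1))) = 0 :=
    Ideal.Quotient.eq_zero_iff_mem.mpr (Ideal.mem_span_singleton_self _)
  rwa [map_sub, sub_eq_zero, map_pow, quantumMk_X, quantumMk_C] at h

theorem quantumT_mul_prod : quantumT N q * ∏ _i : Fin N, quantumT N q =
    algebraMap ℂ (QuantumRing N q) (q ^ (N + 1)) := by
  rw [Finset.prod_const, Finset.card_univ, Fintype.card_fin, ← pow_succ', quantumT_pow]

variable (N) in
/-- The map `ℂ[L_A] → ℂ[T]/(T^{N+1} - q^{N+1})` that sends `e^n` to `T^{ht n}`. -/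
def toQuantum : LatA N →ₗ[ℂ] QuantumRing N q := evalMon (fun _ => quantumT N q) (quantumT N q)

theorem toQuantum_xOp (α : Fin N → ℤ) (c : LatA N) :
    toQuantum N q (xOp q α c) = toQuantum N q (Finsupp.single α 1) * toQuantum N q c := by
  rw [toQuantum, evalMon_xOp (quantumT_mul_prod q), evalMon_single]

theorem toQuantum_zero : toQuantum N q (Finsupp.single 0 1) = 1 :=
  (evalMon_single _).trans redMon_zero

theorem toQuantum_tail (hN : 1 ≤ N) :
    toQuantum N q (Finsupp.single (fun _ => -1) 1) = quantumT N q :=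
  (evalMon_single _).trans (redMon_neg_one hN)

theorem toQuantum_diffOp (hN : 1 ≤ N) (i : Fin N) (c : LatA N) :
    toQuantum N q (diffOp q i c) = 0 := by
  rw [diffOp, LinearMap.sub_apply, map_sub, toQuantum_xOp, toQuantum_xOp, toQuantum_tail q hN,
    show toQuantum N q (Finsupp.single (Pi.single i 1) 1) = quantumT N q from
      (evalMon_single _).trans (redMon_single i), sub_self]

/-- A homomorphism from `ℂ[T]/(T^{N+1} - q^{N+1})` is given by the image of `T`. -/
theorem exists_quantumLift {S : Type*} [CommRing S] [Algebra ℂ S] (t : S)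
    (ht : t ^ (N + 1) = algebraMap ℂ S (q ^ (N + 1))) :
    ∃ f : QuantumRing N q →ₐ[ℂ] S, f (quantumT N q) = t := by
  refine ⟨Ideal.Quotient.liftₐ (Ideal.span {(Polynomial.X ^ (N + 1) - Polynomial.C (q ^ (N + 1)) :
    ℂ[X])}) (Polynomial.aeval t) fun a ha => ?_, ?_⟩
  · obtain ⟨r, rfl⟩ := Ideal.mem_span_singleton.mp ha
    rw [map_mul, map_sub, map_pow, Polynomial.aeval_X, Polynomial.aeval_C, ht, sub_self, zero_mul]
  · exact Polynomial.aeval_X t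

theorem toQuantum_surjective (hN : 1 ≤ N) : Function.Surjective (toQuantum N q) := by
  intro b
  refine range_evalMon hN (quantumT_mul_prod q) rfl b ?_
  obtain ⟨p, rfl⟩ : ∃ p, quantumMk N q p = b := Ideal.Quotient.mk_surjective b
  have hT : quantumT N q ∈ Algebra.adjoin ℂ
      (insert (quantumT N q) (Set.range fun _ : Fin N => quantumT N q)) :=
    Algebra.subset_adjoin (Set.mem_insert _ _)
  induction p using Polynomial.induction_on with
  | C a => rw [quantumMk_C]; exact Subalgebra.algebraMap_mem _ a
  | add p p' h h' => rw [map_add]; exact Subalgebra.add_mem _ h h'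
  | monomial n a _ =>
    rw [map_mul, map_pow, quantumMk_C, quantumMk_X]
    exact Subalgebra.mul_mem _ (Subalgebra.algebraMap_mem _ a) (Subalgebra.pow_mem _ hT _)

/-- The kernel is generated by the `e^{A^i} - e^{-∑ A^j}`, because modulo the `x_i` the family ring
becomes `ℂ[T]/(T^{N+1} - q^{N+1})`. -/
theorem exists_of_toQuantum_eq_zero (hN : 1 ≤ N) {c : LatA N} (hc : toQuantum N q c = 0) :
    ∃ f : Fin N → LatA N, c = ∑ i, diffOp q i (f i) := by
  let J := Ideal.span (Set.range fun i => famX (N := N) q i)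
  let π := Ideal.Quotient.mkₐ ℂ J
  have hX : ∀ i, π (famX q i) = 0 := fun i =>
    Ideal.Quotient.eq_zero_iff_mem.mpr (Ideal.subset_span ⟨i, rfl⟩)
  have hT : π (famT N q) ^ (N + 1) = algebraMap ℂ _ (q ^ (N + 1)) := by
    rw [← π.commutes, ← famT_mul_prod, map_mul, map_prod]
    simp only [map_add, hX, add_zero]
    rw [Finset.prod_const, Finset.card_univ, Fintype.card_fin, ← pow_succ']
  obtain ⟨σ, hσ⟩ := exists_quantumLift q _ hT
  have h1 := congrArg σ hc
  rw [map_zero, toQuantum, map_evalMon, hσ] at h1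
  have h2 : π (famEquiv hN c) = 0 := by
    rw [famEquiv_apply, map_evalMon]
    simp only [map_add, hX, add_zero]
    exact h1
  obtain ⟨b, hb⟩ := Ideal.mem_span_range_iff_exists_fun.mp (Ideal.Quotient.eq_zero_iff_mem.mp h2)
  refine ⟨fun i => (famEquiv hN).symm (b i), (famEquiv (q := q) hN).injective ?_⟩
  rw [map_sum, ← hb]
  refine Finset.sum_congr rfl fun i _ => ?_
  rw [famEquiv_diffOp, LinearEquiv.apply_symm_apply, mul_comm]

end Quantum

/-! ### Operators on `ℂ[L_A]` and the core -/

section LatticeOperators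

variable {N : ℕ}

/-- `c ⊗ u ↦ u ⊗ c e^{m B}`. -/
def place (m : Fin N → ℤ) : LatA N →ₗ[ℂ] Fock N →ₗ[ℂ] VL N :=
  Finsupp.lsum ℂ fun n => LinearMap.toSpanSingleton ℂ (Fock N →ₗ[ℂ] VL N) (Finsupp.lsingle (n, m))

theorem place_single (m n : Fin N → ℤ) (c : ℂ) (u : Fock N) :
    place m (Finsupp.single n c) u = c • Finsupp.single (n, m) u := by
  simp [place, LinearMap.toSpanSingleton_apply]

/-- An operator on `ℂ[L_A]`, acting on `V_L`. -/
def onLat (f : Module.End ℂ (LatA N)) : Module.End ℂ (VL N) :=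
  Finsupp.lsum ℂ fun β : Lat N => place β.2 (f (Finsupp.single β.1 1))

theorem onLat_single (f : Module.End ℂ (LatA N)) (β : Lat N) (u : Fock N) :
    onLat f (Finsupp.single β u) = place β.2 (f (Finsupp.single β.1 1)) u := by
  simp [onLat]

/-- To check linear identities on `ℂ[L_A]` it suffices to do so on the `e^n`. -/
theorem LatA_ext {M : Type*} [AddCommGroup M] [Module ℂ M] {f g : LatA N →ₗ[ℂ] M}
    (h : ∀ n, f (Finsupp.single n 1) = g (Finsupp.single n 1)) : f = g := by
  refine Finsupp.lhom_ext fun n c => ?_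
  rw [← mul_one c, ← smul_eq_mul, ← Finsupp.smul_single, map_smul, map_smul, h]

theorem onLat_place (f : Module.End ℂ (LatA N)) (m : Fin N → ℤ) (c : LatA N) (u : Fock N) :
    onLat f (place m c u) = place m (f c) u := by
  have : (onLat f) ∘ₗ (place m).flip u = (place m).flip u ∘ₗ f := LatA_ext fun n => by
    simp only [LinearMap.comp_apply, LinearMap.flip_apply]
    rw [place_single, one_smul, onLat_single]
  exact LinearMap.congr_fun this c

theorem onLat_mul (f g : Module.End ℂ (LatA N)) : onLat (f * g) = onLat f * onLat g := by
  refine Finsupp.lhom_ext fun β u => ?_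
  rw [Module.End.mul_apply, onLat_single, onLat_single, onLat_place]
  rfl

theorem onLat_one : onLat (1 : Module.End ℂ (LatA N)) = 1 := by
  refine Finsupp.lhom_ext fun β u => ?_
  rw [onLat_single, Module.End.one_apply, place_single, one_smul]
  rfl

theorem onLat_sub (f g : Module.End ℂ (LatA N)) : onLat (f - g) = onLat f - onLat g := by
  refine Finsupp.lhom_ext fun β u => ?_
  rw [LinearMap.sub_apply, onLat_single, onLat_single, onLat_single, LinearMap.sub_apply, map_sub,
    LinearMap.sub_apply]

theorem onFock_onLat (g : Module.End ℂ (Fock N)) (f : Module.End ℂ (LatA N)) :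
    onFock g * onLat f = onLat f * onFock g := by
  refine Finsupp.lhom_ext fun β u => ?_
  rw [Module.End.mul_apply, Module.End.mul_apply, onFock_single, onLat_single, onLat_single]
  have : (onFock g) ∘ₗ (place β.2).flip u = (place β.2).flip (g u) := LatA_ext fun n => by
    simp only [LinearMap.comp_apply, LinearMap.flip_apply]
    rw [place_single, place_single, one_smul, one_smul, onFock_single]
  exact LinearMap.congr_fun this _

theorem fm_onLat (b : Bool) (i : Fin N) (n : ℤ) (f : Module.End ℂ (LatA N)) :
    fm b i n * onLat f = onLat f * fm b i n := onFock_onLat _ _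

theorem coreProj_onLat (f : Module.End ℂ (LatA N)) :
    coreProj N * onLat f = onLat f * coreProj N := by
  refine VL_basis_hom_ext fun β s t => ?_
  rw [← vlBasis_apply, Module.End.mul_apply, Module.End.mul_apply, coreProj, diagOp_basis, map_smul,
    vlBasis_apply, onLat_single]
  set c : ℂ := if β.2 = 0 ∧ confWeight (⟨β, (s, t)⟩ : Idx N) = 0 then 1 else 0 with hc
  have : coreProj N ∘ₗ (place β.2).flip (fockBasis N (s, t)) =
      c • (place β.2).flip (fockBasis N (s, t)) := LatA_ext fun n => by
    simp only [LinearMap.comp_apply, LinearMap.flip_apply, LinearMap.smul_apply]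
    rw [place_single, one_smul, ← vlBasis_apply, coreProj, diagOp_basis, hc]
    congr 2
    rw [eq_iff_iff]
    refine and_congr_right fun h => ?_
    change β.2 = 0 at h
    simp only [confWeight, weight, h]
    simp
  exact LinearMap.congr_fun this _

variable (N) in
/-- The inclusion of `ℂ[L_A]` into `V_L`. -/
def latInc : LatA N →ₗ[ℂ] VL N := (place 0).flip (pureFock 1 1)

theorem latInc_single (n : Fin N → ℤ) : latInc N (Finsupp.single n 1) = expState (n, 0) := by
  rw [latInc, LinearMap.flip_apply, place_single, one_smul, expState]

theorem onLat_latInc (f : Module.End ℂ (LatA N)) (c : LatA N) :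
    onLat f (latInc N c) = latInc N (f c) := onLat_place _ _ _ _

theorem coreProj_latInc (c : LatA N) : coreProj N (latInc N c) = latInc N c := by
  have : coreProj N ∘ₗ latInc N = latInc N := LatA_ext fun n => by
    rw [LinearMap.comp_apply, latInc_single, coreProj_expState rfl]
  exact LinearMap.congr_fun this c

/-- The fermionic annihilation modes kill `ℂ[L_A]`. -/
theorem fm_latInc (b : Bool) (i : Fin N) {n : ℤ} (hn : 0 ≤ n) (c : LatA N) :
    fm b i n (latInc N c) = 0 := by
  have : fm b i n ∘ₗ latInc N = 0 := LatA_ext fun k => by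
    rw [LinearMap.comp_apply, latInc_single, fm_vac _ _ hn, LinearMap.zero_apply]
  exact LinearMap.congr_fun this c

variable (N) in
open Classical in
/-- The projection of `V_L` onto `ℂ[L_A]` along the other monomials. -/
def latCoeff : VL N →ₗ[ℂ] LatA N := (vlBasis N).constr ℂ fun a =>
  if a.1.2 = 0 ∧ a.2 = (∅, 0) then Finsupp.single a.1.1 1 else 0

open Classical in
theorem latCoeff_basis (a : Idx N) : latCoeff N (vlBasis N a) =
    if a.1.2 = 0 ∧ a.2 = (∅, 0) then Finsupp.single a.1.1 1 else 0 :=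
  (vlBasis N).constr_basis _ _ _

theorem latCoeff_latInc (c : LatA N) : latCoeff N (latInc N c) = c := by
  have : latCoeff N ∘ₗ latInc N = LinearMap.id := LatA_ext fun n => by
    rw [LinearMap.comp_apply, latInc_single, ← vlBasis_vac, latCoeff_basis, if_pos ⟨rfl, rfl⟩]
    rfl
  exact LinearMap.congr_fun this c

open Classical in
/-- The projection onto `ℂ[L_A]` is diagonal in the monomials. -/
theorem latInc_latCoeff : latInc N ∘ₗ latCoeff N =
    diagOp (vlBasis N) fun a => if a.1.2 = 0 ∧ a.2 = (∅, 0) then 1 else 0 := by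
  refine diagOp_eq _ fun ⟨β, st⟩ => ?_
  rw [LinearMap.comp_apply, latCoeff_basis]
  split_ifs with h
  · obtain ⟨h1, h2⟩ := h
    obtain ⟨n, m⟩ := β
    obtain rfl : m = 0 := h1
    obtain rfl : st = (∅, 0) := h2
    rw [latInc_single, one_smul, vlBasis_vac]
  · rw [map_zero, zero_smul]

theorem latCoeff_onLat (f : Module.End ℂ (LatA N)) (x : VL N) :
    latCoeff N (onLat f x) = f (latCoeff N x) := by
  classical
  have : latCoeff N ∘ₗ onLat f = f ∘ₗ latCoeff N := VL_basis_hom_ext fun β s t => by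
    rw [LinearMap.comp_apply, LinearMap.comp_apply, onLat_single, ← vlBasis_apply, latCoeff_basis]
    set p : Prop := β.2 = 0 ∧ (s, t) = ((∅, 0) : Finset (Osc N) × (Osc N →₀ ℕ))
    have : latCoeff N ∘ₗ (place β.2).flip (fockBasis N (s, t)) =
        (if p then 1 else 0 : ℂ) • LinearMap.id := LatA_ext fun n => by
      simp only [LinearMap.comp_apply, LinearMap.flip_apply, LinearMap.smul_apply]
      rw [place_single, one_smul, ← vlBasis_apply, latCoeff_basis]
      change (if p then _ else _) = _
      split_ifs
      · rw [one_smul]; rfl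
      · rw [zero_smul]
    refine (LinearMap.congr_fun this _).trans ?_
    rw [LinearMap.smul_apply, LinearMap.id_apply]
    change _ = f (if p then _ else _)
    split_ifs
    · rw [one_smul]
    · rw [zero_smul, map_zero]
  exact LinearMap.congr_fun this x

theorem latCoeff_coreProj (x : VL N) : latCoeff N (coreProj N x) = latCoeff N x := by
  have : latCoeff N ∘ₗ coreProj N = latCoeff N := (vlBasis N).ext fun a => by
    rw [LinearMap.comp_apply, coreProj, diagOp_basis, map_smul, latCoeff_basis]
    by_cases h : a.1.2 = 0 ∧ a.2 = (∅, 0)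
    · have h1 : confWeight a = 0 := by simp [confWeight, weight, h.1, h.2]
      rw [if_pos ⟨h.1, h1⟩, one_smul]
    · rw [if_neg h, smul_zero]
  exact LinearMap.congr_fun this x

end LatticeOperators

/-! ### The Koszul complex -/

section Koszul

variable {N : ℕ} (q : ℂ)

theorem eQ_expState {α β : Lat N} (hα : α.2 = 0) (hβ : β.2 = 0) (n : ℤ) :
    eQ q α n (expState β) = q ^ (ht α.1 + ht β.1 - ht (α.1 + β.1)) •
      Finsupp.single (α + β) (pureFock 1 (creationExp α (-n - 1) 1)) := by
  rw [expState, eQ_single, em_single, pairing_eq_zero hα hβ, sub_zero, gammaCoeff_one, cocycle, hα]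
  simp

theorem eQ_expState_of_nonneg {α β : Lat N} (hα : α.2 = 0) (hβ : β.2 = 0) {n : ℤ} (hn : 0 ≤ n) :
    eQ q α n (expState β) = 0 := by
  obtain ⟨k, hk⟩ := Int.eq_negSucc_of_lt_zero (show -n - 1 < 0 by omega)
  have h : creationExp α (-n - 1) = 0 := by rw [hk]; rfl
  rw [eQ_expState q hα hβ, h, LinearMap.zero_apply, pureFock_zero_right, Finsupp.single_zero,
    smul_zero]

theorem creationExp_zero_one (α : Lat N) : creationExp α 0 (1 : Bos N) = 1 := by
  change expCoeff (creationSeries α) 0 (1 : Bos N) = 1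
  simp [expCoeff]

theorem eQ_neg_one_expState {α β : Lat N} (hα : α.2 = 0) (hβ : β.2 = 0) :
    eQ q α (-1) (expState β) = onLat (xOp q α.1) (expState β) := by
  rw [eQ_expState q hα hβ, show -(-1 : ℤ) - 1 = 0 by ring, creationExp_zero_one, expState,
    onLat_single, hβ, xOp_single, map_smul, LinearMap.smul_apply,
    place_single, one_smul]
  congr 2
  exact Prod.ext rfl (by rw [Prod.snd_add, hα, hβ, add_zero])

/-- On the core the mode of index `-1` of `E^i(z)` is multiplication by `e^{A^i} - e^{-∑ A^j}` in
the deformed group algebra. -/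
theorem diffMode_coreProj (i : Fin N) :
    diffMode q i (-1) * coreProj N = onLat (diffOp q i) * coreProj N := by
  refine core_ext (fun β hβ => ?_) fun j v _ hv => ?_
  · rw [diffMode, diffOp, onLat_sub, LinearMap.sub_apply, LinearMap.sub_apply]
    exact congrArg₂ _ (eQ_neg_one_expState q rfl hβ) (eQ_neg_one_expState q rfl hβ)
  · rw [← Module.End.mul_apply, ← Module.End.mul_apply, ← fm_diffMode, ← fm_onLat,
      Module.End.mul_apply, Module.End.mul_apply, hv]

variable (N) in
/-- The Koszul differential `∑ Ψ^i_0 (e^{A^i} - e^{-∑ A^j})`, to which `D` reduces on the image of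
`coreProj`. -/
def koszulD : Module.End ℂ (VL N) := ∑ i, fm true i 0 * onLat (diffOp q i)

theorem D_expState {β : Lat N} (hβ : β.2 = 0) : D N q (expState β) = 0 := by
  obtain ⟨J, hJ⟩ := (expands_D q (expState β)).exists
  rw [hJ]
  refine Finset.sum_eq_zero fun i _ => Finset.sum_eq_zero fun k _ => ?_
  beta_reduce
  by_cases hk : 0 ≤ k
  · rw [fm_diffMode, Module.End.mul_apply, fm_vac _ _ hk, map_zero]
  · rw [Module.End.mul_apply, diffMode, LinearMap.sub_apply,
      eQ_expState_of_nonneg q rfl hβ (by omega), eQ_expState_of_nonneg q rfl hβ (by omega),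
      sub_zero, map_zero]

theorem fm_true_fm_false_zero (i j : Fin N) : fm true i 0 * fm false j (-1) =
    (-1 : ℂ) • (fm false j (-1) * fm true i 0) + if i = j then 1 else 0 := by
  rw [fm_fm]
  simp

theorem koszulD_fm (j : Fin N) : koszulD N q * fm false j (-1) =
    (-1 : ℂ) • (fm false j (-1) * koszulD N q) + onLat (diffOp q j) := by
  have h : ∀ i, fm true i 0 * onLat (diffOp q i) * fm false j (-1) =
      (-1 : ℂ) • (fm false j (-1) * (fm true i 0 * onLat (diffOp q i))) +
        if i = j then onLat (diffOp q i) else 0 := by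
    intro i
    rw [mul_assoc, ← fm_onLat, ← mul_assoc, fm_true_fm_false_zero, add_mul, smul_mul_assoc,
      mul_assoc]
    split_ifs
    · rw [one_mul]
    · rw [zero_mul]
  rw [koszulD, Finset.sum_mul, Finset.sum_congr rfl fun i _ => h i, Finset.sum_add_distrib,
    Finset.mul_sum, Finset.smul_sum, Finset.sum_ite_eq' Finset.univ j, if_pos (Finset.mem_univ j)]

/-- Both sides vanish on the `e^β` and have the same anticommutators with the `Φ^i_0`. -/
theorem D_coreProj : D N q * coreProj N = koszulD N q * coreProj N := by
  refine core_ext (fun β hβ => ?_) fun j v hv hD => ?_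
  · rw [D_expState q hβ, koszulD, LinearMap.sum_apply]
    refine (Finset.sum_eq_zero fun i _ => ?_).symm
    rw [fm_onLat, Module.End.mul_apply, fm_vac _ _ le_rfl, map_zero]
  · have h1 := LinearMap.congr_fun (D_fm_false q j (-1)) v
    have h2 := LinearMap.congr_fun (koszulD_fm q j) v
    have h3 := LinearMap.congr_fun (diffMode_coreProj q j) v
    simp only [Module.End.mul_apply, LinearMap.add_apply, LinearMap.smul_apply, hv] at h1 h2 h3
    rw [h1, h2, h3, hD]

theorem D_eq_koszulD {x : VL N} (hx : coreProj N x = x) : D N q x = koszulD N q x := by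
  have h := LinearMap.congr_fun (D_coreProj q) x
  rwa [Module.End.mul_apply, Module.End.mul_apply, hx] at h

theorem Q0_of_core {x : VL N} (hx : coreProj N x = x) : Q0 N q x = 0 := by
  rw [← hx]
  exact LinearMap.congr_fun (Q0_coreProj q) x

theorem D_latInc (c : LatA N) : D N q (latInc N c) = 0 := by
  rw [D_eq_koszulD q (coreProj_latInc c), koszulD, LinearMap.sum_apply]
  refine Finset.sum_eq_zero fun i _ => ?_
  rw [Module.End.mul_apply, onLat_latInc, fm_latInc _ _ le_rfl]

/-- In `ℂ[L_A]` the multiples of `e^{A^i} - e^{-∑ A^j}` are coboundaries. -/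
theorem D_fm_latInc (i : Fin N) (c : LatA N) :
    D N q (fm false i (-1) (latInc N c)) = latInc N (diffOp q i c) := by
  have h1 := LinearMap.congr_fun (D_fm_false q i (-1)) (latInc N c)
  have h3 := LinearMap.congr_fun (diffMode_coreProj q i) (latInc N c)
  simp only [Module.End.mul_apply, LinearMap.add_apply, LinearMap.smul_apply, coreProj_latInc,
    D_latInc, map_zero, smul_zero, zero_add] at h1 h3
  rw [h1, h3, onLat_latInc]

theorem coreProj_fm_false {x : VL N} (hx : coreProj N x = x) (i : Fin N) :
    coreProj N (fm false i (-1) x) = fm false i (-1) x := by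
  have h := LinearMap.congr_fun (neutral_fm_false 0 i).coreProj x
  rw [Module.End.mul_apply, Module.End.mul_apply, hx] at h
  exact h.symm

theorem coreProj_D {x : VL N} (hx : coreProj N x = x) : coreProj N (D N q x) = D N q x := by
  rw [← (contraction q).D_P, hx]

theorem coreProj_onLat_of {x : VL N} (hx : coreProj N x = x) (f : Module.End ℂ (LatA N)) :
    coreProj N (onLat f x) = onLat f x := by
  have h := LinearMap.congr_fun (coreProj_onLat f) x
  rwa [Module.End.mul_apply, Module.End.mul_apply, hx] at h

theorem koszul_identity {E : Type*} [Ring E] [Algebra ℂ E] (a b c : E) :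
    (-1 : ℂ) • a + c + (a + b * (1 - c)) = 1 - ((-1 : ℂ) • b + 1) * (1 - c) := by
  simp only [neg_smul, one_smul]
  noncomm_ring

/-- Division by `e^{A^i} - e^{-∑ A^j}` gives a homotopy between the identity and an operator whose
values do not involve `Φ^i_0`. -/
theorem koszul_homotopy {δ : Fin N → Module.End ℂ (LatA N)} (h1 : ∀ i, δ i * diffOp q i = 1)
    (h2 : ∀ i j, i ≠ j → δ i * diffOp q j = diffOp q j * δ i) (i : Fin N) :
    koszulD N q * (fm false i (-1) * onLat (δ i)) + fm false i (-1) * onLat (δ i) * koszulD N q =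
      1 - fm true i 0 * fm false i (-1) * onLat (1 - diffOp q i * δ i) := by
  have e1 : koszulD N q * (fm false i (-1) * onLat (δ i)) =
      (-1 : ℂ) • (fm false i (-1) * (koszulD N q * onLat (δ i))) + onLat (diffOp q i * δ i) := by
    rw [← mul_assoc, koszulD_fm, add_mul, smul_mul_assoc, mul_assoc, onLat_mul]
  have e2 : fm false i (-1) * (onLat (δ i) * koszulD N q) = fm false i (-1) *
      (koszulD N q * onLat (δ i)) + fm false i (-1) * fm true i 0 * onLat (1 - diffOp q i * δ i) := by
    have h : onLat (δ i) * koszulD N q =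
        koszulD N q * onLat (δ i) + fm true i 0 * onLat (1 - diffOp q i * δ i) := by
      rw [koszulD, Finset.mul_sum, Finset.sum_mul, ← Finset.add_sum_erase _ _ (Finset.mem_univ i),
        ← Finset.add_sum_erase (a := i) _ (fun j => fm true j 0 * onLat (diffOp q j) * onLat (δ i))
          (Finset.mem_univ i)]
      have h3 : ∀ j, onLat (δ i) * (fm true j 0 * onLat (diffOp q j)) =
          fm true j 0 * onLat (δ i * diffOp q j) := by
        intro j
        rw [← mul_assoc, ← fm_onLat, mul_assoc, onLat_mul]
      rw [h3, h1, mul_assoc, ← onLat_mul, onLat_sub, mul_sub]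
      rw [Finset.sum_congr rfl fun j hj => (h3 j).trans (by
        rw [h2 i j (Finset.ne_of_mem_erase hj).symm, onLat_mul, ← mul_assoc])]
      abel
    rw [h, mul_add, mul_assoc (fm false i (-1)) (fm true i 0)]
  have e3 := fm_true_fm_false_zero i i
  rw [if_pos rfl] at e3
  rw [e1, mul_assoc (fm false i (-1)), e2, e3, onLat_sub, onLat_one]
  exact koszul_identity _ _ _

/-- A vector in the image of `coreProj` that is annihilated by all `Ψ^i_0` lies in `ℂ[L_A]`. -/
theorem eq_latInc_latCoeff {x : VL N} (hx : coreProj N x = x) (h : ∀ i : Fin N, fm true i 0 x = 0) :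
    latInc N (latCoeff N x) = x := by
  classical
  have h1 : diagOp (vlBasis N) (fun a => if a.1.2 = 0 ∧ a.2 = (∅, 0) then 1 else 0) x = x := by
    rw [diagOp_eq_self_iff]
    intro a ha
    have h2 := (diagOp_eq_self_iff (vlBasis N) _ x).mp hx a ha
    obtain ⟨h3, h4⟩ := core_index h2
    refine ⟨h2.1, Prod.ext (Finset.eq_empty_of_forall_notMem fun o ho => ?_) h3⟩
    obtain ⟨i, rfl⟩ := h4 o ho
    have h5 := LinearMap.congr_fun (fm_mul_fm_eq_diagOp i) x
    rw [Module.End.mul_apply, h, map_zero] at h5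
    have h6 := congrArg (fun v => (vlBasis N).repr v a) h5
    simp only [map_zero, diagOp_repr, if_pos ho, one_mul] at h6
    exact ha h6.symm
  have h2 := LinearMap.congr_fun (latInc_latCoeff (N := N)) x
  rw [LinearMap.comp_apply] at h2
  rw [h2]
  convert h1

theorem fm_true_sq (i : Fin N) (v : VL N) : fm true i 0 (fm true i 0 v) = 0 := by
  have h := LinearMap.congr_fun (fm_anticomm true true i i 0 0) v
  rw [if_neg (by simp)] at h
  have h' : (2 : ℂ) • fm true i 0 (fm true i 0 v) = 0 := by
    rw [two_smul]
    exact h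
  exact (smul_eq_zero.mp h').resolve_left two_ne_zero

/-- The Koszul complex has cohomology only in degree zero. -/
theorem exists_latInc_add_D (hN : 1 ≤ N) {x : VL N} (hx : coreProj N x = x) (hD : D N q x = 0) :
    ∃ c z, coreProj N z = z ∧ x = latInc N c + D N q z := by
  classical
  obtain ⟨δ, h1, h2⟩ := exists_division q hN
  -- Subtracting coboundaries, one removes the `Φ^i_0` one after another: the homotopy for `i` does not
  -- reintroduce a `Φ^j_0` already removed, because it is built from operators that anticommute with
  -- `Ψ^j_0` or commute with it.
  have key : ∀ S : Finset (Fin N), ∃ x' z, coreProj N x' = x' ∧ coreProj N z = z ∧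
      D N q x' = 0 ∧ x = x' + D N q z ∧ ∀ i ∈ S, fm true i 0 x' = 0 := by
    intro S
    induction S using Finset.induction_on with
    | empty => exact ⟨x, 0, hx, map_zero _, hD, by rw [map_zero, add_zero], by simp⟩
    | insert i S _ ih =>
      obtain ⟨x', z, hx', hz, hD', rfl, hS⟩ := ih
      set z' := fm false i (-1) (onLat (δ i) x')
      have hz' : coreProj N z' = z' := coreProj_fm_false (coreProj_onLat_of hx' _) i
      set w := onLat (1 - diffOp q i * δ i) x' with hw
      have h3 : x' - D N q z' = fm true i 0 (fm false i (-1) w) := by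
        have h4 := LinearMap.congr_fun (koszul_homotopy q h1 h2 i) x'
        simp only [Module.End.mul_apply, LinearMap.add_apply, LinearMap.sub_apply,
          Module.End.one_apply] at h4
        rw [← D_eq_koszulD q hx', hD', map_zero, map_zero, add_zero, ← D_eq_koszulD q hz', ← hw]
          at h4
        rw [show D N q z' = _ from h4, sub_sub_cancel]
      refine ⟨x' - D N q z', z + z', ?_, ?_, ?_, ?_, fun j hj => ?_⟩
      · rw [map_sub, hx', coreProj_D q hz']
      · rw [map_add, hz, hz']
      · rw [map_sub, hD', (contraction q).D_sq, sub_zero]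
      · rw [map_add]; abel
      · rw [h3]
        by_cases hij : j = i
        · rw [hij, fm_true_sq]
        · have hjS := hS j (Finset.mem_of_mem_insert_of_ne hj hij)
          have h4 := LinearMap.congr_fun (fm_fm true true j i 0 0) (fm false i (-1) w)
          have h5 := LinearMap.congr_fun (fm_true_fm_false_zero j i) w
          have h6 := LinearMap.congr_fun (fm_onLat true j 0 (1 - diffOp q i * δ i)) x'
          rw [if_neg (by simp), add_zero] at h4
          rw [if_neg hij, add_zero] at h5
          simp only [Module.End.mul_apply, LinearMap.smul_apply] at h4 h5 h6
          rw [h4, h5, h6, hjS, map_zero, map_zero, smul_zero, map_zero, smul_zero]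
  obtain ⟨x', z, hx', hz, -, rfl, hS⟩ := key Finset.univ
  exact ⟨latCoeff N x', z, hz, by
    rw [eq_latInc_latCoeff hx' fun i => hS i (Finset.mem_univ i)]⟩

end Koszul

/-! ### The cohomology ring -/

section QuantumClass

variable {N : ℕ} (q : ℂ)

theorem stateField_expState (α : Lat N) : stateField N (expState α) = expField α := by
  rw [← vlBasis_vac, vlBasis_apply, stateField_single, monomialField]
  simp

theorem qMode_expState (α : Lat N) (n : ℤ) : qMode q (expState α) n = eQ q α n := by
  rw [qMode_sector q (show expState α ∈ sector α from single_mem_sector _ _), eQ]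
  change VertexOperator.ncoeff (stateField N (expState α)) n * _ = _
  rw [stateField_expState]
  rfl

/-- The fields of states in `ℂ[L_A]` are even. -/
theorem parity_qMode_latInc (f : LatA N) (n : ℤ) :
    parity N * qMode q (latInc N f) n * parity N = qMode q (latInc N f) n := by
  have : LinearMap.mulRight ℂ (parity N) ∘ₗ LinearMap.mulLeft ℂ (parity N) ∘ₗ
      LinearMap.proj n ∘ₗ qMode q ∘ₗ latInc N = LinearMap.proj n ∘ₗ qMode q ∘ₗ latInc N :=
    LatA_ext fun k => by
      change parity N * qMode q (latInc N (Finsupp.single k 1)) n * parity N =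
        qMode q (latInc N (Finsupp.single k 1)) n
      rw [latInc_single, qMode_expState, parity_eq, onFerm_eQ, ← parity_eq, mul_assoc,
        parity_mul_self, mul_one]
  exact LinearMap.congr_fun this f

variable (N) in
/-- The states whose `0`-th mode is an odd derivation of all products of `V_{L,q}`. -/
def derivationStates : Submodule ℂ (VL N) where
  carrier := {w | ∀ x n, qMode q w 0 * qMode q x n -
    parity N * qMode q x n * parity N * qMode q w 0 = qMode q (qMode q w 0 x) n}
  zero_mem' x n := by
    rw [map_zero, Pi.zero_apply, zero_mul, mul_zero, sub_zero, LinearMap.zero_apply, map_zero]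
    rfl
  add_mem' h h' x n := by
    rw [map_add, Pi.add_apply, LinearMap.add_apply, map_add, Pi.add_apply, ← h, ← h', add_mul,
      mul_add]
    abel
  smul_mem' c w h x n := by
    rw [map_smul, Pi.smul_apply, LinearMap.smul_apply, map_smul, Pi.smul_apply, ← h, smul_mul_assoc,
      mul_smul_comm]
    exact (smul_sub _ _ _).symm

/-- The total differential is an odd derivation of all products. -/
theorem d_derivation (x : VL N) (n : ℤ) : (D N q + Q0 N q) * qMode q x n -
    parity N * qMode q x n * parity N * (D N q + Q0 N q) =
    qMode q ((D N q + Q0 N q) x) n := by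
  have h : (∑ i : Fin N, (psiState i (latA i) - psiState i (latT N))) + ∑ i, aPhiState i ∈
      derivationStates N q := by
    refine Submodule.add_mem _ (Submodule.sum_mem _ fun i _ => Submodule.sub_mem _ ?_ ?_)
      (Submodule.sum_mem _ fun i _ => ?_)
    · exact qMode_derivation q (psiState_mem_sector i _) (isFieldOf_psiState i _)
    · exact qMode_derivation q (psiState_mem_sector i _) (isFieldOf_psiState i _)
    · exact qMode_derivation q (aPhiState_mem_sector i) (isFieldOf_aPhiState i)
  have h1 := h x n
  rw [map_add] at h1
  exact h1

variable (N) in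
/-- The coefficient in `ℂ[L_A]`, read in `ℂ[T]/(T^{N+1} - q^{N+1})`. On cocycles of `D + Q_0` it
detects the cohomology class. -/
def quantumClass : VL N →ₗ[ℂ] QuantumRing N q := toQuantum N q ∘ₗ latCoeff N

theorem quantumClass_latInc (c : LatA N) : quantumClass N q (latInc N c) = toQuantum N q c := by
  rw [quantumClass, LinearMap.comp_apply, latCoeff_latInc]

theorem quantumClass_d (hN : 1 ≤ N) (x : VL N) : quantumClass N q ((D N q + Q0 N q) x) = 0 := by
  rw [quantumClass, LinearMap.comp_apply, ← latCoeff_coreProj, (contraction q).P_d,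
    D_eq_koszulD q ((contraction q).P_sq x), koszulD, LinearMap.sum_apply, map_sum, map_sum]
  refine Finset.sum_eq_zero fun i _ => ?_
  rw [fm_onLat, Module.End.mul_apply, latCoeff_onLat, toQuantum_diffOp q hN]

theorem d_latInc (c : LatA N) : (D N q + Q0 N q) (latInc N c) = 0 := by
  rw [LinearMap.add_apply, D_latInc, Q0_of_core q (coreProj_latInc c), add_zero]

/-- Every class of the total cohomology has a representative in `ℂ[L_A]`. -/
theorem exists_latInc_add_d (hN : 1 ≤ N) {x : VL N} (hx : (D N q + Q0 N q) x = 0) :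
    ∃ c w, x = latInc N c + (D N q + Q0 N q) w := by
  have h1 := (contraction q).eq_of_cocycle hx
  have h2 : D N q (coreProj N x) = 0 := by rw [← (contraction q).P_d, hx, map_zero]
  obtain ⟨c, z, hz, h3⟩ := exists_latInc_add_D q hN ((contraction q).P_sq x) h2
  refine ⟨c, z + homotopy N x, ?_⟩
  rw [map_add, ← add_assoc, ← hz, (contraction q).d_P, hz, ← h3]
  exact h1

/-- A cocycle with vanishing `quantumClass` is a coboundary. -/
theorem exists_eq_d (hN : 1 ≤ N) {x : VL N} (hx : (D N q + Q0 N q) x = 0)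
    (h : quantumClass N q x = 0) : ∃ w, x = (D N q + Q0 N q) w := by
  obtain ⟨c, w, rfl⟩ := exists_latInc_add_d q hN hx
  rw [map_add, quantumClass_d q hN, add_zero, quantumClass_latInc] at h
  obtain ⟨f, rfl⟩ := exists_of_toQuantum_eq_zero q hN h
  refine ⟨∑ i, fm false i (-1) (latInc N (f i)) + w, ?_⟩
  rw [map_add, map_sum, map_sum]
  congr 1
  refine Finset.sum_congr rfl fun i _ => ?_
  rw [LinearMap.add_apply, D_fm_latInc, Q0_of_core q (coreProj_fm_false (coreProj_latInc _) i),
    add_zero]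

variable {q} in
/-- The isomorphism of the cohomology of `D + Q_0` with `ℂ[T]/(T^{N+1} - q^{N+1})`. -/
def cohEquiv (hN : 1 ≤ N) : Coh (D N q + Q0 N q) ≃ₗ[ℂ] QuantumRing N q :=
  Submodule.quotEquivOfEq _
      (LinearMap.ker (quantumClass N q ∘ₗ (LinearMap.ker (D N q + Q0 N q)).subtype)) (by
    ext ⟨x, hx⟩
    constructor
    · rintro ⟨w, hw⟩
      have hw' : (D N q + Q0 N q) w = x := hw
      exact LinearMap.mem_ker.mpr
        ((congrArg (quantumClass N q) hw').symm.trans (quantumClass_d q hN w))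
    · intro h
      obtain ⟨w, hw⟩ := exists_eq_d q hN hx h
      exact ⟨w, hw.symm⟩) ≪≫ₗ
  LinearMap.quotKerEquivOfSurjective _ fun b => by
    obtain ⟨c, rfl⟩ := toQuantum_surjective q hN b
    exact ⟨⟨latInc N c, d_latInc q c⟩, quantumClass_latInc q c⟩

theorem represents_cohEquiv_symm (hN : 1 ≤ N) {x : VL N} {f : QuantumRing N q} :
    Represents (D N q + Q0 N q) x ((cohEquiv hN).symm f) ↔
      (D N q + Q0 N q) x = 0 ∧ quantumClass N q x = f := by
  refine ⟨fun ⟨hx, h⟩ => ⟨hx, ?_⟩, fun ⟨hx, h⟩ => ⟨hx, ?_⟩⟩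
  · exact (LinearEquiv.eq_symm_apply _).mp h
  · exact (LinearEquiv.eq_symm_apply _).mpr h

/-- On `ℂ[L_A]` the `(-1)`-st product is the product of the deformed group algebra. -/
theorem quantumClass_product (f g : LatA N) :
    quantumClass N q (qMode q (latInc N f) (-1) (latInc N g)) =
      toQuantum N q f * toQuantum N q g := by
  have h1 : ∀ n k, qMode q (latInc N (Finsupp.single n 1)) (-1) (latInc N (Finsupp.single k 1)) =
      latInc N (xOp q n (Finsupp.single k 1)) := by
    intro n k
    rw [latInc_single, latInc_single, qMode_expState, eQ_neg_one_expState q rfl rfl, ← latInc_single,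
      onLat_latInc]
  have h2 : ∀ n, quantumClass N q ∘ₗ qMode q (latInc N (Finsupp.single n 1)) (-1) ∘ₗ latInc N =
      LinearMap.mulLeft ℂ (toQuantum N q (Finsupp.single n 1)) ∘ₗ toQuantum N q :=
    fun n => LatA_ext fun k => by
      simp only [LinearMap.comp_apply]
      rw [h1, quantumClass_latInc, toQuantum_xOp, LinearMap.mulLeft_apply]
  have h3 : quantumClass N q ∘ₗ LinearMap.applyₗ (latInc N g) ∘ₗ LinearMap.proj (-1) ∘ₗ
      qMode q ∘ₗ latInc N = LinearMap.mulRight ℂ (toQuantum N q g) ∘ₗ toQuantum N q :=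
    LatA_ext fun n => LinearMap.congr_fun (h2 n) g
  exact LinearMap.congr_fun h3 f

/-- Modulo coboundaries, the product of two cocycles depends only on their components in
`ℂ[L_A]`, because `D + Q_0` is a derivation. -/
theorem quantumClass_mul (hN : 1 ≤ N) {x y : VL N} (hx : (D N q + Q0 N q) x = 0)
    (hy : (D N q + Q0 N q) y = 0) : (D N q + Q0 N q) (qMode q x (-1) y) = 0 ∧
      quantumClass N q (qMode q x (-1) y) = quantumClass N q x * quantumClass N q y := by
  have hder : ∀ u v, (D N q + Q0 N q) (qMode q u (-1) v) =
      parity N (qMode q u (-1) (parity N ((D N q + Q0 N q) v))) +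
        qMode q ((D N q + Q0 N q) u) (-1) v := by
    intro u v
    have := LinearMap.congr_fun (d_derivation q u (-1)) v
    rw [LinearMap.sub_apply, sub_eq_iff_eq_add'] at this
    exact this
  constructor
  · rw [hder, hx, hy, map_zero, map_zero, map_zero, map_zero, zero_add]
    rfl
  · obtain ⟨f, u, rfl⟩ := exists_latInc_add_d q hN hx
    obtain ⟨g, v, rfl⟩ := exists_latInc_add_d q hN hy
    have h1 : qMode q ((D N q + Q0 N q) u) (-1) (latInc N g + (D N q + Q0 N q) v) =
        (D N q + Q0 N q) (qMode q u (-1) (latInc N g + (D N q + Q0 N q) v)) := by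
      rw [hder, hy, map_zero, map_zero, map_zero, zero_add]
    have h2 : qMode q (latInc N f) (-1) ((D N q + Q0 N q) v) =
        (D N q + Q0 N q) (qMode q (latInc N f) (-1) v) := by
      have := LinearMap.congr_fun (parity_qMode_latInc q f (-1)) ((D N q + Q0 N q) v)
      rw [hder, d_latInc, map_zero]
      exact this.symm.trans (add_zero _).symm
    rw [map_add (qMode q), Pi.add_apply, LinearMap.add_apply, h1, map_add (qMode q _ _), h2, map_add,
      map_add, quantumClass_d q hN, quantumClass_d q hN, quantumClass_product, map_add, map_add,
      quantumClass_d q hN, quantumClass_d q hN, quantumClass_latInc, quantumClass_latInc]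
    simp only [add_zero]

end QuantumClass

end ChiralPN

end

theorem theorem2p4 (N : ℕ) (hN : 1 ≤ N) (q : ℂ) :
    D N q * D N q = 0 ∧
    Q0 N q * Q0 N q = 0 ∧
    (∃ φ : QuantumRing N q ≃ₗ[ℂ] Coh (D N q + Q0 N q),
      Represents (D N q + Q0 N q) (expState 0) (φ 1) ∧
      Represents (D N q + Q0 N q)
        (expState (latT N)) (φ (quantumT N q)) ∧
      ∀ (f g : QuantumRing N q) (x y : VL N),
        Represents (D N q + Q0 N q) x (φ f) →
        Represents (D N q + Q0 N q) y (φ g) →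
        Represents (D N q + Q0 N q)
          (nthProd q (-1) x y) (φ (f * g))) ∧
    Converges (D N q + Q0 N q) (chargeLE N) ∧
    (∀ r : ℕ, 2 ≤ r →
      DifferentialVanishes (D N q + Q0 N q) (chargeLE N) r) ∧
    ∃ (h : Q0 N q * D N q + D N q * Q0 N q = 0)
      (ψ : Coh (Coh.induced (Q0 N q) (D N q) h) ≃ₗ[ℂ]
        Coh (D N q + Q0 N q)),
      (∀ c, ∃ (x : VL N) (u : Coh (Q0 N q)),
        D N q x = 0 ∧ Represents (Q0 N q) x u ∧
        Represents (Coh.induced (Q0 N q) (D N q) h) u c) ∧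
      ∀ (c) (x : VL N) (u : Coh (Q0 N q)),
        D N q x = 0 → Represents (Q0 N q) x u →
        Represents (Coh.induced (Q0 N q) (D N q) h) u c →
        Represents (D N q + Q0 N q) x (ψ c) := by
  refine ⟨D_sq q, Q0_sq q, ⟨(cohEquiv hN).symm, ?_, ?_, fun f g x y hx hy => ?_⟩,
    (contraction q).converges, fun r hr => (contraction q).differentialVanishes hr,
    (contraction q).anticomm, (contraction q).exists_iterated_equiv⟩
  · rw [represents_cohEquiv_symm, ← toQuantum_zero q, ← quantumClass_latInc, latInc_single]
    exact ⟨latInc_single (0 : Fin N → ℤ) ▸ d_latInc q _, rfl⟩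
  · rw [represents_cohEquiv_symm, ← toQuantum_tail q hN, ← quantumClass_latInc, latInc_single]
    exact ⟨latInc_single (fun _ : Fin N => -1) ▸ d_latInc q _, rfl⟩
  · rw [represents_cohEquiv_symm] at hx hy ⊢
    rw [← hx.2, ← hy.2]
    exact quantumClass_mul q hN hx.1 hy.1
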